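/- Let $a\in C^1(\mathbb R)$ be real-valued, $F(z)=a(|z|^2)z$ for $z\in\mathbb C=\mathbb R^2$, $\Delta_L u(x)=u(x+1)-2u(x)+u(x-1)$ on $\mathbb Z$, $\delta(x)=\delta_{0x}$, and consider $$i\dot\psi(x,t)=-\Delta_L\psi(x,t)-\delta(x)F(\psi(0,t)),\qquad x\in\mathbb Z. \tag{1}$$ Let $\beta\ge 2$ and $\|u\|_{l^p_\beta}=\|(1+|x|)^\beta u\|_{l^p}$. **Solitary waves.** For $\omega>0$ or $\omega<-4$ let $k(\omega)>0$ solve $\cosh k=|\omega+2|/2$. The nonzero solitary waves are $e^{i\theta}\psi_\omega(x)e^{i\omega t}$ with $\psi_\omega(x)=Ce^{-k|x|}$, $C>0$, $\sinh k=a(C^2)/2$ if $\omega>0$, and $\psi_\omega(x)=C(-1)^{|x|}e^{-k|x|}$, $C>0$, $\sinh k=-a(C^2)/2$ if $\omega<-4$. Fix one of them, with frequency $\omega_0$, amplitude $C_0$ and phase $\theta_0$. Assume that $a$ is $C^2$ in a neighbourhood of $C_0^2$ and that the spectral condition holds for it: with $a=a(C_0^2)$, $a'=a'(C_0^2)$,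 1. $a'\ne 0$ and $a'\neq (4a+a^3)/(4C_0^2)$; 2. the operator $\mathbf C=\begin{pmatrix}0&\mathbf D_2\\-\mathbf D_1&0\end{pmatrix}$, where $\mathbf D_1=-\Delta_L+\omega_0-\delta(x)(a+2a'C_0^2)$ and $\mathbf D_2=-\Delta_L+\omega_0-\delta(x)a$, has no eigenvalue in $l^2(\mathbb Z;\mathbb C^2)$ except $\lambda=0$, and no resonance at the end points $\lambda=\pm i\omega_0,\ \pm i(\omega_0+4)$ of its continuous spectrum (i.e. $\mathbf C w=\lambda w$ has no nonzero bounded solution for these $\lambda$). **Notation.** Identify $\mathbb R^2=\mathbb C$, so that the matrix $j$ is multiplication by $i$; $\langle u,v\rangle=\sum_x u(x)\cdot v(x)$ is the real scalar product of $l^2(\mathbb Z;\mathbb R^2)$. For a family $\omega\mapsto\Phi_\omega=(\psi_\omega,0)$ of solitary waves let $$\mathbf P^0(\omega)u=\frac{\langle u,j\partial_\omega\Phi_\omega\rangle\, j\Phi_\omega+\langle u,\Phi_\omega\rangle\,\partial_\omega\Phi_\omega}{\langle\Phi_\omega,\partial_\omega\Phi_\omega\rangle},\qquad \mathbf Q(\chi,\omega)=-\delta(x)j^{-1}\bigl(F(\Phi_\omega+\chi)-F(\Phi_\omega)-F'(\Phi_\omega)\chi\bigr).$$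 **Theorem.** There are an open interval $J\ni\omega_0$ and a $C^2$ function $\omega\mapsto C(\omega)$ on $J$ with $C(\omega_0)=C_0$, such that for every $\omega\in J$ the number $C(\omega)$ is the amplitude of a solitary wave $\psi_\omega$ of frequency $\omega$ and $\langle\Phi_\omega,\partial_\omega\Phi_\omega\rangle\ne0$; and there are $d_0>0$ and $K>0$ such that the following holds. Let $\psi\in C(\mathbb R,l^2)$ be a solution of (1) with initial value $\psi_0\in l^2\cap l^1_\beta$ and $$d:=\|\psi_0-\psi_{\omega_0}e^{i\theta_0}\|_{l^2}+\|\psi_0-\psi_{\omega_0}e^{i\theta_0}\|_{l^1_\beta}\le d_0 .$$ Then there exist $C^1$ functions $\omega(t)\in J$ and $\gamma(t)$, defined for all $t\ge0$, such that, with $\theta(t)=\int_0^t\omega(s)\,ds+\gamma(t)$, $$\psi(x,t)=e^{j\theta(t)}\bigl(\Phi_{\omega(t)}(x)+\chi(x,t)\bigr),\qquad \mathbf P^0(\omega(t))\chi(t)=0,\qquad t\ge0,$$ the modulation equations $$\dot\omega=\frac{\langle\mathbf P^0\mathbf Q,\Phi_\omega+\chi\rangle}{\langle\partial_\omega\Phi_\omega-\partial_\omega\mathbf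 P^0\chi,\Phi_\omega+\chi\rangle},\qquad \dot\gamma=\frac{\langle j\mathbf P^0(\partial_\omega\Phi_\omega-\partial_\omega\mathbf P^0\chi),\mathbf P^0\mathbf Q\rangle}{\langle\partial_\omega\Phi_\omega-\partial_\omega\mathbf P^0\chi,\Phi_\omega+\chi\rangle}$$ hold for $t\ge0$ with nonvanishing denominators, and $$\sup_{t\ge0}\Bigl[(1+t)^{3/2}\|\chi(t)\|_{l^\infty_{-\beta}}+(1+t)^3\bigl(|\dot\gamma(t)|+|\dot\omega(t)|\bigr)\Bigr]\le \overline M:=K\,d .$$ -/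

import Mathlib

open Complex Set
open scoped ENNReal

noncomputable section

namespace DiscreteNLS

/-- The difference Laplacian on `ℤ`. -/
def lap (u : ℤ → ℂ) (x : ℤ) : ℂ := u (x + 1) - 2 * u x + u (x - 1)

/-- The Kronecker delta at the origin. -/
def delta (x : ℤ) : ℂ := if x = 0 then 1 else 0

/-- The oscillator force `F(z) = a(|z|²) z` (here `ℂ = ℝ²`). With `a = -2u'` it is minus the
gradient of `U(z) = u(|z|²)`. -/
def force (a : ℝ → ℝ) (z : ℂ) : ℂ := (a (‖z‖ ^ 2) : ℂ) * z

/-- `ψ ∈ C(ℝ, l²)` solves `i ∂ₜψ(x,t) = -Δψ(x,t) - δ(x) F(ψ(0,t))`. -/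
def IsSolution (a : ℝ → ℝ) (ψ : ℝ → lp (fun _ : ℤ => ℂ) 2) : Prop :=
  Continuous ψ ∧ ∀ (t : ℝ) (x : ℤ), ∃ v : ℂ, HasDerivAt (fun s => ψ s x) v t ∧
    I * v = -lap (fun y => ψ t y) x - delta x * force a (ψ t 0)

/-! ### Weighted norms -/

/-- The weight `(1 + |x|)^β`. -/
def weight (β : ℝ) (x : ℤ) : ℝ := (1 + |(x : ℝ)|) ^ β

/-- Membership in `l¹_β`. -/
def MemL1 (β : ℝ) (u : ℤ → ℂ) : Prop := Summable fun x => weight β x * ‖u x‖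

/-- The norm of `l¹_β`. -/
def normL1 (β : ℝ) (u : ℤ → ℂ) : ℝ := ∑' x, weight β x * ‖u x‖

/-- The norm of `l²`. -/
def normL2 (u : ℤ → ℂ) : ℝ := Real.sqrt (∑' x, ‖u x‖ ^ 2)

/-- The norm of `l^∞_β`. -/
def normLinf (β : ℝ) (u : ℤ → ℂ) : ℝ := ⨆ x, weight β x * ‖u x‖

/-! ### Solitary waves -/

/-- The positive solution `k` of `cosh k = |ω + 2| / 2` (for `ω > 0` or `ω < -4`). -/
def decayRate (ω : ℝ) : ℝ := Real.arcosh (|ω + 2| / 2)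

/-- The amplitude of the solitary wave: `C e^{-k|x|}` for `ω > 0` and `C (-1)^{|x|} e^{-k|x|}` for
`ω < -4`. -/
def profile (ω C : ℝ) (x : ℤ) : ℝ :=
  C * (if 0 < ω then 1 else (-1) ^ x.natAbs) * Real.exp (-decayRate ω * |(x : ℝ)|)

/-- The frequency `ω` and the amplitude `C = ψ_ω(0) > 0` belong to a nonzero solitary wave. -/
def IsSolitaryWave (a : ℝ → ℝ) (ω C : ℝ) : Prop :=
  0 < C ∧ ((0 < ω ∧ Real.sinh (decayRate ω) = a (C ^ 2) / 2) ∨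
    (ω < -4 ∧ Real.sinh (decayRate ω) = -a (C ^ 2) / 2))

/-- `C` is a `C²` local parametrization by the frequency, on the open set `J`, of the family of
solitary waves through the one with frequency `ω₀` and amplitude `C₀`. -/
def IsBranch (a : ℝ → ℝ) (ω₀ C₀ : ℝ) (J : Set ℝ) (C : ℝ → ℝ) : Prop :=
  IsOpen J ∧ ω₀ ∈ J ∧ C ω₀ = C₀ ∧ ContDiffOn ℝ 2 C J ∧ ∀ ω ∈ J, IsSolitaryWave a ω (C ω)

/-- `Φ_ω = (ψ_ω, 0)` along the branch `C`, with `ℝ² = ℂ`. -/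
def Phi (C : ℝ → ℝ) (ω : ℝ) (x : ℤ) : ℂ := (profile ω (C ω) x : ℂ)

/-- `∂_ω Φ_ω`. -/
def dPhi (C : ℝ → ℝ) (ω : ℝ) (x : ℤ) : ℂ := deriv (fun w => Phi C w x) ω

/-! ### Linearization and spectral condition -/

/-- `D₁ = -Δ + ω - δ(x) (a + 2 a' C²)`, with `a = a(C²)`, `a' = a'(C²)`. -/
def D1 (a : ℝ → ℝ) (ω C : ℝ) (u : ℤ → ℂ) (x : ℤ) : ℂ :=
  -lap u x + (ω : ℂ) * u x - delta x * ((a (C ^ 2) + 2 * deriv a (C ^ 2) * C ^ 2 : ℝ) : ℂ) * u x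

/-- `D₂ = -Δ + ω - δ(x) a`. -/
def D2 (a : ℝ → ℝ) (ω C : ℝ) (u : ℤ → ℂ) (x : ℤ) : ℂ :=
  -lap u x + (ω : ℂ) * u x - delta x * (a (C ^ 2) : ℂ) * u x

/-- `(u, v) : ℤ → ℂ²` is a nonzero solution of `𝐂 (u, v) = lam (u, v)`, where
`𝐂 (u, v) = (D₂ v, -D₁ u)` is the linearization at the solitary wave. -/
def IsMode (a : ℝ → ℝ) (ω C : ℝ) (lam : ℂ) (u v : ℤ → ℂ) : Prop :=
  (u ≠ 0 ∨ v ≠ 0) ∧ ∀ x, D2 a ω C v x = lam * u x ∧ -D1 a ω C u x = lam * v x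

/-- `lam` is an eigenvalue of `𝐂` in (complexified) `l²`. -/
def IsEigenvalue (a : ℝ → ℝ) (ω C : ℝ) (lam : ℂ) : Prop :=
  ∃ u v : ℤ → ℂ, Memℓp u 2 ∧ Memℓp v 2 ∧ IsMode a ω C lam u v

/-- `lam` is an end point of the continuous spectrum
`[-i(ω+4), -iω] ∪ [iω, i(ω+4)]` of `𝐂`, and `𝐂 w = lam w` has a nonzero bounded solution. -/
def IsThresholdResonance (a : ℝ → ℝ) (ω C : ℝ) (lam : ℂ) : Prop :=
  (lam = I * ω ∨ lam = -(I * ω) ∨ lam = I * (ω + 4) ∨ lam = -(I * (ω + 4))) ∧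
    ∃ u v : ℤ → ℂ, Memℓp u ∞ ∧ Memℓp v ∞ ∧ IsMode a ω C lam u v

/-- The spectral condition on a solitary wave. The values of `a'` excluded first are those for which
the frequency is not a coordinate, respectively for which the generalized kernel of `𝐂` has
dimension larger than two. -/
def SpectralCondition (a : ℝ → ℝ) (ω C : ℝ) : Prop :=
  deriv a (C ^ 2) ≠ 0 ∧
  deriv a (C ^ 2) ≠ (4 * a (C ^ 2) + a (C ^ 2) ^ 3) / (4 * C ^ 2) ∧
  (∀ lam : ℂ, lam ≠ 0 → ¬ IsEigenvalue a ω C lam) ∧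
  (∀ lam : ℂ, ¬ IsThresholdResonance a ω C lam)

/-- The distance in `l² ∩ l¹_β` from the initial datum to the solitary wave `e^{iθ} ψ_ω`. -/
def initialDist (β ω C θ : ℝ) (ψ₀ : ℤ → ℂ) : ℝ :=
  normL2 (fun x => ψ₀ x - exp (I * θ) * profile ω C x) +
    normL1 β (fun x => ψ₀ x - exp (I * θ) * profile ω C x)

/-! ### Symplectic projection and modulation equations

A vector `(u₁, u₂)` of `ℝ²` is the complex number `u₁ + i u₂`; the matrix `j` is then
multiplication by `i`. -/

/-- The scalar product of `l²(ℤ; ℝ²)`. -/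
def pair (u v : ℤ → ℂ) : ℝ := ∑' x, ((u x).re * (v x).re + (u x).im * (v x).im)

/-- The symplectic projection `𝐏⁰(ω)` onto the span of `jΦ_ω` and `∂_ωΦ_ω`. -/
def P0 (C : ℝ → ℝ) (ω : ℝ) (u : ℤ → ℂ) (x : ℤ) : ℂ :=
  ((pair (Phi C ω) (dPhi C ω))⁻¹ : ℝ) *
    ((pair u (fun y => I * dPhi C ω y) : ℂ) * (I * Phi C ω x) +
      (pair u (Phi C ω) : ℂ) * dPhi C ω x)

/-- `(∂_ω 𝐏⁰)(ω) u`. -/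
def dP0 (C : ℝ → ℝ) (ω : ℝ) (u : ℤ → ℂ) (x : ℤ) : ℂ := deriv (fun w => P0 C w u x) ω

/-- `𝐐(χ, ω) = -δ(x) j⁻¹ (F(Φ_ω + χ) - F(Φ_ω) - F'(Φ_ω) χ)`, with `F'` the real derivative. -/
def Q (a : ℝ → ℝ) (C : ℝ → ℝ) (ω : ℝ) (χ : ℤ → ℂ) (x : ℤ) : ℂ :=
  -delta x * I⁻¹ * (force a (Phi C ω 0 + χ 0) - force a (Phi C ω 0)
    - fderiv ℝ (force a) (Phi C ω 0) (χ 0))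

/-- `∂_ωΦ_ω - (∂_ω 𝐏⁰) χ`. -/
def modVec (C : ℝ → ℝ) (ω : ℝ) (χ : ℤ → ℂ) (x : ℤ) : ℂ := dPhi C ω x - dP0 C ω χ x

/-- The denominator `⟨∂_ωΦ_ω - (∂_ω 𝐏⁰) χ, Φ_ω + χ⟩` of the modulation equations. -/
def modDen (C : ℝ → ℝ) (ω : ℝ) (χ : ℤ → ℂ) : ℝ :=
  pair (modVec C ω χ) (fun x => Phi C ω x + χ x)

/-- Right-hand side of the modulation equation for `ω`. -/
def omegaRhs (a : ℝ → ℝ) (C : ℝ → ℝ) (ω : ℝ) (χ : ℤ → ℂ) : ℝ :=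
  pair (P0 C ω (Q a C ω χ)) (fun x => Phi C ω x + χ x) / modDen C ω χ

/-- Right-hand side of the modulation equation for `γ`. -/
def gammaRhs (a : ℝ → ℝ) (C : ℝ → ℝ) (ω : ℝ) (χ : ℤ → ℂ) : ℝ :=
  pair (fun x => I * P0 C ω (modVec C ω χ) x) (P0 C ω (Q a C ω χ)) / modDen C ω χ

end DiscreteNLS

end

noncomputable section

namespace DiscreteNLS

open Filter Topology intervalIntegral
open scoped ComplexConjugate Real
open Real (norm_eq_abs rpow_nonneg pi_pos sq_sqrt rpow_natCast rpow_neg rpow_le_rpow_of_nonpos rpow_le_rpow_of_exponent_le rpow_add abs_sin_le_one abs_cos_le_one sqrt_nonneg sqrt_pos rpow_pos_of_pos rpow_zero one_rpow)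
local notation "sin" => Real.sin
local notation "cos" => Real.cos
local notation "ℓ²" => lp (fun _ : ℤ => ℂ) 2

/-! ### Oscillatory integrals over the circle -/

lemma integrable_of_continuous {f : ℝ → ℂ} {a b : ℝ} (hf : Continuous f := by fun_prop) :
    IntervalIntegrable f MeasureTheory.volume a b := hf.intervalIntegrable a b

lemma sin_sq_add_sq_pos (ε : ℝ) (hε : 0 < ε) (θ : ℝ) : 0 < sin θ ^ 2 + ε ^ 2 := by positivity

lemma hasDerivAt_arctan_sin_div (ε : ℝ) (hε : 0 < ε) (θ : ℝ) :
    HasDerivAt (fun θ => Real.arctan (sin θ / ε) / ε)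
      (cos θ / (sin θ ^ 2 + ε ^ 2)) θ := by
  have h := (((Real.hasDerivAt_sin θ).div_const ε).arctan).div_const ε
  refine h.congr_deriv ?_
  have := sin_sq_add_sq_pos ε hε θ
  field_simp
  ring

lemma integral_inv_sin_sq_le (ε : ℝ) (hε : 0 < ε) (hε1 : ε ≤ 1) :
    ∫ θ in (-π)..π, (sin θ ^ 2 + ε ^ 2)⁻¹ ≤ 4 * π / ε := by
  have hpi := pi_pos
  have hc : Continuous fun θ : ℝ => (sin θ ^ 2 + ε ^ 2)⁻¹ :=
    Continuous.inv₀ (by fun_prop) fun θ => (sin_sq_add_sq_pos ε hε θ).ne'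
  have hc2 : Continuous fun θ : ℝ => cos θ / (sin θ ^ 2 + ε ^ 2) :=
    Continuous.div (by fun_prop) (by fun_prop) fun θ => (sin_sq_add_sq_pos ε hε θ).ne'
  have key : ∀ a b : ℝ, ∫ θ in a..b, cos θ / (sin θ ^ 2 + ε ^ 2) =
      Real.arctan (sin b / ε) / ε - Real.arctan (sin a / ε) / ε := fun a b =>
    integral_eq_sub_of_hasDerivAt
      (fun θ _ => hasDerivAt_arctan_sin_div ε hε θ) (hc2.intervalIntegrable _ _)
  have pt : ∀ θ s : ℝ, (s = 1 ∨ s = -1) → 0 ≤ s * cos θ → (sin θ ^ 2 + ε ^ 2)⁻¹ ≤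
      1 + s * (cos θ / (sin θ ^ 2 + ε ^ 2)) := by
    intro θ s hs h
    have h0 := sin_sq_add_sq_pos ε hε θ
    have h1 : s * cos θ ≤ 1 := by
      rcases hs with rfl | rfl
      · simpa using Real.cos_le_one θ
      · linarith [Real.neg_one_le_cos θ]
    have h2 : s ^ 2 = 1 := by rcases hs with rfl | rfl <;> norm_num
    have h3 : cos θ ^ 2 ≤ s * cos θ := by nlinarith
    rw [inv_eq_one_div, ← mul_div_assoc, ← sub_nonneg]
    have : 1 + s * cos θ / (sin θ ^ 2 + ε ^ 2) - 1 / (sin θ ^ 2 + ε ^ 2) =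
        (sin θ ^ 2 + ε ^ 2 + s * cos θ - 1) / (sin θ ^ 2 + ε ^ 2) := by
      field_simp
    rw [this]
    apply div_nonneg _ h0.le
    nlinarith [Real.sin_sq_add_cos_sq θ]
  have piece : ∀ a b s : ℝ, a ≤ b → (s = 1 ∨ s = -1) → (∀ θ ∈ Icc a b, 0 ≤ s * cos θ) →
      ∫ θ in a..b, (sin θ ^ 2 + ε ^ 2)⁻¹ ≤ (b - a) +
        s * (Real.arctan (sin b / ε) / ε - Real.arctan (sin a / ε) / ε) := by
    intro a b s hab hs h
    calc ∫ θ in a..b, (sin θ ^ 2 + ε ^ 2)⁻¹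
        ≤ ∫ θ in a..b, (1 + s * (cos θ / (sin θ ^ 2 + ε ^ 2))) :=
          integral_mono_on hab (hc.intervalIntegrable _ _)
            ((continuous_const.add (continuous_const.mul hc2)).intervalIntegrable _ _)
            fun θ hθ => pt θ s hs (h θ hθ)
      _ = _ := by
          have hc3 : Continuous fun θ : ℝ => s * (cos θ / (sin θ ^ 2 + ε ^ 2)) :=
            continuous_const.mul hc2
          rw [integral_add (by simp) (hc3.intervalIntegrable _ _),
            integral_const_mul, key]
          simp
  have e1 := piece (-π) (-(π / 2)) (-1) (by linarith) (Or.inr rfl) (by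
    intro θ hθ
    have := Real.cos_nonpos_of_pi_div_two_le_of_le (x := -θ) (by linarith [hθ.2]) (by linarith [hθ.1])
    rw [Real.cos_neg] at this; linarith)
  have e2 := piece (-(π / 2)) (π / 2) 1 (by linarith) (Or.inl rfl) (by
    intro θ hθ
    have := Real.cos_nonneg_of_mem_Icc hθ; linarith)
  have e3 := piece (π / 2) π (-1) (by linarith) (Or.inr rfl) (by
    intro θ hθ
    have := Real.cos_nonpos_of_pi_div_two_le_of_le (x := θ) hθ.1 (by linarith [hθ.2])
    linarith)
  rw [← integral_add_adjacent_intervals (b := π / 2)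
    (hc.intervalIntegrable _ _) (hc.intervalIntegrable _ _),
    ← integral_add_adjacent_intervals (b := -(π / 2))
    (hc.intervalIntegrable _ _) (hc.intervalIntegrable _ _)]
  have ha : Real.arctan (1 / ε) ≤ π / 2 := (Real.arctan_lt_pi_div_two _).le
  have hb : Real.arctan (1 / ε) / ε ≤ π / 2 / ε := by gcongr
  have hpe : π ≤ π / ε := by
    rw [le_div_iff₀ hε]; nlinarith
  simp only [Real.sin_neg, Real.sin_pi, Real.sin_pi_div_two, neg_div, Real.arctan_neg, zero_div,
    neg_zero, Real.arctan_zero] at e1 e2 e3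
  have : π / 2 / ε = π / ε / 2 := by ring
  have h4 : 4 * π / ε = 4 * (π / ε) := by ring
  rw [h4]
  linarith

lemma hasDerivAt_exp_cos (τ θ : ℝ) :
    HasDerivAt (fun θ : ℝ => exp (I * (τ * cos θ : ℝ)))
      (-I * τ * (exp (I * (τ * cos θ : ℝ)) * (sin θ : ℂ))) θ := by
  have h := (((Real.hasDerivAt_cos θ).const_mul τ).ofReal_comp.const_mul I).cexp
  refine h.congr_deriv ?_
  push_cast; ring

lemma norm_exp_I_mul (r : ℝ) : ‖exp (I * (r : ℂ))‖ = 1 := by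
  rw [mul_comm]; exact norm_exp_ofReal_mul_I r

/-- Van der Corput's estimate for the phase `τ cos θ`. -/
lemma norm_integral_exp_cos_le {f f1 : ℝ → ℂ} {B τ : ℝ} (hf : ∀ θ, HasDerivAt f (f1 θ) θ)
    (hf1 : Continuous f1) (hB : ∀ θ, ‖f θ‖ ≤ B) (hB1 : ∀ θ, ‖f1 θ‖ ≤ B) (hτ : 1 ≤ |τ|) :
    ‖∫ θ in (-π)..π, exp (I * (τ * cos θ : ℝ)) * f θ‖ ≤
      9 * π * B / √|τ| := by
  have hpi := pi_pos
  have hB0 : 0 ≤ B := (norm_nonneg _).trans (hB 0)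
  have hτ0 : 0 < |τ| := by linarith
  set ε : ℝ := (√|τ|)⁻¹ with hεd
  have hsq : 1 ≤ √|τ| := Real.one_le_sqrt.2 hτ
  have hε : 0 < ε := by positivity
  have hε1 : ε ≤ 1 := inv_le_one_of_one_le₀ hsq
  have hε2 : ε ^ 2 = |τ|⁻¹ := by rw [hεd, inv_pow, sq_sqrt hτ0.le]
  have hfc : Continuous f := continuous_iff_continuousAt.2 fun θ => (hf θ).continuousAt
  set q : ℝ → ℝ := fun θ => (sin θ ^ 2 + ε ^ 2)⁻¹ with hq
  have hqc : Continuous q :=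
    Continuous.inv₀ (by fun_prop) fun θ => (sin_sq_add_sq_pos ε hε θ).ne'
  have hq0 : ∀ θ, 0 < q θ := fun θ => inv_pos.2 (sin_sq_add_sq_pos ε hε θ)
  have hqd : ∀ θ, HasDerivAt q (-(2 * sin θ * cos θ) * q θ ^ 2) θ := by
    intro θ
    have h := (((Real.hasDerivAt_sin θ).pow 2).add_const (ε ^ 2)).inv
      (sin_sq_add_sq_pos ε hε θ).ne'
    refine h.congr_deriv ?_
    simp only [hq, Pi.pow_apply]
    have := sin_sq_add_sq_pos ε hε θ
    field_simp
    norm_num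
    ring
  set E : ℝ → ℂ := fun θ => exp (I * (τ * cos θ : ℝ)) with hE
  have hEc : Continuous E := by simp only [hE]; fun_prop
  have hEn : ∀ θ, ‖E θ‖ = 1 := fun θ => norm_exp_I_mul _
  set g : ℝ → ℂ := fun θ => f θ * ((sin θ * q θ : ℝ) : ℂ) with hg
  set s' : ℝ → ℝ := fun θ => cos θ * q θ + sin θ * (-(2 * sin θ * cos θ) * q θ ^ 2)
    with hs'
  set g' : ℝ → ℂ := fun θ => f1 θ * ((sin θ * q θ : ℝ) : ℂ) + f θ * (s' θ : ℂ) with hg'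
  have hgd : ∀ θ, HasDerivAt g (g' θ) θ := fun θ =>
    (hf θ).mul ((Real.hasDerivAt_sin θ).mul (hqd θ)).ofReal_comp
  have hg'c : Continuous g' := by simp only [hg', hs']; fun_prop
  have hsn : ∀ θ, |sin θ * q θ| ≤ 1 / (2 * ε) := by
    intro θ
    have h0 := sin_sq_add_sq_pos ε hε θ
    rw [abs_mul, abs_of_pos (hq0 θ), hq, ← div_eq_mul_inv, div_le_div_iff₀ h0 (by positivity)]
    nlinarith [sq_nonneg (|sin θ| - ε), sq_abs (sin θ)]
  have hs'n : ∀ θ, |s' θ| ≤ q θ := by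
    intro θ
    have h0 := sin_sq_add_sq_pos ε hε θ
    have : s' θ = q θ * (cos θ * ((ε ^ 2 - sin θ ^ 2) * q θ)) := by
      simp only [hs', hq]; field_simp; ring
    rw [this, abs_mul, abs_of_pos (hq0 θ)]
    have h1 : |(ε ^ 2 - sin θ ^ 2) * q θ| ≤ 1 := by
      rw [abs_mul, abs_of_pos (hq0 θ), hq, ← div_eq_mul_inv, div_le_one h0, abs_le]
      constructor <;> nlinarith [sq_nonneg (sin θ), sq_nonneg ε]
    have h2 : |cos θ * ((ε ^ 2 - sin θ ^ 2) * q θ)| ≤ 1 := by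
      rw [abs_mul]
      exact mul_le_one₀ (abs_cos_le_one θ) (abs_nonneg _) h1
    nlinarith [hq0 θ]
  have hJ := integral_inv_sin_sq_le ε hε hε1
  change ∫ θ in (-π)..π, q θ ≤ _ at hJ
  have hsplit : ∫ θ in (-π)..π, E θ * f θ =
      (∫ θ in (-π)..π, E θ * f θ * ((ε ^ 2 * q θ : ℝ) : ℂ)) +
      ∫ θ in (-π)..π, (E θ * (sin θ : ℂ)) * g θ := by
    rw [← integral_add]
    · refine integral_congr fun θ _ => ?_
      have h0 := (sin_sq_add_sq_pos ε hε θ).ne'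
      have h1 : ((ε ^ 2 * q θ : ℝ) : ℂ) + (sin θ : ℂ) * ((sin θ * q θ : ℝ) : ℂ) = 1 := by
        rw [← ofReal_mul, ← ofReal_add, ← ofReal_one]
        congr 1
        simp only [hq]; field_simp; ring
      simp only [hg]
      linear_combination (-(E θ * f θ)) * h1
    · exact Continuous.intervalIntegrable (by fun_prop) _ _
    · exact Continuous.intervalIntegrable
        (by have : Continuous g := continuous_iff_continuousAt.2 fun θ => (hgd θ).continuousAt
            fun_prop) _ _
  have hibp : -I * τ * ∫ θ in (-π)..π, (E θ * (sin θ : ℂ)) * g θ =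
      -∫ θ in (-π)..π, E θ * g' θ := by
    have := integral_deriv_mul_eq_sub (a := -π) (b := π)
      (u := E) (v := g) (u' := fun θ => -I * τ * (E θ * (sin θ : ℂ))) (v' := g')
      (fun θ _ => hasDerivAt_exp_cos τ θ) (fun θ _ => hgd θ)
      integrable_of_continuous
      integrable_of_continuous
    have hgc : Continuous g := continuous_iff_continuousAt.2 fun θ => (hgd θ).continuousAt
    rw [integral_add integrable_of_continuous
      integrable_of_continuous] at this
    have hz : E π * g π - E (-π) * g (-π) = 0 := by simp [hg]
    rw [hz] at this
    rw [← integral_const_mul]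
    rw [eq_neg_iff_add_eq_zero, ← this]
    congr 1
    refine integral_congr fun θ _ => by ring
  have hn1 : ‖∫ θ in (-π)..π, E θ * f θ * ((ε ^ 2 * q θ : ℝ) : ℂ)‖ ≤
      B * ε ^ 2 * (4 * π / ε) := by
    calc _ ≤ ∫ θ in (-π)..π, B * ε ^ 2 * q θ := by
          refine norm_integral_le_of_norm_le (by linarith)
            (MeasureTheory.ae_of_all _ fun θ _ => ?_)
            (Continuous.intervalIntegrable (by fun_prop) _ _)
          rw [norm_mul, norm_mul, hEn, one_mul, norm_real, norm_eq_abs,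
            abs_of_pos (mul_pos (by positivity) (hq0 θ)), mul_assoc]
          exact mul_le_mul_of_nonneg_right (hB θ) (mul_pos (by positivity) (hq0 θ)).le
      _ ≤ _ := by
          rw [integral_const_mul]
          gcongr
  have hn2 : ‖∫ θ in (-π)..π, E θ * g' θ‖ ≤
      B * (π / ε + 4 * π / ε) := by
    calc _ ≤ ∫ θ in (-π)..π, B * (1 / (2 * ε) + q θ) := by
          refine norm_integral_le_of_norm_le (by linarith)
            (MeasureTheory.ae_of_all _ fun θ _ => ?_)
            (Continuous.intervalIntegrable (by fun_prop) _ _)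
          rw [norm_mul, hEn, one_mul, mul_add]
          refine (norm_add_le _ _).trans (add_le_add ?_ ?_)
          · rw [norm_mul, norm_real, norm_eq_abs]
            exact mul_le_mul (hB1 θ) (hsn θ) (abs_nonneg _) hB0
          · rw [norm_mul, norm_real, norm_eq_abs]
            exact mul_le_mul (hB θ) (hs'n θ) (abs_nonneg _) hB0
      _ ≤ _ := by
          rw [integral_const_mul, integral_add (by simp)
            (hqc.intervalIntegrable _ _), integral_const]
          gcongr
          rw [smul_eq_mul]
          apply le_of_eq; field_simp; ring
  have hn3 : ‖∫ θ in (-π)..π, (E θ * (sin θ : ℂ)) * g θ‖ ≤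
      ε ^ 2 * (B * (π / ε + 4 * π / ε)) := by
    have h := congrArg norm hibp
    rw [norm_mul, norm_neg, norm_mul, norm_neg, norm_I, one_mul, norm_real,
      norm_eq_abs] at h
    rw [hε2, ← div_eq_inv_mul, le_div_iff₀ hτ0, mul_comm, h]
    exact hn2
  rw [hsplit]
  refine (norm_add_le _ _).trans ((add_le_add hn1 hn3).trans ?_)
  have : 9 * π * B / √|τ| = 9 * π * B * ε := by rw [hεd]; rfl
  rw [this]
  apply le_of_eq; field_simp; ring

/-- Two derivatives of `f`, bounded by `B` together with `f`. -/
def C2Bound (B : ℝ) (f : ℝ → ℂ) : Prop :=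
  ∃ f1 f2 : ℝ → ℂ, (∀ θ, HasDerivAt f (f1 θ) θ) ∧ (∀ θ, HasDerivAt f1 (f2 θ) θ) ∧
    Continuous f2 ∧ ∀ θ, ‖f θ‖ ≤ B ∧ ‖f1 θ‖ ≤ B ∧ ‖f2 θ‖ ≤ B

lemma one_add_rpow_neg_le {τ : ℝ} (hτ : 1 ≤ τ) :
    τ ^ (-(3 / 2) : ℝ) ≤ 3 * (1 + τ) ^ (-(3 / 2) : ℝ) := by
  have h0 : 0 < τ := by linarith
  have h1 : (2 * τ) ^ (-(3 / 2) : ℝ) ≤ (1 + τ) ^ (-(3 / 2) : ℝ) :=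
    rpow_le_rpow_of_nonpos (by linarith) (by linarith) (by norm_num)
  rw [Real.mul_rpow (by norm_num) h0.le] at h1
  have h2 : (1 / 3 : ℝ) ≤ 2 ^ (-(3 / 2) : ℝ) := by
    rw [rpow_neg (by norm_num), one_div]
    apply inv_anti₀ (by positivity)
    rw [show (3 / 2 : ℝ) = 1 + 1 / 2 by norm_num, rpow_add (by norm_num), Real.rpow_one,
      ← Real.sqrt_eq_rpow]
    have : √2 ≤ 3 / 2 := Real.sqrt_le_iff.2 (by norm_num)
    linarith
  have h3 : 0 ≤ τ ^ (-(3 / 2) : ℝ) := by positivity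
  nlinarith

/-- Decay of oscillatory integrals whose amplitude vanishes at the stationary points. -/
lemma norm_integral_exp_cos_mul_sin_le {f : ℝ → ℂ} {B : ℝ} (hf : C2Bound B f)
    (hper : f π = f (-π)) (τ : ℝ) :
    ‖∫ θ in (-π)..π, exp (I * (τ * cos θ : ℝ)) * ((sin θ : ℂ) * f θ)‖ ≤
      100 * B * (1 + |τ|) ^ (-(3 / 2) : ℝ) := by
  obtain ⟨f1, f2, h1, h2, h2c, hB⟩ := hf
  have hpi := pi_pos
  have hB0 : 0 ≤ B := (norm_nonneg _).trans (hB 0).1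
  have hfc : Continuous f := continuous_iff_continuousAt.2 fun θ => (h1 θ).continuousAt
  have hf1c : Continuous f1 := continuous_iff_continuousAt.2 fun θ => (h2 θ).continuousAt
  rcases le_total |τ| 1 with hτ | hτ
  · calc _ ≤ B * |π - -π| := by
          refine norm_integral_le_of_norm_le_const fun θ _ => ?_
          rw [norm_mul, norm_exp_I_mul, one_mul, norm_mul, norm_real, norm_eq_abs]
          calc _ ≤ 1 * B := mul_le_mul (abs_sin_le_one θ) (hB θ).1 (norm_nonneg _) (by norm_num)
            _ = B := one_mul B
      _ ≤ 100 * B * (1 / 3) := by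
          rw [abs_of_pos (by linarith)]
          nlinarith [Real.pi_lt_four]
      _ ≤ _ := by
          gcongr
          calc (1 / 3 : ℝ) ≤ (1 + 1) ^ (-(3 / 2) : ℝ) := by
                have := one_add_rpow_neg_le (le_refl (1 : ℝ))
                rw [one_rpow] at this; linarith
            _ ≤ _ := rpow_le_rpow_of_nonpos (by positivity) (by linarith) (by norm_num)
  · have hτ0 : 0 < |τ| := by linarith
    set E : ℝ → ℂ := fun θ => exp (I * (τ * cos θ : ℝ)) with hE
    have hEc : Continuous E := by simp only [hE]; fun_prop
    have hibp : -I * τ * ∫ θ in (-π)..π, E θ * ((sin θ : ℂ) * f θ) =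
        -∫ θ in (-π)..π, E θ * f1 θ := by
      have := integral_deriv_mul_eq_sub (a := -π) (b := π)
        (u := E) (v := f) (u' := fun θ => -I * τ * (E θ * (sin θ : ℂ))) (v' := f1)
        (fun θ _ => hasDerivAt_exp_cos τ θ) (fun θ _ => h1 θ)
        integrable_of_continuous
        integrable_of_continuous
      rw [integral_add integrable_of_continuous
        integrable_of_continuous] at this
      have hz : E π * f π - E (-π) * f (-π) = 0 := by
        rw [hper]; simp [hE]
      rw [hz] at this
      rw [← integral_const_mul, eq_neg_iff_add_eq_zero, ← this]
      congr 1
      refine integral_congr fun θ _ => by ring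
    have hv := norm_integral_exp_cos_le h2 h2c (fun θ => (hB θ).2.1) (fun θ => (hB θ).2.2) hτ
    have h := congrArg norm hibp
    rw [norm_mul, norm_neg, norm_mul, norm_neg, norm_I, one_mul, norm_real,
      norm_eq_abs] at h
    have hle : ‖∫ θ in (-π)..π, E θ * ((sin θ : ℂ) * f θ)‖ ≤
        9 * π * B / √|τ| / |τ| := by
      rw [le_div_iff₀ hτ0, mul_comm, h]; exact hv
    refine hle.trans ?_
    have e1 : 9 * π * B / √|τ| / |τ| = 9 * π * B * |τ| ^ (-(3 / 2) : ℝ) := by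
      rw [show (-(3 / 2) : ℝ) = -(1 / 2) + -1 by norm_num, rpow_add hτ0,
        rpow_neg hτ0.le, Real.rpow_neg_one, ← Real.sqrt_eq_rpow]
      field_simp
    rw [e1]
    calc 9 * π * B * |τ| ^ (-(3 / 2) : ℝ)
        ≤ 9 * π * B * (3 * (1 + |τ|) ^ (-(3 / 2) : ℝ)) := by
          gcongr
          exact one_add_rpow_neg_le hτ
      _ = (27 * π) * B * (1 + |τ|) ^ (-(3 / 2) : ℝ) := by ring
      _ ≤ _ := by
          gcongr
          nlinarith [Real.pi_lt_d2]

/-! ### Algebra of `C²` bounds -/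

lemma C2Bound.nonneg {B : ℝ} {f : ℝ → ℂ} (h : C2Bound B f) : 0 ≤ B := by
  obtain ⟨f1, f2, -, -, -, hB⟩ := h
  exact (norm_nonneg _).trans (hB 0).1

lemma C2Bound.norm_le {B : ℝ} {f : ℝ → ℂ} (h : C2Bound B f) (θ : ℝ) : ‖f θ‖ ≤ B := by
  obtain ⟨f1, f2, -, -, -, hB⟩ := h
  exact (hB θ).1

lemma C2Bound.continuous {B : ℝ} {f : ℝ → ℂ} (h : C2Bound B f) : Continuous f := by
  obtain ⟨f1, f2, h1, -, -, -⟩ := h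
  exact continuous_iff_continuousAt.2 fun θ => (h1 θ).continuousAt

lemma C2Bound.mono {B B' : ℝ} {f : ℝ → ℂ} (h : C2Bound B f) (hB : B ≤ B') : C2Bound B' f := by
  obtain ⟨f1, f2, h1, h2, h3, h4⟩ := h
  exact ⟨f1, f2, h1, h2, h3, fun θ => ⟨(h4 θ).1.trans hB, (h4 θ).2.1.trans hB, (h4 θ).2.2.trans hB⟩⟩

lemma C2Bound.const (c : ℂ) : C2Bound ‖c‖ fun _ => c :=
  ⟨fun _ => 0, fun _ => 0, fun θ => hasDerivAt_const θ c, fun θ => hasDerivAt_const θ 0,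
    continuous_const, fun _ => by simp⟩

lemma C2Bound.add {B B' : ℝ} {f g : ℝ → ℂ} (hf : C2Bound B f) (hg : C2Bound B' g) :
    C2Bound (B + B') fun θ => f θ + g θ := by
  obtain ⟨f1, f2, h1, h2, h3, h4⟩ := hf
  obtain ⟨g1, g2, k1, k2, k3, k4⟩ := hg
  refine ⟨fun θ => f1 θ + g1 θ, fun θ => f2 θ + g2 θ, fun θ => (h1 θ).add (k1 θ),
    fun θ => (h2 θ).add (k2 θ), h3.add k3, fun θ => ⟨?_, ?_, ?_⟩⟩
  · exact (norm_add_le _ _).trans (add_le_add (h4 θ).1 (k4 θ).1)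
  · exact (norm_add_le _ _).trans (add_le_add (h4 θ).2.1 (k4 θ).2.1)
  · exact (norm_add_le _ _).trans (add_le_add (h4 θ).2.2 (k4 θ).2.2)

lemma C2Bound.mul {B B' : ℝ} {f g : ℝ → ℂ} (hf : C2Bound B f) (hg : C2Bound B' g) :
    C2Bound (4 * (B * B')) fun θ => f θ * g θ := by
  have hB := hf.nonneg
  have hB' := hg.nonneg
  obtain ⟨f1, f2, h1, h2, h3, h4⟩ := hf
  obtain ⟨g1, g2, k1, k2, k3, k4⟩ := hg
  have hfc : Continuous f := continuous_iff_continuousAt.2 fun θ => (h1 θ).continuousAt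
  have hf1c : Continuous f1 := continuous_iff_continuousAt.2 fun θ => (h2 θ).continuousAt
  have hgc : Continuous g := continuous_iff_continuousAt.2 fun θ => (k1 θ).continuousAt
  have hg1c : Continuous g1 := continuous_iff_continuousAt.2 fun θ => (k2 θ).continuousAt
  have hBB := mul_nonneg hB hB'
  have key : ∀ a b : ℂ, ‖a‖ ≤ B → ‖b‖ ≤ B' → ‖a * b‖ ≤ B * B' := fun a b ha hb => by
    rw [norm_mul]; exact mul_le_mul ha hb (norm_nonneg _) hB
  refine ⟨fun θ => f1 θ * g θ + f θ * g1 θ,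
    fun θ => (f2 θ * g θ + f1 θ * g1 θ) + (f1 θ * g1 θ + f θ * g2 θ), fun θ => (h1 θ).mul (k1 θ),
    fun θ => ((h2 θ).mul (k1 θ)).add ((h1 θ).mul (k2 θ)), by fun_prop, fun θ => ⟨?_, ?_, ?_⟩⟩
  · linarith [key _ _ (h4 θ).1 (k4 θ).1]
  · have := norm_add_le (f1 θ * g θ) (f θ * g1 θ)
    linarith [key _ _ (h4 θ).1 (k4 θ).2.1, key _ _ (h4 θ).2.1 (k4 θ).1]
  · have e1 := norm_add_le (f2 θ * g θ + f1 θ * g1 θ) (f1 θ * g1 θ + f θ * g2 θ)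
    have e2 := norm_add_le (f2 θ * g θ) (f1 θ * g1 θ)
    have e3 := norm_add_le (f1 θ * g1 θ) (f θ * g2 θ)
    linarith [key _ _ (h4 θ).2.2 (k4 θ).1, key _ _ (h4 θ).2.1 (k4 θ).2.1,
      key _ _ (h4 θ).1 (k4 θ).2.2]

lemma C2Bound.const_mul {B : ℝ} {f : ℝ → ℂ} (c : ℂ) (hf : C2Bound B f) :
    C2Bound (‖c‖ * B) fun θ => c * f θ := by
  obtain ⟨f1, f2, h1, h2, h3, h4⟩ := hf
  refine ⟨fun θ => c * f1 θ, fun θ => c * f2 θ, fun θ => (h1 θ).const_mul c,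
    fun θ => (h2 θ).const_mul c, continuous_const.mul h3, fun θ => ⟨?_, ?_, ?_⟩⟩ <;>
  rw [norm_mul]
  · exact mul_le_mul_of_nonneg_left (h4 θ).1 (norm_nonneg _)
  · exact mul_le_mul_of_nonneg_left (h4 θ).2.1 (norm_nonneg _)
  · exact mul_le_mul_of_nonneg_left (h4 θ).2.2 (norm_nonneg _)

lemma C2Bound.sum {B : ℝ} {ι : Type*} (s : Finset ι) {f : ι → ℝ → ℂ}
    (hf : ∀ i ∈ s, C2Bound B (f i)) : C2Bound (s.card * B) fun θ => ∑ i ∈ s, f i θ := by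
  classical
  induction s using Finset.induction_on with
  | empty => simpa using C2Bound.const 0
  | insert a s ha ih =>
    have h := (hf a (Finset.mem_insert_self _ _)).add
      (ih fun i hi => hf i (Finset.mem_insert_of_mem hi))
    simp only [Finset.sum_insert ha, Finset.card_insert_of_notMem ha]
    refine h.mono (le_of_eq ?_)
    push_cast; ring

lemma C2Bound.conj {B : ℝ} {f : ℝ → ℂ} (hf : C2Bound B f) :
    C2Bound B fun θ => conj (f θ) := by
  obtain ⟨f1, f2, h1, h2, h3, h4⟩ := hf
  refine ⟨fun θ => conj (f1 θ), fun θ => conj (f2 θ), fun θ => (h1 θ).star,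
    fun θ => (h2 θ).star, continuous_conj.comp h3, fun θ => ?_⟩
  simpa using h4 θ

lemma C2Bound.inv {B c : ℝ} {f : ℝ → ℂ} (hf : C2Bound B f) (hc : 0 < c) (hfc : ∀ θ, c ≤ ‖f θ‖) :
    C2Bound (c⁻¹ + 2 * B * c⁻¹ ^ 2 + 2 * B ^ 2 * c⁻¹ ^ 3) fun θ => (f θ)⁻¹ := by
  have hB := hf.nonneg
  have hcont := hf.continuous
  obtain ⟨f1, f2, h1, h2, h3, h4⟩ := hf
  have hf1c : Continuous f1 := continuous_iff_continuousAt.2 fun θ => (h2 θ).continuousAt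
  have hne : ∀ θ, f θ ≠ 0 := fun θ h => by
    have := hfc θ; rw [h, norm_zero] at this; linarith
  have hin : ∀ θ, ‖(f θ)⁻¹‖ ≤ c⁻¹ := fun θ => by
    rw [norm_inv]; exact inv_anti₀ hc (hfc θ)
  have hc0 : 0 < c⁻¹ := inv_pos.2 hc
  have hic : Continuous fun θ => (f θ)⁻¹ := hcont.inv₀ hne
  have d1 : ∀ θ, HasDerivAt (fun θ => (f θ)⁻¹) (-f1 θ * (f θ)⁻¹ ^ 2) θ := fun θ => by
    refine ((h1 θ).inv (hne θ)).congr_deriv ?_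
    rw [div_eq_mul_inv, inv_pow]
  refine ⟨fun θ => -f1 θ * (f θ)⁻¹ ^ 2,
    fun θ => -f2 θ * (f θ)⁻¹ ^ 2 + -f1 θ * (2 * (f θ)⁻¹ * (-f1 θ * (f θ)⁻¹ ^ 2)), d1, fun θ => ?_,
    by fun_prop, fun θ => ⟨?_, ?_, ?_⟩⟩
  · refine ((h2 θ).neg.mul ((d1 θ).pow 2)).congr_deriv ?_
    simp
  · have : 0 ≤ 2 * B * c⁻¹ ^ 2 + 2 * B ^ 2 * c⁻¹ ^ 3 := by positivity
    linarith [hin θ]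
  · have : ‖-f1 θ * (f θ)⁻¹ ^ 2‖ ≤ B * c⁻¹ ^ 2 := by
      rw [norm_mul, norm_neg, norm_pow]
      exact mul_le_mul (h4 θ).2.1 (pow_le_pow_left₀ (norm_nonneg _) (hin θ) 2) (by positivity) hB
    have h0 : 0 ≤ B * c⁻¹ ^ 2 := by positivity
    have h00 : 0 ≤ B ^ 2 * c⁻¹ ^ 3 := by positivity
    linarith
  · refine (norm_add_le _ _).trans ?_
    have e1 : ‖-f2 θ * (f θ)⁻¹ ^ 2‖ ≤ B * c⁻¹ ^ 2 := by
      rw [norm_mul, norm_neg, norm_pow]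
      exact mul_le_mul (h4 θ).2.2 (pow_le_pow_left₀ (norm_nonneg _) (hin θ) 2) (by positivity) hB
    have e2 : ‖-f1 θ * (2 * (f θ)⁻¹ * (-f1 θ * (f θ)⁻¹ ^ 2))‖ ≤ 2 * B ^ 2 * c⁻¹ ^ 3 := by
      have : -f1 θ * (2 * (f θ)⁻¹ * (-f1 θ * (f θ)⁻¹ ^ 2)) = 2 * (f1 θ ^ 2 * (f θ)⁻¹ ^ 3) := by ring
      rw [this, norm_mul, norm_mul, norm_pow, norm_pow, norm_ofNat, mul_assoc]
      gcongr
      · exact (h4 θ).2.1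
      · exact hin θ
    have h0 : 0 ≤ B * c⁻¹ ^ 2 := by positivity
    linarith

lemma C2Bound.pow {B : ℝ} {f : ℝ → ℂ} (hf : C2Bound B f) (hB : 1 ≤ B) (hf1 : ∀ θ, ‖f θ‖ ≤ 1)
    (n : ℕ) : C2Bound (B ^ 2 * (1 + n) ^ 2) fun θ => f θ ^ n := by
  have hcont := hf.continuous
  obtain ⟨f1, f2, h1, h2, h3, h4⟩ := hf
  have hf1c : Continuous f1 := continuous_iff_continuousAt.2 fun θ => (h2 θ).continuousAt
  have hp : ∀ θ (k : ℕ), ‖f θ ^ k‖ ≤ 1 := fun θ k => by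
    rw [norm_pow]; exact pow_le_one₀ (norm_nonneg _) (hf1 θ)
  have hn0 : (0 : ℝ) ≤ n := Nat.cast_nonneg n
  have hB2 : B ≤ B ^ 2 := by nlinarith
  have d1 : ∀ k : ℕ, ∀ θ, HasDerivAt (fun θ => f θ ^ k) (k * f θ ^ (k - 1) * f1 θ) θ :=
    fun k θ => (h1 θ).pow k
  refine ⟨fun θ => n * f θ ^ (n - 1) * f1 θ,
    fun θ => n * (((n - 1 : ℕ) : ℂ) * f θ ^ (n - 1 - 1) * f1 θ) * f1 θ + n * f θ ^ (n - 1) * f2 θ,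
    d1 n, fun θ => ((d1 (n - 1) θ).const_mul (n : ℂ)).mul (h2 θ), by fun_prop,
    fun θ => ⟨?_, ?_, ?_⟩⟩
  · calc ‖f θ ^ n‖ ≤ 1 := hp θ n
      _ ≤ _ := by nlinarith [sq_nonneg (n : ℝ)]
  · have : ‖(n : ℂ) * f θ ^ (n - 1) * f1 θ‖ ≤ n * 1 * B := by
      rw [norm_mul, norm_mul, norm_natCast]
      gcongr
      · exact hp θ _
      · exact (h4 θ).2.1
    refine this.trans ?_
    have h5 : n * B ≤ n * B ^ 2 := by gcongr
    nlinarith [sq_nonneg B, mul_nonneg hn0 (sq_nonneg B), mul_nonneg (sq_nonneg (n : ℝ)) (sq_nonneg B)]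
  · have e1 : ‖(n : ℂ) * f θ ^ (n - 1) * f2 θ‖ ≤ n * 1 * B := by
      rw [norm_mul, norm_mul, norm_natCast]
      gcongr
      · exact hp θ _
      · exact (h4 θ).2.2
    have e2 : ‖(n : ℂ) * (((n - 1 : ℕ) : ℂ) * f θ ^ (n - 1 - 1) * f1 θ) * f1 θ‖ ≤
        n * (n * 1 * B) * B := by
      rw [norm_mul, norm_mul, norm_mul, norm_mul, norm_natCast, norm_natCast]
      gcongr
      · exact Nat.sub_le _ _
      · exact hp θ _
      · exact (h4 θ).2.1
      · exact (h4 θ).2.1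
    refine (norm_add_le _ _).trans ?_
    have : n * B ≤ n * B ^ 2 := by gcongr
    nlinarith [sq_nonneg B]

lemma C2Bound.sqrt {B m : ℝ} {g g1 g2 : ℝ → ℝ} (h1 : ∀ θ, HasDerivAt g (g1 θ) θ)
    (h2 : ∀ θ, HasDerivAt g1 (g2 θ) θ) (h3 : Continuous g2) (hm : 0 < m) (hgm : ∀ θ, m ^ 2 ≤ g θ)
    (hB : ∀ θ, |g θ| ≤ B ∧ |g1 θ| ≤ B ∧ |g2 θ| ≤ B) :
    C2Bound ((1 + B) + B * m⁻¹ + B ^ 2 * m⁻¹ ^ 3) fun θ => (√(g θ) : ℂ) := by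
  have hB0 : 0 ≤ B := (abs_nonneg _).trans (hB 0).1
  have hg0 : ∀ θ, 0 < g θ := fun θ => lt_of_lt_of_le (by positivity) (hgm θ)
  have hs0 : ∀ θ, 0 < √(g θ) := fun θ => Real.sqrt_pos.2 (hg0 θ)
  have hsm : ∀ θ, m ≤ √(g θ) := fun θ => Real.le_sqrt_of_sq_le (hgm θ)
  have hi : ∀ θ, (√(g θ))⁻¹ ≤ m⁻¹ := fun θ => inv_anti₀ hm (hsm θ)
  have hi0 : ∀ θ, 0 < (√(g θ))⁻¹ := fun θ => inv_pos.2 (hs0 θ)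
  have hm0 : 0 < m⁻¹ := inv_pos.2 hm
  have hgc : Continuous g := continuous_iff_continuousAt.2 fun θ => (h1 θ).continuousAt
  have hg1c : Continuous g1 := continuous_iff_continuousAt.2 fun θ => (h2 θ).continuousAt
  have d1 : ∀ θ, HasDerivAt (fun θ => √(g θ)) (g1 θ / 2 * (√(g θ))⁻¹) θ :=
    fun θ => ((h1 θ).sqrt (hg0 θ).ne').congr_deriv (by field_simp)
  have d2 : ∀ θ, HasDerivAt (fun θ => g1 θ / 2 * (√(g θ))⁻¹)
      (g2 θ / 2 * (√(g θ))⁻¹ - g1 θ ^ 2 / 4 * (√(g θ))⁻¹ ^ 3) θ := fun θ => by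
    refine (((h2 θ).div_const 2).mul ((d1 θ).inv (hs0 θ).ne')).congr_deriv ?_
    have := hs0 θ
    simp only [Pi.inv_apply]
    field_simp
    ring
  have hsc : Continuous fun θ => (√(g θ))⁻¹ :=
    (Real.continuous_sqrt.comp hgc).inv₀ fun θ => (hs0 θ).ne'
  have p1 : 0 ≤ B * m⁻¹ := by positivity
  have p2 : 0 ≤ B ^ 2 * m⁻¹ ^ 3 := by positivity
  have ec : Continuous fun θ =>
      (g2 θ / 2 * (√(g θ))⁻¹ - g1 θ ^ 2 / 4 * (√(g θ))⁻¹ ^ 3) := by fun_prop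
  refine ⟨_, _, fun θ => (d1 θ).ofReal_comp, fun θ => (d2 θ).ofReal_comp,
    continuous_ofReal.comp ec, fun θ => ?_⟩
  simp only [norm_real, norm_eq_abs]
  have q1 : |g1 θ / 2 * (√(g θ))⁻¹| ≤ B * m⁻¹ := by
    rw [abs_mul, abs_of_pos (hi0 θ)]
    refine mul_le_mul ?_ (hi θ) (hi0 θ).le hB0
    rw [abs_div, abs_two]; linarith [(hB θ).2.1, abs_nonneg (g1 θ)]
  have q2 : |g2 θ / 2 * (√(g θ))⁻¹| ≤ B * m⁻¹ := by
    rw [abs_mul, abs_of_pos (hi0 θ)]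
    refine mul_le_mul ?_ (hi θ) (hi0 θ).le hB0
    rw [abs_div, abs_two]; linarith [(hB θ).2.2, abs_nonneg (g2 θ)]
  have q3 : |g1 θ ^ 2 / 4 * (√(g θ))⁻¹ ^ 3| ≤ B ^ 2 * m⁻¹ ^ 3 := by
    rw [abs_mul, abs_of_pos (pow_pos (hi0 θ) 3)]
    refine mul_le_mul ?_ (pow_le_pow_left₀ (hi0 θ).le (hi θ) 3) (pow_pos (hi0 θ) 3).le (by positivity)
    rw [abs_div, abs_pow, abs_of_pos (by norm_num : (0:ℝ) < 4)]
    have := pow_le_pow_left₀ (abs_nonneg _) (hB θ).2.1 2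
    linarith [sq_nonneg (|g1 θ|)]
  refine ⟨?_, by linarith, (abs_sub _ _).trans (by linarith)⟩
  rw [abs_of_pos (hs0 θ)]
  have : √(g θ) ≤ 1 + g θ := by
    rw [Real.sqrt_le_left (by linarith [hg0 θ])]
    nlinarith [hg0 θ]
  linarith [(hB θ).1, le_abs_self (g θ)]

lemma C2Bound.cexp : C2Bound 1 fun θ : ℝ => exp (I * (θ : ℂ)) := by
  have d : ∀ θ : ℝ, HasDerivAt (fun θ : ℝ => exp (I * (θ : ℂ))) (I * exp (I * (θ : ℂ))) θ := fun θ => by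
    have h := ((hasDerivAt_id θ).ofReal_comp.const_mul I).cexp
    refine h.congr_deriv ?_
    simp [mul_comm]
  refine ⟨_, fun θ => I * (I * exp (I * (θ : ℂ))), d, fun θ => (d θ).const_mul I, by fun_prop,
    fun θ => ?_⟩
  simp only [norm_mul, norm_I, one_mul, norm_exp_I_mul]
  simp

lemma C2Bound.sin_mul (k : ℤ) : C2Bound ((1 + |(k : ℝ)|) ^ 2) fun θ : ℝ => ((sin (k * θ) : ℝ) : ℂ) := by
  have d1 : ∀ θ : ℝ, HasDerivAt (fun θ : ℝ => sin (k * θ)) (k * cos (k * θ)) θ := fun θ => by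
    refine ((hasDerivAt_id θ).const_mul (k : ℝ)).sin.congr_deriv ?_
    simp [mul_comm]
  have d2 : ∀ θ : ℝ, HasDerivAt (fun θ : ℝ => (k : ℝ) * cos (k * θ))
      (-(k : ℝ) ^ 2 * sin (k * θ)) θ := fun θ => by
    refine (((hasDerivAt_id θ).const_mul (k : ℝ)).cos.const_mul (k : ℝ)).congr_deriv ?_
    simp; ring
  refine ⟨_, _, fun θ => (d1 θ).ofReal_comp, fun θ => (d2 θ).ofReal_comp, by fun_prop, fun θ => ?_⟩
  simp only [norm_real, norm_eq_abs, abs_mul, abs_neg, abs_pow]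
  have h1 := abs_sin_le_one (k * θ)
  have h2 := abs_cos_le_one (k * θ)
  have h3 := abs_nonneg (k : ℝ)
  have h4 := abs_nonneg (sin (k * θ))
  refine ⟨by nlinarith, by nlinarith, ?_⟩
  calc |(k : ℝ)| ^ 2 * |sin (k * θ)| ≤ |(k : ℝ)| ^ 2 * 1 := by gcongr
    _ ≤ _ := by nlinarith

/-! ### The kernel of the linearized flow as a circle integral -/

/-- The spectral parameter `m + 2` of the second channel on the band `2 cos θ` of the first one. -/
def evW (w θ : ℝ) : ℝ := 2 * w - 2 * cos θ

/-- `ζ⁻¹ - ζ` in the second channel. -/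
def evS (w θ : ℝ) : ℝ := √(evW w θ ^ 2 - 4)

/-- The decaying root `ζ` in the second channel. -/
def evZ (w θ : ℝ) : ℝ := (evW w θ - evS w θ) / 2

/-- `e^{iθ}` -/
def circ (θ : ℝ) : ℂ := exp (I * (θ : ℂ))

/-- The determinant on the band. -/
def bandDet (w α β θ : ℝ) : ℂ :=
  (-2 * I * (sin θ : ℂ) - α) * ((evS w θ : ℂ) - α) - (β : ℂ) ^ 2

def bandP (w α β : ℝ) (c : ℂ) (n : ℕ) (θ : ℝ) : ℂ :=
  I * (β * conj c * (evZ w θ : ℂ) ^ n - ((evS w θ : ℂ) - α) * c * circ θ ^ n) *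
    (bandDet w α β θ)⁻¹

def bandR (w α β : ℝ) (c : ℂ) (n : ℕ) (θ : ℝ) : ℂ :=
  I * (β * conj c * conj (circ θ) ^ n -
    (2 * I * (sin θ : ℂ) - α) * c * (evZ w θ : ℂ) ^ n) *
    (conj (bandDet w α β θ))⁻¹

/-- Parameters in a compact set away from the resonances. -/
structure Par (δ Λ w α β : ℝ) : Prop where
  hδ : 0 < δ
  hw : 2 + δ ≤ w
  hw' : w ≤ Λ
  hα : |α| ≤ Λ
  hβ : |β| ≤ Λ
  hD : ∀ θ, δ ≤ ‖bandDet w α β θ‖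

lemma Par.hΛ {δ Λ w α β : ℝ} (h : Par δ Λ w α β) : 2 < Λ := by linarith [h.hδ, h.hw, h.hw']

lemma evW_ge {w : ℝ} (θ : ℝ) : 2 * w - 2 ≤ evW w θ := by
  have := Real.cos_le_one θ; unfold evW; linarith

lemma evW_le {w : ℝ} (θ : ℝ) : evW w θ ≤ 2 * w + 2 := by
  have := Real.neg_one_le_cos θ; unfold evW; linarith

lemma evW_sq_pos {w : ℝ} (hw : 2 < w) (θ : ℝ) : 0 < evW w θ ^ 2 - 4 := by
  nlinarith [evW_ge (w := w) θ]

lemma evS_sq {w : ℝ} (hw : 2 < w) (θ : ℝ) : evS w θ ^ 2 = evW w θ ^ 2 - 4 :=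
  sq_sqrt (evW_sq_pos hw θ).le

lemma evS_pos {w : ℝ} (hw : 2 < w) (θ : ℝ) : 0 < evS w θ := Real.sqrt_pos.2 (evW_sq_pos hw θ)

lemma evS_lt {w : ℝ} (hw : 2 < w) (θ : ℝ) : evS w θ < evW w θ := by
  have := evW_ge (w := w) θ
  rw [evS, Real.sqrt_lt' (by linarith)]; linarith

lemma evZ_pos {w : ℝ} (hw : 2 < w) (θ : ℝ) : 0 < evZ w θ := by
  unfold evZ; linarith [evS_lt hw θ]

lemma evZ_lt_one {w : ℝ} (hw : 2 < w) (θ : ℝ) : evZ w θ < 1 := by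
  have h1 := evW_ge (w := w) θ
  have h2 := evS_sq hw θ
  have h3 := evS_pos hw θ
  unfold evZ
  nlinarith

lemma evZ_quad {w : ℝ} (hw : 2 < w) (θ : ℝ) : evZ w θ ^ 2 = evW w θ * evZ w θ - 1 := by
  have h2 := evS_sq hw θ
  unfold evZ
  nlinarith

lemma circ_quad (θ : ℝ) : circ θ ^ 2 = 2 * (cos θ : ℂ) * circ θ - 1 := by
  have h : circ θ = cos θ + sin θ * I := by
    rw [circ, mul_comm, exp_mul_I]; simp
  have h1 : (cos θ : ℂ) ^ 2 + (sin θ : ℂ) ^ 2 = 1 := by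
    have := Real.cos_sq_add_sin_sq θ
    exact_mod_cast this
  rw [h]
  linear_combination (-1 : ℂ) * h1 + (sin θ : ℂ) ^ 2 * I_sq

lemma circ_eq (θ : ℝ) : circ θ = cos θ + sin θ * I := by
  rw [circ, mul_comm, exp_mul_I]; simp

lemma norm_circ (θ : ℝ) : ‖circ θ‖ = 1 := norm_exp_I_mul θ

lemma circ_pi : circ π = -1 := by simp [circ_eq]

lemma circ_neg_pi : circ (-π) = -1 := by simp [circ_eq]

lemma C2Bound.evS_unif (δ Λ : ℝ) (hδ : 0 < δ) : ∃ K, 1 ≤ K ∧ ∀ w, 2 + δ ≤ w → w ≤ Λ →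
    C2Bound K (fun θ => (evS w θ : ℂ)) := by
  set B : ℝ := (2 * Λ + 2) ^ 2 + 4 + 4 * (2 * Λ + 2) + 8 with hB
  refine ⟨max 1 ((1 + B) + B * (√(8 * δ))⁻¹ + B ^ 2 * (√(8 * δ))⁻¹ ^ 3),
    le_max_left _ _, fun w hw hw' => ?_⟩
  have hΛ : 2 < Λ := by linarith
  have h1 : ∀ θ, HasDerivAt (fun θ => evW w θ ^ 2 - 4) (2 * evW w θ * (2 * sin θ)) θ := fun θ => by
    have h := (((Real.hasDerivAt_cos θ).const_mul 2).const_sub (2 * w)).pow 2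
    refine (h.sub_const 4).congr_deriv ?_
    simp only [evW, Nat.cast_ofNat]; ring
  have h2 : ∀ θ, HasDerivAt (fun θ => 2 * evW w θ * (2 * sin θ))
      (2 * (2 * sin θ) * (2 * sin θ) + 2 * evW w θ * (2 * cos θ)) θ := fun θ => by
    have h := (((Real.hasDerivAt_cos θ).const_mul 2).const_sub (2 * w)).const_mul 2
    refine (h.mul ((Real.hasDerivAt_sin θ).const_mul 2)).congr_deriv ?_
    simp only [evW]; ring
  refine (C2Bound.sqrt (m := √(8 * δ)) (B := B) h1 h2 (by unfold evW; fun_prop)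
    (by positivity) (fun θ => ?_) (fun θ => ?_)).mono (le_max_right _ _)
  · rw [sq_sqrt (by positivity)]
    nlinarith [evW_ge (w := w) θ]
  · have e1 := evW_ge (w := w) θ
    have e2 := evW_le (w := w) θ
    have e3 := Real.sin_sq_add_cos_sq θ
    have e4 := abs_sin_le_one θ
    have e5 := abs_cos_le_one θ
    have e6 : |evW w θ| ≤ 2 * Λ + 2 := by rw [abs_of_pos] <;> linarith
    have e7 : 0 ≤ 2 * Λ + 2 := by linarith
    refine ⟨?_, ?_, ?_⟩
    · rw [abs_of_pos (evW_sq_pos (by linarith) θ)]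
      nlinarith
    · rw [abs_mul, abs_mul, abs_mul, abs_two]
      have : |evW w θ| * |sin θ| ≤ (2 * Λ + 2) * 1 := by gcongr
      nlinarith
    · refine (abs_add_le _ _).trans ?_
      rw [abs_mul, abs_mul, abs_mul, abs_mul, abs_mul, abs_mul, abs_two]
      have : |evW w θ| * |cos θ| ≤ (2 * Λ + 2) * 1 := by gcongr
      have : |sin θ| * |sin θ| ≤ 1 * 1 := by gcongr
      nlinarith

lemma C2Bound.evW (w Λ : ℝ) (hw : 2 < w) (hw' : w ≤ Λ) :
    C2Bound (2 * Λ + 2) (fun θ => (evW w θ : ℂ)) := by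
  have h1 : ∀ θ, HasDerivAt (DiscreteNLS.evW w) (2 * sin θ) θ := fun θ =>
    (((Real.hasDerivAt_cos θ).const_mul 2).const_sub (2 * w)).congr_deriv (by ring)
  have h2 : ∀ θ, HasDerivAt (fun θ => 2 * sin θ) (2 * cos θ) θ := fun θ =>
    (Real.hasDerivAt_sin θ).const_mul 2
  refine ⟨_, _, fun θ => (h1 θ).ofReal_comp, fun θ => (h2 θ).ofReal_comp, by fun_prop, fun θ => ?_⟩
  simp only [norm_real, norm_eq_abs, abs_mul, abs_two]
  have e1 := evW_ge (w := w) θ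
  have e2 := evW_le (w := w) θ
  refine ⟨?_, ?_, ?_⟩
  · rw [abs_of_pos] <;> linarith
  · linarith [abs_sin_le_one θ]
  · linarith [abs_cos_le_one θ]

lemma C2Bound.evZ_unif (δ Λ : ℝ) (hδ : 0 < δ) : ∃ K, 1 ≤ K ∧ ∀ w, 2 + δ ≤ w → w ≤ Λ →
    C2Bound K (fun θ => (evZ w θ : ℂ)) := by
  obtain ⟨K, hK, h⟩ := C2Bound.evS_unif δ Λ hδ
  refine ⟨max 1 (‖(1 / 2 : ℂ)‖ * ((2 * Λ + 2) + ‖(-1 : ℂ)‖ * K)), le_max_left _ _,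
    fun w hw hw' => ?_⟩
  have := (((C2Bound.evW w Λ (by linarith) hw').add ((h w hw hw').const_mul (-1))).const_mul (1 / 2))
  refine C2Bound.mono ?_ (le_max_right _ _)
  convert this using 2
  unfold evZ
  push_cast; ring

lemma C2Bound.bandDet_unif (δ Λ : ℝ) (hδ : 0 < δ) : ∃ K, ∀ w α β, Par δ Λ w α β →
    C2Bound K (fun θ => (bandDet w α β θ)⁻¹) := by
  obtain ⟨K, hK, h⟩ := C2Bound.evS_unif δ Λ hδ
  set B : ℝ := 4 * ((‖(-2 * I : ℂ)‖ * (1 + |((1 : ℤ) : ℝ)|) ^ 2 + Λ) * (K + Λ)) + Λ ^ 2 with hB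
  refine ⟨δ⁻¹ + 2 * B * δ⁻¹ ^ 2 + 2 * B ^ 2 * δ⁻¹ ^ 3, fun w α β hp => ?_⟩
  have hαn : ‖-(α : ℂ)‖ ≤ Λ := by simpa using hp.hα
  have hβn : ‖-(β : ℂ) ^ 2‖ ≤ Λ ^ 2 := by
    rw [norm_neg, norm_pow]
    exact pow_le_pow_left₀ (norm_nonneg _) (by simpa using hp.hβ) 2
  have h1 : C2Bound (‖(-2 * I : ℂ)‖ * (1 + |((1 : ℤ) : ℝ)|) ^ 2 + Λ)
      fun θ => -2 * I * (sin θ : ℂ) + -(α : ℂ) := by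
    have := ((C2Bound.sin_mul 1).const_mul (-2 * I)).add ((C2Bound.const (-(α : ℂ))).mono hαn)
    simpa using this
  have h2 := (h w hp.hw hp.hw').add ((C2Bound.const (-(α : ℂ))).mono hαn)
  have h3 := (h1.mul h2).add ((C2Bound.const (-(β : ℂ) ^ 2)).mono hβn)
  have h4 : C2Bound B (bandDet w α β) := by
    convert h3 using 2
    unfold bandDet
    ring
  exact h4.inv hδ hp.hD

lemma C2Bound.circ_pow (n : ℕ) : C2Bound ((1 + n) ^ 2) fun θ => circ θ ^ n := by
  have := C2Bound.cexp.pow le_rfl (fun θ => (norm_exp_I_mul θ).le) n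
  simpa [circ] using this

lemma C2Bound.evZ_pow_unif (δ Λ : ℝ) (hδ : 0 < δ) : ∃ K, 0 ≤ K ∧ ∀ w, 2 + δ ≤ w → w ≤ Λ →
    ∀ n : ℕ, C2Bound (K * (1 + n) ^ 2) (fun θ => (evZ w θ : ℂ) ^ n) := by
  obtain ⟨K, hK, h⟩ := C2Bound.evZ_unif δ Λ hδ
  refine ⟨K ^ 2, by positivity, fun w hw hw' n => (h w hw hw').pow hK (fun θ => ?_) n⟩
  rw [norm_real, norm_eq_abs, abs_of_pos (evZ_pos (by linarith) θ)]
  exact (evZ_lt_one (by linarith) θ).le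

lemma C2Bound.bandPR_unif (δ Λ : ℝ) (hδ : 0 < δ) : ∃ K, 0 ≤ K ∧ ∀ w α β, Par δ Λ w α β →
    ∀ c : ℂ, ‖c‖ = 1 → ∀ n : ℕ, C2Bound (K * (1 + n) ^ 2) (bandP w α β c n) ∧
      C2Bound (K * (1 + n) ^ 2) (bandR w α β c n) := by
  obtain ⟨K1, hK1, h1⟩ := C2Bound.evS_unif δ Λ hδ
  obtain ⟨K2, hK2, h2⟩ := C2Bound.evZ_pow_unif δ Λ hδ
  obtain ⟨K3, h3⟩ := C2Bound.bandDet_unif δ Λ hδ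
  set A : ℝ := 4 * ((Λ * K2 + 4 * ((K1 + Λ) * 1)) * |K3|) with hA
  set A' : ℝ := 4 * ((Λ * 1 + 4 * ((8 + Λ) * K2)) * |K3|) with hA'
  refine ⟨max 0 (max A A'), le_max_left _ _, fun w α β hp c hc n => ?_⟩
  have hΛ := hp.hΛ
  have hαn : ‖-(α : ℂ)‖ ≤ Λ := by simpa using hp.hα
  have hcc : ‖(β : ℂ) * conj c‖ ≤ Λ := by
    rw [norm_mul, RCLike.norm_conj, hc, mul_one]; simpa using hp.hβ
  have hc' : ‖-c‖ = 1 := by rw [norm_neg, hc]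
  have hn : (0 : ℝ) ≤ (1 + n) ^ 2 := by positivity
  have hZ := h2 w hp.hw hp.hw' n
  have hD := (h3 w α β hp).mono (le_abs_self K3)
  constructor
  · have e1 := (hZ.const_mul ((β : ℂ) * conj c)).mono
      (mul_le_mul_of_nonneg_right hcc hZ.nonneg)
    have e2 := ((h1 w hp.hw hp.hw').add ((C2Bound.const (-(α : ℂ))).mono hαn)).mul
      (((C2Bound.circ_pow n).const_mul (-c)))
    have e3 := ((e1.add e2).const_mul I).mul hD
    rw [hc', norm_I, one_mul, one_mul] at e3
    refine C2Bound.mono (B := A * (1 + n) ^ 2) ?_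
      (mul_le_mul_of_nonneg_right ((le_max_left _ _).trans (le_max_right _ _)) hn)
    have e4 : bandP w α β c n = fun θ => I * (β * conj c * (evZ w θ : ℂ) ^ n +
        ((evS w θ : ℂ) + -α) * (-c * circ θ ^ n)) * (bandDet w α β θ)⁻¹ := by
      funext θ; unfold bandP; ring
    rw [e4]
    exact e3.mono (le_of_eq (by rw [hA]; ring))
  · have h1' : C2Bound (8 + Λ) fun θ => 2 * I * (sin θ : ℂ) + -(α : ℂ) := by
      have := ((C2Bound.sin_mul 1).const_mul (2 * I)).add ((C2Bound.const (-(α : ℂ))).mono hαn)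
      refine (C2Bound.mono ?_ (le_of_eq (?_ : ‖(2 * I : ℂ)‖ * (1 + |((1 : ℤ) : ℝ)|) ^ 2 + Λ = _)))
      · simpa using this
      · simp; norm_num
    have e1 := ((C2Bound.circ_pow n).conj.const_mul ((β : ℂ) * conj c)).mono
      (mul_le_mul_of_nonneg_right hcc (by positivity))
    have e2 := h1'.mul (hZ.const_mul (-c))
    have e3 := ((e1.add e2).const_mul I).mul hD.conj
    rw [hc', norm_I, one_mul, one_mul] at e3
    refine C2Bound.mono (B := A' * (1 + n) ^ 2) ?_
      (mul_le_mul_of_nonneg_right ((le_max_right _ _).trans (le_max_right _ _)) hn)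
    have e4 : bandR w α β c n = fun θ => I * (β * conj c *
        conj (circ θ ^ n) + (2 * I * (sin θ : ℂ) + -α) *
        (-c * (evZ w θ : ℂ) ^ n)) * conj (bandDet w α β θ)⁻¹ := by
      funext θ; unfold bandR; rw [map_inv₀, map_pow]; ring
    rw [e4]
    exact e3.mono (le_of_eq (by rw [hA']; ring))

/-- The amplitude in the first channel. -/
def amp1 (w α β : ℝ) (c : ℂ) (x z : ℤ) (θ : ℝ) : ℂ :=
  c * ((cos ((x - z : ℤ) * θ) - cos ((|x| + |z| : ℤ) * θ) : ℝ) : ℂ) +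
    2 * ((sin θ : ℂ) * (circ θ ^ x.natAbs * bandP w α β c z.natAbs θ))

/-- The amplitude in the second channel. -/
def amp2 (w α β : ℝ) (c : ℂ) (x z : ℤ) (θ : ℝ) : ℂ :=
  2 * ((sin θ : ℂ) * ((evZ w θ : ℂ) ^ x.natAbs * bandR w α β c z.natAbs θ))

/-- Superposition of the oscillations `e^{iνt}`, `ν = 2 cos θ - w`. -/
def bandInt (w : ℝ) (f : ℝ → ℂ) (t : ℝ) : ℂ :=
  ∫ θ in (-π)..π, exp (I * ((t * (2 * cos θ - w) : ℝ) : ℂ)) * f θ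

/-- The kernel. -/
def bandKernel (w α β : ℝ) (c : ℂ) (z x : ℤ) (t : ℝ) : ℂ :=
  ((2 * π)⁻¹ : ℝ) * (bandInt w (amp1 w α β c x z) t + bandInt w (amp2 w α β c x z) (-t))

lemma bandInt_add (w t : ℝ) {f g : ℝ → ℂ} (hf : Continuous f) (hg : Continuous g) :
    bandInt w (fun θ => f θ + g θ) t = bandInt w f t + bandInt w g t := by
  unfold bandInt
  rw [← integral_add integrable_of_continuous
    integrable_of_continuous]
  exact integral_congr fun θ _ => by ring

lemma bandInt_const_mul (w t : ℝ) (c : ℂ) (f : ℝ → ℂ) :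
    bandInt w (fun θ => c * f θ) t = c * bandInt w f t := by
  unfold bandInt
  rw [← integral_const_mul]
  exact integral_congr fun θ _ => by ring

lemma bandInt_conj (w t : ℝ) (f : ℝ → ℂ) :
    conj (bandInt w f t) = bandInt w (fun θ => conj (f θ)) (-t) := by
  unfold bandInt
  rw [← intervalIntegral_conj]
  refine integral_congr fun θ _ => ?_
  simp only [map_mul, ← exp_conj, conj_I, conj_ofReal]
  congr 2
  push_cast; ring

lemma bandInt_odd (w t : ℝ) (f : ℝ → ℂ) (hf : ∀ θ, f (-θ) = -f θ) : bandInt w f t = 0 := by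
  have h := integral_comp_neg (a := -π) (b := π)
    (fun θ => exp (I * ((t * (2 * cos θ - w) : ℝ) : ℂ)) * f θ)
  simp only [Real.cos_neg, hf, neg_neg, mul_neg, integral_neg] at h
  have h' : -bandInt w f t = bandInt w f t := h
  have h2 : (2 : ℂ) * bandInt w f t = 0 := by linear_combination -h'
  simpa using h2

lemma norm_bandInt_le (w t B : ℝ) (f : ℝ → ℂ) (hf : ∀ θ, ‖f θ‖ ≤ B) :
    ‖bandInt w f t‖ ≤ B * (2 * π) := by
  unfold bandInt
  refine (norm_integral_le_of_norm_le_const (C := B) fun θ _ => ?_).trans ?_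
  · rw [norm_mul, norm_exp_I_mul, one_mul]; exact hf θ
  · rw [abs_of_pos (by linarith [pi_pos])]; apply le_of_eq; ring

lemma norm_bandInt_sin_le (w t : ℝ) {B : ℝ} {f : ℝ → ℂ} (hf : C2Bound B f)
    (hper : f π = f (-π)) :
    ‖bandInt w (fun θ => (sin θ : ℂ) * f θ) t‖ ≤ 100 * B * (1 + |t|) ^ (-(3 / 2) : ℝ) := by
  have hB := hf.nonneg
  have h := norm_integral_exp_cos_mul_sin_le hf hper (2 * t)
  have e : bandInt w (fun θ => (sin θ : ℂ) * f θ) t = exp (I * ((-t * w : ℝ) : ℂ)) *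
      ∫ θ in (-π)..π, exp (I * ((2 * t) * cos θ : ℝ)) * ((sin θ : ℂ) * f θ) := by
    unfold bandInt
    rw [← integral_const_mul]
    refine integral_congr fun θ _ => ?_
    simp only
    rw [← mul_assoc (exp _) (exp _), ← exp_add]
    congr 2
    push_cast; ring
  rw [e, norm_mul, norm_exp_I_mul, one_mul]
  refine h.trans ?_
  gcongr 100 * B * ?_
  apply rpow_le_rpow_of_nonpos (by positivity) _ (by norm_num)
  rw [abs_mul, abs_two]; linarith [abs_nonneg t]

lemma hasDerivAt_bandInt (w : ℝ) {f : ℝ → ℂ} (hf : Continuous f) (t : ℝ) :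
    HasDerivAt (bandInt w f) (bandInt w (fun θ => I * ((2 * cos θ - w : ℝ) : ℂ) * f θ) t) t := by
  have h := hasDerivAt_integral_of_dominated_loc_of_deriv_le
    (μ := MeasureTheory.volume) (a := -π) (b := π)
    (F := fun t θ => exp (I * ((t * (2 * cos θ - w) : ℝ) : ℂ)) * f θ)
    (F' := fun t θ => exp (I * ((t * (2 * cos θ - w) : ℝ) : ℂ)) *
      (I * ((2 * cos θ - w : ℝ) : ℂ) * f θ)) (x₀ := t) (s := univ)
    (bound := fun θ => ‖I * ((2 * cos θ - w : ℝ) : ℂ) * f θ‖) Filter.univ_mem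
    (Filter.Eventually.of_forall fun s => Continuous.aestronglyMeasurable (by fun_prop))
    integrable_of_continuous
    (Continuous.aestronglyMeasurable (by fun_prop))
    (MeasureTheory.ae_of_all _ fun θ _ s _ => by rw [norm_mul, norm_exp_I_mul, one_mul])
    (Continuous.intervalIntegrable (by fun_prop) _ _)
    (MeasureTheory.ae_of_all _ fun θ _ s _ => by
      have h1 : HasDerivAt (fun s : ℝ => s * (2 * cos θ - w)) (2 * cos θ - w) s := by
        simpa using (hasDerivAt_id s).mul_const (2 * cos θ - w)
      have h2 := ((h1.ofReal_comp.const_mul I).cexp).mul_const (f θ)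
      exact h2.congr_deriv (by ring))
  exact h.2

lemma cos_sub_cos_eq_sin_mul_sum (k : ℤ) (m : ℕ) (θ : ℝ) :
    cos (k * θ) - cos ((k + 2 * m : ℤ) * θ) =
      sin θ * ∑ j ∈ Finset.range m, 2 * sin ((k + 2 * j + 1 : ℤ) * θ) := by
  induction m with
  | zero => simp
  | succ m ih =>
    rw [Finset.sum_range_succ, mul_add, ← ih]
    have h1 : ((k + 2 * (m : ℤ) : ℤ) : ℝ) * θ = ((k + 2 * m + 1 : ℤ) : ℝ) * θ - θ := by
      push_cast; ring
    have h2 : ((k + 2 * ((m + 1 : ℕ) : ℤ) : ℤ) : ℝ) * θ = ((k + 2 * m + 1 : ℤ) : ℝ) * θ + θ := by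
      push_cast; ring
    rw [h1, h2, Real.cos_sub, Real.cos_add]
    ring

lemma cos_sub_cos_natCast (n m : ℕ) (hmn : m ≤ n) : ∃ G : ℝ → ℂ,
    C2Bound (8 * ((1 + n) ^ 2 * (1 + m) ^ 2)) G ∧ G π = G (-π) ∧
    ∀ θ, ((cos ((n - m : ℤ) * θ) - cos ((n + m : ℤ) * θ) : ℝ) : ℂ) =
      (sin θ : ℂ) * G θ := by
  refine ⟨fun θ => ∑ j ∈ Finset.range m,
    2 * ((sin (((n : ℤ) - m + 2 * j + 1 : ℤ) * θ) : ℝ) : ℂ), ?_, ?_, fun θ => ?_⟩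
  · have h : ∀ j ∈ Finset.range m, C2Bound (8 * (1 + n) ^ 2)
        fun θ : ℝ => 2 * ((sin (((n : ℤ) - m + 2 * j + 1 : ℤ) * θ) : ℝ) : ℂ) := by
      intro j hj
      have hj' : j < m := Finset.mem_range.1 hj
      refine ((C2Bound.sin_mul ((n : ℤ) - m + 2 * j + 1)).const_mul 2).mono ?_
      have hk : |(((n : ℤ) - m + 2 * j + 1 : ℤ) : ℝ)| ≤ 1 + 2 * n := by
        rw [← Int.cast_abs]
        have : |(n : ℤ) - m + 2 * j + 1| ≤ 1 + 2 * n := by rw [abs_le]; omega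
        exact_mod_cast this
      rw [norm_ofNat]
      have h0 := abs_nonneg (((n : ℤ) - m + 2 * j + 1 : ℤ) : ℝ)
      nlinarith
    refine (C2Bound.sum _ h).mono ?_
    rw [Finset.card_range]
    have : (m : ℝ) ≤ (1 + m) ^ 2 := by nlinarith [sq_nonneg (m : ℝ), Nat.cast_nonneg (α := ℝ) m]
    have h0 : (0 : ℝ) ≤ 8 * (1 + n) ^ 2 := by positivity
    nlinarith
  · refine Finset.sum_congr rfl fun j _ => ?_
    rw [mul_neg, Real.sin_neg, Real.sin_int_mul_pi]; simp
  · have h := cos_sub_cos_eq_sin_mul_sum ((n : ℤ) - m) m θ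
    rw [show ((n : ℤ) - m + 2 * m : ℤ) = n + m by ring] at h
    rw [h]; push_cast; rfl

lemma cos_sub_cos_intCast (x z : ℤ) : ∃ G : ℝ → ℂ,
    C2Bound (8 * ((1 + x.natAbs) ^ 2 * (1 + z.natAbs) ^ 2)) G ∧ G π = G (-π) ∧
    ∀ θ, ((cos ((x - z : ℤ) * θ) - cos ((|x| + |z| : ℤ) * θ) : ℝ) : ℂ) =
      (sin θ : ℂ) * G θ := by
  have hcos : ∀ (k l : ℤ) (θ : ℝ), |k| = |l| → cos (k * θ) = cos (l * θ) := by
    intro k l θ h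
    rcases abs_eq_abs.1 h with rfl | rfl
    · rfl
    · push_cast; rw [neg_mul, Real.cos_neg]
  by_cases hxz : |x - z| = |x| + |z|
  · refine ⟨fun _ => 0, (C2Bound.const 0).mono (by simp; positivity), rfl, fun θ => ?_⟩
    rw [hcos (x - z) (|x| + |z|) θ
      (hxz.trans (abs_of_nonneg (add_nonneg (abs_nonneg x) (abs_nonneg z))).symm)]
    simp
  · have hd : |x - z| = |(x.natAbs : ℤ) - z.natAbs| := by
      simp only [abs_eq_max_neg] at *; omega
    have e2 : (|x| + |z| : ℤ) = (x.natAbs : ℤ) + z.natAbs := by simp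
    rcases le_total z.natAbs x.natAbs with h | h
    · obtain ⟨G, h1, h2, h3⟩ := cos_sub_cos_natCast _ _ h
      refine ⟨G, h1, h2, fun θ => ?_⟩
      rw [← h3, hcos _ _ θ hd, e2]
    · obtain ⟨G, h1, h2, h3⟩ := cos_sub_cos_natCast _ _ h
      refine ⟨G, by rwa [mul_comm ((1 + (x.natAbs : ℝ)) ^ 2)], h2, fun θ => ?_⟩
      rw [← h3, hcos _ _ θ hd, e2, add_comm (x.natAbs : ℤ), hcos _ _ θ (abs_sub_comm _ _)]

lemma continuous_circ : Continuous circ := by unfold circ; fun_prop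

lemma Par.continuous_bandP {δ Λ w α β : ℝ} (h : Par δ Λ w α β) {c : ℂ} (hc : ‖c‖ = 1) (n : ℕ) :
    Continuous (bandP w α β c n) := by
  obtain ⟨K, _, hK⟩ := C2Bound.bandPR_unif δ Λ h.hδ
  exact (hK w α β h c hc n).1.continuous

lemma Par.continuous_bandR {δ Λ w α β : ℝ} (h : Par δ Λ w α β) {c : ℂ} (hc : ‖c‖ = 1) (n : ℕ) :
    Continuous (bandR w α β c n) := by
  obtain ⟨K, _, hK⟩ := C2Bound.bandPR_unif δ Λ h.hδ
  exact (hK w α β h c hc n).2.continuous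

lemma Par.two_lt {δ Λ w α β : ℝ} (h : Par δ Λ w α β) : 2 < w := by linarith [h.hδ, h.hw]

lemma Par.continuous_evZ {δ Λ w α β : ℝ} (h : Par δ Λ w α β) :
    Continuous fun θ => (evZ w θ : ℂ) := by
  obtain ⟨K, _, hK⟩ := C2Bound.evZ_unif δ Λ h.hδ
  exact (hK w h.hw h.hw').continuous

lemma Par.continuous_amp1 {δ Λ w α β : ℝ} (h : Par δ Λ w α β) {c : ℂ} (hc : ‖c‖ = 1) (x z : ℤ) :
    Continuous (amp1 w α β c x z) := by
  have := h.continuous_bandP hc z.natAbs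
  have := continuous_circ
  unfold amp1; fun_prop

lemma Par.continuous_amp2 {δ Λ w α β : ℝ} (h : Par δ Λ w α β) {c : ℂ} (hc : ‖c‖ = 1) (x z : ℤ) :
    Continuous (amp2 w α β c x z) := by
  have := h.continuous_bandR hc z.natAbs
  have := h.continuous_evZ
  unfold amp2; fun_prop

lemma Par.bandDet_ne_zero {δ Λ w α β : ℝ} (h : Par δ Λ w α β) (θ : ℝ) : bandDet w α β θ ≠ 0 :=
  fun h0 => by have := h.hD θ; rw [h0, norm_zero] at this; linarith [h.hδ]

lemma natAbs_add_one_sub_one {M : Type*} [AddCommMonoid M] (g : ℕ → M) {x : ℤ} (hx : x ≠ 0) :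
    ∃ n : ℕ, x.natAbs = n + 1 ∧ g (x + 1).natAbs + g (x - 1).natAbs = g (n + 2) + g n := by
  refine ⟨x.natAbs - 1, by omega, ?_⟩
  rcases lt_or_gt_of_ne hx with h | h
  · rw [add_comm]; congr 2 <;> omega
  · congr 2 <;> omega

lemma amp1_add_sub (w α β : ℝ) (c : ℂ) {x : ℤ} (hx : x ≠ 0) (z : ℤ) (θ : ℝ) :
    amp1 w α β c (x + 1) z θ + amp1 w α β c (x - 1) z θ =
      2 * (cos θ : ℂ) * amp1 w α β c x z θ := by
  have h1 : cos ((x + 1 - z : ℤ) * θ) + cos ((x - 1 - z : ℤ) * θ) =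
      2 * cos θ * cos ((x - z : ℤ) * θ) := by
    have e1 : ((x + 1 - z : ℤ) : ℝ) * θ = ((x - z : ℤ) : ℝ) * θ + θ := by push_cast; ring
    have e2 : ((x - 1 - z : ℤ) : ℝ) * θ = ((x - z : ℤ) : ℝ) * θ - θ := by push_cast; ring
    rw [e1, e2, Real.cos_add, Real.cos_sub]; ring
  have h2 : cos ((|x + 1| + |z| : ℤ) * θ) + cos ((|x - 1| + |z| : ℤ) * θ) =
      2 * cos θ * cos ((|x| + |z| : ℤ) * θ) := by
    obtain ⟨n, hn, h⟩ := natAbs_add_one_sub_one (fun k : ℕ => cos ((k + |z| : ℤ) * θ)) hx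
    simp only [Int.natCast_natAbs] at h
    rw [h]
    have e0 : |x| = (n : ℤ) + 1 := by rw [← Int.natCast_natAbs, hn]; push_cast; ring
    have e1 : (((n + 2 : ℕ) + |z| : ℤ) : ℝ) * θ = ((|x| + |z| : ℤ) : ℝ) * θ + θ := by
      rw [e0]; push_cast; ring
    have e2 : ((n + |z| : ℤ) : ℝ) * θ = ((|x| + |z| : ℤ) : ℝ) * θ - θ := by
      rw [e0]; push_cast; ring
    rw [e1, e2, Real.cos_add, Real.cos_sub]; ring
  have h3 : circ θ ^ (x + 1).natAbs + circ θ ^ (x - 1).natAbs =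
      2 * (cos θ : ℂ) * circ θ ^ x.natAbs := by
    obtain ⟨n, hn, h⟩ := natAbs_add_one_sub_one (fun k : ℕ => circ θ ^ k) hx
    rw [h, hn]
    have := circ_quad θ
    linear_combination circ θ ^ n * this
  have h1' := congrArg (fun r : ℝ => (r : ℂ)) h1
  have h2' := congrArg (fun r : ℝ => (r : ℂ)) h2
  simp only [ofReal_add, ofReal_mul, ofReal_ofNat] at h1' h2'
  unfold amp1
  simp only [ofReal_sub]
  linear_combination c * h1' - c * h2' + 2 * (sin θ : ℂ) * bandP w α β c z.natAbs θ * h3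

lemma amp2_add_sub {w : ℝ} (hw : 2 < w) (α β : ℝ) (c : ℂ) {x : ℤ} (hx : x ≠ 0) (z : ℤ) (θ : ℝ) :
    amp2 w α β c (x + 1) z θ + amp2 w α β c (x - 1) z θ =
      (evW w θ : ℂ) * amp2 w α β c x z θ := by
  have h3 : (evZ w θ : ℂ) ^ (x + 1).natAbs + (evZ w θ : ℂ) ^ (x - 1).natAbs =
      (evW w θ : ℂ) * (evZ w θ : ℂ) ^ x.natAbs := by
    obtain ⟨n, hn, h⟩ := natAbs_add_one_sub_one (fun k : ℕ => (evZ w θ : ℂ) ^ k) hx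
    rw [h, hn]
    have := congrArg (fun r : ℝ => (r : ℂ)) (evZ_quad hw θ)
    simp only [ofReal_sub, ofReal_mul, ofReal_pow, ofReal_one] at this
    linear_combination (evZ w θ : ℂ) ^ n * this
  unfold amp2
  linear_combination 2 * (sin θ : ℂ) * bandR w α β c z.natAbs θ * h3

lemma bandP_rel {w α β θ : ℝ} (h : bandDet w α β θ ≠ 0) (c : ℂ) (n : ℕ) :
    (-2 * I * (sin θ : ℂ) - α) * bandP w α β c n θ -
      β * conj (bandR w α β c n θ) = -I * c * circ θ ^ n := by
  have h' : conj (bandR w α β c n θ) = -I * (β * c * circ θ ^ n -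
      (-2 * I * (sin θ : ℂ) - α) * conj c * (evZ w θ : ℂ) ^ n) *
      (bandDet w α β θ)⁻¹ := by
    unfold bandR
    simp only [map_mul, map_sub, map_inv₀, map_pow, conj_I, conj_ofReal, conj_conj, map_ofNat]
    ring
  rw [h', bandP]
  field_simp
  rw [bandDet]
  ring

lemma bandR_rel {w α β θ : ℝ} (h : bandDet w α β θ ≠ 0) (c : ℂ) (n : ℕ) :
    ((evS w θ : ℂ) - α) * bandR w α β c n θ -
      β * conj (bandP w α β c n θ) = -I * c * (evZ w θ : ℂ) ^ n := by
  have h0 : conj (bandDet w α β θ) ≠ 0 := by simpa using h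
  have h' : conj (bandP w α β c n θ) = -I * (β * c * (evZ w θ : ℂ) ^ n -
      ((evS w θ : ℂ) - α) * conj c * conj (circ θ) ^ n) *
      (conj (bandDet w α β θ))⁻¹ := by
    unfold bandP
    simp only [map_mul, map_sub, map_inv₀, map_pow, conj_I, conj_ofReal, conj_conj]
  have h'' : conj (bandDet w α β θ) =
      (2 * I * (sin θ : ℂ) - α) * ((evS w θ : ℂ) - α) - (β : ℂ) ^ 2 := by
    unfold bandDet
    simp only [map_mul, map_sub, map_neg, map_pow, conj_I, conj_ofReal, map_ofNat]
    ring
  rw [h', bandR]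
  field_simp
  rw [h'']
  ring

lemma bandInt_congr_odd (w t : ℝ) {f g : ℝ → ℂ} (hf : Continuous f) (hg : Continuous g)
    (h : ∀ θ, f (-θ) - g (-θ) = -(f θ - g θ)) : bandInt w f t = bandInt w g t := by
  have h1 := bandInt_odd w t (fun θ => f θ + -1 * g θ) fun θ => by linear_combination h θ
  rw [bandInt_add w t hf (by fun_prop), bandInt_const_mul] at h1
  linear_combination h1

lemma bandInt_lin (w t : ℝ) (k1 k2 k3 k4 k5 : ℂ) {f1 f2 f3 f4 f5 : ℝ → ℂ} (h1 : Continuous f1)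
    (h2 : Continuous f2) (h3 : Continuous f3) (h4 : Continuous f4) (h5 : Continuous f5) :
    bandInt w (fun θ => k1 * f1 θ + (k2 * f2 θ + (k3 * f3 θ + (k4 * f4 θ + k5 * f5 θ)))) t =
      k1 * bandInt w f1 t + (k2 * bandInt w f2 t + (k3 * bandInt w f3 t + (k4 * bandInt w f4 t +
        k5 * bandInt w f5 t))) := by
  rw [bandInt_add w t (by fun_prop) (by fun_prop), bandInt_add w t (by fun_prop) (by fun_prop),
    bandInt_add w t (by fun_prop) (by fun_prop), bandInt_add w t (by fun_prop) (by fun_prop)]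
  simp only [bandInt_const_mul]

lemma evS_neg (w θ : ℝ) : evS w (-θ) = evS w θ := by simp [evS, evW]
lemma evZ_neg (w θ : ℝ) : evZ w (-θ) = evZ w θ := by simp [evZ, evS, evW]

/-- The kernel solves the linearized equation. -/
lemma Par.hasDerivAt_bandKernel {δ Λ w α β : ℝ} (h : Par δ Λ w α β) {c : ℂ} (hc : ‖c‖ = 1)
    (z x : ℤ) (t : ℝ) : HasDerivAt (bandKernel w α β c z x)
      (-I * (w * bandKernel w α β c z x t - bandKernel w α β c z (x + 1) t -
          bandKernel w α β c z (x - 1) t) +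
        I * delta x * (α * bandKernel w α β c z 0 t +
          β * conj (bandKernel w α β c z 0 t))) t := by
  have c1 := fun y => h.continuous_amp1 hc y z
  have c2 := fun y => h.continuous_amp2 hc y z
  have c1' : Continuous fun θ => conj (amp1 w α β c 0 z θ) :=
    continuous_conj.comp (c1 0)
  have c2' : Continuous fun θ => conj (amp2 w α β c 0 z θ) :=
    continuous_conj.comp (c2 0)
  have hw := h.two_lt
  have d1 := hasDerivAt_bandInt w (c1 x) t
  have d2 := (hasDerivAt_bandInt w (c2 x) (-t)).scomp t (hasDerivAt_neg t)
  have hd : HasDerivAt (bandKernel w α β c z x) _ t :=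
    (d1.add d2).const_mul (((2 * π)⁻¹ : ℝ) : ℂ)
  refine hd.congr_deriv ?_
  have E1 : bandInt w (fun θ => I * ((2 * cos θ - w : ℝ) : ℂ) * amp1 w α β c x z θ) t =
      (-I * w) * bandInt w (amp1 w α β c x z) t + (I * bandInt w (amp1 w α β c (x + 1) z) t +
        (I * bandInt w (amp1 w α β c (x - 1) z) t +
          ((I * delta x * α) * bandInt w (amp1 w α β c 0 z) t +
          (I * delta x * β) * bandInt w (fun θ => conj (amp2 w α β c 0 z θ)) t))) := by
    have c1x := c1 x
    rw [← bandInt_lin w t _ _ _ _ _ (c1 x) (c1 (x + 1)) (c1 (x - 1)) (c1 0) c2']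
    have cr : Continuous fun θ => (-I * w) * amp1 w α β c x z θ + (I * amp1 w α β c (x + 1) z θ +
        (I * amp1 w α β c (x - 1) z θ + ((I * delta x * α) * amp1 w α β c 0 z θ +
          (I * delta x * β) * conj (amp2 w α β c 0 z θ)))) := by
      have := c1 (x + 1)
      have := c1 (x - 1)
      have := c1 0
      fun_prop
    refine bandInt_congr_odd w t (by fun_prop) cr ?_
    rcases eq_or_ne x 0 with rfl | hx
    · have key : ∀ θ, I * ((2 * cos θ - w : ℝ) : ℂ) * amp1 w α β c 0 z θ -
          ((-I * w) * amp1 w α β c 0 z θ + (I * amp1 w α β c (0 + 1) z θ +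
        (I * amp1 w α β c (0 - 1) z θ + ((I * delta 0 * α) * amp1 w α β c 0 z θ +
          (I * delta 0 * β) * conj (amp2 w α β c 0 z θ))))) =
          2 * c * (sin θ : ℂ) * (cos (|z| * θ) : ℂ) := by
        intro θ
        have hrel := bandP_rel (h.bandDet_ne_zero θ) c z.natAbs
        have e1 : circ θ ^ z.natAbs = (cos (|z| * θ) : ℂ) + sin (|z| * θ) * I := by
          have : circ θ ^ z.natAbs = circ (|z| * θ) := by
            rw [circ, circ, ← exp_nat_mul]
            congr 1
            have hza : ((|z| : ℤ) : ℝ) = (z.natAbs : ℝ) := by rw [← Int.natCast_natAbs]; simp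
            rw [hza]; push_cast; ring
          rw [this, circ_eq]
        have e2 : cos ((0 + 1 - z : ℤ) * θ) + cos ((0 - 1 - z : ℤ) * θ) =
            2 * cos θ * cos (|z| * θ) := by
          have e3 : ((0 + 1 - z : ℤ) : ℝ) * θ = θ - z * θ := by push_cast; ring
          have e4 : ((0 - 1 - z : ℤ) : ℝ) * θ = -(θ + z * θ) := by push_cast; ring
          have e5 : cos ((|z| : ℤ) * θ) = cos (z * θ) := by
            rw [Int.cast_abs]
            rcases abs_choice (z : ℝ) with h | h <;> rw [h]
            rw [neg_mul, Real.cos_neg]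
          rw [e3, e4, e5, Real.cos_neg, Real.cos_sub, Real.cos_add]; ring
        have e6 : cos ((|0 + 1| + |z| : ℤ) * θ) =
            cos (|z| * θ) * cos θ - sin (|z| * θ) * sin θ := by
          rw [← Real.cos_add]; congr 1; push_cast; simp; ring
        have e7 : cos ((|0 - 1| + |z| : ℤ) * θ) =
            cos (|z| * θ) * cos θ - sin (|z| * θ) * sin θ := by
          rw [← Real.cos_add]; congr 1; push_cast; simp; ring
        have e8 : cos ((0 - z : ℤ) * θ) = cos ((|0| + |z| : ℤ) * θ) := by
          push_cast
          rw [abs_zero, zero_add, zero_sub, neg_mul, Real.cos_neg]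
          rcases abs_choice (z : ℝ) with h | h <;> rw [h]
          rw [neg_mul, Real.cos_neg]
        have e2' := congrArg (fun r : ℝ => (r : ℂ)) e2
        simp only [ofReal_add, ofReal_mul, ofReal_ofNat] at e2'
        have hn1 : (0 + 1 : ℤ).natAbs = 1 := rfl
        have hn2 : (0 - 1 : ℤ).natAbs = 1 := rfl
        have hn0 : (0 : ℤ).natAbs = 0 := rfl
        have hdel : delta 0 = 1 := by simp [delta]
        rw [e1] at hrel
        unfold amp1 amp2
        rw [e6, e7, e8, hn1, hn2, hn0, hdel]
        simp only [map_mul, conj_ofReal, map_ofNat, pow_zero, pow_one, one_mul, ofReal_sub,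
          ofReal_mul, ofReal_ofNat]
        have hcirc := circ_eq θ
        simp only [hcirc]
        linear_combination (-I * c) * e2' + (2 * I * (sin θ : ℂ)) * hrel +
          (-2 * (sin θ : ℂ) * c * (cos (|z| * θ) : ℂ) -
          2 * (sin θ : ℂ) * c * (sin (|z| * θ) : ℂ) * I) * I_sq
      intro θ
      rw [key, key]
      simp only [Real.sin_neg, mul_neg, Real.cos_neg, ofReal_neg]
      ring
    · have hdel : delta x = 0 := by simp [delta, hx]
      have key : ∀ θ, I * ((2 * cos θ - w : ℝ) : ℂ) * amp1 w α β c x z θ -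
          ((-I * w) * amp1 w α β c x z θ + (I * amp1 w α β c (x + 1) z θ +
        (I * amp1 w α β c (x - 1) z θ + ((I * delta x * α) * amp1 w α β c 0 z θ +
          (I * delta x * β) * conj (amp2 w α β c 0 z θ))))) = 0 := by
        intro θ
        have := amp1_add_sub w α β c hx z θ
        rw [hdel]
        simp only [ofReal_sub, ofReal_mul, ofReal_ofNat]
        linear_combination (-I) * this
      intro θ
      rw [key, key, neg_zero]
  have E2 : -bandInt w (fun θ => I * ((2 * cos θ - w : ℝ) : ℂ) * amp2 w α β c x z θ) (-t) =
      (-I * w) * bandInt w (amp2 w α β c x z) (-t) + (I * bandInt w (amp2 w α β c (x + 1) z) (-t) +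
        (I * bandInt w (amp2 w α β c (x - 1) z) (-t) +
          ((I * delta x * α) * bandInt w (amp2 w α β c 0 z) (-t) +
          (I * delta x * β) * bandInt w (fun θ => conj (amp1 w α β c 0 z θ)) (-t)))) := by
    have c2x := c2 x
    rw [← bandInt_lin w (-t) _ _ _ _ _ (c2 x) (c2 (x + 1)) (c2 (x - 1)) (c2 0) c1',
      ← neg_one_mul, ← bandInt_const_mul]
    have cr : Continuous fun θ => (-I * w) * amp2 w α β c x z θ + (I * amp2 w α β c (x + 1) z θ +
        (I * amp2 w α β c (x - 1) z θ + ((I * delta x * α) * amp2 w α β c 0 z θ +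
          (I * delta x * β) * conj (amp1 w α β c 0 z θ)))) := by
      have := c2 (x + 1)
      have := c2 (x - 1)
      have := c2 0
      fun_prop
    refine bandInt_congr_odd w (-t) (by fun_prop) cr ?_
    rcases eq_or_ne x 0 with rfl | hx
    · have key : ∀ θ, -1 * (I * ((2 * cos θ - w : ℝ) : ℂ) * amp2 w α β c 0 z θ) -
          ((-I * w) * amp2 w α β c 0 z θ + (I * amp2 w α β c (0 + 1) z θ +
        (I * amp2 w α β c (0 - 1) z θ + ((I * delta 0 * α) * amp2 w α β c 0 z θ +
          (I * delta 0 * β) * conj (amp1 w α β c 0 z θ))))) =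
          2 * c * (sin θ : ℂ) * (evZ w θ : ℂ) ^ z.natAbs := by
        intro θ
        have hrel := bandR_rel (h.bandDet_ne_zero θ) c z.natAbs
        have e8 : cos ((0 - z : ℤ) * θ) = cos ((|0| + |z| : ℤ) * θ) := by
          push_cast
          rw [abs_zero, zero_add, zero_sub, neg_mul, Real.cos_neg]
          rcases abs_choice (z : ℝ) with h | h <;> rw [h]
          rw [neg_mul, Real.cos_neg]
        have hn1 : (0 + 1 : ℤ).natAbs = 1 := rfl
        have hn2 : (0 - 1 : ℤ).natAbs = 1 := rfl
        have hn0 : (0 : ℤ).natAbs = 0 := rfl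
        have hdel : delta 0 = 1 := by simp [delta]
        have hz : (evS w θ : ℂ) = (evW w θ : ℂ) - 2 * (evZ w θ : ℂ) := by
          unfold evZ; push_cast; ring
        have hW : (evW w θ : ℂ) = 2 * w - 2 * (cos θ : ℂ) := by
          unfold evW; simp only [ofReal_sub, ofReal_mul, ofReal_ofNat]
        rw [hz, hW] at hrel
        unfold amp1 amp2
        rw [e8, hn1, hn2, hn0, hdel]
        simp only [map_add, map_mul, conj_ofReal, map_ofNat, pow_zero, pow_one, one_mul,
          ofReal_sub, ofReal_mul, ofReal_ofNat, sub_self, ofReal_zero, map_add, map_zero]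
        linear_combination (2 * I * (sin θ : ℂ)) * hrel -
          (2 * (sin θ : ℂ) * c * (evZ w θ : ℂ) ^ z.natAbs) * I_sq
      intro θ
      rw [key, key]
      simp only [Real.sin_neg, ofReal_neg, evZ_neg]
      ring
    · have hdel : delta x = 0 := by simp [delta, hx]
      have key : ∀ θ, -1 * (I * ((2 * cos θ - w : ℝ) : ℂ) * amp2 w α β c x z θ) -
          ((-I * w) * amp2 w α β c x z θ + (I * amp2 w α β c (x + 1) z θ +
        (I * amp2 w α β c (x - 1) z θ + ((I * delta x * α) * amp2 w α β c 0 z θ +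
          (I * delta x * β) * conj (amp1 w α β c 0 z θ))))) = 0 := by
        intro θ
        have := amp2_add_sub hw α β c hx z θ
        have hW : (evW w θ : ℂ) = 2 * w - 2 * (cos θ : ℂ) := by
          unfold evW; simp only [ofReal_sub, ofReal_mul, ofReal_ofNat]
        rw [hdel]
        rw [hW] at this
        simp only [ofReal_sub, ofReal_mul, ofReal_ofNat]
        linear_combination (-I) * this
      intro θ
      rw [key, key, neg_zero]
  have hconj : conj (bandKernel w α β c z 0 t) = (((2 * π)⁻¹ : ℝ) : ℂ) *
      (bandInt w (fun θ => conj (amp1 w α β c 0 z θ)) (-t) +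
        bandInt w (fun θ => conj (amp2 w α β c 0 z θ)) t) := by
    unfold bandKernel
    rw [map_mul, map_add, conj_ofReal, bandInt_conj, bandInt_conj, neg_neg]
  rw [hconj]
  unfold bandKernel
  simp only [neg_smul, one_smul]
  linear_combination (((2 * π)⁻¹ : ℝ) : ℂ) * E1 + (((2 * π)⁻¹ : ℝ) : ℂ) * E2

/-- Decay of the kernel. -/
lemma bandKernel_decay (δ Λ : ℝ) (hδ : 0 < δ) : ∃ K, 0 ≤ K ∧ ∀ w α β, Par δ Λ w α β →
    ∀ c : ℂ, ‖c‖ = 1 → ∀ z x : ℤ, ∀ t : ℝ, ‖bandKernel w α β c z x t‖ ≤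
      K * (1 + |(x : ℝ)|) ^ 2 * (1 + |(z : ℝ)|) ^ 2 * (1 + |t|) ^ (-(3 / 2) : ℝ) := by
  obtain ⟨K1, hK1, h1⟩ := C2Bound.bandPR_unif δ Λ hδ
  obtain ⟨K2, hK2, h2⟩ := C2Bound.evZ_pow_unif δ Λ hδ
  refine ⟨100 * (8 + 8 * K1) + 100 * (8 * (K2 * K1)), by positivity, fun w α β hp c hc z x t => ?_⟩
  have hx : (x.natAbs : ℝ) = |(x : ℝ)| := by rw [← Int.cast_abs, ← Int.natCast_natAbs]; simp
  have hz : (z.natAbs : ℝ) = |(z : ℝ)| := by rw [← Int.cast_abs, ← Int.natCast_natAbs]; simp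
  obtain ⟨G, hG, hGp, hGe⟩ := cos_sub_cos_intCast x z
  rw [hx, hz] at hG
  have hPR := h1 w α β hp c hc z.natAbs
  rw [hz] at hPR
  have hcp := C2Bound.circ_pow x.natAbs
  have hzp := h2 w hp.hw hp.hw' x.natAbs
  rw [hx] at hcp hzp
  set X := (1 + |(x : ℝ)|) ^ 2
  set Z := (1 + |(z : ℝ)|) ^ 2
  have hX : 0 ≤ X := by positivity
  have hZ : 0 ≤ Z := by positivity
  set T := (1 + |t|) ^ (-(3 / 2) : ℝ) with hT
  have hT0 : 0 ≤ T := by positivity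
  have f1 : C2Bound ((8 + 8 * K1) * (X * Z)) fun θ => c * G θ +
      2 * (circ θ ^ x.natAbs * bandP w α β c z.natAbs θ) := by
    refine ((hG.const_mul c).add ((hcp.mul hPR.1).const_mul 2)).mono (le_of_eq ?_)
    rw [hc, norm_ofNat]; ring
  have f2 : C2Bound (8 * (K2 * K1) * (X * Z)) fun θ =>
      2 * ((evZ w θ : ℂ) ^ x.natAbs * bandR w α β c z.natAbs θ) := by
    refine ((hzp.mul hPR.2).const_mul 2).mono (le_of_eq ?_)
    rw [norm_ofNat]; ring
  have g1 := norm_bandInt_sin_le w t f1 (by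
    simp only [hGp, circ_pi, circ_neg_pi, bandP, evZ, evS, evW, bandDet, Real.cos_neg, Real.sin_neg,
      Real.sin_pi, neg_zero])
  have g2 := norm_bandInt_sin_le w (-t) f2 (by
    simp only [circ_pi, circ_neg_pi, bandR, evZ, evS, evW, bandDet, Real.cos_neg, Real.sin_neg,
      Real.sin_pi, neg_zero])
  rw [abs_neg] at g2
  have e1 : (fun θ => (sin θ : ℂ) * (c * G θ +
      2 * (circ θ ^ x.natAbs * bandP w α β c z.natAbs θ))) = amp1 w α β c x z := by
    funext θ
    unfold amp1
    rw [hGe]; ring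
  have e2 : (fun θ => (sin θ : ℂ) *
      (2 * ((evZ w θ : ℂ) ^ x.natAbs * bandR w α β c z.natAbs θ))) = amp2 w α β c x z := by
    funext θ
    unfold amp2
    ring
  rw [e1, ← hT] at g1
  rw [e2, ← hT] at g2
  unfold bandKernel
  rw [norm_mul, norm_real, norm_eq_abs, abs_of_pos (by positivity)]
  have hpi : (2 * π)⁻¹ ≤ 1 := inv_le_one_of_one_le₀ (by linarith [Real.pi_gt_three])
  calc _ ≤ 1 * (100 * ((8 + 8 * K1) * (X * Z)) * T + 100 * (8 * (K2 * K1) * (X * Z)) * T) := by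
        gcongr
        exact (norm_add_le _ _).trans (add_le_add g1 g2)
    _ = _ := by ring

/-- The kernel is bounded. -/
lemma Par.bandKernel_bounded {δ Λ w α β : ℝ} (h : Par δ Λ w α β) {c : ℂ} (hc : ‖c‖ = 1) (z : ℤ) :
    ∃ K, ∀ x t, ‖bandKernel w α β c z x t‖ ≤ K := by
  obtain ⟨K1, hK1, h1⟩ := C2Bound.bandPR_unif δ Λ h.hδ
  have hPR := h1 w α β h c hc z.natAbs
  set K := K1 * (1 + (z.natAbs : ℝ)) ^ 2
  have hK : 0 ≤ K := by positivity
  refine ⟨(2 * π)⁻¹ * ((2 + 2 * K) * (2 * π) + (2 * K) * (2 * π)), fun x t => ?_⟩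
  unfold bandKernel
  rw [norm_mul, norm_real, norm_eq_abs, abs_of_pos (by positivity)]
  gcongr
  refine (norm_add_le _ _).trans (add_le_add (norm_bandInt_le _ _ _ _ fun θ => ?_)
    (norm_bandInt_le _ _ _ _ fun θ => ?_))
  · unfold amp1
    refine (norm_add_le _ _).trans (add_le_add ?_ ?_)
    · rw [norm_mul, hc, one_mul, norm_real, norm_eq_abs]
      refine (abs_sub _ _).trans ?_
      linarith [abs_cos_le_one ((x - z : ℤ) * θ), abs_cos_le_one ((|x| + |z| : ℤ) * θ)]
    · rw [norm_mul, norm_mul, norm_mul, norm_pow, norm_circ, one_pow, one_mul, norm_ofNat,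
        norm_real, norm_eq_abs]
      gcongr
      calc _ ≤ 1 * K := mul_le_mul (abs_sin_le_one θ) (hPR.1.norm_le θ) (norm_nonneg _)
            zero_le_one
        _ = K := one_mul K
  · unfold amp2
    rw [norm_mul, norm_mul, norm_mul, norm_pow, norm_ofNat, norm_real,
      norm_real, norm_eq_abs, norm_eq_abs, abs_of_pos (evZ_pos h.two_lt θ)]
    gcongr
    have hz1 : evZ w θ ^ x.natAbs ≤ 1 :=
      pow_le_one₀ (evZ_pos h.two_lt θ).le (evZ_lt_one h.two_lt θ).le
    calc _ ≤ 1 * (1 * K) := mul_le_mul (abs_sin_le_one θ)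
          (mul_le_mul hz1 (hPR.2.norm_le θ) (norm_nonneg _) zero_le_one) (by
            have := evZ_pos h.two_lt θ; positivity) zero_le_one
      _ = K := by ring

/-! ### The root of `v² - 4` on the closed upper half plane -/

/-- The root of `-i v`, continuous on the closed upper half plane. -/
def halfRoot (v : ℂ) : ℂ := (-I * v) ^ (2⁻¹ : ℂ)

/-- The root of `v² - 4` which is asymptotic to `v` in the upper half plane. -/
def jouk (v : ℂ) : ℂ := I * (halfRoot (v - 2) * halfRoot (v + 2))

lemma halfRoot_sq (v : ℂ) : halfRoot v ^ 2 = -I * v := by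
  unfold halfRoot
  exact cpow_nat_inv_pow (-I * v) two_ne_zero

lemma cpow_half_re_nonneg (x : ℂ) : 0 ≤ (x ^ (2⁻¹ : ℂ)).re := by
  rcases eq_or_ne x 0 with rfl | hx
  · simp
  · rw [cpow_def_of_ne_zero hx, exp_re]
    refine mul_nonneg (Real.exp_pos _).le (Real.cos_nonneg_of_mem_Icc ⟨?_, ?_⟩)
    · have : (log x * 2⁻¹).im = x.arg / 2 := by
        rw [show (2⁻¹ : ℂ) = ((2⁻¹ : ℝ) : ℂ) by norm_num, im_mul_ofReal, log_im]; ring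
      rw [this]; linarith [neg_pi_lt_arg x]
    · have : (log x * 2⁻¹).im = x.arg / 2 := by
        rw [show (2⁻¹ : ℂ) = ((2⁻¹ : ℝ) : ℂ) by norm_num, im_mul_ofReal, log_im]; ring
      rw [this]; linarith [arg_le_pi x]

lemma halfRoot_im_le {v : ℂ} (hv : 0 ≤ v.im) : |(halfRoot v).im| ≤ (halfRoot v).re := by
  have h1 : 0 ≤ (halfRoot v).re := cpow_half_re_nonneg _
  have h2 := congrArg re (halfRoot_sq v)
  simp [pow_two] at h2
  exact abs_le_of_sq_le_sq (by nlinarith) h1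

lemma halfRoot_im_lt {v : ℂ} (hv : 0 < v.im) : |(halfRoot v).im| < (halfRoot v).re := by
  have h1 : 0 ≤ (halfRoot v).re := cpow_half_re_nonneg _
  have h2 := congrArg re (halfRoot_sq v)
  simp [pow_two] at h2
  exact abs_lt_of_sq_lt_sq (by nlinarith) h1

lemma continuousAt_halfRoot {v : ℂ} (hv : 0 ≤ v.im) : ContinuousAt halfRoot v := by
  have h : ContinuousAt (fun x : ℂ => x ^ (2⁻¹ : ℂ)) (-I * v) :=
    continuousAt_cpow_const_of_re_pos (Or.inl (by simpa using hv)) (by norm_num)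
  exact ContinuousAt.comp (f := fun v => -I * v) h (by fun_prop)

lemma differentiableAt_halfRoot {v : ℂ} (hv : 0 < v.im ∨ v.re ≠ 0) :
    DifferentiableAt ℂ halfRoot v := by
  have h : (-I * v) ∈ slitPlane := by
    rw [mem_slitPlane_iff]; simpa using hv
  unfold halfRoot
  exact DifferentiableAt.cpow (by fun_prop) (by fun_prop) h

lemma jouk_sq (v : ℂ) : jouk v ^ 2 = v ^ 2 - 4 := by
  have h1 := halfRoot_sq (v - 2)
  have h2 := halfRoot_sq (v + 2)
  unfold jouk
  calc _ = I ^ 2 * (halfRoot (v - 2) ^ 2 * halfRoot (v + 2) ^ 2) := by ring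
    _ = _ := by
      rw [h1, h2]
      linear_combination (v ^ 2 - 4) * (I ^ 2 - 1) * I_sq

lemma jouk_im_nonneg {v : ℂ} (hv : 0 ≤ v.im) : 0 ≤ (jouk v).im := by
  have h1 := halfRoot_im_le (v := v - 2) (by simpa using hv)
  have h2 := halfRoot_im_le (v := v + 2) (by simpa using hv)
  unfold jouk
  simp only [mul_im, mul_re, I_re, I_im]
  have h3 : |(halfRoot (v - 2)).im * (halfRoot (v + 2)).im| ≤
      (halfRoot (v - 2)).re * (halfRoot (v + 2)).re := by
    rw [abs_mul]; exact mul_le_mul h1 h2 (abs_nonneg _) ((abs_nonneg _).trans h1)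
  have := le_abs_self ((halfRoot (v - 2)).im * (halfRoot (v + 2)).im)
  linarith

lemma jouk_add_sub (v : ℂ) : v - jouk v = I * (halfRoot (v - 2) - halfRoot (v + 2)) ^ 2 / 2 ∧
    v + jouk v = I * (halfRoot (v - 2) + halfRoot (v + 2)) ^ 2 / 2 := by
  have h1 := halfRoot_sq (v - 2)
  have h2 := halfRoot_sq (v + 2)
  unfold jouk
  constructor
  · linear_combination (-I / 2) * h1 - I / 2 * h2 + v * I_sq
  · linear_combination (-I / 2) * h1 - I / 2 * h2 + v * I_sq

lemma normSq_sub_le_add (a b : ℂ) : normSq (a + b) - normSq (a - b) = 4 * (a.re * b.re + a.im * b.im) := by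
  simp [normSq_apply]; ring

lemma norm_sub_jouk_le {v : ℂ} (hv : 0 ≤ v.im) : ‖v - jouk v‖ ≤ ‖v + jouk v‖ := by
  have h1 := halfRoot_im_le (v := v - 2) (by simpa using hv)
  have h2 := halfRoot_im_le (v := v + 2) (by simpa using hv)
  rw [(jouk_add_sub v).1, (jouk_add_sub v).2]
  simp only [norm_div, norm_mul, norm_pow]
  gcongr ‖I‖ * ?_ / ‖(2 : ℂ)‖
  rw [← normSq_eq_norm_sq, ← normSq_eq_norm_sq]
  have h3 : |(halfRoot (v - 2)).im * (halfRoot (v + 2)).im| ≤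
      (halfRoot (v - 2)).re * (halfRoot (v + 2)).re := by
    rw [abs_mul]; exact mul_le_mul h1 h2 (abs_nonneg _) ((abs_nonneg _).trans h1)
  have := neg_abs_le ((halfRoot (v - 2)).im * (halfRoot (v + 2)).im)
  linarith [normSq_sub_le_add (halfRoot (v - 2)) (halfRoot (v + 2))]

lemma norm_sub_jouk_lt {v : ℂ} (hv : 0 < v.im) : ‖v - jouk v‖ < ‖v + jouk v‖ := by
  have h1 := halfRoot_im_lt (v := v - 2) (by simpa using hv)
  have h2 := halfRoot_im_lt (v := v + 2) (by simpa using hv)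
  rw [(jouk_add_sub v).1, (jouk_add_sub v).2]
  simp only [norm_div, norm_mul, norm_pow, norm_I, one_mul, norm_ofNat]
  rw [← normSq_eq_norm_sq, ← normSq_eq_norm_sq]
  have h3 : |(halfRoot (v - 2)).im * (halfRoot (v + 2)).im| <
      (halfRoot (v - 2)).re * (halfRoot (v + 2)).re := by
    rw [abs_mul]; exact mul_lt_mul'' h1 h2 (abs_nonneg _) (abs_nonneg _)
  have := neg_abs_le ((halfRoot (v - 2)).im * (halfRoot (v + 2)).im)
  linarith [normSq_sub_le_add (halfRoot (v - 2)) (halfRoot (v + 2))]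

lemma jouk_mul (v : ℂ) : (v - jouk v) * (v + jouk v) = 4 := by
  linear_combination -jouk_sq v

lemma norm_jouk_sub_le {v : ℂ} (hv : 0 ≤ v.im) : ‖jouk v - v‖ ≤ 2 := by
  have h := norm_sub_jouk_le hv
  have h2 := congrArg norm (jouk_mul v)
  rw [norm_mul, norm_ofNat] at h2
  rw [norm_sub_rev]
  nlinarith [norm_nonneg (v - jouk v)]

lemma norm_jouk_sub_lt {v : ℂ} (hv : 0 < v.im) : ‖jouk v - v‖ < 2 := by
  have h := norm_sub_jouk_lt hv
  have h2 := congrArg norm (jouk_mul v)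
  rw [norm_mul, norm_ofNat] at h2
  rw [norm_sub_rev]
  nlinarith [norm_nonneg (v - jouk v)]

lemma continuousAt_jouk {v : ℂ} (hv : 0 ≤ v.im) : ContinuousAt jouk v := by
  have h1 : ContinuousAt (fun v => halfRoot (v - 2)) v :=
    ContinuousAt.comp (f := fun v : ℂ => v - 2) (continuousAt_halfRoot (by simpa using hv))
      (by fun_prop)
  have h2 : ContinuousAt (fun v => halfRoot (v + 2)) v :=
    ContinuousAt.comp (f := fun v : ℂ => v + 2) (continuousAt_halfRoot (by simpa using hv))
      (by fun_prop)
  exact continuousAt_const.mul (h1.mul h2)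

lemma differentiableAt_jouk {v : ℂ} (hv : 0 < v.im ∨ (v.re ≠ 2 ∧ v.re ≠ -2)) :
    DifferentiableAt ℂ jouk v := by
  have h1 : DifferentiableAt ℂ (fun v => halfRoot (v - 2)) v :=
    DifferentiableAt.comp (f := fun v : ℂ => v - 2) v (differentiableAt_halfRoot (by
      rcases hv with h | h
      · left; simpa using h
      · right; simpa [sub_eq_zero] using h.1)) (by fun_prop)
  have h2 : DifferentiableAt ℂ (fun v => halfRoot (v + 2)) v :=
    DifferentiableAt.comp (f := fun v : ℂ => v + 2) v (differentiableAt_halfRoot (by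
      rcases hv with h | h
      · left; simpa using h
      · right; simpa [add_eq_zero_iff_eq_neg] using h.2)) (by fun_prop)
  exact (h1.mul h2).const_mul I

lemma jouk_ofReal_of_one_le {v : ℝ} (hv : 2 ≤ v) : jouk v = (√(v ^ 2 - 4) : ℝ) := by
  have h1 := jouk_sq v
  have h2 := norm_sub_jouk_le (v := v) (by simp)
  have h3 : jouk v ^ 2 = ((√(v ^ 2 - 4) : ℝ) : ℂ) ^ 2 := by
    have : ((√(v ^ 2 - 4) : ℝ) : ℂ) ^ 2 = ((v ^ 2 - 4 : ℝ) : ℂ) := by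
      rw [← ofReal_pow, sq_sqrt (by nlinarith)]
    rw [h1, this]; push_cast; ring
  rcases sq_eq_sq_iff_eq_or_eq_neg.1 h3 with h | h
  · exact h
  · rw [h] at h2 ⊢
    have h4 := sqrt_nonneg (v ^ 2 - 4)
    rw [sub_neg_eq_add, ← ofReal_neg, ← ofReal_add, ← ofReal_add, norm_real,
      norm_real, norm_eq_abs, norm_eq_abs, abs_of_nonneg (by linarith)] at h2
    rcases le_total 0 (v + -√(v ^ 2 - 4)) with h5 | h5
    · rw [abs_of_nonneg h5] at h2
      have : √(v ^ 2 - 4) = 0 := by linarith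
      rw [this]; simp
    · rw [abs_of_nonpos h5] at h2
      linarith

lemma jouk_ofReal_conj {v : ℝ} (hv : 2 ≤ |v|) : conj (jouk v) = jouk v := by
  have h1 := jouk_sq v
  have h3 : jouk v ^ 2 = ((√(v ^ 2 - 4) : ℝ) : ℂ) ^ 2 := by
    have : ((√(v ^ 2 - 4) : ℝ) : ℂ) ^ 2 = ((v ^ 2 - 4 : ℝ) : ℂ) := by
      rw [← ofReal_pow, sq_sqrt (by nlinarith [sq_abs v, abs_nonneg v])]
    rw [h1, this]; push_cast; ring
  rcases sq_eq_sq_iff_eq_or_eq_neg.1 h3 with h | h <;> rw [h] <;> simp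

lemma jouk_two_cos {θ : ℝ} (h0 : 0 ≤ sin θ) :
    jouk ((2 * cos θ : ℝ) : ℂ) = 2 * I * (sin θ : ℂ) := by
  have h1 := jouk_sq ((2 * cos θ : ℝ) : ℂ)
  have h2 := jouk_im_nonneg (v := ((2 * cos θ : ℝ) : ℂ)) (by rw [ofReal_im])
  have h3 : jouk ((2 * cos θ : ℝ) : ℂ) ^ 2 = (2 * I * (sin θ : ℂ)) ^ 2 := by
    rw [h1, mul_pow, mul_pow, I_sq]
    have := congrArg (fun r : ℝ => (r : ℂ)) (Real.sin_sq_add_cos_sq θ)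
    simp only [ofReal_add, ofReal_pow, ofReal_one] at this
    simp only [ofReal_mul, ofReal_ofNat]
    linear_combination 4 * this
  rcases sq_eq_sq_iff_eq_or_eq_neg.1 h3 with h | h
  · exact h
  · rw [h] at h2 ⊢
    simp only [neg_im, mul_im, mul_re, I_re, I_im, ofReal_re, ofReal_im, re_ofNat, im_ofNat] at h2
    have : sin θ = 0 := by linarith
    rw [this]; simp

/-! ### Contour integration in the right half plane -/

/-- The closed right half plane. -/
def rightHalf : Set ℂ := {z | 0 ≤ z.re}

lemma tendsto_integral_imaginary_axis {H : ℂ → ℂ} (hc : ContinuousOn H rightHalf)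
    (hd : DifferentiableOn ℂ H {z | 0 < z.re})
    (hlim : Tendsto (fun z => z * H z) (cocompact ℂ ⊓ 𝓟 rightHalf) (𝓝 0)) :
    Tendsto (fun R : ℝ => ∫ y in (-R)..R, H (y * I)) atTop (𝓝 0) := by
  rw [Metric.tendsto_atTop]
  intro ε hε
  have h1 : ∀ᶠ z in cocompact ℂ ⊓ 𝓟 rightHalf, ‖z * H z‖ < ε / 8 := by
    have := Metric.tendsto_nhds.1 hlim (ε / 8) (by positivity)
    simpa using this
  rw [eventually_inf_principal, ← Metric.cobounded_eq_cocompact, ← comap_norm_atTop, eventually_comap] at h1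
  obtain ⟨R0, hR0⟩ := eventually_atTop.1 h1
  refine ⟨max R0 1, fun R hR => ?_⟩
  have hR1 : 1 ≤ R := (le_max_right _ _).trans hR
  have hRp : 0 < R := by linarith
  have hb : ∀ z ∈ rightHalf, R ≤ ‖z‖ → ‖H z‖ ≤ ε / 8 / R := by
    intro z hz hzR
    have := hR0 ‖z‖ ((le_max_left _ _).trans (hR.trans hzR)) z rfl hz
    rw [norm_mul] at this
    rw [le_div_iff₀ hRp]
    nlinarith [norm_nonneg (H z)]
  have hrect := integral_boundary_rect_eq_zero_of_continuousOn_of_differentiableOn H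
    (-(R : ℂ) * I) (R + R * I) (hc.mono ?_) (hd.mono ?_)
  · simp only [neg_mul, neg_re, mul_re, ofReal_re, I_re, mul_zero, ofReal_im, I_im, mul_one, sub_self,
      neg_zero, add_re, add_zero, neg_im, mul_im, add_im, zero_add, ofReal_neg,
      ofReal_zero] at hrect
    have e1 : ‖∫ x in (0 : ℝ)..R, H (x + -(R * I))‖ ≤ ε / 8 / R * |R - 0| := by
      refine norm_integral_le_of_norm_le_const fun x hx => hb _ ?_ ?_
      · rw [uIoc_of_le hRp.le] at hx
        simp [rightHalf, hx.1.le]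
      · refine le_trans ?_ (abs_im_le_norm _)
        simp [abs_of_pos hRp]
    have e2 : ‖∫ x in (0 : ℝ)..R, H (x + R * I)‖ ≤ ε / 8 / R * |R - 0| := by
      refine norm_integral_le_of_norm_le_const fun x hx => hb _ ?_ ?_
      · rw [uIoc_of_le hRp.le] at hx
        simp [rightHalf, hx.1.le]
      · refine le_trans ?_ (abs_im_le_norm _)
        simp [abs_of_pos hRp]
    have e3 : ‖∫ y in (-R)..R, H (R + y * I)‖ ≤ ε / 8 / R * |R - -R| := by
      refine norm_integral_le_of_norm_le_const fun x hx => hb _ ?_ ?_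
      · simp [rightHalf, hRp.le]
      · refine le_trans ?_ (abs_re_le_norm _)
        simp [abs_of_pos hRp]
    rw [sub_zero, abs_of_pos hRp, div_mul_cancel₀ _ hRp.ne'] at e1 e2
    rw [sub_neg_eq_add, abs_of_pos (by linarith)] at e3
    have e3' : ε / 8 / R * (R + R) = ε / 4 := by field_simp; norm_num
    rw [e3'] at e3
    have e4 : I * ∫ y in (-R)..R, H (y * I) = (∫ x in (0 : ℝ)..R, H (x + -(R * I))) -
        (∫ x in (0 : ℝ)..R, H (x + R * I)) + I * ∫ y in (-R)..R, H (R + y * I) := by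
      simp only [smul_eq_mul] at hrect
      linear_combination -hrect
    have e5 := congrArg norm e4
    rw [norm_mul, norm_I, one_mul] at e5
    rw [dist_zero_right, e5]
    refine lt_of_le_of_lt (norm_add_le _ _) ?_
    rw [norm_mul, norm_I, one_mul]
    have := norm_sub_le (∫ x in (0 : ℝ)..R, H (x + -(R * I))) (∫ x in (0 : ℝ)..R, H (x + R * I))
    linarith
  · intro z hz
    rw [mem_reProdIm] at hz
    have h2 := hz.1
    simp only [neg_mul, neg_re, mul_re, ofReal_re, I_re, mul_zero, ofReal_im, I_im, mul_one, sub_self,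
      neg_zero, add_re, add_zero] at h2
    rw [uIcc_of_le hRp.le] at h2
    exact h2.1
  · intro z hz
    rw [mem_reProdIm] at hz
    have h2 := hz.1
    simp only [neg_mul, neg_re, mul_re, ofReal_re, I_re, mul_zero, ofReal_im, I_im, mul_one, sub_self,
      neg_zero, add_re, add_zero] at h2
    rw [min_eq_left hRp.le] at h2
    exact h2.1

/-- A function with a double pole at the origin, regularized. -/
lemma tendsto_integral_dslope {G : ℂ → ℂ} {ℓ : ℂ} (hc : ContinuousOn G rightHalf)
    (hd : DifferentiableOn ℂ G {z | 0 < z.re}) (ha : AnalyticAt ℂ G 0)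
    (hlim : Tendsto (fun z => z⁻¹ * G z) (cocompact ℂ ⊓ 𝓟 rightHalf) (𝓝 ℓ)) :
    ContinuousOn (dslope (dslope G 0) 0) rightHalf ∧
    Tendsto (fun R : ℝ => ∫ y in (-R)..R,
      (dslope (dslope G 0) 0 (y * I) - (ℓ - deriv G 0) / (y * I + 1))) atTop (𝓝 0) := by
  have hform : ∀ z : ℂ, z ≠ 0 → dslope (dslope G 0) 0 z = z⁻¹ * (z⁻¹ * (G z - G 0) - deriv G 0) := by
    intro z hz
    rw [dslope_of_ne _ hz, slope_def_field, dslope_of_ne _ hz, dslope_same, slope_def_field, sub_zero]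
    field_simp
  have hcont0 : ContinuousAt (dslope (dslope G 0) 0) 0 := by
    obtain ⟨p, hp⟩ := ha
    exact (hp.has_fpower_series_dslope_fslope.has_fpower_series_dslope_fslope).continuousAt
  have hc2 : ContinuousOn (dslope (dslope G 0) 0) rightHalf := by
    intro z hz
    rcases eq_or_ne z 0 with rfl | hz0
    · exact hcont0.continuousWithinAt
    · have h1 : ContinuousWithinAt (fun z => z⁻¹ * (z⁻¹ * (G z - G 0) - deriv G 0)) rightHalf z := by
        have hi : ContinuousWithinAt (fun z : ℂ => z⁻¹) rightHalf z :=
          (continuousAt_inv₀ hz0).continuousWithinAt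
        exact hi.mul ((hi.mul ((hc z hz).sub continuousWithinAt_const)).sub continuousWithinAt_const)
      refine h1.congr_of_eventuallyEq ?_ (hform z hz0)
      filter_upwards [mem_nhdsWithin_of_mem_nhds (isOpen_ne.mem_nhds hz0)] with y hy
      exact hform y hy
  have hne1 : ∀ z ∈ rightHalf, z + 1 ≠ 0 := by
    intro z hz h0
    have := congrArg re h0
    simp [rightHalf] at this hz
    linarith
  refine ⟨hc2, tendsto_integral_imaginary_axis
    (H := fun z => dslope (dslope G 0) 0 z - (ℓ - deriv G 0) / (z + 1)) ?_ ?_ ?_⟩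
  · exact hc2.sub (ContinuousOn.div continuousOn_const (by fun_prop) hne1)
  · intro z hz
    have hz0 : z ≠ 0 := fun h => by simp [h] at hz
    have hG : DifferentiableAt ℂ G z :=
      (hd z hz).differentiableAt ((isOpen_lt continuous_const continuous_re).mem_nhds hz)
    have hi : DifferentiableAt ℂ (fun z : ℂ => z⁻¹) z := differentiableAt_inv hz0
    have h1 : DifferentiableAt ℂ (fun z => z⁻¹ * (z⁻¹ * (G z - G 0) - deriv G 0)) z :=
      hi.mul ((hi.mul (hG.sub_const _)).sub_const _)
    have h2 : DifferentiableAt ℂ (dslope (dslope G 0) 0) z := by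
      refine h1.congr_of_eventuallyEq ?_
      filter_upwards [isOpen_ne.mem_nhds hz0] with y hy
      exact hform y hy
    have h3 : DifferentiableAt ℂ (fun z : ℂ => (ℓ - deriv G 0) / (z + 1)) z :=
      (differentiableAt_const _).div (by fun_prop) (hne1 z (show z ∈ rightHalf from le_of_lt (show 0 < z.re from hz)))
    exact (h2.sub h3).differentiableWithinAt
  · have hinv : Tendsto (fun z : ℂ => z⁻¹) (cocompact ℂ ⊓ 𝓟 rightHalf) (𝓝 0) :=
      (tendsto_inv₀_cobounded (α := ℂ)).mono_left (by
        rw [Metric.cobounded_eq_cocompact]; exact inf_le_left)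
    have hne : ∀ᶠ z : ℂ in cocompact ℂ ⊓ 𝓟 rightHalf, z ≠ 0 ∧ z ∈ rightHalf := by
      rw [eventually_inf_principal]
      have : ∀ᶠ z : ℂ in cocompact ℂ, z ≠ 0 := by
        have := (isCompact_singleton (x := (0 : ℂ))).compl_mem_cocompact
        filter_upwards [this] with z hz using hz
      filter_upwards [this] with z hz hz' using ⟨hz, hz'⟩
    have h1 : Tendsto (fun z : ℂ => (z⁻¹ * G z - z⁻¹ * G 0 - deriv G 0) -
        (ℓ - deriv G 0) * (1 + z⁻¹)⁻¹) (cocompact ℂ ⊓ 𝓟 rightHalf)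
        (𝓝 ((ℓ - 0 * G 0 - deriv G 0) - (ℓ - deriv G 0) * (1 + 0)⁻¹)) :=
      ((hlim.sub (hinv.mul_const _)).sub_const _).sub
        (((hinv.const_add 1).inv₀ (by simp)).const_mul _)
    have h2 : (ℓ - 0 * G 0 - deriv G 0) - (ℓ - deriv G 0) * (1 + 0)⁻¹ = 0 := by simp
    rw [h2] at h1
    refine h1.congr' ?_
    filter_upwards [hne] with z hz
    have hz1 := hne1 z hz.2
    have hz0 := hz.1
    rw [hform z hz0]
    have : (1 + z⁻¹)⁻¹ = z / (z + 1) := by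
      rw [show (1 : ℂ) + z⁻¹ = (z + 1) / z by field_simp, inv_div]
    rw [this]
    field_simp

/-- The integral of the jump of a function across the imaginary axis. -/
lemma tendsto_integral_jump {G G' : ℂ → ℂ} {ℓ : ℂ} (hc : ContinuousOn G rightHalf)
    (hd : DifferentiableOn ℂ G {z | 0 < z.re}) (ha : AnalyticAt ℂ G 0)
    (hlim : Tendsto (fun z => z⁻¹ * G z) (cocompact ℂ ⊓ 𝓟 rightHalf) (𝓝 ℓ))
    (hc' : ContinuousOn G' rightHalf) (hd' : DifferentiableOn ℂ G' {z | 0 < z.re})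
    (ha' : AnalyticAt ℂ G' 0)
    (hlim' : Tendsto (fun z => z⁻¹ * G' z) (cocompact ℂ ⊓ 𝓟 rightHalf) (𝓝 (-ℓ)))
    (h0 : G' 0 = G 0) (h1 : deriv G' 0 = -deriv G 0) :
    ∃ J : ℝ → ℂ, Continuous J ∧
      (∀ y : ℝ, y ≠ 0 → J y = ((y * I) ^ 2)⁻¹ * (G (y * I) - G' (-(y * I)))) ∧
      Tendsto (fun R : ℝ => ∫ y in (-R)..R, J y) atTop (𝓝 (2 * π * (ℓ - deriv G 0))) := by
  obtain ⟨k1, k2⟩ := tendsto_integral_dslope hc hd ha hlim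
  obtain ⟨k1', k2'⟩ := tendsto_integral_dslope hc' hd' ha' hlim'
  set A : ℂ := ℓ - deriv G 0 with hA
  set D := dslope (dslope G 0) 0 with hD
  set D' := dslope (dslope G' 0) 0 with hD'
  have hA' : -ℓ - deriv G' 0 = -A := by rw [h1, hA]; ring
  rw [hA'] at k2'
  have hmem : ∀ y : ℝ, (y : ℂ) * I ∈ rightHalf := fun y => by simp [rightHalf]
  have hDc : Continuous fun y : ℝ => D (y * I) :=
    continuous_iff_continuousAt.2 fun y => by
      have : ContinuousOn (fun y : ℝ => D (y * I)) univ :=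
        k1.comp (by fun_prop) fun y _ => hmem y
      exact (continuousOn_univ.1 this).continuousAt
  have hDc' : Continuous fun y : ℝ => D' (y * I) :=
    continuousOn_univ.1 (k1'.comp (by fun_prop) fun y _ => hmem y)
  have hDcn : Continuous fun y : ℝ => D' (-(y * I)) := by
    have := hDc'.comp (continuous_neg (G := ℝ))
    refine this.congr fun y => ?_
    simp
  have hform : ∀ F : ℂ → ℂ, ∀ z : ℂ, z ≠ 0 →
      dslope (dslope F 0) 0 z = z⁻¹ * (z⁻¹ * (F z - F 0) - deriv F 0) := by
    intro F z hz
    rw [dslope_of_ne _ hz, slope_def_field, dslope_of_ne _ hz, dslope_same, slope_def_field, sub_zero]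
    field_simp
  refine ⟨fun y => D (y * I) - D' (-(y * I)), hDc.sub hDcn, fun y hy => ?_, ?_⟩
  · have hy0 : (y : ℂ) * I ≠ 0 := by simp [hy]
    simp only [hD, hD']
    rw [hform G _ hy0, hform G' _ (neg_ne_zero.2 hy0), h0, h1]
    have : (y : ℂ) ≠ 0 := by exact_mod_cast hy
    field_simp
    ring
  · have hr : Tendsto (fun R : ℝ => ∫ y in (-R)..R, (D' (-(y * I)) + A / (-(y * I) + 1))) atTop (𝓝 0) := by
      refine k2'.congr fun R => ?_
      have := integral_comp_neg (a := -R) (b := R)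
        (fun y : ℝ => D' (y * I) - -A / (y * I + 1))
      rw [neg_neg] at this
      rw [← this]
      refine integral_congr fun y _ => ?_
      simp only [ofReal_neg, neg_mul]
      ring
    have hat : Tendsto (fun R : ℝ => 2 * A * ((2 * Real.arctan R : ℝ) : ℂ)) atTop
        (𝓝 (2 * A * ((2 * (π / 2) : ℝ) : ℂ))) := by
      refine Tendsto.const_mul _ ((continuous_ofReal.tendsto _).comp ?_)
      exact ((Real.tendsto_arctan_atTop).mono_right nhdsWithin_le_nhds).const_mul 2
    have hs := (k2.sub hr).add hat
    have he : (0 : ℂ) - 0 + 2 * A * ((2 * (π / 2) : ℝ) : ℂ) = 2 * π * A := by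
      push_cast; ring
    rw [he] at hs
    refine hs.congr fun R => ?_
    have hn1 : ∀ y : ℝ, (y : ℂ) * I + 1 ≠ 0 := fun y h => by
      have := congrArg re h; simp at this
    have hn2 : ∀ y : ℝ, -((y : ℂ) * I) + 1 ≠ 0 := fun y h => by
      have := congrArg re h; simp at this
    have c1 : Continuous fun y : ℝ => A / ((y : ℂ) * I + 1) :=
      Continuous.div continuous_const (by fun_prop) hn1
    have c2 : Continuous fun y : ℝ => A / (-((y : ℂ) * I) + 1) :=
      Continuous.div continuous_const (by fun_prop) hn2
    have c3 : Continuous fun y : ℝ => (1 + y ^ 2)⁻¹ :=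
      Continuous.inv₀ (by fun_prop) fun y => by positivity
    have e1 : ((2 * Real.arctan R : ℝ) : ℂ) = ∫ y in (-R)..R, (((1 + y ^ 2)⁻¹ : ℝ) : ℂ) := by
      rw [integral_ofReal, integral_inv_one_add_sq, Real.arctan_neg]
      congr 1; ring
    have i1 : Continuous fun y : ℝ => D (y * I) - A / (y * I + 1) := hDc.sub c1
    have i2 : Continuous fun y : ℝ => D' (-(y * I)) + A / (-(y * I) + 1) := hDcn.add c2
    have i3 : Continuous fun y : ℝ => (D (y * I) - A / (y * I + 1)) -
      (D' (-(y * I)) + A / (-(y * I) + 1)) := i1.sub i2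
    have i4 : Continuous fun y : ℝ => 2 * A * (((1 + y ^ 2)⁻¹ : ℝ) : ℂ) := by fun_prop
    rw [e1, ← integral_const_mul, ← integral_sub
      (i1.intervalIntegrable _ _) (i2.intervalIntegrable _ _),
      ← integral_add (i3.intervalIntegrable _ _) (i4.intervalIntegrable _ _)]
    refine integral_congr fun y _ => ?_
    have h3 : (1 : ℂ) + y ^ 2 ≠ 0 := by
      have : (0 : ℝ) < 1 + y ^ 2 := by positivity
      exact_mod_cast this.ne'
    have h4 : A / ((y : ℂ) * I + 1) + A / (-((y : ℂ) * I) + 1) = 2 * A * (1 + (y : ℂ) ^ 2)⁻¹ := by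
      rw [div_add_div _ _ (hn1 y) (hn2 y), ← div_eq_mul_inv, div_eq_div_iff
        (mul_ne_zero (hn1 y) (hn2 y)) h3]
      linear_combination 2 * A * (y : ℂ) ^ 2 * I_sq
    simp only [ofReal_inv, ofReal_add, ofReal_one, ofReal_pow]
    linear_combination -h4

/-! ### Resolvent coefficients -/

/-- A pair of branches of the roots of `(w ∓ e i λ)² - 4` on the right half plane. -/
structure Channels (w : ℝ) (e : ℂ) (s1 s2 : ℂ → ℂ) : Prop where
  hw : 2 < w
  he : e * e = 1
  sq1 : ∀ z, s1 z ^ 2 = (w - e * I * z) ^ 2 - 4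
  sq2 : ∀ z, s2 z ^ 2 = (w + e * I * z) ^ 2 - 4
  cont1 : ContinuousOn s1 rightHalf
  cont2 : ContinuousOn s2 rightHalf
  diff1 : ∀ z, 0 < z.re → DifferentiableAt ℂ s1 z
  diff2 : ∀ z, 0 < z.re → DifferentiableAt ℂ s2 z
  near1 : AnalyticAt ℂ s1 0
  near2 : AnalyticAt ℂ s2 0
  zero1 : s1 0 = (√(w ^ 2 - 4) : ℝ)
  zero2 : s2 0 = (√(w ^ 2 - 4) : ℝ)
  bd1 : ∀ z ∈ rightHalf, ‖s1 z - (w - e * I * z)‖ ≤ 2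
  bd2 : ∀ z ∈ rightHalf, ‖s2 z - (w + e * I * z)‖ ≤ 2

/-- `ζ₁`, `ζ₂` of a channel. -/
def chRoot (v s : ℂ) : ℂ := (v - s) / 2

/-- The determinant. -/
def chDet (α β : ℝ) (s1 s2 : ℂ) : ℂ := (s1 - α) * (s2 - α) - (β : ℂ) ^ 2

/-- The resolvent coefficient as a function of the roots. -/
def chCoef (α β : ℝ) (c : ℂ) (X n : ℕ) (v1 v2 s1 s2 : ℂ) : ℂ :=
  chRoot v1 s1 ^ X * (I * (β * conj c * chRoot v2 s2 ^ n -
    (s2 - α) * c * chRoot v1 s1 ^ n)) * (chDet α β s1 s2)⁻¹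

/-- The leading coefficient of the determinant at the origin. -/
def detLead (w β : ℝ) : ℝ :=
  (w ^ 2 - 4 * β / √(w ^ 2 - 4)) / (w ^ 2 - 4)

/-- The decaying root at the origin. -/
def root0 (w : ℝ) : ℝ := (w - √(w ^ 2 - 4)) / 2

/-- The resolvent coefficient times `λ²`. -/
def chFun (w α β : ℝ) (c : ℂ) (X n : ℕ) (e : ℂ) (s1 s2 : ℂ → ℂ) (z : ℂ) : ℂ :=
  if z = 0 then 2 * I * β * c.re * (root0 w : ℂ) ^ (X + n) / detLead w β
  else z ^ 2 * chCoef α β c X n (w - e * I * z) (w + e * I * z) (s1 z) (s2 z)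

/-- The numerator of the resolvent coefficient. -/
def chNum (w α β : ℝ) (c : ℂ) (X n : ℕ) (e : ℂ) (s1 s2 : ℂ → ℂ) (z : ℂ) : ℂ :=
  chRoot (w - e * I * z) (s1 z) ^ X * (I * (β * conj c *
    chRoot (w + e * I * z) (s2 z) ^ n - (s2 z - α) * c * chRoot (w - e * I * z) (s1 z) ^ n))

/-- The numerator and the denominator of the determinant divided by `λ²`. -/
def chM (w : ℝ) (s1 s2 : ℂ → ℂ) (z : ℂ) : ℂ :=
  (s1 z + (√(w ^ 2 - 4) : ℝ)) * (s2 z + (√(w ^ 2 - 4) : ℝ))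

def chN (w β : ℝ) (s1 s2 : ℂ → ℂ) (z : ℂ) : ℂ :=
  4 * (w : ℂ) ^ 2 + z ^ 2 - 8 * β * (w : ℂ) ^ 2 * (s1 z + s2 z)⁻¹ +
    β * (s1 z + s2 z + 2 * (√(w ^ 2 - 4) : ℝ))

namespace Channels

variable {w : ℝ} {e : ℂ} {s1 s2 : ℂ → ℂ}

lemma s0_pos (hw : 2 < w) : 0 < √(w ^ 2 - 4) := Real.sqrt_pos.2 (by nlinarith)

lemma s0_sq (hw : 2 < w) : ((√(w ^ 2 - 4) : ℝ) : ℂ) ^ 2 = (w : ℂ) ^ 2 - 4 := by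
  rw [← ofReal_pow, sq_sqrt (by nlinarith)]; push_cast; ring

lemma det_identity (h : Channels w e s1 s2) (β : ℝ) {z : ℂ} (hs : s1 z + s2 z ≠ 0) :
    chDet (√(w ^ 2 - 4) + β) β (s1 z) (s2 z) * chM w s1 s2 z = z ^ 2 * chN w β s1 s2 z := by
  have h1 := h.sq1 z
  have h2 := h.sq2 z
  have h0 := s0_sq h.hw
  have he := h.he
  have hI := I_sq
  unfold chDet chM chN
  set s0 : ℂ := ((√(w ^ 2 - 4) : ℝ) : ℂ)
  push_cast
  have e1 : (s1 z - s0) * (s1 z + s0) = -2 * e * I * w * z - z ^ 2 := by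
    linear_combination h1 - h0 + e ^ 2 * z ^ 2 * hI - z ^ 2 * he
  have e2 : (s2 z - s0) * (s2 z + s0) = 2 * e * I * w * z - z ^ 2 := by
    linear_combination h2 - h0 + e ^ 2 * z ^ 2 * hI - z ^ 2 * he
  have e3 : (s1 z - s2 z) = -4 * e * I * w * z * (s1 z + s2 z)⁻¹ := by
    field_simp
    linear_combination e1 - e2
  have e4 : (s1 z - s0) * (s2 z - s0) * ((s1 z + s0) * (s2 z + s0)) = 4 * w ^ 2 * z ^ 2 + z ^ 4 := by
    calc _ = ((s1 z - s0) * (s1 z + s0)) * ((s2 z - s0) * (s2 z + s0)) := by ring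
      _ = _ := by
        rw [e1, e2]
        linear_combination -4 * w ^ 2 * z ^ 2 * e ^ 2 * hI + 4 * w ^ 2 * z ^ 2 * he
  linear_combination e4 - β * (s2 z + s0) * e1 - β * (s1 z + s0) * e2 - 2 * β * e * I * w * z * e3 +
    8 * β * w ^ 2 * z ^ 2 * (s1 z + s2 z)⁻¹ * e ^ 2 * hI - 8 * β * w ^ 2 * z ^ 2 * (s1 z + s2 z)⁻¹ * he

lemma hasDerivAt1 (h : Channels w e s1 s2) :
    HasDerivAt s1 (-(e * I * w / (√(w ^ 2 - 4) : ℝ))) 0 := by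
  have hs0 : ((√(w ^ 2 - 4) : ℝ) : ℂ) ≠ 0 := by exact_mod_cast (s0_pos h.hw).ne'
  have h1 := h.near1.differentiableAt.hasDerivAt
  have h2 : HasDerivAt (fun z => s1 z ^ 2) (2 * s1 0 * deriv s1 0) 0 :=
    (h1.pow 2).congr_deriv (by simp)
  have h3 : HasDerivAt (fun z => s1 z ^ 2) (2 * w * (-(e * I))) 0 := by
    rw [funext h.sq1]
    have := ((((hasDerivAt_id (0 : ℂ)).const_mul (e * I)).const_sub (w : ℂ)).pow 2).sub_const 4
    simpa using this
  have h4 := h2.unique h3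
  rw [h.zero1] at h4
  refine h1.congr_deriv ?_
  field_simp
  linear_combination (1 / 2 : ℂ) * h4

lemma hasDerivAt2 (h : Channels w e s1 s2) :
    HasDerivAt s2 (e * I * w / (√(w ^ 2 - 4) : ℝ)) 0 := by
  have hs0 : ((√(w ^ 2 - 4) : ℝ) : ℂ) ≠ 0 := by exact_mod_cast (s0_pos h.hw).ne'
  have h1 := h.near2.differentiableAt.hasDerivAt
  have h2 : HasDerivAt (fun z => s2 z ^ 2) (2 * s2 0 * deriv s2 0) 0 :=
    (h1.pow 2).congr_deriv (by simp)
  have h3 : HasDerivAt (fun z => s2 z ^ 2) (2 * w * (e * I)) 0 := by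
    rw [funext h.sq2]
    have := ((((hasDerivAt_id (0 : ℂ)).const_mul (e * I)).const_add (w : ℂ)).pow 2).sub_const 4
    simpa using this
  have h4 := h2.unique h3
  rw [h.zero2] at h4
  refine h1.congr_deriv ?_
  field_simp
  linear_combination (1 / 2 : ℂ) * h4

lemma root1_zero (h : Channels w e s1 s2) : chRoot (w - e * I * 0) (s1 0) = root0 w := by
  rw [h.zero1]; simp [chRoot, root0]

lemma root2_zero (h : Channels w e s1 s2) : chRoot (w + e * I * 0) (s2 0) = root0 w := by
  rw [h.zero2]; simp [chRoot, root0]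

lemma hasDerivAt_root1_pow (h : Channels w e s1 s2) (n : ℕ) :
    HasDerivAt (fun z => chRoot (w - e * I * z) (s1 z) ^ n)
      (n * (root0 w : ℂ) ^ n * (e * I / (√(w ^ 2 - 4) : ℝ))) 0 := by
  have hs0 : ((√(w ^ 2 - 4) : ℝ) : ℂ) ≠ 0 := by exact_mod_cast (s0_pos h.hw).ne'
  have h1 : HasDerivAt (fun z => chRoot (w - e * I * z) (s1 z))
      (root0 w * (e * I / (√(w ^ 2 - 4) : ℝ))) 0 := by
    have := ((((hasDerivAt_id (0 : ℂ)).const_mul (e * I)).const_sub (w : ℂ)).sub h.hasDerivAt1).div_const 2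
    refine this.congr_deriv ?_
    rw [root0]; push_cast; field_simp; ring
  refine (h1.pow n).congr_deriv ?_
  rw [h.root1_zero]
  rcases n with _ | n
  · simp
  · simp only [Nat.add_sub_cancel, pow_succ]; ring

lemma hasDerivAt_root2_pow (h : Channels w e s1 s2) (n : ℕ) :
    HasDerivAt (fun z => chRoot (w + e * I * z) (s2 z) ^ n)
      (-(n * (root0 w : ℂ) ^ n * (e * I / (√(w ^ 2 - 4) : ℝ)))) 0 := by
  have hs0 : ((√(w ^ 2 - 4) : ℝ) : ℂ) ≠ 0 := by exact_mod_cast (s0_pos h.hw).ne'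
  have h1 : HasDerivAt (fun z => chRoot (w + e * I * z) (s2 z))
      (-(root0 w * (e * I / (√(w ^ 2 - 4) : ℝ)))) 0 := by
    have := ((((hasDerivAt_id (0 : ℂ)).const_mul (e * I)).const_add (w : ℂ)).sub h.hasDerivAt2).div_const 2
    refine this.congr_deriv ?_
    rw [root0]; push_cast; field_simp; ring
  refine (h1.pow n).congr_deriv ?_
  rw [h.root2_zero]
  rcases n with _ | n
  · simp
  · simp only [Nat.add_sub_cancel, pow_succ]; ring

lemma hasDerivAt_num (h : Channels w e s1 s2) (β : ℝ) (c : ℂ) (X n : ℕ) :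
    HasDerivAt (chNum w (√(w ^ 2 - 4) + β) β c X n e s1 s2)
      (e * (root0 w : ℂ) ^ (X + n) / (√(w ^ 2 - 4) : ℝ) *
        (-2 * X * β * c.re + w * c - 2 * I * β * n * c.im)) 0 := by
  have hs0 : ((√(w ^ 2 - 4) : ℝ) : ℂ) ≠ 0 := by exact_mod_cast (s0_pos h.hw).ne'
  have h1 := (h.hasDerivAt_root1_pow X).mul ((((h.hasDerivAt_root2_pow n).const_mul
    ((β : ℂ) * conj c)).sub (((h.hasDerivAt2.sub_const
      (((√(w ^ 2 - 4) + β : ℝ)) : ℂ)).mul_const c).mul (h.hasDerivAt_root1_pow n))).const_mul I)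
  refine h1.congr_deriv ?_
  simp only [Pi.mul_apply, Pi.sub_apply]
  rw [h.root1_zero, h.root2_zero, h.zero2, pow_add]
  have hc : conj c = 2 * c.re - c := by
    apply Complex.ext <;> simp; ring
  have hc2 : c = c.re + c.im * I := (re_add_im c).symm
  rw [hc]
  push_cast
  set r := (c.re : ℂ)
  set m := (c.im : ℂ)
  rw [hc2]
  field_simp
  ring_nf
  simp only [I_sq, show I ^ 3 = -I by rw [pow_succ, I_sq]; ring]
  ring

lemma num_zero (h : Channels w e s1 s2) (β : ℝ) (c : ℂ) (X n : ℕ) :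
    chNum w (√(w ^ 2 - 4) + β) β c X n e s1 s2 0 =
      2 * I * β * c.re * (root0 w : ℂ) ^ (X + n) := by
  unfold chNum
  have hc : conj c = 2 * c.re - c := by
    apply Complex.ext <;> simp; ring
  rw [h.root1_zero, h.root2_zero, h.zero2, pow_add, hc]
  push_cast; ring

lemma hasDerivAt_M (h : Channels w e s1 s2) : HasDerivAt (chM w s1 s2) 0 0 := by
  refine ((h.hasDerivAt1.add_const _).mul (h.hasDerivAt2.add_const _)).congr_deriv ?_
  rw [h.zero1, h.zero2]; ring

lemma M_zero (h : Channels w e s1 s2) : chM w s1 s2 0 = 4 * ((w : ℂ) ^ 2 - 4) := by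
  unfold chM; rw [h.zero1, h.zero2, ← s0_sq h.hw]; ring

lemma add_zero_ne (h : Channels w e s1 s2) : s1 0 + s2 0 ≠ 0 := by
  rw [h.zero1, h.zero2]
  have := s0_pos h.hw
  exact_mod_cast (by linarith : (0:ℝ) < √(w ^ 2 - 4) + √(w ^ 2 - 4)).ne'

lemma hasDerivAt_N (h : Channels w e s1 s2) (β : ℝ) : HasDerivAt (chN w β s1 s2) 0 0 := by
  have hs := h.hasDerivAt1.add h.hasDerivAt2
  have h1 := (((hasDerivAt_pow 2 (0 : ℂ)).const_add (4 * (w : ℂ) ^ 2)).sub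
    ((hs.inv h.add_zero_ne).const_mul (8 * β * (w : ℂ) ^ 2))).add
    ((hs.add_const (2 * ((√(w ^ 2 - 4) : ℝ) : ℂ))).const_mul (β : ℂ))
  refine h1.congr_deriv ?_
  simp

lemma N_zero (h : Channels w e s1 s2) (β : ℝ) :
    chN w β s1 s2 0 = 4 * ((w : ℂ) ^ 2 - 4) * detLead w β := by
  have hs0 : ((√(w ^ 2 - 4) : ℝ) : ℂ) ≠ 0 := by exact_mod_cast (s0_pos h.hw).ne'
  have h2 := s0_sq h.hw
  have h3 : (w : ℂ) ^ 2 - 4 ≠ 0 := by rw [← h2]; exact pow_ne_zero 2 hs0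
  unfold chN detLead
  rw [h.zero1, h.zero2]
  push_cast
  rw [mul_assoc (4 : ℂ), mul_div_cancel₀ _ h3]
  set s0 : ℂ := ((√(w ^ 2 - 4) : ℝ) : ℂ)
  have : (s0 + s0)⁻¹ = s0⁻¹ / 2 := by field_simp; norm_num
  rw [this]
  field_simp
  linear_combination 8 * (β : ℂ) * h2

lemma M_zero_ne (h : Channels w e s1 s2) : chM w s1 s2 0 ≠ 0 := by
  rw [h.M_zero, ← s0_sq h.hw]
  have hs0 : ((√(w ^ 2 - 4) : ℝ) : ℂ) ≠ 0 := by exact_mod_cast (s0_pos h.hw).ne'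
  exact mul_ne_zero (by norm_num) (pow_ne_zero 2 hs0)

lemma N_zero_ne (h : Channels w e s1 s2) {β : ℝ} (hE : detLead w β ≠ 0) : chN w β s1 s2 0 ≠ 0 := by
  rw [h.N_zero, ← s0_sq h.hw]
  have hs0 : ((√(w ^ 2 - 4) : ℝ) : ℂ) ≠ 0 := by exact_mod_cast (s0_pos h.hw).ne'
  have : (detLead w β : ℂ) ≠ 0 := by exact_mod_cast hE
  exact mul_ne_zero (mul_ne_zero (by norm_num) (pow_ne_zero 2 hs0)) this

/-- Near the origin the resolvent coefficient is given by a regular quotient. -/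
lemma chFun_eventuallyEq (h : Channels w e s1 s2) {β : ℝ} (hE : detLead w β ≠ 0) (c : ℂ) (X n : ℕ) :
    chFun w (√(w ^ 2 - 4) + β) β c X n e s1 s2 =ᶠ[𝓝 0] fun z =>
      chNum w (√(w ^ 2 - 4) + β) β c X n e s1 s2 z * chM w s1 s2 z /
        chN w β s1 s2 z := by
  have k1 : ∀ᶠ z in 𝓝 (0 : ℂ), chM w s1 s2 z ≠ 0 :=
    h.hasDerivAt_M.continuousAt.eventually_ne h.M_zero_ne
  have k2 : ∀ᶠ z in 𝓝 (0 : ℂ), chN w β s1 s2 z ≠ 0 :=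
    (h.hasDerivAt_N β).continuousAt.eventually_ne (h.N_zero_ne hE)
  have k3 : ∀ᶠ z in 𝓝 (0 : ℂ), s1 z + s2 z ≠ 0 :=
    (h.hasDerivAt1.continuousAt.add h.hasDerivAt2.continuousAt).eventually_ne h.add_zero_ne
  filter_upwards [k1, k2, k3] with z h1 h2 h3
  have hid := h.det_identity β h3
  unfold chFun
  split_ifs with hz
  · subst hz
    have hE' : (detLead w β : ℂ) ≠ 0 := by exact_mod_cast hE
    have h4 : (w : ℂ) ^ 2 - 4 ≠ 0 := by
      have := h.M_zero_ne; rw [h.M_zero] at this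
      exact right_ne_zero_of_mul this
    rw [h.num_zero, h.N_zero, h.M_zero]
    field_simp
  · have hD : chDet (√(w ^ 2 - 4) + β) β (s1 z) (s2 z) ≠ 0 := by
      intro h0
      rw [h0, zero_mul] at hid
      exact mul_ne_zero (pow_ne_zero 2 hz) h2 hid.symm
    have hq : z ^ 2 * (chDet (√(w ^ 2 - 4) + β) β (s1 z) (s2 z))⁻¹ =
        chM w s1 s2 z / chN w β s1 s2 z := by
      rw [eq_div_iff h2]
      field_simp
      linear_combination -hid
    have : z ^ 2 * chCoef (√(w ^ 2 - 4) + β) β c X n (w - e * I * z) (w + e * I * z)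
        (s1 z) (s2 z) = chNum w (√(w ^ 2 - 4) + β) β c X n e s1 s2 z *
        (z ^ 2 * (chDet (√(w ^ 2 - 4) + β) β (s1 z) (s2 z))⁻¹) := by
      unfold chCoef chNum; push_cast; ring
    rw [this, hq]; ring

lemma hasDerivAt_chFun (h : Channels w e s1 s2) {β : ℝ} (hE : detLead w β ≠ 0) (c : ℂ) (X n : ℕ) :
    HasDerivAt (chFun w (√(w ^ 2 - 4) + β) β c X n e s1 s2)
      (e * (root0 w : ℂ) ^ (X + n) / ((√(w ^ 2 - 4) : ℝ) * detLead w β) *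
        (-2 * X * β * c.re + w * c - 2 * I * β * n * c.im)) 0 := by
  have h1 := (((h.hasDerivAt_num β c X n).mul h.hasDerivAt_M).div (h.hasDerivAt_N β)
    (h.N_zero_ne hE)).congr_of_eventuallyEq (h.chFun_eventuallyEq hE c X n)
  refine h1.congr_deriv ?_
  have hE' : (detLead w β : ℂ) ≠ 0 := by exact_mod_cast hE
  have h4 : (w : ℂ) ^ 2 - 4 ≠ 0 := by
    have := h.M_zero_ne; rw [h.M_zero] at this
    exact right_ne_zero_of_mul this
  have hs0 : ((√(w ^ 2 - 4) : ℝ) : ℂ) ≠ 0 := by exact_mod_cast (s0_pos h.hw).ne'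
  rw [h.N_zero, h.M_zero]
  field_simp
  ring

lemma analyticAt_chFun (h : Channels w e s1 s2) {β : ℝ} (hE : detLead w β ≠ 0) (c : ℂ) (X n : ℕ) :
    AnalyticAt ℂ (chFun w (√(w ^ 2 - 4) + β) β c X n e s1 s2) 0 := by
  refine AnalyticAt.congr ?_ (h.chFun_eventuallyEq hE c X n).symm
  have n1 := h.near1
  have n2 := h.near2
  have a1 : AnalyticAt ℂ (chM w s1 s2) 0 := by unfold chM; fun_prop
  have a2 : AnalyticAt ℂ (chN w β s1 s2) 0 := by
    have : AnalyticAt ℂ (fun z => (s1 z + s2 z)⁻¹) 0 := (n1.add n2).inv h.add_zero_ne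
    unfold chN; fun_prop
  have a3 : AnalyticAt ℂ (chNum w (√(w ^ 2 - 4) + β) β c X n e s1 s2) 0 := by
    unfold chNum chRoot; fun_prop (disch := norm_num)
  exact (a3.mul a1).div a2 (h.N_zero_ne hE)

lemma differentiableOn_chFun (h : Channels w e s1 s2) (α β : ℝ)
    (hD : ∀ z ∈ rightHalf, z ≠ 0 → chDet α β (s1 z) (s2 z) ≠ 0) (c : ℂ) (X n : ℕ) :
    DifferentiableOn ℂ (chFun w α β c X n e s1 s2) {z | 0 < z.re} := by
  intro z hz
  have hz0 : z ≠ 0 := fun h => by simp [h] at hz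
  have d1 := h.diff1 z hz
  have d2 := h.diff2 z hz
  have hd := hD z (show 0 ≤ z.re from le_of_lt hz) hz0
  have k : DifferentiableAt ℂ (fun z => z ^ 2 * chCoef α β c X n (w - e * I * z) (w + e * I * z)
      (s1 z) (s2 z)) z := by
    have d3 : DifferentiableAt ℂ (fun z => (chDet α β (s1 z) (s2 z))⁻¹) z :=
      DifferentiableAt.inv (by unfold chDet; fun_prop) hd
    unfold chCoef chRoot
    fun_prop (disch := norm_num)
  refine (k.congr_of_eventuallyEq ?_).differentiableWithinAt
  filter_upwards [isOpen_ne.mem_nhds hz0] with y hy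
  exact if_neg hy

lemma continuousOn_chFun (h : Channels w e s1 s2) {β : ℝ} (hE : detLead w β ≠ 0)
    (hD : ∀ z ∈ rightHalf, z ≠ 0 → chDet (√(w ^ 2 - 4) + β) β (s1 z) (s2 z) ≠ 0)
    (c : ℂ) (X n : ℕ) :
    ContinuousOn (chFun w (√(w ^ 2 - 4) + β) β c X n e s1 s2) rightHalf := by
  intro z hz
  rcases eq_or_ne z 0 with rfl | hz0
  · exact (h.hasDerivAt_chFun hE c X n).continuousAt.continuousWithinAt
  have d1 := h.cont1 z hz
  have d2 := h.cont2 z hz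
  have hd := hD z hz hz0
  have k : ContinuousWithinAt (fun z => z ^ 2 * chCoef (√(w ^ 2 - 4) + β) β c X n
      (w - e * I * z) (w + e * I * z) (s1 z) (s2 z)) rightHalf z := by
    have d3 : ContinuousWithinAt (fun z => (chDet (√(w ^ 2 - 4) + β) β (s1 z) (s2 z))⁻¹)
        rightHalf z :=
      ContinuousWithinAt.inv₀ (by unfold chDet; fun_prop) hd
    unfold chCoef chRoot
    fun_prop (disch := norm_num)
  refine k.congr_of_eventuallyEq ?_ (if_neg hz0)
  filter_upwards [mem_nhdsWithin_of_mem_nhds (isOpen_ne.mem_nhds hz0)] with y hy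
  exact if_neg hy

lemma norm_root1_le (h : Channels w e s1 s2) {z : ℂ} (hz : z ∈ rightHalf) :
    ‖chRoot (w - e * I * z) (s1 z)‖ ≤ 1 := by
  have := h.bd1 z hz
  rw [chRoot, norm_div, norm_sub_rev, norm_ofNat]; linarith

lemma norm_root2_le (h : Channels w e s1 s2) {z : ℂ} (hz : z ∈ rightHalf) :
    ‖chRoot (w + e * I * z) (s2 z)‖ ≤ 1 := by
  have := h.bd2 z hz
  rw [chRoot, norm_div, norm_sub_rev, norm_ofNat]; linarith

lemma root1_mul (h : Channels w e s1 s2) (z : ℂ) : chRoot (w - e * I * z) (s1 z) *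
    ((w - e * I * z) - chRoot (w - e * I * z) (s1 z)) = 1 := by
  unfold chRoot
  linear_combination (-1 / 4 : ℂ) * h.sq1 z

lemma tendsto_chFun (h : Channels w e s1 s2) (α β : ℝ) (c : ℂ) (X n : ℕ) :
    Tendsto (fun z => z⁻¹ * chFun w α β c X n e s1 s2 z) (cocompact ℂ ⊓ 𝓟 rightHalf)
      (𝓝 (e * (c * 0 ^ X * 0 ^ n))) := by
  have he := h.he
  have hI := I_sq
  set l := cocompact ℂ ⊓ 𝓟 rightHalf
  have hinv : Tendsto (fun z : ℂ => z⁻¹) l (𝓝 0) :=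
    (tendsto_inv₀_cobounded (α := ℂ)).mono_left (by
      rw [Metric.cobounded_eq_cocompact]; exact inf_le_left)
  have hne : ∀ᶠ z : ℂ in l, z ≠ 0 := by
    have := (isCompact_singleton (x := (0 : ℂ))).compl_mem_cocompact
    exact mem_inf_of_left this
  have hmem : ∀ᶠ z : ℂ in l, z ∈ rightHalf := mem_inf_of_right (mem_principal_self _)
  have hbdd : ∀ f : ℂ → ℂ, ∀ B : ℝ, (∀ z ∈ rightHalf, ‖f z‖ ≤ B) →
      Tendsto (fun z => z⁻¹ * f z) l (𝓝 0) := by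
    intro f B hf
    have h0 : Tendsto (fun z : ℂ => ‖z⁻¹‖ * B) l (𝓝 0) := by
      simpa using hinv.norm.mul_const B
    refine squeeze_zero_norm' ?_ h0
    filter_upwards [hmem] with z hz
    rw [norm_mul]; gcongr; exact hf z hz
  have t1 := hbdd _ _ fun z hz => h.norm_root1_le hz
  have t2 : Tendsto (fun z => chRoot (w - e * I * z) (s1 z)) l (𝓝 0) := by
    have k1 : Tendsto (fun z => (w : ℂ) * z⁻¹ - e * I - z⁻¹ * chRoot (w - e * I * z) (s1 z)) l
        (𝓝 (w * 0 - e * I - 0)) := ((hinv.const_mul _).sub_const _).sub t1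
    have hne0 : (w : ℂ) * 0 - e * I - 0 ≠ 0 := by
      have : e ≠ 0 := left_ne_zero_of_mul (by rw [he]; exact one_ne_zero)
      simp [this]
    have k2 := hinv.mul (k1.inv₀ hne0)
    rw [zero_mul] at k2
    refine k2.congr' ?_
    filter_upwards [hne] with z hz
    have hm := h.root1_mul z
    have : (w : ℂ) * z⁻¹ - e * I - z⁻¹ * chRoot (w - e * I * z) (s1 z) =
        z⁻¹ * ((w - e * I * z) - chRoot (w - e * I * z) (s1 z)) := by field_simp
    rw [this, mul_inv, inv_inv, ← mul_assoc, inv_mul_cancel₀ hz, one_mul]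
    exact (eq_inv_of_mul_eq_one_left hm).symm
  have t3 : Tendsto (fun z => z⁻¹ * (s1 z - α)) l (𝓝 (-(e * I))) := by
    have k := ((hbdd (fun z => s1 z - (w - e * I * z)) 2 (fun z hz => h.bd1 z hz)).add
      (hinv.mul_const ((w : ℂ) - α))).sub_const (e * I)
    rw [zero_mul, zero_add, zero_sub] at k
    refine k.congr' ?_
    filter_upwards [hne] with z hz
    field_simp; ring
  have t4 : Tendsto (fun z => z⁻¹ * (s2 z - α)) l (𝓝 (e * I)) := by
    have k := ((hbdd (fun z => s2 z - (w + e * I * z)) 2 (fun z hz => h.bd2 z hz)).add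
      (hinv.mul_const ((w : ℂ) - α))).add_const (e * I)
    rw [zero_mul, zero_add, zero_add] at k
    refine k.congr' ?_
    filter_upwards [hne] with z hz
    field_simp; ring
  have t5 : Tendsto (fun z => z⁻¹ * chRoot (w + e * I * z) (s2 z) ^ n) l (𝓝 0) :=
    hbdd _ 1 fun z hz => by
      rw [norm_pow]; exact pow_le_one₀ (norm_nonneg _) (h.norm_root2_le hz)
  have t6 := ((t2.pow X).mul ((((t5.const_mul (β * conj c)).sub
    ((t4.mul_const c).mul (t2.pow n)))).const_mul I)).mul
    (((t3.mul t4).sub ((hinv.pow 2).const_mul ((β : ℂ) ^ 2))).inv₀ (by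
      have : -(e * I) * (e * I) - (β : ℂ) ^ 2 * 0 ^ 2 = 1 := by
        linear_combination -e ^ 2 * hI + he
      rw [this]; exact one_ne_zero))
  have e1 : -(e * I) * (e * I) - (β : ℂ) ^ 2 * 0 ^ 2 = 1 := by
    linear_combination -e ^ 2 * hI + he
  rw [e1] at t6
  have e2 : (0 : ℂ) ^ X * (I * ((β * conj c) * 0 - e * I * c * 0 ^ n)) * (1 : ℂ)⁻¹ =
      e * (c * 0 ^ X * 0 ^ n) := by
    rw [inv_one]
    linear_combination -(0 : ℂ) ^ X * 0 ^ n * e * c * hI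
  rw [e2] at t6
  refine t6.congr' ?_
  filter_upwards [hne] with z hz
  rw [chFun, if_neg hz, chCoef]
  have e3 : z⁻¹ * (s1 z - α) * (z⁻¹ * (s2 z - α)) - (β : ℂ) ^ 2 * z⁻¹ ^ 2 =
      z⁻¹ ^ 2 * chDet α β (s1 z) (s2 z) := by unfold chDet; ring
  rw [e3, mul_inv]
  field_simp

end Channels

/-! ### The initial value of the kernel -/

/-- The root of `(w + iλ)² - 4`. -/
def sMinus (w : ℝ) (z : ℂ) : ℂ := jouk (w + I * z)

/-- The root of `(w - iλ)² - 4`. -/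
def sPlus (w : ℝ) (z : ℂ) : ℂ := conj (jouk (w + I * conj z))

lemma channels_aux (w : ℝ) (z : ℂ) : (w + I * z : ℂ).im = z.re := by simp

lemma sMinus_sq (w : ℝ) (z : ℂ) : sMinus w z ^ 2 = (w + I * z) ^ 2 - 4 := jouk_sq _

lemma sPlus_sq (w : ℝ) (z : ℂ) : sPlus w z ^ 2 = (w - I * z) ^ 2 - 4 := by
  unfold sPlus
  rw [← map_pow, jouk_sq]
  simp only [map_sub, map_pow, map_add, map_mul, conj_I, conj_ofReal, conj_conj, map_ofNat]
  ring

lemma continuousAt_sMinus (w : ℝ) {z : ℂ} (hz : z ∈ rightHalf) : ContinuousAt (sMinus w) z :=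
  ContinuousAt.comp (f := fun z : ℂ => (w : ℂ) + I * z) (continuousAt_jouk (by
    rw [channels_aux]; exact hz)) (by fun_prop)

lemma continuousAt_sPlus (w : ℝ) {z : ℂ} (hz : z ∈ rightHalf) : ContinuousAt (sPlus w) z := by
  have h1 : ContinuousAt (sMinus w) (conj z) :=
    continuousAt_sMinus w (by simpa [rightHalf] using hz)
  exact continuous_conj.continuousAt.comp
    (ContinuousAt.comp (f := fun z => conj z) h1 continuous_conj.continuousAt)

lemma differentiableAt_sMinus {w : ℝ} {z : ℂ} (hz : 0 < z.re ∨ (w - z.im ≠ 2 ∧ w - z.im ≠ -2)) :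
    DifferentiableAt ℂ (sMinus w) z := by
  have h1 : DifferentiableAt ℂ jouk (w + I * z) := differentiableAt_jouk (by
    simpa [sub_eq_add_neg] using hz)
  exact h1.comp z (f := fun z : ℂ => (w : ℂ) + I * z) (by fun_prop)

lemma differentiableAt_sPlus {w : ℝ} {z : ℂ} (hz : 0 < z.re ∨ (w + z.im ≠ 2 ∧ w + z.im ≠ -2)) :
    DifferentiableAt ℂ (sPlus w) z := by
  have h1 : DifferentiableAt ℂ (sMinus w) (conj z) :=
    differentiableAt_sMinus (by simpa using hz)
  have h2 := h1.conj_conj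
  rw [conj_conj] at h2
  exact h2

lemma sMinus_zero {w : ℝ} (hw : 2 < w) : sMinus w 0 = (√(w ^ 2 - 4) : ℝ) := by
  simp only [sMinus, mul_zero, add_zero]
  exact jouk_ofReal_of_one_le hw.le

lemma sPlus_zero {w : ℝ} (hw : 2 < w) : sPlus w 0 = (√(w ^ 2 - 4) : ℝ) := by
  simp only [sPlus, map_zero, mul_zero, add_zero]
  rw [jouk_ofReal_of_one_le hw.le, conj_ofReal]

lemma norm_sMinus_sub_le (w : ℝ) {z : ℂ} (hz : z ∈ rightHalf) : ‖sMinus w z - (w + I * z)‖ ≤ 2 :=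
  norm_jouk_sub_le (by rw [channels_aux]; exact hz)

lemma norm_sPlus_sub_le (w : ℝ) {z : ℂ} (hz : z ∈ rightHalf) : ‖sPlus w z - (w - I * z)‖ ≤ 2 := by
  have h := norm_sMinus_sub_le w (z := conj z) (by simpa [rightHalf] using hz)
  rw [← norm_conj] at h
  simpa [sPlus, sMinus, sub_eq_add_neg] using h

lemma analyticAt_sMinus {w : ℝ} (hw : 2 < w) : AnalyticAt ℂ (sMinus w) 0 := by
  rw [analyticAt_iff_eventually_differentiableAt]
  have h1 : ∀ᶠ z : ℂ in 𝓝 0, w - z.im ≠ 2 := by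
    have : ContinuousAt (fun z : ℂ => w - z.im) 0 := by fun_prop
    exact this.eventually_ne (by simp; exact hw.ne')
  have h2 : ∀ᶠ z : ℂ in 𝓝 0, w - z.im ≠ -2 := by
    have : ContinuousAt (fun z : ℂ => w - z.im) 0 := by fun_prop
    exact this.eventually_ne (by simp; linarith)
  filter_upwards [h1, h2] with z a b
  exact differentiableAt_sMinus (Or.inr ⟨a, b⟩)

lemma analyticAt_sPlus {w : ℝ} (hw : 2 < w) : AnalyticAt ℂ (sPlus w) 0 := by
  rw [analyticAt_iff_eventually_differentiableAt]
  have h1 : ∀ᶠ z : ℂ in 𝓝 0, w + z.im ≠ 2 := by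
    have : ContinuousAt (fun z : ℂ => w + z.im) 0 := by fun_prop
    exact this.eventually_ne (by simp; exact hw.ne')
  have h2 : ∀ᶠ z : ℂ in 𝓝 0, w + z.im ≠ -2 := by
    have : ContinuousAt (fun z : ℂ => w + z.im) 0 := by fun_prop
    exact this.eventually_ne (by simp; linarith)
  filter_upwards [h1, h2] with z a b
  exact differentiableAt_sPlus (Or.inr ⟨a, b⟩)

lemma channels_right {w : ℝ} (hw : 2 < w) : Channels w 1 (sPlus w) (sMinus w) where
  hw := hw
  he := one_mul _
  sq1 z := by rw [sPlus_sq, one_mul]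
  sq2 z := by rw [sMinus_sq, one_mul]
  cont1 z hz := (continuousAt_sPlus w hz).continuousWithinAt
  cont2 z hz := (continuousAt_sMinus w hz).continuousWithinAt
  diff1 z hz := differentiableAt_sPlus (Or.inl hz)
  diff2 z hz := differentiableAt_sMinus (Or.inl hz)
  near1 := analyticAt_sPlus hw
  near2 := analyticAt_sMinus hw
  zero1 := sPlus_zero hw
  zero2 := sMinus_zero hw
  bd1 z hz := by simpa using norm_sPlus_sub_le w hz
  bd2 z hz := by simpa using norm_sMinus_sub_le w hz

lemma channels_left {w : ℝ} (hw : 2 < w) : Channels w (-1) (sMinus w) (sPlus w) where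
  hw := hw
  he := by ring
  sq1 z := by rw [sMinus_sq]; ring
  sq2 z := by rw [sPlus_sq]; ring
  cont1 z hz := (continuousAt_sMinus w hz).continuousWithinAt
  cont2 z hz := (continuousAt_sPlus w hz).continuousWithinAt
  diff1 z hz := differentiableAt_sMinus (Or.inl hz)
  diff2 z hz := differentiableAt_sPlus (Or.inl hz)
  near1 := analyticAt_sMinus hw
  near2 := analyticAt_sPlus hw
  zero1 := sMinus_zero hw
  zero2 := sPlus_zero hw
  bd1 z hz := by simpa using norm_sMinus_sub_le w hz
  bd2 z hz := by simpa [sub_eq_add_neg] using norm_sPlus_sub_le w hz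

lemma chDet_symm (α β : ℝ) (s1 s2 : ℂ) : chDet α β s1 s2 = chDet α β s2 s1 := by
  unfold chDet; ring

/-- The jump of the resolvent coefficient across the imaginary axis, at `iy`. -/
def jumpFun (w α β : ℝ) (c : ℂ) (X n : ℕ) (y : ℝ) : ℂ :=
  chCoef α β c X n (w + y : ℝ) (w - y : ℝ) (conj (jouk (w + y : ℝ))) (jouk (w - y : ℝ)) -
  chCoef α β c X n (w + y : ℝ) (w - y : ℝ) (jouk (w + y : ℝ)) (conj (jouk (w - y : ℝ)))

lemma exists_jump {w β : ℝ} (hw : 2 < w) (hE : detLead w β ≠ 0)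
    (hD : ∀ z ∈ rightHalf, z ≠ 0 →
      chDet (√(w ^ 2 - 4) + β) β (sPlus w z) (sMinus w z) ≠ 0) (c : ℂ) (X n : ℕ) :
    ∃ J : ℝ → ℂ, Continuous J ∧
      (∀ y, y ≠ 0 → J y = jumpFun w (√(w ^ 2 - 4) + β) β c X n y) ∧
      Tendsto (fun R : ℝ => ∫ y in (-R)..R, J y) atTop (𝓝 (2 * π * (c * 0 ^ X * 0 ^ n -
        (root0 w : ℂ) ^ (X + n) / ((√(w ^ 2 - 4) : ℝ) * detLead w β) *
        (-2 * X * β * c.re + w * c - 2 * I * β * n * c.im)))) := by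
  set α := √(w ^ 2 - 4) + β with hα
  have hr := channels_right hw
  have hl := channels_left hw
  have hD' : ∀ z ∈ rightHalf, z ≠ 0 → chDet α β (sMinus w z) (sPlus w z) ≠ 0 := fun z hz h0 => by
    rw [chDet_symm]; exact hD z hz h0
  have h1 := hr.hasDerivAt_chFun hE c X n
  have h2 := hl.hasDerivAt_chFun hE c X n
  have t1 := hr.tendsto_chFun α β c X n
  have t2 := hl.tendsto_chFun α β c X n
  rw [one_mul] at t1
  rw [neg_one_mul] at t2
  obtain ⟨J, hJ, hJy, hJt⟩ := tendsto_integral_jump (hr.continuousOn_chFun hE hD c X n)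
    (hr.differentiableOn_chFun α β hD c X n) (hr.analyticAt_chFun hE c X n) t1
    (hl.continuousOn_chFun hE hD' c X n)
    (hl.differentiableOn_chFun α β hD' c X n) (hl.analyticAt_chFun hE c X n) t2
    (by simp [chFun]) (by rw [h1.deriv, h2.deriv]; ring)
  refine ⟨J, hJ, fun y hy => ?_, ?_⟩
  · rw [hJy y hy]
    have hy0 : (y : ℂ) * I ≠ 0 := by simp [hy]
    rw [chFun, if_neg hy0, chFun, if_neg (neg_ne_zero.2 hy0), neg_pow_two, ← mul_sub,
      inv_mul_cancel_left₀ (pow_ne_zero 2 hy0), jumpFun]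
    have a1 : (w : ℂ) - 1 * I * (y * I) = ((w + y : ℝ) : ℂ) := by
      push_cast; linear_combination -(y : ℂ) * I_sq
    have a2 : (w : ℂ) + 1 * I * (y * I) = ((w - y : ℝ) : ℂ) := by
      push_cast; linear_combination (y : ℂ) * I_sq
    have a3 : (w : ℂ) - -1 * I * (-(y * I)) = ((w + y : ℝ) : ℂ) := by
      push_cast; linear_combination -(y : ℂ) * I_sq
    have a4 : (w : ℂ) + -1 * I * (-(y * I)) = ((w - y : ℝ) : ℂ) := by
      push_cast; linear_combination (y : ℂ) * I_sq
    have b1 : sPlus w (y * I) = conj (jouk (w + y : ℝ)) := by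
      rw [sPlus]; congr 2
      simp only [map_mul, conj_ofReal, conj_I]; push_cast; linear_combination -(y : ℂ) * I_sq
    have b2 : sMinus w (y * I) = jouk (w - y : ℝ) := by
      rw [sMinus]; congr 1
      push_cast; linear_combination (y : ℂ) * I_sq
    have b3 : sMinus w (-(y * I)) = jouk (w + y : ℝ) := by
      rw [sMinus]; congr 1
      push_cast; linear_combination -(y : ℂ) * I_sq
    have b4 : sPlus w (-(y * I)) = conj (jouk (w - y : ℝ)) := by
      rw [sPlus]; congr 2
      simp only [map_mul, map_neg, conj_ofReal, conj_I]; push_cast; linear_combination (y : ℂ) * I_sq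
    rw [a1, a2, a3, a4, b1, b2, b3, b4]
  · rw [h1.deriv, one_mul] at hJt
    exact hJt

lemma jumpFun_eq_zero {w y : ℝ} (α β : ℝ) (c : ℂ) (X n : ℕ) (h1 : 2 ≤ |w + y|) (h2 : 2 ≤ |w - y|) :
    jumpFun w α β c X n y = 0 := by
  rw [jumpFun, jouk_ofReal_conj h1, jouk_ofReal_conj h2, sub_self]

lemma jouk_evW {w : ℝ} (hw : 2 < w) (θ : ℝ) : jouk (evW w θ) = evS w θ :=
  jouk_ofReal_of_one_le (by linarith [evW_ge (w := w) θ])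

lemma chRoot_evW (w θ : ℝ) : chRoot (evW w θ) (evS w θ) = evZ w θ := by
  simp [chRoot, evZ]

lemma conj_circ (θ : ℝ) : conj (circ θ) = circ (-θ) := by
  rw [circ, circ, ← exp_conj]; simp

lemma chRoot_circ (θ : ℝ) : chRoot ((2 * cos θ : ℝ) : ℂ) (-(2 * I * (sin θ : ℂ))) = circ θ := by
  rw [chRoot, circ_eq]; push_cast; ring

lemma chRoot_circ' (θ : ℝ) : chRoot ((2 * cos θ : ℝ) : ℂ) (2 * I * (sin θ : ℂ)) =
    conj (circ θ) := by
  rw [chRoot, conj_circ, circ_eq, Real.sin_neg, Real.cos_neg]; push_cast; ring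

lemma chCoef_band1 {w α β : ℝ} (c : ℂ) (X n : ℕ) (θ : ℝ) :
    chCoef α β c X n ((2 * cos θ : ℝ) : ℂ) (evW w θ) (-(2 * I * (sin θ : ℂ))) (evS w θ) =
      circ θ ^ X * bandP w α β c n θ := by
  rw [chCoef, chRoot_circ, chRoot_evW, bandP, chDet, bandDet]
  ring_nf

lemma chCoef_band2 {w α β : ℝ} (c : ℂ) (X n : ℕ) (θ : ℝ) :
    chCoef α β c X n (evW w θ) ((2 * cos θ : ℝ) : ℂ) (evS w θ) (2 * I * (sin θ : ℂ)) =
      (evZ w θ : ℂ) ^ X * bandR w α β c n θ := by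
  have : conj (bandDet w α β θ) = chDet α β (evS w θ) (2 * I * (sin θ : ℂ)) := by
    simp only [bandDet, chDet, map_sub, map_mul, map_neg, map_pow, conj_I, conj_ofReal, map_ofNat]
    ring
  rw [chCoef, chRoot_circ', chRoot_evW, bandR, this]
  ring

lemma jumpFun_band1 {w α β : ℝ} (hw : 2 < w) (c : ℂ) (X n : ℕ) {θ : ℝ} (h0 : 0 ≤ sin θ) :
    jumpFun w α β c X n (2 * cos θ - w) =
      circ θ ^ X * bandP w α β c n θ - circ (-θ) ^ X * bandP w α β c n (-θ) := by
  have e1 : w + (2 * cos θ - w) = 2 * cos θ := by ring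
  have e2 : w - (2 * cos θ - w) = evW w θ := by unfold evW; ring
  have e3 : conj (2 * I * (sin θ : ℂ)) = -(2 * I * (sin θ : ℂ)) := by
    simp only [map_mul, conj_I, conj_ofReal, map_ofNat]; ring
  have k := chCoef_band1 (w := w) (α := α) (β := β) c X n (-θ)
  rw [Real.cos_neg, Real.sin_neg, evS_neg] at k
  have e4 : evW w (-θ) = evW w θ := by simp [evW]
  rw [e4] at k
  rw [← k, ← chCoef_band1, jumpFun, e1, e2, jouk_two_cos h0, jouk_evW hw, e3, conj_ofReal]
  congr 2
  push_cast; ring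

lemma jumpFun_band2 {w α β : ℝ} (hw : 2 < w) (c : ℂ) (X n : ℕ) {θ : ℝ} (h0 : 0 ≤ sin θ) :
    jumpFun w α β c X n (w - 2 * cos θ) =
      (evZ w θ : ℂ) ^ X * bandR w α β c n θ - (evZ w (-θ) : ℂ) ^ X * bandR w α β c n (-θ) := by
  have e1 : w - (w - 2 * cos θ) = 2 * cos θ := by ring
  have e2 : w + (w - 2 * cos θ) = evW w θ := by unfold evW; ring
  have e3 : conj (2 * I * (sin θ : ℂ)) = -(2 * I * (sin θ : ℂ)) := by
    simp only [map_mul, conj_I, conj_ofReal, map_ofNat]; ring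
  have k := chCoef_band2 (w := w) (α := α) (β := β) c X n (-θ)
  rw [Real.cos_neg, Real.sin_neg, evS_neg] at k
  have e4 : evW w (-θ) = evW w θ := by simp [evW]
  rw [e4] at k
  rw [← k, ← chCoef_band2, jumpFun, e1, e2, jouk_two_cos h0, jouk_evW hw, e3, conj_ofReal]
  congr 2
  push_cast; ring

lemma integral_sin_mul_symm {f : ℝ → ℂ} (hf : Continuous f) :
    ∫ θ in (0 : ℝ)..π, (2 * sin θ : ℂ) * (f θ - f (-θ)) =
      ∫ θ in (-π)..π, 2 * ((sin θ : ℂ) * f θ) := by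
  have c1 : Continuous fun θ : ℝ => 2 * ((sin θ : ℂ) * f θ) := by fun_prop
  have h1 := integral_comp_neg (a := 0) (b := π)
    (fun θ : ℝ => 2 * ((sin θ : ℂ) * f θ))
  rw [neg_zero] at h1
  rw [← integral_add_adjacent_intervals (c1.intervalIntegrable (-π) 0)
    (c1.intervalIntegrable 0 π), ← h1, ← integral_add
    integrable_of_continuous integrable_of_continuous]
  refine integral_congr fun θ _ => ?_
  simp only [Real.sin_neg, ofReal_neg]
  ring

lemma integral_cos_int (k : ℤ) : ∫ θ in (-π)..π, cos (k * θ) =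
    if k = 0 then 2 * π else 0 := by
  split_ifs with h
  · simp [h]; ring
  · have hk : (k : ℝ) ≠ 0 := by exact_mod_cast h
    rw [integral_comp_mul_left (fun x => cos x) hk, integral_cos, mul_neg,
      Real.sin_neg, Real.sin_int_mul_pi]
    simp

/-- The initial value of the kernel. -/
lemma Par.bandKernel_zero {δ Λ w β : ℝ} (h : Par δ Λ w (√(w ^ 2 - 4) + β) β)
    (hE : detLead w β ≠ 0)
    (hD : ∀ z ∈ rightHalf, z ≠ 0 →
      chDet (√(w ^ 2 - 4) + β) β (sPlus w z) (sMinus w z) ≠ 0) {c : ℂ} (hc : ‖c‖ = 1)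
    (z x : ℤ) :
    bandKernel w (√(w ^ 2 - 4) + β) β c z x 0 = (if x = z then c else 0) -
      (root0 w : ℂ) ^ (x.natAbs + z.natAbs) / ((√(w ^ 2 - 4) : ℝ) * detLead w β) *
        (-2 * x.natAbs * β * c.re + w * c - 2 * I * β * z.natAbs * c.im) := by
  have hw := h.two_lt
  set α := √(w ^ 2 - 4) + β with hα
  obtain ⟨J, hJ, hJy, hJt⟩ := exists_jump hw hE hD c x.natAbs z.natAbs
  have hp := h.continuous_bandP hc z.natAbs
  have hr := h.continuous_bandR hc z.natAbs
  have hz := h.continuous_evZ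
  have hcc := continuous_circ
  have hev : ∀ R : ℝ, w + 2 ≤ R → ∫ y in (-R)..R, J y =
      (∫ θ in (-π)..π, 2 * ((sin θ : ℂ) * (circ θ ^ x.natAbs * bandP w α β c z.natAbs θ))) +
      ∫ θ in (-π)..π, 2 * ((sin θ : ℂ) * ((evZ w θ : ℂ) ^ x.natAbs * bandR w α β c z.natAbs θ)) := by
    intro R hR
    have hi : ∀ a b, IntervalIntegrable J MeasureTheory.volume a b := fun a b =>
      hJ.intervalIntegrable a b
    have hz0 : ∀ a b : ℝ, a ≤ b → (∀ y ∈ Icc a b, 2 ≤ |w + y| ∧ 2 ≤ |w - y|) →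
        ∫ y in a..b, J y = 0 := by
      intro a b hab hy
      refine integral_zero_ae ?_
      have : ∀ᵐ y : ℝ, y ≠ 0 := by simp [MeasureTheory.ae_iff]
      filter_upwards [this] with y hy0 hymem
      rw [uIoc_of_le hab] at hymem
      have := hy y (Ioc_subset_Icc_self hymem)
      rw [hJy y hy0, jumpFun_eq_zero _ _ _ _ _ this.1 this.2]
    have p1 : ∫ y in (-R)..(-w - 2), J y = 0 := hz0 _ _ (by linarith) fun y hy =>
      ⟨by rw [abs_of_nonpos (by linarith [hy.2])]; linarith [hy.2],
        by rw [abs_of_nonneg (by linarith [hy.2])]; linarith [hy.2]⟩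
    have p3 : ∫ y in (-w + 2)..(w - 2), J y = 0 := hz0 _ _ (by linarith) fun y hy =>
      ⟨by rw [abs_of_nonneg (by linarith [hy.1])]; linarith [hy.1],
        by rw [abs_of_nonneg (by linarith [hy.2])]; linarith [hy.2]⟩
    have p5 : ∫ y in (w + 2)..R, J y = 0 := hz0 _ _ (by linarith) fun y hy =>
      ⟨by rw [abs_of_nonneg (by linarith [hy.1])]; linarith [hy.1],
        by rw [abs_of_nonpos (by linarith [hy.1])]; linarith [hy.1]⟩
    have p2 : ∫ y in (-w - 2)..(-w + 2), J y = ∫ θ in (-π)..π,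
        2 * ((sin θ : ℂ) * (circ θ ^ x.natAbs * bandP w α β c z.natAbs θ)) := by
      rw [← integral_sin_mul_symm (f := fun θ => circ θ ^ x.natAbs * bandP w α β c z.natAbs θ)
        (by fun_prop)]
      have hs := integral_deriv_smul_comp (a := π) (b := 0)
        (f := fun θ => 2 * cos θ - w) (f' := fun θ => -2 * sin θ) (g := J)
        (fun θ _ => (((Real.hasDerivAt_cos θ).const_mul 2).sub_const w).congr_deriv (by ring))
        (by fun_prop) hJ
      have b1 : 2 * cos π - w = -w - 2 := by rw [Real.cos_pi]; ring
      have b2 : 2 * cos 0 - w = -w + 2 := by rw [Real.cos_zero]; ring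
      simp only [b1, b2] at hs
      rw [← hs, integral_symm, ← integral_neg]
      refine integral_congr fun θ hθ => ?_
      rw [uIcc_of_le Real.pi_pos.le] at hθ
      have hne : 2 * cos θ - w ≠ 0 := by linarith [Real.cos_le_one θ]
      simp only [Function.comp, hJy _ hne,
        jumpFun_band1 hw c _ _ (Real.sin_nonneg_of_mem_Icc hθ), real_smul]
      push_cast; ring
    have p4 : ∫ y in (w - 2)..(w + 2), J y = ∫ θ in (-π)..π,
        2 * ((sin θ : ℂ) * ((evZ w θ : ℂ) ^ x.natAbs * bandR w α β c z.natAbs θ)) := by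
      rw [← integral_sin_mul_symm (f := fun θ => (evZ w θ : ℂ) ^ x.natAbs * bandR w α β c z.natAbs θ)
        (by fun_prop)]
      have hs := integral_deriv_smul_comp (a := 0) (b := π)
        (f := fun θ => w - 2 * cos θ) (f' := fun θ => 2 * sin θ) (g := J)
        (fun θ _ => (((Real.hasDerivAt_cos θ).const_mul 2).const_sub w).congr_deriv (by ring))
        (by fun_prop) hJ
      have b1 : w - 2 * cos π = w + 2 := by rw [Real.cos_pi]; ring
      have b2 : w - 2 * cos 0 = w - 2 := by rw [Real.cos_zero]; ring
      simp only [b1, b2] at hs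
      rw [← hs]
      refine integral_congr fun θ hθ => ?_
      rw [uIcc_of_le Real.pi_pos.le] at hθ
      have hne : w - 2 * cos θ ≠ 0 := by linarith [Real.cos_le_one θ]
      simp only [Function.comp, hJy _ hne,
        jumpFun_band2 hw c _ _ (Real.sin_nonneg_of_mem_Icc hθ), real_smul]
      push_cast; ring
    rw [← integral_add_adjacent_intervals (hi (-R) (-w - 2)) (hi _ R),
      ← integral_add_adjacent_intervals (hi (-w - 2) (-w + 2)) (hi _ R),
      ← integral_add_adjacent_intervals (hi (-w + 2) (w - 2)) (hi _ R),
      ← integral_add_adjacent_intervals (hi (w - 2) (w + 2)) (hi _ R),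
      p1, p2, p3, p4, p5]
    ring
  have hlim := tendsto_nhds_unique_of_eventuallyEq hJt tendsto_const_nhds
    (by filter_upwards [eventually_ge_atTop (w + 2)] with R hR using hev R hR)
  have c1 : Continuous fun θ : ℝ => c * ((cos ((x - z : ℤ) * θ) -
    cos ((|x| + |z| : ℤ) * θ) : ℝ) : ℂ) := by fun_prop
  have c2 : Continuous fun θ : ℝ => 2 * ((sin θ : ℂ) *
    (circ θ ^ x.natAbs * bandP w α β c z.natAbs θ)) := by fun_prop
  have hcos : ∫ θ in (-π)..π, c * ((cos ((x - z : ℤ) * θ) -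
      cos ((|x| + |z| : ℤ) * θ) : ℝ) : ℂ) =
      2 * π * ((if x = z then c else 0) - c * 0 ^ x.natAbs * 0 ^ z.natAbs) := by
    rw [integral_const_mul, integral_ofReal,
      integral_sub (Continuous.intervalIntegrable (by fun_prop) _ _)
      (Continuous.intervalIntegrable (by fun_prop) _ _), integral_cos_int, integral_cos_int]
    have h3 : ((if |x| + |z| = 0 then 2 * π else 0 : ℝ) : ℂ) =
        2 * π * (0 ^ x.natAbs * 0 ^ z.natAbs) := by
      by_cases hx : x = 0
      · by_cases hz : z = 0
        · simp [hx, hz]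
        · simp [hx, hz]
      · have : |x| + |z| ≠ 0 := by positivity
        simp [hx, this]
    rw [ofReal_sub, h3]
    by_cases hxz : x = z
    · subst hxz; simp; ring
    · simp [sub_eq_zero, hxz]; ring
  have hpi : (π : ℂ) ≠ 0 := by exact_mod_cast Real.pi_ne_zero
  unfold bandKernel bandInt amp1 amp2
  simp only [neg_zero, zero_mul, ofReal_zero, mul_zero, exp_zero, one_mul]
  rw [integral_add (c1.intervalIntegrable _ _) (c2.intervalIntegrable _ _),
    add_assoc, ← hlim, hcos]
  push_cast
  field_simp
  ring

/-! ### Modes of the linearization -/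

lemma delta_zero : delta 0 = 1 := by simp [delta]

lemma delta_of_ne {x : ℤ} (hx : x ≠ 0) : delta x = 0 := by simp [delta, hx]

lemma pow_natAbs_add_sub {η v : ℂ} (h : η ^ 2 = v * η - 1) (x : ℤ) :
    η ^ (x + 1).natAbs + η ^ (x - 1).natAbs = v * η ^ x.natAbs - delta x * (v - 2 * η) := by
  rcases eq_or_ne x 0 with rfl | hx
  · simp [delta_zero]; ring
  · obtain ⟨n, hn, hs⟩ := natAbs_add_one_sub_one (fun k : ℕ => η ^ k) hx
    rw [hs, hn, delta_of_ne hx, pow_add, h]; ring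

lemma summable_pow_natAbs {r : ℝ} (h0 : 0 ≤ r) (h1 : r < 1) : Summable fun x : ℤ => r ^ x.natAbs := by
  have hs := summable_geometric_of_lt_one h0 h1
  refine Summable.of_nat_of_neg (by simpa using hs) (by simpa using hs)

lemma memℓp_two_pow {η : ℂ} (h : ‖η‖ < 1) (c : ℂ) : Memℓp (fun x : ℤ => c * η ^ x.natAbs) 2 := by
  refine memℓp_gen ?_
  have := (summable_pow_natAbs (r := ‖η‖ ^ 2) (by positivity)
    (by nlinarith [norm_nonneg η])).mul_left (‖c‖ ^ 2)
  refine this.congr fun x => ?_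
  simp only [ENNReal.toReal_ofNat, Real.rpow_ofNat, norm_mul, norm_pow]
  rw [mul_pow, ← pow_mul, ← pow_mul, mul_comm]; ring

lemma memℓp_infty_pow {η : ℂ} (h : ‖η‖ ≤ 1) (c : ℂ) : Memℓp (fun x : ℤ => c * η ^ x.natAbs) ∞ := by
  refine memℓp_infty ⟨‖c‖, ?_⟩
  rintro _ ⟨x, rfl⟩
  simp only [norm_mul, norm_pow]
  exact mul_le_of_le_one_right (norm_nonneg _) (pow_le_one₀ (norm_nonneg _) h)

/-- The components of the mode built from two exponentials. -/
def modeU (β : ℝ) (d η1 η2 : ℂ) (x : ℤ) : ℂ := β / 2 * η1 ^ x.natAbs + d / 2 * η2 ^ x.natAbs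

def modeV (β : ℝ) (d η1 η2 : ℂ) (x : ℤ) : ℂ :=
  -I * β / 2 * η1 ^ x.natAbs + I * d / 2 * η2 ^ x.natAbs

lemma isMode_of_det (a : ℝ → ℝ) (ω C : ℝ) {lam η1 η2 : ℂ}
    (h1 : η1 ^ 2 = ((ω : ℂ) + 2 - I * lam) * η1 - 1) (h2 : η2 ^ 2 = ((ω : ℂ) + 2 + I * lam) * η2 - 1)
    (hβ : deriv a (C ^ 2) * C ^ 2 ≠ 0)
    (hdet : chDet (a (C ^ 2) + deriv a (C ^ 2) * C ^ 2) (deriv a (C ^ 2) * C ^ 2)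
      ((ω : ℂ) + 2 - I * lam - 2 * η1) ((ω : ℂ) + 2 + I * lam - 2 * η2) = 0) :
    IsMode a ω C lam
      (modeU (deriv a (C ^ 2) * C ^ 2) ((ω : ℂ) + 2 - I * lam - 2 * η1 -
        (a (C ^ 2) + deriv a (C ^ 2) * C ^ 2 : ℝ)) η1 η2)
      (modeV (deriv a (C ^ 2) * C ^ 2) ((ω : ℂ) + 2 - I * lam - 2 * η1 -
        (a (C ^ 2) + deriv a (C ^ 2) * C ^ 2 : ℝ)) η1 η2) := by
  have hβ' : ((deriv a (C ^ 2) * C ^ 2 : ℝ) : ℂ) ≠ 0 := by exact_mod_cast hβ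
  constructor
  · by_contra hcon
    push Not at hcon
    have e1 := congrFun hcon.1 0
    have e2 := congrFun hcon.2 0
    simp only [modeU, modeV, Int.natAbs_zero, pow_zero, mul_one, Pi.zero_apply] at e1 e2
    apply hβ'
    linear_combination e1 + I * e2 + (((deriv a (C ^ 2) * C ^ 2 : ℝ) : ℂ) / 2 -
      ((ω : ℂ) + 2 - I * lam - 2 * η1 - (a (C ^ 2) + deriv a (C ^ 2) * C ^ 2 : ℝ)) / 2) * I_sq
  · intro x
    have k1 := pow_natAbs_add_sub h1 x
    have k2 := pow_natAbs_add_sub h2 x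
    unfold chDet at hdet
    unfold D1 D2 lap modeU modeV
    rcases eq_or_ne x 0 with rfl | hx
    · rw [delta_zero] at k1 k2
      simp only [delta_zero, Int.natAbs_zero, pow_zero, mul_one, one_mul] at k1 k2 ⊢
      push_cast at hdet k1 k2 ⊢
      set b : ℂ := ((deriv a (C ^ 2) : ℝ) : ℂ) * (C : ℂ) ^ 2
      set A : ℂ := (a (C ^ 2) : ℂ)
      set d : ℂ := (ω : ℂ) + 2 - I * lam - 2 * η1 - (A + b) with hd
      constructor
      · linear_combination (I * b / 2) * k1 - (I * d / 2) * k2 + (I / 2) * hdet +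
          (-b * lam / 2 - d * lam / 2) * I_sq
      · linear_combination (b / 2) * k1 + (d / 2) * k2 - (1 / 2) * hdet
    · rw [delta_of_ne hx] at k1 k2 ⊢
      set d : ℂ := (ω : ℂ) + 2 - I * lam - 2 * η1 - (a (C ^ 2) + deriv a (C ^ 2) * C ^ 2 : ℝ)
      set b : ℂ := ((deriv a (C ^ 2) * C ^ 2 : ℝ) : ℂ)
      constructor
      · linear_combination (I * b / 2) * k1 - (I * d / 2) * k2 +
          (-b * lam / 2 * η1 ^ x.natAbs - d * lam / 2 * η2 ^ x.natAbs) * I_sq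
      · linear_combination (b / 2) * k1 + (d / 2) * k2

lemma memℓp_modeUV {p : ℝ≥0∞} (β : ℝ) (d : ℂ) {η1 η2 : ℂ}
    (h1 : ∀ c : ℂ, Memℓp (fun x : ℤ => c * η1 ^ x.natAbs) p)
    (h2 : ∀ c : ℂ, Memℓp (fun x : ℤ => c * η2 ^ x.natAbs) p) :
    Memℓp (modeU β d η1 η2) p ∧ Memℓp (modeV β d η1 η2) p :=
  ⟨(h1 _).add (h2 _), (h1 _).add (h2 _)⟩

/-- The determinant does not vanish when there are neither eigenvalues nor resonances: exponentials
given by arbitrary roots. -/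
lemma SpectralCondition.roots {a : ℝ → ℝ} {ω C : ℝ} (hC : C ≠ 0) (h : SpectralCondition a ω C)
    {lam η1 η2 : ℂ}
    (h1 : η1 ^ 2 = ((ω : ℂ) + 2 - I * lam) * η1 - 1) (h2 : η2 ^ 2 = ((ω : ℂ) + 2 + I * lam) * η2 - 1)
    (hdet : chDet (a (C ^ 2) + deriv a (C ^ 2) * C ^ 2) (deriv a (C ^ 2) * C ^ 2)
      ((ω : ℂ) + 2 - I * lam - 2 * η1) ((ω : ℂ) + 2 + I * lam - 2 * η2) = 0) (hlam : lam ≠ 0) :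
    ¬ (‖η1‖ < 1 ∧ ‖η2‖ < 1) ∧ ¬ (‖η1‖ ≤ 1 ∧ ‖η2‖ ≤ 1 ∧
      (lam = I * ω ∨ lam = -(I * ω) ∨ lam = I * (ω + 4) ∨ lam = -(I * (ω + 4)))) := by
  have hβ : deriv a (C ^ 2) * C ^ 2 ≠ 0 := mul_ne_zero h.1 (pow_ne_zero 2 hC)
  have hm := isMode_of_det a ω C h1 h2 hβ hdet
  constructor
  · rintro ⟨n1, n2⟩
    have := memℓp_modeUV (deriv a (C ^ 2) * C ^ 2) ((ω : ℂ) + 2 - I * lam - 2 * η1 -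
        (a (C ^ 2) + deriv a (C ^ 2) * C ^ 2 : ℝ)) (memℓp_two_pow n1) (memℓp_two_pow n2)
    exact h.2.2.1 lam hlam ⟨_, _, this.1, this.2, hm⟩
  · rintro ⟨n1, n2, hl⟩
    have := memℓp_modeUV (deriv a (C ^ 2) * C ^ 2) ((ω : ℂ) + 2 - I * lam - 2 * η1 -
        (a (C ^ 2) + deriv a (C ^ 2) * C ^ 2 : ℝ)) (memℓp_infty_pow n1) (memℓp_infty_pow n2)
    exact h.2.2.2 lam ⟨hl, _, _, this.1, this.2, hm⟩

lemma chRoot_quad {v s : ℂ} (h : s ^ 2 = v ^ 2 - 4) : chRoot v s ^ 2 = v * chRoot v s - 1 := by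
  unfold chRoot; linear_combination (1 / 4 : ℂ) * h

lemma norm_chRoot_jouk_lt {v : ℝ} (hv : 2 < |v|) : ‖chRoot v (jouk v)‖ < 1 := by
  have h1 := norm_sub_jouk_le (v := v) (by simp)
  have h2 := congrArg norm (jouk_mul v)
  rw [norm_mul, norm_ofNat] at h2
  have h3 := jouk_sq v
  rw [chRoot, norm_div, norm_ofNat, div_lt_one (by norm_num)]
  by_contra hcon
  push Not at hcon
  have e1 : ‖(v : ℂ) - jouk v‖ = 2 := by nlinarith
  obtain ⟨r, hr⟩ := conj_eq_iff_real.1 (jouk_ofReal_conj hv.le)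
  rw [hr] at e1 h3 h2
  have h4 : r ^ 2 = v ^ 2 - 4 := by exact_mod_cast h3
  rw [← ofReal_sub, ← ofReal_add, norm_real, norm_real, norm_eq_abs,
    norm_eq_abs] at h2
  rw [← ofReal_sub, norm_real, norm_eq_abs] at e1
  rw [e1] at h2
  have e2 : |v + r| = 2 := by linarith
  have e3 : (v - r) ^ 2 = 4 := by rw [← sq_abs, e1]; norm_num
  have e4 : (v + r) ^ 2 = 4 := by rw [← sq_abs, e2]; norm_num
  have e5 : v ^ 2 = 4 := by nlinarith
  have : 4 < v ^ 2 := by rw [← sq_abs]; nlinarith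
  linarith

lemma jouk_re_of_abs_lt {v : ℝ} (hv : |v| < 2) : (jouk v).re = 0 ∧ (jouk v).im ≠ 0 := by
  have h3 := jouk_sq v
  have hlt : v ^ 2 < 4 := by rw [← sq_abs]; nlinarith [abs_nonneg v]
  have hre := congrArg re h3
  have him := congrArg im h3
  rw [show ((v : ℂ) ^ 2 - 4) = ((v ^ 2 - 4 : ℝ) : ℂ) by push_cast; ring] at hre him
  simp only [pow_two, mul_re, mul_im, ofReal_re, ofReal_im] at hre him
  have h0 : (jouk v).im ≠ 0 := fun h0 => by rw [h0] at hre; nlinarith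
  refine ⟨?_, h0⟩
  have : (jouk v).im * (jouk v).re = 0 := by linarith
  exact (mul_eq_zero.1 this).resolve_left h0

lemma det_ne_of_mixed {A B : ℝ} (hB : B ≠ 0) {s t : ℂ} (hs : s.re = 0) (hs' : s.im ≠ 0)
    (ht : t.im = 0) : chDet A B s t ≠ 0 := by
  intro h0
  unfold chDet at h0
  have h1 := congrArg im h0
  have h2 := congrArg re h0
  rw [show (B : ℂ) ^ 2 = ((B ^ 2 : ℝ) : ℂ) by push_cast; ring] at h1 h2
  simp only [sub_re, sub_im, mul_re, mul_im, ofReal_re, ofReal_im, hs, ht, zero_re, zero_im] at h1 h2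
  have h3 : s.im * (t.re - A) = 0 := by linarith
  have h4 := (mul_eq_zero.1 h3).resolve_left hs'
  rw [h4] at h2
  have : B ^ 2 = 0 := by linarith
  exact hB (pow_eq_zero_iff two_ne_zero |>.1 this)

lemma chDet_neg_one (A B : ℝ) (s t : ℂ) : chDet (-1 * A) (-1 * B) s t = chDet A B (-t) (-s) := by
  unfold chDet; push_cast; ring

/-- The sign of the half line of frequencies. -/
def waveSign (ω : ℝ) : ℝ := if 0 < ω then 1 else -1

/-- The determinant does not vanish on the closed right half plane, except at the origin. -/
lemma SpectralCondition.chDet_ne_zero {a : ℝ → ℝ} {ω C : ℝ} (hC : C ≠ 0)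
    (h : SpectralCondition a ω C) (hω : 0 < ω ∨ ω < -4) {z : ℂ} (hz : z ∈ rightHalf) (hz0 : z ≠ 0) :
    chDet (waveSign ω * (a (C ^ 2) + deriv a (C ^ 2) * C ^ 2))
      (waveSign ω * (deriv a (C ^ 2) * C ^ 2)) (sPlus (waveSign ω * (ω + 2)) z)
      (sMinus (waveSign ω * (ω + 2)) z) ≠ 0 := by
  have hβ : deriv a (C ^ 2) * C ^ 2 ≠ 0 := mul_ne_zero h.1 (pow_ne_zero 2 hC)
  set σ := waveSign ω with hσ
  have hσ1 : σ = 1 ∧ 0 < ω ∨ σ = -1 ∧ ω < -4 := by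
    rcases hω with hω | hω
    · left; exact ⟨if_pos hω, hω⟩
    · right; exact ⟨if_neg (by linarith), hω⟩
  have hw : 2 < σ * (ω + 2) := by rcases hσ1 with ⟨h, h'⟩ | ⟨h, h'⟩ <;> rw [h] <;> linarith
  set w := σ * (ω + 2) with hwd
  set A := a (C ^ 2) + deriv a (C ^ 2) * C ^ 2
  set B := deriv a (C ^ 2) * C ^ 2
  intro hdet
  set η1 := chRoot (w - I * z) (sPlus w z) with hη1
  set η2 := chRoot (w + I * z) (sMinus w z) with hη2
  have q1 : η1 ^ 2 = (w - I * z) * η1 - 1 := chRoot_quad (sPlus_sq w z)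
  have q2 : η2 ^ 2 = (w + I * z) * η2 - 1 := chRoot_quad (sMinus_sq w z)
  have r1 : w - I * z - 2 * η1 = sPlus w z := by rw [hη1, chRoot]; ring
  have r2 : w + I * z - 2 * η2 = sMinus w z := by rw [hη2, chRoot]; ring
  have n1 : ‖η1‖ ≤ 1 := by
    have := norm_sPlus_sub_le w hz
    rw [hη1, chRoot, norm_div, norm_sub_rev, norm_ofNat]; linarith
  have n2 : ‖η2‖ ≤ 1 := by
    have := norm_sMinus_sub_le w hz
    rw [hη2, chRoot, norm_div, norm_sub_rev, norm_ofNat]; linarith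
  have key : ¬ (‖η1‖ < 1 ∧ ‖η2‖ < 1) ∧
      ¬ (z = I * ω ∨ z = -(I * ω) ∨ z = I * (ω + 4) ∨ z = -(I * (ω + 4))) := by
    rcases hσ1 with ⟨h1, _⟩ | ⟨h1, _⟩
    · have ew : (w : ℂ) = ω + 2 := by rw [hwd, h1]; push_cast; ring
      rw [ew] at q1 q2 r1 r2
      rw [h1, one_mul, one_mul, ← r1, ← r2] at hdet
      have k := h.roots hC q1 q2 hdet hz0
      exact ⟨k.1, fun hh => k.2 ⟨n1, n2, hh⟩⟩
    · have ew : (w : ℂ) = -(ω + 2) := by rw [hwd, h1]; push_cast; ring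
      rw [ew] at q1 q2 r1 r2
      rw [h1, ← r1, ← r2] at hdet
      have k := h.roots hC (lam := z) (η1 := -η2) (η2 := -η1) (by linear_combination q2)
        (by linear_combination q1) (by
          rw [← hdet, chDet_neg_one]; congr 1 <;> ring) hz0
      rw [norm_neg, norm_neg] at k
      exact ⟨fun hh => k.1 ⟨hh.2, hh.1⟩, fun hh => k.2 ⟨n2, n1, hh⟩⟩
  rcases (show 0 ≤ z.re from hz).lt_or_eq with hre | hre
  · refine key.1 ⟨?_, ?_⟩
    · have k := norm_jouk_sub_lt (v := w + I * conj z) (by simpa using hre)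
      rw [← norm_conj] at k
      simp only [map_sub, map_add, map_mul, conj_I, conj_ofReal, conj_conj] at k
      rw [hη1, chRoot, norm_div, norm_sub_rev, norm_ofNat, div_lt_one (by norm_num)]
      simpa [sPlus, sub_eq_add_neg] using k
    · have k := norm_jouk_sub_lt (v := w + I * z) (by simpa using hre)
      rw [hη2, chRoot, norm_div, norm_sub_rev, norm_ofNat, div_lt_one (by norm_num)]
      exact k
  · set y := z.im with hy
    have hzy : z = y * I := by apply Complex.ext <;> simp [← hre, hy]
    have a1 : (w : ℂ) - I * z = ((w + y : ℝ) : ℂ) := by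
      rw [hzy]; push_cast; linear_combination -(y : ℂ) * I_sq
    have a2 : (w : ℂ) + I * z = ((w - y : ℝ) : ℂ) := by
      rw [hzy]; push_cast; linear_combination (y : ℂ) * I_sq
    have b1 : sPlus w z = conj (jouk (w + y : ℝ)) := by
      rw [sPlus, hzy]; congr 2
      simp only [map_mul, conj_ofReal, conj_I]; push_cast; linear_combination -(y : ℂ) * I_sq
    have b2 : sMinus w z = jouk (w - y : ℝ) := by rw [sMinus, a2]
    have hthr : |w + y| ≠ 2 ∧ |w - y| ≠ 2 := by
      have k := key.2
      have aux : ∀ r : ℝ, y = r → z = I * r := fun r hr => by rw [hzy, hr]; ring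
      constructor <;> intro habs <;> apply k
      · rcases (abs_eq (by norm_num)).1 habs with hh | hh <;> rcases hσ1 with ⟨h1, _⟩ | ⟨h1, _⟩ <;>
          rw [hwd, h1] at hh
        · right; left; rw [aux (-ω) (by linarith)]; push_cast; ring
        · right; right; left; rw [aux (ω + 4) (by linarith)]; push_cast; ring
        · right; right; right; rw [aux (-(ω + 4)) (by linarith)]; push_cast; ring
        · left; rw [aux ω (by linarith)]
      · rcases (abs_eq (by norm_num)).1 habs with hh | hh <;> rcases hσ1 with ⟨h1, _⟩ | ⟨h1, _⟩ <;>
          rw [hwd, h1] at hh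
        · left; rw [aux ω (by linarith)]
        · right; right; right; rw [aux (-(ω + 4)) (by linarith)]; push_cast; ring
        · right; right; left; rw [aux (ω + 4) (by linarith)]; push_cast; ring
        · right; left; rw [aux (-ω) (by linarith)]; push_cast; ring
    have hσB : σ * B ≠ 0 := mul_ne_zero (by
      rcases hσ1 with ⟨h1, _⟩ | ⟨h1, _⟩ <;> rw [h1] <;> norm_num) hβ
    rcases lt_or_gt_of_ne hthr.1 with g1 | g1
    · have g2 : 2 < |w - y| := by
        rw [abs_lt] at g1
        exact lt_of_lt_of_le (by linarith) (le_abs_self _)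
      have k := jouk_re_of_abs_lt g1
      refine det_ne_of_mixed hσB (s := sPlus w z) (t := sMinus w z) ?_ ?_ ?_ hdet
      · rw [b1]; simpa using k.1
      · rw [b1]; simpa using k.2
      · rw [b2]; exact conj_eq_iff_im.1 (jouk_ofReal_conj g2.le)
    · rcases lt_or_gt_of_ne hthr.2 with g2 | g2
      · have k := jouk_re_of_abs_lt g2
        rw [chDet_symm] at hdet
        refine det_ne_of_mixed hσB (s := sMinus w z) (t := sPlus w z) ?_ ?_ ?_ hdet
        · rw [b2]; exact k.1
        · rw [b2]; exact k.2
        · rw [b1, jouk_ofReal_conj g1.le]; exact conj_eq_iff_im.1 (jouk_ofReal_conj g1.le)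
      · refine key.1 ⟨?_, ?_⟩
        · rw [hη1, a1, b1, jouk_ofReal_conj g1.le]; exact norm_chRoot_jouk_lt g1
        · rw [hη2, a2, b2]; exact norm_chRoot_jouk_lt g2

/-! ### Persistence of the nonvanishing of the determinant -/

lemma continuousAt_sMinus_param (W B : ℝ) {z : ℂ} (hz : z ∈ rightHalf) :
    ContinuousAt (fun q : (ℝ × ℝ) × ℂ => sMinus q.1.1 q.2) ((W, B), z) :=
  ContinuousAt.comp (f := fun q : (ℝ × ℝ) × ℂ => (q.1.1 : ℂ) + I * q.2) (g := jouk)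
    (continuousAt_jouk (by simpa [rightHalf] using hz)) (by fun_prop)

lemma continuousAt_sPlus_param (W B : ℝ) {z : ℂ} (hz : z ∈ rightHalf) :
    ContinuousAt (fun q : (ℝ × ℝ) × ℂ => sPlus q.1.1 q.2) ((W, B), z) := by
  have h1 : ContinuousAt (fun q : (ℝ × ℝ) × ℂ => jouk (q.1.1 + I * conj q.2)) ((W, B), z) :=
    ContinuousAt.comp (f := fun q : (ℝ × ℝ) × ℂ => (q.1.1 : ℂ) + I * conj q.2) (g := jouk)
      (continuousAt_jouk (by simpa [rightHalf] using hz))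
      (by have := continuous_conj; fun_prop)
  exact continuous_conj.continuousAt.comp h1

lemma eventually_chDet_ne_zero {W0 B0 : ℝ} (hW : 2 < W0) (hE : detLead W0 B0 ≠ 0)
    (hD : ∀ z ∈ rightHalf, z ≠ 0 →
      chDet (√(W0 ^ 2 - 4) + B0) B0 (sPlus W0 z) (sMinus W0 z) ≠ 0) :
    ∀ᶠ p : ℝ × ℝ in 𝓝 (W0, B0), 2 < p.1 ∧ detLead p.1 p.2 ≠ 0 ∧ ∀ z ∈ rightHalf, z ≠ 0 →
      chDet (√(p.1 ^ 2 - 4) + p.2) p.2 (sPlus p.1 z) (sMinus p.1 z) ≠ 0 := by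
  have e1 : ∀ᶠ p : ℝ × ℝ in 𝓝 (W0, B0), 2 < p.1 :=
    continuousAt_fst.eventually (lt_mem_nhds hW)
  have hs0 : √(W0 ^ 2 - 4) ≠ 0 := (Channels.s0_pos hW).ne'
  have hs1 : W0 ^ 2 - 4 ≠ 0 := by nlinarith
  have e2 : ∀ᶠ p : ℝ × ℝ in 𝓝 (W0, B0), detLead p.1 p.2 ≠ 0 := by
    have : ContinuousAt (fun p : ℝ × ℝ => detLead p.1 p.2) (W0, B0) := by
      unfold detLead
      fun_prop (disch := assumption)
    exact this.eventually_ne hE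
  set R : ℝ := W0 + 1 + 2 + (|√(W0 ^ 2 - 4) + B0| + 1) + (|B0| + 1) with hR
  set K : Set ℂ := rightHalf ∩ Metric.closedBall 0 R with hK
  have hKc : IsCompact K := (isCompact_closedBall _ _).inter_left
    (isClosed_le continuous_const continuous_re)
  have e3 : ∀ᶠ p : ℝ × ℝ in 𝓝 (W0, B0), ∀ z ∈ K, z ≠ 0 →
      chDet (√(p.1 ^ 2 - 4) + p.2) p.2 (sPlus p.1 z) (sMinus p.1 z) ≠ 0 := by
    refine hKc.eventually_forall_of_forall_eventually fun z hz => ?_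
    have c1 := continuousAt_sPlus_param W0 B0 hz.1
    have c2 := continuousAt_sMinus_param W0 B0 hz.1
    rcases eq_or_ne z 0 with rfl | hz0
    · have hch := channels_right hW
      have k1 : ∀ᶠ q : (ℝ × ℝ) × ℂ in 𝓝 ((W0, B0), 0), sPlus q.1.1 q.2 + sMinus q.1.1 q.2 ≠ 0 :=
        (c1.add c2).eventually_ne hch.add_zero_ne
      have k2 : ∀ᶠ q : (ℝ × ℝ) × ℂ in 𝓝 ((W0, B0), 0),
          chN q.1.1 q.1.2 (sPlus q.1.1) (sMinus q.1.1) q.2 ≠ 0 := by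
        have : ContinuousAt (fun q : (ℝ × ℝ) × ℂ => chN q.1.1 q.1.2 (sPlus q.1.1) (sMinus q.1.1) q.2)
            ((W0, B0), 0) := by
          have k := ContinuousAt.inv₀ (c1.add c2) hch.add_zero_ne
          have k' : ContinuousAt (fun q : (ℝ × ℝ) × ℂ => (sPlus q.1.1 q.2 + sMinus q.1.1 q.2)⁻¹)
            ((W0, B0), 0) := k
          unfold chN
          fun_prop
        exact this.eventually_ne (hch.N_zero_ne hE)
      have k3 : ∀ᶠ q : (ℝ × ℝ) × ℂ in 𝓝 ((W0, B0), 0), 2 < q.1.1 :=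
        (continuousAt_fst.comp continuousAt_fst).eventually (lt_mem_nhds hW)
      filter_upwards [k1, k2, k3] with q h1 h2 h3 hq0 h0
      have := (channels_right h3).det_identity q.1.2 h1
      rw [h0, zero_mul] at this
      exact mul_ne_zero (pow_ne_zero 2 hq0) h2 this.symm
    · have : ContinuousAt (fun q : (ℝ × ℝ) × ℂ => chDet (√(q.1.1 ^ 2 - 4) + q.1.2) q.1.2
          (sPlus q.1.1 q.2) (sMinus q.1.1 q.2)) ((W0, B0), z) := by
        unfold chDet
        fun_prop
      filter_upwards [this.eventually_ne (hD z hz.1 hz0)] with q hq _ using hq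
  have e4 : ∀ᶠ p : ℝ × ℝ in 𝓝 (W0, B0), p.1 < W0 + 1 :=
    continuousAt_fst.eventually (gt_mem_nhds (by simp))
  have e5 : ∀ᶠ p : ℝ × ℝ in 𝓝 (W0, B0), |√(p.1 ^ 2 - 4) + p.2| <
      |√(W0 ^ 2 - 4) + B0| + 1 := by
    have : ContinuousAt (fun p : ℝ × ℝ => |√(p.1 ^ 2 - 4) + p.2|) (W0, B0) := by fun_prop
    exact this.eventually (gt_mem_nhds (by simp))
  have e6 : ∀ᶠ p : ℝ × ℝ in 𝓝 (W0, B0), |p.2| < |B0| + 1 := by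
    have : ContinuousAt (fun p : ℝ × ℝ => |p.2|) (W0, B0) := by fun_prop
    exact this.eventually (gt_mem_nhds (by simp))
  filter_upwards [e1, e2, e3, e4, e5, e6] with p h1 h2 h3 h4 h5 h6
  refine ⟨h1, h2, fun z hz hz0 => ?_⟩
  by_cases hzK : ‖z‖ ≤ R
  · exact h3 z ⟨hz, by simpa using hzK⟩ hz0
  push Not at hzK
  have aux : ∀ s v : ℂ, ‖s - v‖ ≤ 2 → ‖z‖ ≤ ‖v - p.1‖ →
      |p.2| < ‖s - ((√(p.1 ^ 2 - 4) + p.2 : ℝ) : ℂ)‖ := by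
    intro s v hs hv
    have k : v - p.1 = (s - ((√(p.1 ^ 2 - 4) + p.2 : ℝ) : ℂ)) - (s - v) +
      (((√(p.1 ^ 2 - 4) + p.2 : ℝ) : ℂ) - p.1) := by ring
    have k1 := norm_add_le ((s - ((√(p.1 ^ 2 - 4) + p.2 : ℝ) : ℂ)) - (s - v))
      (((√(p.1 ^ 2 - 4) + p.2 : ℝ) : ℂ) - p.1)
    rw [← k] at k1
    have k2 := norm_sub_le (s - ((√(p.1 ^ 2 - 4) + p.2 : ℝ) : ℂ)) (s - v)
    have k3 := norm_sub_le ((√(p.1 ^ 2 - 4) + p.2 : ℝ) : ℂ) (p.1 : ℂ)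
    rw [norm_real, norm_real, norm_eq_abs, norm_eq_abs,
      abs_of_pos (by linarith : 0 < p.1)] at k3
    linarith
  have m1 := aux (sPlus p.1 z) _ (norm_sPlus_sub_le p.1 hz) (by simp)
  have m2 := aux (sMinus p.1 z) _ (norm_sMinus_sub_le p.1 hz) (by simp)
  intro h0
  unfold chDet at h0
  have h7 := congrArg norm (sub_eq_zero.1 h0)
  rw [norm_mul, norm_pow, norm_real, norm_eq_abs] at h7
  nlinarith [abs_nonneg p.2]

lemma bandDet_ne_zero_of_det {w A B : ℝ} (hw : 2 < w)
    (hD : ∀ z ∈ rightHalf, z ≠ 0 → chDet A B (sPlus w z) (sMinus w z) ≠ 0) (θ : ℝ) :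
    bandDet w A B θ ≠ 0 := by
  have key : ∀ θ, 0 ≤ sin θ → bandDet w A B θ ≠ 0 := by
    intro θ h0
    set y : ℝ := 2 * cos θ - w with hy
    have hy0 : y ≠ 0 := by rw [hy]; linarith [Real.cos_le_one θ]
    have k := hD (y * I) (by simp [rightHalf]) (by simp [hy0])
    have b1 : sPlus w (y * I) = -(2 * I * (sin θ : ℂ)) := by
      rw [sPlus,
        show w + I * conj (y * I) = ((2 * cos θ : ℝ) : ℂ) by
          rw [hy]; simp only [map_mul, conj_ofReal, conj_I]; push_cast
          linear_combination -(2 * Complex.cos θ - w) * I_sq, jouk_two_cos h0]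
      simp only [map_mul, conj_I, conj_ofReal, map_ofNat]; ring
    have b2 : sMinus w (y * I) = evS w θ := by
      rw [sMinus, show w + I * (y * I) = ((evW w θ : ℝ) : ℂ) by
        rw [hy, evW]; push_cast; linear_combination (2 * Complex.cos θ - w) * I_sq, jouk_evW hw]
    rw [b1, b2] at k
    intro hh
    apply k
    rw [← hh, chDet, bandDet]; ring
  rcases le_total 0 (sin θ) with h0 | h0
  · exact key θ h0
  · have k := key (-θ) (by rw [Real.sin_neg]; linarith)
    intro hh
    apply k
    have := congrArg conj hh
    rw [map_zero] at this
    rw [← this]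
    simp only [bandDet, map_sub, map_mul, map_neg, map_pow, conj_I, conj_ofReal, map_ofNat,
      Real.sin_neg, evS_neg, ofReal_neg]
    ring

/-- All hypotheses of the kernel estimates hold uniformly near a nonresonant wave. -/
theorem exists_uniform_par {W0 B0 : ℝ} (hW : 2 < W0) (hE : detLead W0 B0 ≠ 0)
    (hD : ∀ z ∈ rightHalf, z ≠ 0 →
      chDet (√(W0 ^ 2 - 4) + B0) B0 (sPlus W0 z) (sMinus W0 z) ≠ 0) :
    ∃ δ Λ r : ℝ, 0 < δ ∧ 0 < r ∧ ∀ W B : ℝ, |W - W0| ≤ r → |B - B0| ≤ r →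
      Par δ Λ W (√(W ^ 2 - 4) + B) B ∧ detLead W B ≠ 0 ∧ ∀ z ∈ rightHalf, z ≠ 0 →
      chDet (√(W ^ 2 - 4) + B) B (sPlus W z) (sMinus W z) ≠ 0 := by
  obtain ⟨r, hr, hball⟩ := Metric.nhds_basis_closedBall.eventually_iff.1
    (eventually_chDet_ne_zero hW hE hD)
  set S : Set ((ℝ × ℝ) × ℝ) := Metric.closedBall (W0, B0) r ×ˢ Icc (-π) π with hS
  have hSc : IsCompact S := (isCompact_closedBall _ _).prod isCompact_Icc
  have hSne : S.Nonempty := ⟨((W0, B0), 0), by simp [hr.le], by simp [Real.pi_pos.le]⟩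
  have hc : Continuous fun q : (ℝ × ℝ) × ℝ =>
      bandDet q.1.1 (√(q.1.1 ^ 2 - 4) + q.1.2) q.1.2 q.2 := by
    unfold bandDet evS evW; fun_prop
  obtain ⟨q0, hq0, hmin⟩ := hSc.exists_isMinOn hSne hc.norm.continuousOn
  obtain ⟨q1, hq1, hmax⟩ := hSc.exists_isMaxOn hSne (f := fun q : (ℝ × ℝ) × ℝ =>
    |√(q.1.1 ^ 2 - 4) + q.1.2|) (by fun_prop)
  have hmem : ∀ W B : ℝ, |W - W0| ≤ r → |B - B0| ≤ r → (W, B) ∈ Metric.closedBall (W0, B0) r := by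
    intro W B h1 h2
    rw [Metric.mem_closedBall, Prod.dist_eq, Real.dist_eq, Real.dist_eq]
    exact max_le h1 h2
  have hmax' : ∀ p ∈ Metric.closedBall (W0, B0) r, |√(p.1 ^ 2 - 4) + p.2| ≤
      |√(q1.1.1 ^ 2 - 4) + q1.1.2| := fun p hp =>
    isMaxOn_iff.1 hmax (p, 0) ⟨hp, by simp [Real.pi_pos.le]⟩
  have hmin' : ∀ p : ℝ × ℝ, ∀ y : ℝ, p ∈ Metric.closedBall (W0, B0) r → y ∈ Icc (-π) π →
      ‖bandDet q0.1.1 (√(q0.1.1 ^ 2 - 4) + q0.1.2) q0.1.2 q0.2‖ ≤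
      ‖bandDet p.1 (√(p.1 ^ 2 - 4) + p.2) p.2 y‖ := fun p y hp hy =>
    isMinOn_iff.1 hmin (p, y) ⟨hp, hy⟩
  have hWr : 2 < W0 - r := (hball (hmem (W0 - r) B0 (by simp [abs_of_pos hr]) (by simp [hr.le]))).1
  have hpos : 0 < ‖bandDet q0.1.1 (√(q0.1.1 ^ 2 - 4) + q0.1.2) q0.1.2 q0.2‖ := by
    have := hball hq0.1
    exact norm_pos_iff.2 (bandDet_ne_zero_of_det this.1 this.2.2 _)
  refine ⟨min ‖bandDet q0.1.1 (√(q0.1.1 ^ 2 - 4) + q0.1.2) q0.1.2 q0.2‖ (W0 - r - 2),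
    max (W0 + r) (max (|B0| + r) |√(q1.1.1 ^ 2 - 4) + q1.1.2|), r,
    lt_min hpos (by linarith), hr, fun W B h1 h2 => ?_⟩
  have hm := hmem W B h1 h2
  have hb := hball hm
  refine ⟨⟨lt_min hpos (by linarith), ?_, ?_, ?_, ?_, fun θ => ?_⟩, hb.2.1, hb.2.2⟩
  · have := min_le_right ‖bandDet q0.1.1 (√(q0.1.1 ^ 2 - 4) + q0.1.2) q0.1.2 q0.2‖ (W0 - r - 2)
    linarith [(abs_le.1 h1).1]
  · exact le_trans (by linarith [(abs_le.1 h1).2]) (le_max_left _ _)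
  · refine le_trans ?_ ((le_max_right _ _).trans (le_max_right _ _))
    exact hmax' (W, B) hm
  · refine le_trans ?_ ((le_max_left _ _).trans (le_max_right _ _))
    have := abs_add_le (B - B0) B0
    rw [sub_add_cancel] at this
    linarith
  · have hper : Function.Periodic (fun θ => bandDet W (√(W ^ 2 - 4) + B) B θ)
        (2 * π) := fun θ => by
      simp [bandDet, evS, evW]
    obtain ⟨y, hy, hyθ⟩ := hper.exists_mem_Ico (by linarith [pi_pos]) θ (-π)
    have hyθ' : bandDet W (√(W ^ 2 - 4) + B) B θ =
      bandDet W (√(W ^ 2 - 4) + B) B y := hyθ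
    rw [hyθ']
    refine (min_le_left _ _).trans ?_
    exact hmin' (W, B) y hm ⟨hy.1, by linarith [hy.2]⟩

/-! ### The kernel for frequencies of either sign -/

/-- `a(C²)` along the family of solitary waves. -/
def coup (σ ω : ℝ) : ℝ := σ * √((ω + 2) ^ 2 - 4)

/-- The ratio `ψ_ω(x+1) / ψ_ω(x)`, `x ≥ 0`. -/
def ratio (σ ω : ℝ) : ℝ := σ * root0 (σ * (ω + 2))

lemma sign_sq_mul {σ : ℝ} (hσ : σ = 1 ∨ σ = -1) (ω : ℝ) : (σ * (ω + 2)) ^ 2 = (ω + 2) ^ 2 := by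
  rcases hσ with h | h <;> rw [h] <;> ring

lemma sign_mul_self {σ : ℝ} (hσ : σ = 1 ∨ σ = -1) : σ * σ = 1 := by
  rcases hσ with h | h <;> rw [h] <;> ring

lemma waveSign_cases (ω : ℝ) : waveSign ω = 1 ∨ waveSign ω = -1 := by
  unfold waveSign; split_ifs <;> simp

/-- The sign `(±1)^{|x|}` -/
def alt (σ : ℝ) (x : ℤ) : ℂ := (σ : ℂ) ^ x.natAbs

lemma alt_mul_self {σ : ℝ} (hσ : σ = 1 ∨ σ = -1) (x : ℤ) : alt σ x * alt σ x = 1 := by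
  unfold alt
  rw [← mul_pow, ← ofReal_mul, sign_mul_self hσ]; simp

lemma conj_alt (σ : ℝ) (x : ℤ) : conj (alt σ x) = alt σ x := by
  simp [alt]

lemma norm_alt {σ : ℝ} (hσ : σ = 1 ∨ σ = -1) (x : ℤ) : ‖alt σ x‖ = 1 := by
  rcases hσ with h | h <;> simp [alt, h]

lemma alt_neg_one_step (x : ℤ) : alt (-1) (x + 1) = -alt (-1) x ∧ alt (-1) (x - 1) = -alt (-1) x := by
  have key : ∀ y : ℤ, alt (-1) (y + 1) = -alt (-1) y := by
    intro y
    unfold alt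
    rcases le_or_gt 0 y with h | h
    · rw [show (y + 1).natAbs = y.natAbs + 1 by omega, pow_succ]; simp
    · rw [show y.natAbs = (y + 1).natAbs + 1 by omega, pow_succ]; simp
  refine ⟨key x, ?_⟩
  have := key (x - 1)
  rw [sub_add_cancel] at this
  rw [this, neg_neg]

/-- Kernels of the linearized equation, with dispersive decay and prescribed initial values modulo
the generalized kernel. -/
structure IsKernel (K w α b q : ℝ) (c : ℂ) (z : ℤ) (U : ℤ → ℝ → ℂ) : Prop where
  deriv : ∀ x t, HasDerivAt (U x) (-I * (w * U x t - U (x + 1) t - U (x - 1) t) +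
    I * delta x * (α * U 0 t + b * conj (U 0 t))) t
  decay : ∀ x t, ‖U x t‖ ≤
    K * (1 + |(x : ℝ)|) ^ 2 * (1 + |(z : ℝ)|) ^ 2 * (1 + |t|) ^ (-(3 / 2) : ℝ)
  bdd : ∃ B, ∀ x t, ‖U x t‖ ≤ B
  init : ∃ μ κ : ℝ, ∀ x : ℤ, U x 0 = (if x = z then c else 0) -
    ((μ * (w - 2 * b * x.natAbs) : ℝ) + I * (κ : ℝ)) * (q : ℂ) ^ x.natAbs

lemma exists_isKernel_pos {δ Λ K W B : ℝ} (h : Par δ Λ W (√(W ^ 2 - 4) + B) B)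
    (hK : ∀ c : ℂ, ‖c‖ = 1 → ∀ z x : ℤ, ∀ t : ℝ,
      ‖bandKernel W (√(W ^ 2 - 4) + B) B c z x t‖ ≤
      K * (1 + |(x : ℝ)|) ^ 2 * (1 + |(z : ℝ)|) ^ 2 * (1 + |t|) ^ (-(3 / 2) : ℝ))
    (hE : detLead W B ≠ 0)
    (hD : ∀ z ∈ rightHalf, z ≠ 0 →
      chDet (√(W ^ 2 - 4) + B) B (sPlus W z) (sMinus W z) ≠ 0) {c : ℂ} (hc : ‖c‖ = 1)
    (z : ℤ) :
    ∃ U, IsKernel K W (√(W ^ 2 - 4) + B) B (root0 W) c z U := by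
  refine ⟨fun x t => bandKernel W (√(W ^ 2 - 4) + B) B c z x t, ?_, hK c hc z,
    h.bandKernel_bounded hc z, ?_⟩
  · intro x t
    exact h.hasDerivAt_bandKernel hc z x t
  · refine ⟨root0 W ^ z.natAbs / (√(W ^ 2 - 4) * detLead W B) * c.re,
      root0 W ^ z.natAbs / (√(W ^ 2 - 4) * detLead W B) * (c.im * (W - 2 * B * z.natAbs)),
      fun x => ?_⟩
    rw [h.bandKernel_zero hE hD hc z x, pow_add]
    congr 1
    have hc2 : c = c.re + c.im * I := (re_add_im c).symm
    set r := c.re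
    set m := c.im
    rw [hc2]
    push_cast
    ring

lemma exists_isKernel_neg {K W A B q : ℝ} {c : ℂ} {z : ℤ} {U : ℤ → ℝ → ℂ}
    (h : IsKernel K W A B q (alt (-1) z * conj c) z U) :
    IsKernel K (-W) (-A) (-B) (-q) c z (fun x t => alt (-1) x * conj (U x t)) := by
  have ha : (-1 : ℝ) = 1 ∨ (-1 : ℝ) = -1 := Or.inr rfl
  refine ⟨fun x t => ?_, fun x t => ?_, ?_, ?_⟩
  · have hd := ((h.deriv x t).star).const_mul (alt (-1) x)
    simp only [star_def] at hd
    refine HasDerivAt.congr_deriv hd ?_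
    have k := alt_neg_one_step x
    rw [k.1, k.2]
    have h0 : alt (-1) 0 = 1 := by simp [alt]
    simp only [map_add, map_mul, map_neg, map_sub, conj_I, conj_ofReal, conj_conj, conj_alt]
    rcases eq_or_ne x 0 with rfl | hx
    · rw [h0, delta_zero]; simp only [map_one]; push_cast; ring
    · rw [delta_of_ne hx]; simp only [map_zero]; push_cast; ring
  · rw [norm_mul, norm_alt ha, one_mul, norm_conj]; exact h.decay x t
  · obtain ⟨B, hB⟩ := h.bdd
    exact ⟨B, fun x t => by rw [norm_mul, norm_alt ha, one_mul, norm_conj]; exact hB x t⟩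
  · obtain ⟨μ, κ, hi⟩ := h.init
    refine ⟨-μ, -κ, fun x => ?_⟩
    rw [hi x, map_sub]
    have e1 : alt (-1) x * conj (if x = z then alt (-1) z * conj c else 0) =
        if x = z then c else 0 := by
      split_ifs with hx
      · subst hx
        rw [map_mul, conj_alt, conj_conj, ← mul_assoc, alt_mul_self ha, one_mul]
      · simp
    have e2 : ((-q : ℝ) : ℂ) ^ x.natAbs = alt (-1) x * (q : ℂ) ^ x.natAbs := by
      rw [alt, ← mul_pow]; congr 1; push_cast; ring
    rw [mul_sub, e1, e2]
    simp only [map_add, map_mul, map_pow, conj_I, conj_ofReal]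
    push_cast; ring

lemma sinh_decayRate {ω : ℝ} (hw : 2 < |ω + 2|) :
    Real.sinh (decayRate ω) = √((ω + 2) ^ 2 - 4) / 2 := by
  rw [decayRate, Real.sinh_arcosh (by linarith)]
  rw [eq_div_iff two_ne_zero, ← Real.sqrt_sq (show (0 : ℝ) ≤ 2 by norm_num), ← Real.sqrt_mul (by nlinarith)]
  congr 1
  rw [div_pow, sq_abs]; ring

lemma IsSolitaryWave.coup_eq {a : ℝ → ℝ} {ω C : ℝ} (h : IsSolitaryWave a ω C) :
    a (C ^ 2) = coup (waveSign ω) ω ∧ (0 < ω ∨ ω < -4) ∧ 2 < waveSign ω * (ω + 2) := by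
  rcases h.2 with ⟨h1, h2⟩ | ⟨h1, h2⟩
  · have hs : waveSign ω = 1 := if_pos h1
    rw [sinh_decayRate (by rw [abs_of_pos (by linarith)]; linarith)] at h2
    rw [hs, coup]
    exact ⟨by linarith, Or.inl h1, by linarith⟩
  · have hs : waveSign ω = -1 := if_neg (by linarith)
    rw [sinh_decayRate (by rw [abs_of_neg (by linarith)]; linarith)] at h2
    rw [hs, coup]
    exact ⟨by linarith, Or.inr h1, by linarith⟩

/-- Kernels exist, with uniform decay, for all frequencies near that of a wave satisfying the
spectral condition. -/
theorem SpectralCondition.exists_kernel {a : ℝ → ℝ} {ω₀ C₀ : ℝ} (hwave : IsSolitaryWave a ω₀ C₀)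
    (hSP : SpectralCondition a ω₀ C₀) :
    ∃ K r : ℝ, 0 ≤ K ∧ 0 < r ∧ ∀ ω b : ℝ, |ω - ω₀| ≤ r → |b - deriv a (C₀ ^ 2) * C₀ ^ 2| ≤ r →
      ∀ c : ℂ, ‖c‖ = 1 → ∀ z : ℤ, ∃ U, IsKernel K (ω + 2) (coup (waveSign ω₀) ω + b) b
        (ratio (waveSign ω₀) ω) c z U := by
  obtain ⟨hcoup, hω, hW⟩ := hwave.coup_eq
  have hC := hwave.1.ne'
  have hσ := waveSign_cases ω₀
  set σ := waveSign ω₀ with hσd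
  set b₀ := deriv a (C₀ ^ 2) * C₀ ^ 2 with hb0
  have hσσ := sign_mul_self hσ
  have hs0 := Channels.s0_pos hW
  have hss : ∀ ω, √((σ * (ω + 2)) ^ 2 - 4) = σ * coup σ ω := by
    intro ω; rw [sign_sq_mul hσ, coup, ← mul_assoc, hσσ, one_mul]
  have hE : detLead (σ * (ω₀ + 2)) (σ * b₀) ≠ 0 := by
    have hcne : coup σ ω₀ ≠ 0 := by
      have := hss ω₀
      intro h0; rw [h0, mul_zero] at this; linarith
    have hsq : (coup σ ω₀) ^ 2 = (ω₀ + 2) ^ 2 - 4 := by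
      rw [coup, mul_pow, sq_sqrt (by rw [← sign_sq_mul hσ]; nlinarith), pow_two σ, hσσ, one_mul]
    unfold detLead
    rw [hss]
    have hne : (σ * (ω₀ + 2)) ^ 2 - 4 ≠ 0 := by nlinarith
    refine div_ne_zero ?_ hne
    have hσ0 : σ ≠ 0 := left_ne_zero_of_mul (by rw [hσσ]; exact one_ne_zero)
    have e1 : 4 * (σ * b₀) / (σ * coup σ ω₀) = 4 * b₀ / coup σ ω₀ := by field_simp
    rw [e1, sign_sq_mul hσ]
    intro h0
    apply hSP.2.1
    rw [hcoup]
    rw [sub_eq_zero, eq_div_iff hcne] at h0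
    rw [eq_div_iff (by positivity)]
    rw [hb0] at h0
    linear_combination -h0 - coup σ ω₀ * hsq
  have hD : ∀ z ∈ rightHalf, z ≠ 0 → chDet (√((σ * (ω₀ + 2)) ^ 2 - 4) + σ * b₀) (σ * b₀)
      (sPlus (σ * (ω₀ + 2)) z) (sMinus (σ * (ω₀ + 2)) z) ≠ 0 := by
    intro z hz hz0
    have := hSP.chDet_ne_zero hC hω hz hz0
    rw [hss, ← mul_add, ← hcoup]
    exact this
  obtain ⟨δ, Λ, r, hδ, hr, hP⟩ := exists_uniform_par hW hE hD
  obtain ⟨K, hK, hdec⟩ := bandKernel_decay δ Λ hδ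
  refine ⟨K, r, hK, hr, fun ω b hω' hb' c hc z => ?_⟩
  have habs : |σ| = 1 := by rcases hσ with h | h <;> rw [h] <;> simp
  obtain ⟨p1, p2, p3⟩ := hP (σ * (ω + 2)) (σ * b)
    (by rw [← mul_sub, abs_mul, habs, one_mul]; rwa [show ω + 2 - (ω₀ + 2) = ω - ω₀ by ring])
    (by rw [← mul_sub, abs_mul, habs, one_mul]; exact hb')
  have hk := fun (c : ℂ) (hc : ‖c‖ = 1) =>
    exists_isKernel_pos p1 (fun c hc => hdec _ _ _ p1 c hc) p2 p3 hc z
  rw [hss, ← mul_add] at hk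
  rcases hσ with h | h
  · obtain ⟨U, hU⟩ := hk c hc
    refine ⟨U, ?_⟩
    rw [ratio, h]
    simpa [h] using hU
  · obtain ⟨U, hU⟩ := hk (alt (-1) z * conj c) (by
      rw [norm_mul, norm_alt (Or.inr rfl), norm_conj, hc, one_mul])
    refine ⟨fun x t => alt (-1) x * conj (U x t), ?_⟩
    have := exists_isKernel_neg hU
    rw [ratio]
    simp only [h, neg_one_mul, neg_neg] at this ⊢
    exact this

/-! ### The branch of solitary waves -/

/-- `ψ_ω`. -/
def phi (σ : ℝ) (C : ℝ → ℝ) (ω : ℝ) (x : ℤ) : ℝ := C ω * ratio σ ω ^ x.natAbs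

/-- `∂_ω ψ_ω`. -/
def phi1 (σ : ℝ) (C : ℝ → ℝ) (ω : ℝ) (x : ℤ) : ℝ :=
  (deriv C ω - C ω / coup σ ω * x.natAbs) * ratio σ ω ^ x.natAbs

/-- `∂²_ω ψ_ω`. -/
def phi2 (σ : ℝ) (C : ℝ → ℝ) (ω : ℝ) (x : ℤ) : ℝ :=
  (deriv (deriv C) ω + (C ω * (ω + 2) / coup σ ω ^ 3 - 2 * deriv C ω / coup σ ω) * x.natAbs +
    C ω / coup σ ω ^ 2 * (x.natAbs : ℝ) ^ 2) * ratio σ ω ^ x.natAbs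

/-- The quadratic weight. -/
def wt (x : ℤ) : ℝ := (1 + |(x : ℝ)|) ^ 2

lemma one_le_wt (x : ℤ) : 1 ≤ wt x := by
  unfold wt; nlinarith [abs_nonneg (x : ℝ)]

lemma wt_pos (x : ℤ) : 0 < wt x := lt_of_lt_of_le one_pos (one_le_wt x)

/-- A `C²` branch of solitary waves, with exponential bounds. -/
structure Branch (a : ℝ → ℝ) (σ ω₀ r : ℝ) (C : ℝ → ℝ) (h : ℤ → ℝ) : Prop where
  sign : σ = 1 ∨ σ = -1
  hr : 0 < r
  two_lt : ∀ ω, |ω - ω₀| < r → 2 < σ * (ω + 2)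
  pos : ∀ ω, |ω - ω₀| < r → 0 < C ω
  smooth : ∀ ω, |ω - ω₀| < r → ContDiffAt ℝ 2 C ω
  amp : ∀ ω, |ω - ω₀| < r → a (C ω ^ 2) = coup σ ω
  smooth_a : ∀ ω, |ω - ω₀| < r → ContDiffAt ℝ 2 a (C ω ^ 2)
  maj : ∀ ω, |ω - ω₀| < r → ∀ x, |phi σ C ω x| ≤ h x ∧ |phi1 σ C ω x| ≤ h x ∧ |phi2 σ C ω x| ≤ h x
  summable : Summable fun x => wt x * h x

lemma coup_sq {σ ω : ℝ} (hσ : σ = 1 ∨ σ = -1) (h : 2 < σ * (ω + 2)) :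
    coup σ ω ^ 2 = (ω + 2) ^ 2 - 4 := by
  rw [coup, mul_pow, sq_sqrt (by rw [← sign_sq_mul hσ]; nlinarith), pow_two σ,
    sign_mul_self hσ, one_mul]

lemma coup_ne_zero {σ ω : ℝ} (hσ : σ = 1 ∨ σ = -1) (h : 2 < σ * (ω + 2)) : coup σ ω ≠ 0 := by
  intro h0
  have := coup_sq hσ h
  rw [h0, ← sign_sq_mul hσ] at this
  nlinarith

lemma two_mul_ratio {σ ω : ℝ} (hσ : σ = 1 ∨ σ = -1) : 2 * ratio σ ω = ω + 2 - coup σ ω := by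
  rw [ratio, root0, coup, sign_sq_mul hσ]
  linear_combination (ω + 2) * sign_mul_self hσ

lemma ratio_quad {σ ω : ℝ} (hσ : σ = 1 ∨ σ = -1) (h : 2 < σ * (ω + 2)) :
    ratio σ ω ^ 2 = (ω + 2) * ratio σ ω - 1 := by
  have h1 := two_mul_ratio (ω := ω) hσ
  have h2 := coup_sq hσ h
  linear_combination ((ratio σ ω - (ω + 2) / 2 - coup σ ω / 2) / 2) * h1 + (1 / 4 : ℝ) * h2

lemma root0_pos {W : ℝ} (h : 2 < W) : 0 < root0 W := by
  have : √(W ^ 2 - 4) < W := by rw [Real.sqrt_lt' (by linarith)]; linarith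
  unfold root0; linarith

lemma root0_lt_one {W : ℝ} (h : 2 < W) : root0 W < 1 := by
  have : W - 2 < √(W ^ 2 - 4) := by
    rw [Real.lt_sqrt (by linarith)]; nlinarith
  unfold root0; linarith

lemma abs_ratio {σ ω : ℝ} (hσ : σ = 1 ∨ σ = -1) (h : 2 < σ * (ω + 2)) :
    0 < |ratio σ ω| ∧ |ratio σ ω| < 1 := by
  have h1 := root0_pos h
  have h2 := root0_lt_one h
  have : |ratio σ ω| = root0 (σ * (ω + 2)) := by
    rw [ratio, abs_mul, abs_of_pos h1]
    rcases hσ with h | h <;> rw [h] <;> simp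
  rw [this]; exact ⟨h1, h2⟩

lemma hasDerivAt_coup {σ ω : ℝ} (hσ : σ = 1 ∨ σ = -1) (h : 2 < σ * (ω + 2)) :
    HasDerivAt (coup σ) ((ω + 2) / coup σ ω) ω := by
  have hne : (ω + 2) ^ 2 - 4 ≠ 0 := by rw [← sign_sq_mul hσ]; nlinarith
  have h0 : HasDerivAt (fun ω : ℝ => (ω + 2) ^ 2 - 4) (2 * (ω + 2)) ω :=
    ((((hasDerivAt_id ω).add_const 2).pow 2).sub_const 4).congr_deriv (by simp)
  refine HasDerivAt.congr_deriv ((h0.sqrt hne).const_mul σ) ?_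
  have hs : σ * (ω + 2) ≠ 0 := by linarith
  have hs0 : σ ≠ 0 := left_ne_zero_of_mul hs
  have hsq : √((ω + 2) ^ 2 - 4) ≠ 0 := fun h0 => coup_ne_zero hσ h (by rw [coup, h0, mul_zero])
  unfold coup
  have := sign_mul_self hσ
  field_simp
  linear_combination (ω + 2) * this

lemma hasDerivAt_ratio {σ ω : ℝ} (hσ : σ = 1 ∨ σ = -1) (h : 2 < σ * (ω + 2)) :
    HasDerivAt (ratio σ) (-ratio σ ω / coup σ ω) ω := by
  have e : ratio σ = fun ω => (ω + 2 - coup σ ω) / 2 := by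
    funext ω; linarith [two_mul_ratio (ω := ω) hσ]
  rw [e]
  refine ((((hasDerivAt_id ω).add_const 2).sub (hasDerivAt_coup hσ h)).div_const 2).congr_deriv ?_
  have := coup_ne_zero hσ h
  field_simp; ring

lemma hasDerivAt_ratio_pow {σ ω : ℝ} (hσ : σ = 1 ∨ σ = -1) (h : 2 < σ * (ω + 2)) (n : ℕ) :
    HasDerivAt (fun ω => ratio σ ω ^ n) (-(n / coup σ ω) * ratio σ ω ^ n) ω := by
  refine ((hasDerivAt_ratio hσ h).pow n).congr_deriv ?_
  rcases n with _ | n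
  · simp
  · simp only [Nat.add_sub_cancel, pow_succ]; push_cast; ring

namespace Branch

variable {a : ℝ → ℝ} {σ ω₀ r : ℝ} {C : ℝ → ℝ} {h : ℤ → ℝ}

lemma coup_ne (hb : Branch a σ ω₀ r C h) {ω : ℝ} (hω : |ω - ω₀| < r) : coup σ ω ≠ 0 :=
  coup_ne_zero hb.sign (hb.two_lt ω hω)

lemma hasDerivAt_C (hb : Branch a σ ω₀ r C h) {ω : ℝ} (hω : |ω - ω₀| < r) :
    HasDerivAt C (deriv C ω) ω :=
  ((hb.smooth ω hω).differentiableAt (by norm_num)).hasDerivAt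

lemma contDiffAt_C1 (hb : Branch a σ ω₀ r C h) {ω : ℝ} (hω : |ω - ω₀| < r) :
    ContDiffAt ℝ 1 (deriv C) ω :=
  ContDiffAt.derivWithin (hb.smooth ω hω) (by norm_num)

lemma hasDerivAt_C1 (hb : Branch a σ ω₀ r C h) {ω : ℝ} (hω : |ω - ω₀| < r) :
    HasDerivAt (deriv C) (deriv (deriv C) ω) ω :=
  ((hb.contDiffAt_C1 hω).differentiableAt (by norm_num)).hasDerivAt

lemma continuousAt_C2 (hb : Branch a σ ω₀ r C h) {ω : ℝ} (hω : |ω - ω₀| < r) :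
    ContinuousAt (deriv (deriv C)) ω :=
  (ContDiffAt.derivWithin (m := 0) (hb.contDiffAt_C1 hω) (by norm_num)).continuousAt

lemma hasDerivAt_phi (hb : Branch a σ ω₀ r C h) {ω : ℝ} (hω : |ω - ω₀| < r) (x : ℤ) :
    HasDerivAt (fun ω => phi σ C ω x) (phi1 σ C ω x) ω := by
  refine ((hb.hasDerivAt_C hω).mul
    (hasDerivAt_ratio_pow hb.sign (hb.two_lt ω hω) x.natAbs)).congr_deriv ?_
  unfold phi1; ring

lemma hasDerivAt_phi1 (hb : Branch a σ ω₀ r C h) {ω : ℝ} (hω : |ω - ω₀| < r) (x : ℤ) :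
    HasDerivAt (fun ω => phi1 σ C ω x) (phi2 σ C ω x) ω := by
  have hne := hb.coup_ne hω
  have h1 := ((hb.hasDerivAt_C hω).div (hasDerivAt_coup hb.sign (hb.two_lt ω hω)) hne).mul_const
    (x.natAbs : ℝ)
  refine (((hb.hasDerivAt_C1 hω).sub h1).mul
    (hasDerivAt_ratio_pow hb.sign (hb.two_lt ω hω) x.natAbs)).congr_deriv ?_
  simp only [phi2, Pi.sub_apply]
  field_simp
  simp only [Pi.div_apply]
  field_simp
  ring

lemma continuousAt_phi2 (hb : Branch a σ ω₀ r C h) {ω : ℝ} (hω : |ω - ω₀| < r) (x : ℤ) :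
    ContinuousAt (fun ω => phi2 σ C ω x) ω := by
  have hne := hb.coup_ne hω
  have c1 := (hb.hasDerivAt_C hω).continuousAt
  have c2 := (hb.hasDerivAt_C1 hω).continuousAt
  have c3 := hb.continuousAt_C2 hω
  have c4 := (hasDerivAt_coup hb.sign (hb.two_lt ω hω)).continuousAt
  have c5 := (hasDerivAt_ratio hb.sign (hb.two_lt ω hω)).continuousAt
  unfold phi2
  fun_prop (disch := simp [hne])

end Branch

/-- The pairing of `ψ_ω` and `∂_ω ψ_ω`. -/
lemma hasSum_pow_natAbs {Q : ℝ} (h0 : 0 ≤ Q) (h1 : Q < 1) :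
    HasSum (fun x : ℤ => Q ^ x.natAbs) ((1 + Q) / (1 - Q)) ∧
    HasSum (fun x : ℤ => (x.natAbs : ℝ) * Q ^ x.natAbs) (2 * Q / (1 - Q) ^ 2) := by
  have g1 := hasSum_geometric_of_lt_one h0 h1
  have g2 := hasSum_coe_mul_geometric_of_norm_lt_one (r := Q) (by rwa [norm_eq_abs, abs_of_nonneg h0])
  have hne : (1 - Q) ≠ 0 := by linarith
  have nat1 : ∀ n : ℕ, (-((n : ℤ) + 1)).natAbs = n + 1 := fun n => by omega
  constructor
  · have k1 : HasSum (fun n : ℕ => Q ^ ((n : ℤ)).natAbs) (1 - Q)⁻¹ := by simpa using g1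
    have k2 : HasSum (fun n : ℕ => Q ^ (-((n : ℤ) + 1)).natAbs) ((1 - Q)⁻¹ * Q) := by
      simp only [nat1, pow_succ]; exact g1.mul_right Q
    have := HasSum.of_nat_of_neg_add_one (f := fun x : ℤ => Q ^ x.natAbs) k1 k2
    convert this using 1
    field_simp
  · have k1 : HasSum (fun n : ℕ => (((n : ℤ)).natAbs : ℝ) * Q ^ ((n : ℤ)).natAbs) (Q / (1 - Q) ^ 2) := by
      simpa using g2
    have k2 : HasSum (fun n : ℕ => ((-((n : ℤ) + 1)).natAbs : ℝ) * Q ^ (-((n : ℤ) + 1)).natAbs)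
        ((Q / (1 - Q) ^ 2 + (1 - Q)⁻¹) * Q) := by
      simp only [nat1, pow_succ]
      refine ((g2.add g1).mul_right Q).congr_fun fun n => ?_
      push_cast; ring
    have := HasSum.of_nat_of_neg_add_one (f := fun x : ℤ => (x.natAbs : ℝ) * Q ^ x.natAbs) k1 k2
    convert this using 1
    field_simp; ring

/-- The derivative of the half norm squared along the branch. -/
lemma hasSum_phi_mul_phi1 {σ ω : ℝ} (hσ : σ = 1 ∨ σ = -1) (hw : 2 < σ * (ω + 2)) (C : ℝ → ℝ) :
    HasSum (fun x => phi σ C ω x * phi1 σ C ω x)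
      (C ω * deriv C ω * (ω + 2) / coup σ ω - 2 * C ω ^ 2 / coup σ ω ^ 3) := by
  have hne := coup_ne_zero hσ hw
  have hr := abs_ratio hσ hw
  set q := ratio σ ω with hq
  have hQ1 : q ^ 2 < 1 := by rw [← sq_abs]; nlinarith [hr.1]
  have hq0 : q ≠ 0 := abs_pos.1 hr.1
  have h1 := ratio_quad hσ hw
  have h2 := two_mul_ratio (ω := ω) hσ
  rw [← hq] at h1 h2
  obtain ⟨s1, s2⟩ := hasSum_pow_natAbs (sq_nonneg q) hQ1
  have e1 : (1 - q ^ 2) = q * coup σ ω := by linear_combination h1 - q * h2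
  have e2 : (1 + q ^ 2) = q * (ω + 2) := by linear_combination h1
  rw [e1] at s1 s2
  rw [e2] at s1
  have := (s1.mul_left (C ω * deriv C ω)).sub (s2.mul_left (C ω ^ 2 / coup σ ω))
  have e : C ω * deriv C ω * (q * (ω + 2) / (q * coup σ ω)) -
      C ω ^ 2 / coup σ ω * (2 * q ^ 2 / (q * coup σ ω) ^ 2) =
      C ω * deriv C ω * (ω + 2) / coup σ ω - 2 * C ω ^ 2 / coup σ ω ^ 3 := by
    field_simp
  rw [e] at this
  refine this.congr_fun fun x => ?_
  unfold phi phi1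
  rw [← hq, ← pow_mul, mul_comm 2 x.natAbs, pow_mul]; ring

/-- The polynomial weights are summable against exponentials. -/
lemma summable_wt_mul_pow {ρ : ℝ} (h0 : 0 ≤ ρ) (h1 : ρ < 1) (L : ℝ) :
    Summable fun x : ℤ => wt x * (L * (1 + (x.natAbs : ℝ)) ^ 2 * ρ ^ x.natAbs) := by
  have key : ∀ k : ℕ, Summable fun x : ℤ => (x.natAbs : ℝ) ^ k * ρ ^ x.natAbs := by
    intro k
    have hs := summable_pow_mul_geometric_of_norm_lt_one (R := ℝ) k (r := ρ)
      (by rwa [norm_eq_abs, abs_of_nonneg h0])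
    exact Summable.of_nat_of_neg (by simpa using hs) (by simpa using hs)
  have := (((((key 0).add ((key 1).mul_left 4)).add ((key 2).mul_left 6)).add
    ((key 3).mul_left 4)).add (key 4)).mul_left L
  refine this.congr fun x => ?_
  have hx : |(x : ℝ)| = (x.natAbs : ℝ) := by rw [← Int.cast_abs, ← Int.natCast_natAbs]; simp
  rw [wt, hx]; ring

/-- The pairing of `ψ_ω` with `∂_ω ψ_ω`. -/
def dlt (σ : ℝ) (C : ℝ → ℝ) (ω : ℝ) : ℝ := ∑' x, phi σ C ω x * phi1 σ C ω x

/-- The squared norm of `ψ_ω`. -/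
def nrm (σ : ℝ) (C : ℝ → ℝ) (ω : ℝ) : ℝ := ∑' x, phi σ C ω x ^ 2

lemma abs_quadratic_le {L c0 c1 c2 n : ℝ} (h0 : |c0| ≤ L) (h1 : |c1| ≤ L) (h2 : |c2| ≤ L)
    (hn : 0 ≤ n) : |c0 + c1 * n + c2 * n ^ 2| ≤ L * (1 + n) ^ 2 := by
  refine (abs_add_le _ _).trans ((add_le_add_left (abs_add_le _ _) _).trans ?_)
  rw [abs_mul, abs_mul, abs_of_nonneg hn, abs_of_nonneg (by positivity : 0 ≤ n ^ 2)]
  have k1 := mul_le_mul_of_nonneg_right h1 hn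
  have k2 := mul_le_mul_of_nonneg_right h2 (by positivity : 0 ≤ n ^ 2)
  have k3 : 0 ≤ L * n := mul_nonneg ((abs_nonneg _).trans h0) hn
  linarith

theorem exists_branch {a : ℝ → ℝ} {ω₀ C₀ : ℝ} (hwave : IsSolitaryWave a ω₀ C₀)
    (ha₂ : ContDiffAt ℝ 2 a (C₀ ^ 2)) (h1 : deriv a (C₀ ^ 2) ≠ 0)
    (h2 : deriv a (C₀ ^ 2) ≠ (4 * a (C₀ ^ 2) + a (C₀ ^ 2) ^ 3) / (4 * C₀ ^ 2)) (r₁ : ℝ) (hr₁ : 0 < r₁) :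
    ∃ r C h, C ω₀ = C₀ ∧ Branch a (waveSign ω₀) ω₀ r C h ∧
      (∀ ω, |ω - ω₀| < r → dlt (waveSign ω₀) C ω ≠ 0) ∧
      (∀ ω, |ω - ω₀| < r → |ω - ω₀| ≤ r₁ ∧
        |deriv a (C ω ^ 2) * C ω ^ 2 - deriv a (C₀ ^ 2) * C₀ ^ 2| ≤ r₁) := by
  obtain ⟨hcoup, hω, hW⟩ := hwave.coup_eq
  have hC := hwave.1
  have hσ := waveSign_cases ω₀
  set σ := waveSign ω₀ with hσd
  have hsne := coup_ne_zero hσ hW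
  have hssq := coup_sq hσ hW
  have hda : HasDerivAt a (deriv a (C₀ ^ 2)) (C₀ ^ 2) :=
    (ha₂.differentiableAt (by norm_num)).hasDerivAt
  set f : ℝ → ℝ := fun c => a (c ^ 2) with hf
  have hfs : ContDiffAt ℝ 2 f C₀ :=
    ContDiffAt.comp (g := a) (f := fun c => c ^ 2) C₀ ha₂ (by fun_prop)
  have hfd : HasDerivAt f (deriv a (C₀ ^ 2) * (2 * C₀)) C₀ := by
    have := HasDerivAt.comp C₀ (h := fun c : ℝ => c ^ 2) hda ((hasDerivAt_pow 2 C₀))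
    refine HasDerivAt.congr_deriv this (by simp)
  have hne : deriv a (C₀ ^ 2) * (2 * C₀) ≠ 0 := mul_ne_zero h1 (by positivity)
  have hfd' := hfd.hasFDerivAt_equiv hne
  set g := hfs.localInverse hfd' (by norm_num) with hg
  have hgs : ContDiffAt ℝ 2 g (f C₀) := hfs.to_localInverse hfd' (by norm_num)
  have hg0 : g (f C₀) = C₀ := hfs.localInverse_apply_image hfd' (by norm_num)
  have hginv : ∀ᶠ y in 𝓝 (f C₀), f (g y) = y :=
    (hfs.hasStrictFDerivAt' hfd' (by norm_num)).eventually_right_inverse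
  have hfC : f C₀ = coup σ ω₀ := hcoup
  rw [hfC] at hgs hg0 hginv
  have hcs : ContDiffAt ℝ 2 (coup σ) ω₀ := by
    have : ContDiffAt ℝ 2 (fun ω : ℝ => (ω + 2) ^ 2 - 4) ω₀ := by fun_prop
    exact contDiffAt_const.mul (this.sqrt (by rw [← hssq]; positivity))
  set C : ℝ → ℝ := fun ω => g (coup σ ω) with hCd
  have hC0 : C ω₀ = C₀ := hg0
  have hCs : ContDiffAt ℝ 2 C ω₀ := ContDiffAt.comp (g := g) ω₀ hgs hcs
  have hCs1 : ContDiffAt ℝ 1 (deriv C) ω₀ := ContDiffAt.derivWithin hCs (by norm_num)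
  have hCs2 : ContinuousAt (deriv (deriv C)) ω₀ :=
    (ContDiffAt.derivWithin (m := 0) hCs1 (by norm_num)).continuousAt
  have cC := hCs.continuousAt
  have cC1 := hCs1.continuousAt
  have cc := hcs.continuousAt
  have ev1 : ∀ᶠ ω in 𝓝 ω₀, 2 < σ * (ω + 2) := by
    have : ContinuousAt (fun ω => σ * (ω + 2)) ω₀ := by fun_prop
    exact this.eventually (lt_mem_nhds hW)
  have ev2 : ∀ᶠ ω in 𝓝 ω₀, 0 < C ω := cC.eventually (lt_mem_nhds (by rw [hC0]; exact hC))
  have ev3 : ∀ᶠ ω in 𝓝 ω₀, ContDiffAt ℝ 2 C ω := hCs.eventually (by simp)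
  have ev4 : ∀ᶠ ω in 𝓝 ω₀, a (C ω ^ 2) = coup σ ω := cc.eventually hginv
  have cC2 : ContinuousAt (fun ω => C ω ^ 2) ω₀ := cC.pow 2
  have ev5 : ∀ᶠ ω in 𝓝 ω₀, ContDiffAt ℝ 2 a (C ω ^ 2) := by
    have := ha₂.eventually (by simp)
    rw [← hC0] at this
    exact cC2.eventually this
  have evb : ∀ F : ℝ → ℝ, ContinuousAt F ω₀ → ∀ᶠ ω in 𝓝 ω₀, |F ω| ≤ |F ω₀| + 1 := fun F hF =>
    (hF.abs.eventually (gt_mem_nhds (show |F ω₀| < |F ω₀| + 1 by linarith))).mono fun _ h => le_of_lt h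
  have hrat := abs_ratio hσ hW
  have crat := (hasDerivAt_ratio hσ hW).continuousAt
  obtain ⟨ρ, hρ1, hρ2⟩ := exists_between hrat.2
  have ev6 : ∀ᶠ ω in 𝓝 ω₀, |ratio σ ω| < ρ := crat.abs.eventually (gt_mem_nhds hρ1)
  have b1 := evb C cC
  have b2 := evb (deriv C) cC1
  have b3 := evb (fun ω => C ω / coup σ ω) (cC.div cc hsne)
  have b4 := evb _ hCs2
  have b5 := evb (fun ω => C ω * (ω + 2) / coup σ ω ^ 3 - 2 * deriv C ω / coup σ ω)
    (by fun_prop (disch := simp [hsne]))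
  have b6 := evb (fun ω => C ω / coup σ ω ^ 2) (by fun_prop (disch := simp [hsne]))
  set B1 := |C ω₀| + 1
  set B2 := |deriv C ω₀| + 1
  set B3 := |C ω₀ / coup σ ω₀| + 1
  set B4 := |deriv (deriv C) ω₀| + 1
  set B5 := |C ω₀ * (ω₀ + 2) / coup σ ω₀ ^ 3 - 2 * deriv C ω₀ / coup σ ω₀| + 1
  set B6 := |C ω₀ / coup σ ω₀ ^ 2| + 1
  have p1 : 0 ≤ B1 := by positivity
  have p2 : 0 ≤ B2 := by positivity
  have p3 : 0 ≤ B3 := by positivity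
  have p4 : 0 ≤ B4 := by positivity
  have p5 : 0 ≤ B5 := by positivity
  have p6 : 0 ≤ B6 := by positivity
  set L := B1 + B2 + B3 + B4 + B5 + B6 with hL
  have hC1 : deriv a (C₀ ^ 2) * (2 * C₀) * deriv C ω₀ = (ω₀ + 2) / coup σ ω₀ := by
    have k1 : HasDerivAt (fun ω => f (C ω)) (deriv a (C₀ ^ 2) * (2 * C₀) * deriv C ω₀) ω₀ := by
      rw [← hC0] at hfd
      have := HasDerivAt.comp ω₀ hfd (hCs.differentiableAt (by norm_num)).hasDerivAt
      rw [hC0] at this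
      exact this
    have k2 : HasDerivAt (fun ω => f (C ω)) ((ω₀ + 2) / coup σ ω₀) ω₀ :=
      (hasDerivAt_coup hσ hW).congr_of_eventuallyEq ev4
    exact k1.unique k2
  have hD0 : C ω₀ * deriv C ω₀ * (ω₀ + 2) / coup σ ω₀ - 2 * C ω₀ ^ 2 / coup σ ω₀ ^ 3 ≠ 0 := by
    rw [hC0]
    intro h0
    apply h2
    rw [hcoup, eq_div_iff (by positivity)]
    rw [sub_eq_zero, div_eq_div_iff hsne (pow_ne_zero 3 hsne)] at h0
    have hC1' : deriv a (C₀ ^ 2) * (2 * C₀) * deriv C ω₀ * coup σ ω₀ = ω₀ + 2 := by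
      rw [hC1]; field_simp
    have hC0' : C₀ * coup σ ω₀ ≠ 0 := mul_ne_zero hC.ne' hsne
    have e1 : deriv C ω₀ * (ω₀ + 2) * coup σ ω₀ ^ 2 = 2 * C₀ := by
      apply mul_left_cancel₀ hC0'
      linear_combination h0
    linear_combination -2 * deriv a (C₀ ^ 2) * C₀ * e1 + (ω₀ + 2) * coup σ ω₀ * hC1' +
      coup σ ω₀ * (-hssq)
  have ev7 : ∀ᶠ ω in 𝓝 ω₀, C ω * deriv C ω * (ω + 2) / coup σ ω - 2 * C ω ^ 2 / coup σ ω ^ 3 ≠ 0 := by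
    have : ContinuousAt (fun ω => C ω * deriv C ω * (ω + 2) / coup σ ω - 2 * C ω ^ 2 / coup σ ω ^ 3) ω₀ := by
      fun_prop (disch := simp [hsne])
    exact this.eventually_ne hD0
  have ev8 : ∀ᶠ ω in 𝓝 ω₀, |deriv a (C ω ^ 2) * C ω ^ 2 - deriv a (C₀ ^ 2) * C₀ ^ 2| < r₁ := by
    have hda' : ContinuousAt (deriv a) (C ω₀ ^ 2) := by
      rw [hC0]
      exact (ContDiffAt.derivWithin (m := 1) ha₂ (by norm_num)).continuousAt
    have : ContinuousAt (fun ω => |deriv a (C ω ^ 2) * C ω ^ 2 - deriv a (C₀ ^ 2) * C₀ ^ 2|) ω₀ :=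
      (((ContinuousAt.comp (x := ω₀) (f := fun ω => C ω ^ 2) (g := deriv a) hda' cC2).mul cC2).sub continuousAt_const).abs
    refine this.eventually (gt_mem_nhds ?_)
    simpa [hC0] using hr₁
  have ev9 : ∀ᶠ ω in 𝓝 ω₀, |ω - ω₀| < r₁ := by
    have : ContinuousAt (fun ω => |ω - ω₀|) ω₀ := by fun_prop
    exact this.eventually (gt_mem_nhds (by simpa using hr₁))
  obtain ⟨r, hr, hall⟩ := Metric.eventually_nhds_iff.1 (ev1.and (ev2.and (ev3.and (ev4.and (ev5.and
    (ev6.and (ev7.and (ev8.and (ev9.and (b1.and (b2.and (b3.and (b4.and (b5.and b6))))))))))))))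
  have hρ0 : 0 ≤ ρ := hrat.1.le.trans hρ1.le
  refine ⟨r, C, fun x => L * (1 + (x.natAbs : ℝ)) ^ 2 * ρ ^ x.natAbs, hC0,
    ⟨hσ, hr, fun ω hω => (hall hω).1, fun ω hω => (hall hω).2.1, fun ω hω => (hall hω).2.2.1,
      fun ω hω => (hall hω).2.2.2.1, fun ω hω => (hall hω).2.2.2.2.1, fun ω hω x => ?_,
      summable_wt_mul_pow hρ0 hρ2 L⟩, fun ω hω => ?_, fun ω hω => ?_⟩
  · obtain ⟨-, -, -, -, -, e6, -, -, -, c1, c2, c3, c4, c5, c6⟩ := hall hω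
    have hq : |ratio σ ω| ^ x.natAbs ≤ ρ ^ x.natAbs := pow_le_pow_left₀ (abs_nonneg _) e6.le _
    have hn : (0 : ℝ) ≤ (x.natAbs : ℝ) := Nat.cast_nonneg _
    set n : ℝ := (x.natAbs : ℝ)
    have aux : ∀ P : ℝ, |P| ≤ L * (1 + n) ^ 2 →
        |P * ratio σ ω ^ x.natAbs| ≤ L * (1 + n) ^ 2 * ρ ^ x.natAbs := by
      intro P hP
      rw [abs_mul, abs_pow]
      exact mul_le_mul hP hq (by positivity) (by positivity)
    have hL : 0 ≤ L := by positivity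
    have l1 : |C ω| ≤ L := c1.trans (by linarith)
    have l2 : |deriv C ω| ≤ L := c2.trans (by linarith)
    have l3 : |C ω / coup σ ω| ≤ L := c3.trans (by linarith)
    have l4 : |deriv (deriv C) ω| ≤ L := c4.trans (by linarith)
    have l5 := c5.trans (show B5 ≤ L by linarith)
    have l6 := c6.trans (show B6 ≤ L by linarith)
    refine ⟨aux _ ?_, aux _ ?_, aux _ (abs_quadratic_le l4 l5 l6 hn)⟩
    · simpa using abs_quadratic_le (c1 := 0) (c2 := 0) l1 (by simpa using hL) (by simpa using hL) hn
    · have k := abs_quadratic_le (c1 := -(C ω / coup σ ω)) (c2 := 0) l2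
        (by rwa [abs_neg]) (by simpa using hL) hn
      rwa [zero_mul, add_zero, neg_mul, ← sub_eq_add_neg] at k
  · obtain ⟨e1, -, -, -, -, -, e7, -⟩ := hall hω
    rw [dlt, (hasSum_phi_mul_phi1 hσ e1 C).tsum_eq]
    exact e7
  · obtain ⟨-, -, -, -, -, -, -, e8, e9, -⟩ := hall hω
    exact ⟨e9.le, e8.le⟩

/-! ### Weighted pairings -/

/-- The bilinear pairing with a real sequence. -/
def ps (f : ℤ → ℝ) (u : ℤ → ℂ) : ℂ := ∑' x, u x * (f x : ℂ)

section
variable {f h : ℤ → ℝ} {u v : ℤ → ℂ} {M : ℝ}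

lemma norm_mul_le_wt (hf : ∀ x, |f x| ≤ h x) (hu : ∀ x, ‖u x‖ ≤ M * wt x) (x : ℤ) :
    ‖u x * (f x : ℂ)‖ ≤ M * (wt x * h x) := by
  rw [norm_mul, norm_real, norm_eq_abs, ← mul_assoc]
  exact mul_le_mul (hu x) (hf x) (abs_nonneg _) ((norm_nonneg _).trans (hu x))

lemma summable_ps (hf : ∀ x, |f x| ≤ h x) (hs : Summable fun x => wt x * h x)
    (hu : ∀ x, ‖u x‖ ≤ M * wt x) : Summable fun x => u x * (f x : ℂ) :=
  Summable.of_norm_bounded (hs.mul_left M) (norm_mul_le_wt hf hu)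

lemma norm_ps_le (hf : ∀ x, |f x| ≤ h x) (hs : Summable fun x => wt x * h x)
    (hu : ∀ x, ‖u x‖ ≤ M * wt x) : ‖ps f u‖ ≤ M * ∑' x, wt x * h x := by
  rw [← tsum_mul_left]
  exact tsum_of_norm_bounded (hs.mul_left M).hasSum (norm_mul_le_wt hf hu)

lemma ps_smul (c : ℂ) (f : ℤ → ℝ) (u : ℤ → ℂ) : ps f (fun x => c * u x) = c * ps f u := by
  unfold ps
  rw [← tsum_mul_left]
  exact tsum_congr fun x => by ring

lemma ps_sub {M' : ℝ} (hf : ∀ x, |f x| ≤ h x) (hs : Summable fun x => wt x * h x)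
    (hu : ∀ x, ‖u x‖ ≤ M * wt x) (hv : ∀ x, ‖v x‖ ≤ M' * wt x) :
    ps f (fun x => u x - v x) = ps f u - ps f v := by
  unfold ps
  rw [← (summable_ps hf hs hu).tsum_sub (summable_ps hf hs hv)]
  exact tsum_congr fun x => by ring

lemma nonneg_of_abs_le (hf : ∀ x, |f x| ≤ h x) (x : ℤ) : 0 ≤ h x := (abs_nonneg _).trans (hf x)

lemma le_tsum_wt (h0 : ∀ x, 0 ≤ h x) (hs : Summable fun x => wt x * h x) (x : ℤ) :
    h x ≤ ∑' x, wt x * h x :=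
  le_trans (le_mul_of_one_le_left (h0 x) (one_le_wt x))
    (hs.le_tsum x fun y _ => mul_nonneg (wt_pos y).le (h0 y))

lemma summable_of_wt (h0 : ∀ x, 0 ≤ h x) (hs : Summable fun x => wt x * h x) : Summable h :=
  Summable.of_nonneg_of_le h0 (fun x => le_mul_of_one_le_left (h0 x) (one_le_wt x)) hs

lemma hasDerivAt_ps {F F' : ℝ → ℤ → ℝ} {ω₀ r ω : ℝ} (hd : ∀ ω, |ω - ω₀| < r → ∀ x,
    HasDerivAt (fun ω => F ω x) (F' ω x) ω) (hF : ∀ ω, |ω - ω₀| < r → ∀ x, |F ω x| ≤ h x)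
    (hF' : ∀ ω, |ω - ω₀| < r → ∀ x, |F' ω x| ≤ h x) (hs : Summable fun x => wt x * h x)
    (hu : ∀ x, ‖u x‖ ≤ M * wt x) (hω : |ω - ω₀| < r) :
    HasDerivAt (fun ω => ps (F ω) u) (ps (F' ω) u) ω := by
  have hmem : ω ∈ Metric.ball ω₀ r := by simpa [Real.dist_eq] using hω
  have := hasDerivAt_tsum_of_isPreconnected (t := Metric.ball ω₀ r) (hs.mul_left M)
    (g := fun x ω => u x * (F ω x : ℂ)) (g' := fun x ω => u x * (F' ω x : ℂ)) (y₀ := ω) (y := ω)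
    Metric.isOpen_ball (convex_ball ω₀ r).isPreconnected
    (fun x y hy => ((hd y (by simpa [Real.dist_eq] using hy) x).ofReal_comp).const_mul (u x))
    (fun x y hy => norm_mul_le_wt (hF' y (by simpa [Real.dist_eq] using hy)) hu x)
    hmem (summable_ps (hF ω hω) hs hu) hmem
  exact this

lemma norm_ps_sub_le {F F' : ℝ → ℤ → ℝ} {ω₀ r ω ω' : ℝ} (hd : ∀ ω, |ω - ω₀| < r → ∀ x,
    HasDerivAt (fun ω => F ω x) (F' ω x) ω) (hF : ∀ ω, |ω - ω₀| < r → ∀ x, |F ω x| ≤ h x)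
    (hF' : ∀ ω, |ω - ω₀| < r → ∀ x, |F' ω x| ≤ h x) (hs : Summable fun x => wt x * h x)
    (hu : ∀ x, ‖u x‖ ≤ M * wt x) (hω : |ω - ω₀| < r) (hω' : |ω' - ω₀| < r) :
    ‖ps (F ω') u - ps (F ω) u‖ ≤ M * (∑' x, wt x * h x) * |ω' - ω| :=
  (convex_ball ω₀ r).norm_image_sub_le_of_norm_hasDerivWithin_le
    (fun _ hy => (hasDerivAt_ps hd hF hF' hs hu hy).hasDerivWithinAt)
    (fun y hy => norm_ps_le (hF' y hy) hs hu) hω hω'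

lemma abs_sub_le_of_hasDerivAt {F F' : ℝ → ℤ → ℝ} {ω₀ r ω ω' : ℝ} (hd : ∀ ω, |ω - ω₀| < r → ∀ x,
    HasDerivAt (fun ω => F ω x) (F' ω x) ω)
    (hF' : ∀ ω, |ω - ω₀| < r → ∀ x, |F' ω x| ≤ h x)
    (hω : |ω - ω₀| < r) (hω' : |ω' - ω₀| < r) (x : ℤ) :
    |F ω' x - F ω x| ≤ h x * |ω' - ω| :=
  (convex_ball ω₀ r).norm_image_sub_le_of_norm_hasDerivWithin_le
    (fun y hy => (hd y hy x).hasDerivWithinAt) (fun y hy => hF' y hy x) hω hω'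

end

/-! ### Identities along the branch -/

lemma phi_zero (σ : ℝ) (C : ℝ → ℝ) (ω : ℝ) : phi σ C ω 0 = C ω := by simp [phi]

lemma phi1_zero (σ : ℝ) (C : ℝ → ℝ) (ω : ℝ) : phi1 σ C ω 0 = deriv C ω := by simp [phi1]

lemma phi_step {σ ω : ℝ} (hσ : σ = 1 ∨ σ = -1) (h : 2 < σ * (ω + 2)) (C : ℝ → ℝ) (x : ℤ) :
    phi σ C ω (x + 1) + phi σ C ω (x - 1) = (ω + 2) * phi σ C ω x -
      if x = 0 then coup σ ω * C ω else 0 := by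
  have h1 : ((ratio σ ω : ℝ) : ℂ) ^ 2 = ((ω + 2 : ℝ) : ℂ) * ((ratio σ ω : ℝ) : ℂ) - 1 := by
    exact_mod_cast ratio_quad hσ h
  have h2 := two_mul_ratio (ω := ω) hσ
  have k := pow_natAbs_add_sub h1 x
  rcases eq_or_ne x 0 with rfl | hx
  · simp [phi]; linear_combination C ω * h2
  · rw [delta_of_ne hx, zero_mul, sub_zero] at k
    have k' : ratio σ ω ^ (x + 1).natAbs + ratio σ ω ^ (x - 1).natAbs =
      (ω + 2) * ratio σ ω ^ x.natAbs := by exact_mod_cast k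
    simp only [phi, hx, if_false]
    linear_combination C ω * k'

/-- The coefficient `a'(C²) C²` of the linearization. -/
def bcoef (a : ℝ → ℝ) (C : ℝ → ℝ) (ω : ℝ) : ℝ := deriv a (C ω ^ 2) * C ω ^ 2

/-- The weighted mass of the majorant. -/
def mass (h : ℤ → ℝ) : ℝ := ∑' x, wt x * h x

namespace Branch

variable {a : ℝ → ℝ} {σ ω₀ r : ℝ} {C : ℝ → ℝ} {h : ℤ → ℝ}

variable (hb : Branch a σ ω₀ r C h)
include hb

lemma phi1_step {ω : ℝ} (hω : |ω - ω₀| < r) (x : ℤ) :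
    phi1 σ C ω (x + 1) + phi1 σ C ω (x - 1) = (ω + 2) * phi1 σ C ω x + phi σ C ω x -
      if x = 0 then (ω + 2) / coup σ ω * C ω + coup σ ω * deriv C ω else 0 := by
  have k1 := (hb.hasDerivAt_phi hω (x + 1)).add (hb.hasDerivAt_phi hω (x - 1))
  have k2 : HasDerivAt (fun ω => if x = 0 then coup σ ω * C ω else 0)
      (if x = 0 then (ω + 2) / coup σ ω * C ω + coup σ ω * deriv C ω else 0) ω := by
    split_ifs
    · exact (hasDerivAt_coup hb.sign (hb.two_lt ω hω)).mul (hb.hasDerivAt_C hω)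
    · exact hasDerivAt_const _ _
  have k3 := ((((hasDerivAt_id ω).add_const 2).mul (hb.hasDerivAt_phi hω x)).sub k2)
  have k4 : HasDerivAt (fun ω => phi σ C ω (x + 1) + phi σ C ω (x - 1)) _ ω :=
    k3.congr_of_eventuallyEq (by
      filter_upwards [Metric.isOpen_ball.mem_nhds (show ω ∈ Metric.ball ω₀ r from hω)] with y hy
      exact phi_step hb.sign (hb.two_lt y hy) C x)
  have := HasDerivAt.unique k1 k4
  rw [this]
  simp only [id]
  ring

lemma deriv_relation {ω : ℝ} (hω : |ω - ω₀| < r) :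
    2 * bcoef a C ω * coup σ ω * deriv C ω = C ω * (ω + 2) := by
  have hda : HasDerivAt a (deriv a (C ω ^ 2)) (C ω ^ 2) :=
    ((hb.smooth_a ω hω).differentiableAt (by norm_num)).hasDerivAt
  have k1 := HasDerivAt.comp ω (h := fun ω => C ω ^ 2) hda ((hb.hasDerivAt_C hω).pow 2)
  have k2 : HasDerivAt (fun ω => a (C ω ^ 2)) ((ω + 2) / coup σ ω) ω :=
    (hasDerivAt_coup hb.sign (hb.two_lt ω hω)).congr_of_eventuallyEq (by
      filter_upwards [Metric.isOpen_ball.mem_nhds (show ω ∈ Metric.ball ω₀ r from hω)] with y hy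
      exact hb.amp y hy)
  have := HasDerivAt.unique k1 k2
  have hne := hb.coup_ne hω
  rw [eq_div_iff hne] at this
  unfold bcoef
  simp only [Nat.cast_ofNat, Nat.add_one_sub_one, pow_one] at this
  linear_combination C ω * this

lemma nrm_eq {ω : ℝ} (hω : |ω - ω₀| < r) :
    nrm σ C ω = 2 * bcoef a C ω * C ω * deriv C ω := by
  have hne := hb.coup_ne hω
  have hσ := hb.sign
  have hw := hb.two_lt ω hω
  have hr := abs_ratio hσ hw
  have hQ1 : ratio σ ω ^ 2 < 1 := by rw [← sq_abs]; nlinarith [hr.1]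
  have hq0 : ratio σ ω ≠ 0 := abs_pos.1 hr.1
  have h1 := ratio_quad hσ hw
  have h2 := two_mul_ratio (ω := ω) hσ
  have s1 := (hasSum_pow_natAbs (sq_nonneg (ratio σ ω)) hQ1).1
  have e1 : (1 - ratio σ ω ^ 2) = ratio σ ω * coup σ ω := by linear_combination h1 - ratio σ ω * h2
  have e2 : (1 + ratio σ ω ^ 2) = ratio σ ω * (ω + 2) := by linear_combination h1
  rw [e1, e2, mul_div_mul_left _ _ hq0] at s1
  have s2 : HasSum (fun x => phi σ C ω x ^ 2) (C ω ^ 2 * ((ω + 2) / coup σ ω)) := by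
    refine (s1.mul_left (C ω ^ 2)).congr_fun fun x => ?_
    unfold phi; rw [← pow_mul, mul_comm 2 x.natAbs, pow_mul]; ring
  rw [nrm, s2.tsum_eq]
  have := hb.deriv_relation hω
  field_simp
  linear_combination -C ω * this

lemma phi_le {ω : ℝ} (hω : |ω - ω₀| < r) (x : ℤ) : |phi σ C ω x| ≤ h x :=
  (hb.maj ω hω x).1

lemma phi1_le {ω : ℝ} (hω : |ω - ω₀| < r) (x : ℤ) : |phi1 σ C ω x| ≤ h x :=
  (hb.maj ω hω x).2.1

lemma phi2_le {ω : ℝ} (hω : |ω - ω₀| < r) (x : ℤ) : |phi2 σ C ω x| ≤ h x :=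
  (hb.maj ω hω x).2.2

lemma self : |ω₀ - ω₀| < r := by simpa using hb.hr

lemma h_nonneg (x : ℤ) : 0 ≤ h x := nonneg_of_abs_le (hb.phi_le hb.self) x

lemma h_le_mass (x : ℤ) : h x ≤ mass h := le_tsum_wt hb.h_nonneg hb.summable x

lemma mass_nonneg : 0 ≤ mass h := (hb.h_nonneg 0).trans (hb.h_le_mass 0)

lemma growth {f : ℤ → ℝ} (hf : ∀ x, |f x| ≤ h x) (x : ℤ) :
    ‖(f x : ℂ)‖ ≤ mass h * wt x := by
  rw [norm_real, norm_eq_abs]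
  exact ((hf x).trans (hb.h_le_mass x)).trans (le_mul_of_one_le_right hb.mass_nonneg (one_le_wt x))

end Branch

/-! ### The time evolution of the pairings -/

lemma force_rot (a : ℝ → ℝ) {e : ℂ} (he : ‖e‖ = 1) (z : ℂ) : force a (e * z) = e * force a z := by
  unfold force; rw [norm_mul, he, one_mul]; ring

lemma continuous_force {a : ℝ → ℝ} (ha : Continuous a) : Continuous (force a) := by
  unfold force; fun_prop

section
variable {a : ℝ → ℝ} {ψ : ℝ → ℓ²}

lemma norm_coord_le (u : ℓ²) (x : ℤ) : ‖u x‖ ≤ ‖u‖ :=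
  lp.norm_apply_le_norm (by norm_num) u x

lemma growth_lp (u : ℓ²) (x : ℤ) : ‖u x‖ ≤ ‖u‖ * wt x :=
  (norm_coord_le u x).trans (le_mul_of_one_le_right (norm_nonneg _) (one_le_wt x))

lemma IsSolution.continuous_coord (hψ : IsSolution a ψ) (x : ℤ) : Continuous fun t => ψ t x := by
  have h : Continuous fun u : ℓ² => u x := by
    refine LipschitzWith.continuous (K := 1) (LipschitzWith.of_dist_le_mul fun u v => ?_)
    rw [dist_eq_norm, dist_eq_norm, NNReal.coe_one, one_mul]
    exact norm_coord_le (u - v) x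
  exact h.comp hψ.1

lemma IsSolution.hasDerivAt (hψ : IsSolution a ψ) (t : ℝ) (x : ℤ) :
    HasDerivAt (fun s => ψ s x) (I * (ψ t (x + 1) + ψ t (x - 1) - 2 * ψ t x) +
      I * delta x * force a (ψ t 0)) t := by
  obtain ⟨v, hv, he⟩ := hψ.2 t x
  refine hv.congr_deriv ?_
  unfold lap at he
  linear_combination -I * he + v * I_sq

lemma IsSolution.exists_bound (ha : Continuous a) (hψ : IsSolution a ψ) (t : ℝ) :
    ∃ M, 0 ≤ M ∧ ∀ s ∈ Metric.ball t 1, ‖ψ s‖ ≤ M ∧ ∀ x, ‖I * (ψ s (x + 1) + ψ s (x - 1) - 2 * ψ s x) +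
      I * delta x * force a (ψ s 0)‖ ≤ M * wt x := by
  have c2 : Continuous fun s => force a (ψ s 0) := (continuous_force ha).comp (hψ.continuous_coord 0)
  obtain ⟨M1, hM1⟩ := (isCompact_closedBall t 1).exists_bound_of_continuousOn hψ.1.continuousOn
  obtain ⟨M2, hM2⟩ := (isCompact_closedBall t 1).exists_bound_of_continuousOn c2.continuousOn
  have p1 : 0 ≤ M1 := (norm_nonneg _).trans (hM1 t (by simp))
  have p2 : 0 ≤ M2 := (norm_nonneg _).trans (hM2 t (by simp))
  refine ⟨4 * M1 + M2, by positivity, fun s hs => ?_⟩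
  have hs' := Metric.ball_subset_closedBall hs
  have b1 := hM1 s hs'
  have b2 := hM2 s hs'
  refine ⟨by linarith, fun x => ?_⟩
  refine le_trans ?_ (le_mul_of_one_le_right (by positivity) (one_le_wt x))
  have n1 : ‖I * delta x * force a (ψ s 0)‖ ≤ M2 := by
    rw [norm_mul, norm_mul, norm_I, one_mul]
    have : ‖delta x‖ ≤ 1 := by unfold delta; split_ifs <;> simp
    nlinarith [norm_nonneg (delta x), norm_nonneg (force a (ψ s 0))]
  have n2 : ‖I * (ψ s (x + 1) + ψ s (x - 1) - 2 * ψ s x)‖ ≤ 4 * M1 := by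
    rw [norm_mul, norm_I, one_mul]
    have k1 := norm_sub_le (ψ s (x + 1) + ψ s (x - 1)) (2 * ψ s x)
    have k2 := norm_add_le (ψ s (x + 1)) (ψ s (x - 1))
    rw [norm_mul, norm_ofNat] at k1
    linarith [norm_coord_le (ψ s) (x + 1), norm_coord_le (ψ s) (x - 1), norm_coord_le (ψ s) x]
  exact (norm_add_le _ _).trans (add_le_add n2 n1)

lemma IsSolution.hasDerivAt_ps (ha : Continuous a) (hψ : IsSolution a ψ) {f h : ℤ → ℝ}
    (hf : ∀ x, |f x| ≤ h x) (hs : Summable fun x => wt x * h x) (t : ℝ) :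
    HasDerivAt (fun s => ps f (fun x => ψ s x))
      (I * (ps (fun x => f (x + 1) + f (x - 1) - 2 * f x) (fun x => ψ t x) +
        f 0 * force a (ψ t 0))) t := by
  obtain ⟨M, hM0, hM⟩ := hψ.exists_bound ha t
  have hg : ∀ s : ℝ, ∀ x, ‖ψ s x‖ ≤ ‖ψ s‖ * wt x := fun s x => growth_lp (ψ s) x
  have hd := hasDerivAt_tsum_of_isPreconnected (t := Metric.ball t 1) (hs.mul_left M)
    Metric.isOpen_ball (convex_ball t 1).isPreconnected
    (g := fun x s => ψ s x * (f x : ℂ)) (g' := fun x s => (I * (ψ s (x + 1) + ψ s (x - 1) -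
      2 * ψ s x) + I * delta x * force a (ψ s 0)) * (f x : ℂ)) (y₀ := t) (y := t)
    (fun x s _ => (hψ.hasDerivAt s x).mul_const _)
    (fun x s hs => norm_mul_le_wt hf (hM s hs).2 x) (Metric.mem_ball_self one_pos)
    (summable_ps hf hs (hg t)) (Metric.mem_ball_self one_pos)
  refine HasDerivAt.congr_deriv hd ?_
  have hsh : Summable h := summable_of_wt (nonneg_of_abs_le hf) hs
  have s0 : ∀ g : ℤ → ℤ, Summable fun x => ψ t (g x) * (f x : ℂ) := fun g =>
    Summable.of_norm_bounded (hsh.mul_left ‖ψ t‖) fun x => by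
      rw [norm_mul, norm_real, norm_eq_abs]
      exact mul_le_mul (norm_coord_le _ _) (hf x) (abs_nonneg _) (norm_nonneg _)
  have s1 := s0 fun x => x + 1
  have s2 := s0 fun x => x - 1
  have s3 := s0 fun x => x
  have e1 : ∑' x, ψ t (x + 1) * (f x : ℂ) = ∑' x, ψ t x * (f (x - 1) : ℂ) := by
    rw [← (Equiv.subRight (1 : ℤ)).tsum_eq]
    exact tsum_congr fun x => by simp
  have e2 : ∑' x, ψ t (x - 1) * (f x : ℂ) = ∑' x, ψ t x * (f (x + 1) : ℂ) := by
    rw [← (Equiv.addRight (1 : ℤ)).tsum_eq]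
    exact tsum_congr fun x => by simp
  have s1' : Summable fun x => ψ t x * (f (x - 1) : ℂ) := by
    refine ((Equiv.subRight (1 : ℤ)).summable_iff.2 s1).congr fun x => by simp
  have s2' : Summable fun x => ψ t x * (f (x + 1) : ℂ) := by
    refine ((Equiv.addRight (1 : ℤ)).summable_iff.2 s2).congr fun x => by simp
  have hdel : HasSum (fun x => I * delta x * force a (ψ t 0) * (f x : ℂ)) (I * (f 0 * force a (ψ t 0))) := by
    have := hasSum_single (f := fun x => I * delta x * force a (ψ t 0) * (f x : ℂ)) 0
      (fun x hx => by simp [delta_of_ne hx])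
    convert! this using 1
    simp only [delta_zero]; ring
  have t1 : HasSum (fun x => (I * (ψ t (x + 1) + ψ t (x - 1) - 2 * ψ t x) +
      I * delta x * force a (ψ t 0)) * (f x : ℂ))
      (I * (∑' x, ψ t x * (f (x - 1) : ℂ) + ∑' x, ψ t x * (f (x + 1) : ℂ) -
        2 * ∑' x, ψ t x * (f x : ℂ)) + I * (f 0 * force a (ψ t 0))) := by
    rw [← e1, ← e2]
    have := (((s1.hasSum.add s2.hasSum).sub (s3.hasSum.mul_left 2)).mul_left I).add hdel
    refine this.congr_fun fun x => ?_
    ring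
  have t2 : HasSum (fun x => ψ t x * ((f (x + 1) + f (x - 1) - 2 * f x : ℝ) : ℂ))
      (∑' x, ψ t x * (f (x - 1) : ℂ) + ∑' x, ψ t x * (f (x + 1) : ℂ) -
        2 * ∑' x, ψ t x * (f x : ℂ)) := by
    refine ((s1'.hasSum.add s2'.hasSum).sub (s3.hasSum.mul_left 2)).congr_fun fun x => ?_
    push_cast; ring
  rw [t1.tsum_eq]
  unfold ps
  rw [t2.tsum_eq]
  ring

lemma IsSolution.continuousAt_ps (ha : Continuous a) (hψ : IsSolution a ψ) {F : ℝ → ℤ → ℝ} {h : ℤ → ℝ}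
    {ω₀ r : ℝ} (hF : ∀ ω, |ω - ω₀| < r → ∀ x, |F ω x| ≤ h x)
    (hc : ∀ ω, |ω - ω₀| < r → ∀ x, ContinuousAt (fun ω => F ω x) ω)
    (hs : Summable fun x => wt x * h x) {t ω : ℝ} (hω : |ω - ω₀| < r) :
    ContinuousAt (fun p : ℝ × ℝ => ps (F p.2) (fun x => ψ p.1 x)) (t, ω) := by
  obtain ⟨M, hM0, hM⟩ := hψ.exists_bound ha t
  have : ContinuousOn (fun p : ℝ × ℝ => ps (F p.2) (fun x => ψ p.1 x))
      (Metric.ball t 1 ×ˢ Metric.ball ω₀ r) := by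
    refine continuousOn_tsum (u := fun x => M * (wt x * h x)) (fun x => ?_) (hs.mul_left M)
      (fun x p hp => ?_)
    · intro p hp
      have c1 : ContinuousAt (fun p : ℝ × ℝ => ψ p.1 x) p :=
        ((hψ.continuous_coord x).comp continuous_fst).continuousAt
      have c2 : ContinuousAt (fun p : ℝ × ℝ => F p.2 x) p :=
        ContinuousAt.comp (g := fun ω => F ω x) (f := fun p : ℝ × ℝ => p.2) (hc p.2 hp.2 x)
          continuousAt_snd
      exact (c1.mul (continuous_ofReal.continuousAt.comp c2)).continuousWithinAt
    · exact norm_mul_le_wt (hF p.2 hp.2) (fun y => (growth_lp (ψ p.1) y).trans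
        (mul_le_mul_of_nonneg_right (hM p.1 hp.1).1 (wt_pos y).le)) x
  exact this.continuousAt ((Metric.isOpen_ball.prod Metric.isOpen_ball).mem_nhds
    ⟨Metric.mem_ball_self one_pos, hω⟩)

end

/-! ### Two calculus lemmas -/

lemma contDiffAt_one_of_partial {f f₁ f₂ : ℝ → ℝ → ℂ} {s : Set (ℝ × ℝ)} (hs : IsOpen s)
    (h₁ : ∀ p ∈ s, HasDerivAt (fun t => f t p.2) (f₁ p.1 p.2) p.1)
    (h₂ : ∀ p ∈ s, HasDerivAt (fun y => f p.1 y) (f₂ p.1 p.2) p.2)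
    (c₁ : ∀ p ∈ s, ContinuousAt (fun p : ℝ × ℝ => f₁ p.1 p.2) p)
    (c₂ : ∀ p ∈ s, ContinuousAt (fun p : ℝ × ℝ => f₂ p.1 p.2) p) {p : ℝ × ℝ} (hp : p ∈ s) :
    ContDiffAt ℝ 1 (fun p : ℝ × ℝ => f p.1 p.2) p := by
  have hsp : ∀ {g : ℝ → ℝ → ℂ} {q : ℝ × ℝ}, ContinuousAt (fun p : ℝ × ℝ => g p.1 p.2) q →
      ContinuousAt (fun p : ℝ × ℝ => ContinuousLinearMap.toSpanSingleton ℝ (g p.1 p.2)) q :=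
    fun {g q} hg => (ContinuousLinearMap.toSpanSingletonCLE (𝕜 := ℝ)
      (E := ℂ)).continuous.continuousAt.comp hg
  rw [contDiffAt_one_iff]
  refine ⟨fun p => (ContinuousLinearMap.toSpanSingleton ℝ (f₁ p.1 p.2)).comp (.fst ℝ ℝ ℝ) +
    (ContinuousLinearMap.toSpanSingleton ℝ (f₂ p.1 p.2)).comp (.snd ℝ ℝ ℝ), s, hs.mem_nhds hp, fun q hq => ?_,
    fun q hq => ?_⟩
  · refine ContinuousAt.continuousWithinAt ?_
    exact ((hsp (c₁ q hq)).clm_comp continuousAt_const).add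
      ((hsp (c₂ q hq)).clm_comp continuousAt_const)
  · refine (hasStrictFDerivAt_uncurry_coprod (u := q) (f := f)
      (f₁ := fun t y => ContinuousLinearMap.toSpanSingleton ℝ (f₁ t y))
      (f₂ := fun t y => ContinuousLinearMap.toSpanSingleton ℝ (f₂ t y)) ?_ ?_ (hsp (c₁ q hq))
      (hsp (c₂ q hq))).hasFDerivAt
    · filter_upwards [hs.mem_nhds hq] with y hy using (h₁ y hy).hasFDerivAt
    · filter_upwards [hs.mem_nhds hq] with y hy using (h₂ y hy).hasFDerivAt

lemma contDiffAt_root {g : ℝ × ℝ → ℝ} {w : ℝ → ℝ} {t g' : ℝ} (hg : ContDiffAt ℝ 1 g (t, w t))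
    (hg' : HasDerivAt (fun y => g (t, y)) g' (w t)) (hne : g' ≠ 0) (hw : ContinuousAt w t)
    (h0 : ∀ᶠ s in 𝓝 t, g (s, w s) = 0) : ContDiffAt ℝ 1 w t := by
  have hf := (hg.differentiableAt one_ne_zero).hasFDerivAt
  have hinv : (fderiv ℝ g (t, w t) ∘L .inr ℝ ℝ ℝ).IsInvertible := by
    have h1 : HasFDerivAt (fun y => g (t, y)) (fderiv ℝ g (t, w t) ∘L .inr ℝ ℝ ℝ) (w t) :=
      HasFDerivAt.comp (w t) hf (hasFDerivAt_prodMk_right t (w t))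
    have h2 := h1.unique hg'.hasFDerivAt
    refine ⟨ContinuousLinearEquiv.unitsEquivAut ℝ (Units.mk0 g' hne), ?_⟩
    rw [h2]
    ext
    simp
  have h1 := hg.contDiffAt_implicitFunction one_ne_zero hinv
  refine h1.congr_of_eventuallyEq ?_
  have h2 := hg.eventually_apply_eq_iff_implicitFunction one_ne_zero hinv
  have h3 : Tendsto (fun s => (s, w s)) (𝓝 t) (𝓝 (t, w t)) := continuousAt_id.prodMk hw
  filter_upwards [h3.eventually h2, h0] with s hs hs0
  have := h0.self_of_nhds
  exact (hs.1 (by rw [hs0, this])).symm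

/-! ### The modulation function -/

/-- The scalar function of `ω` whose zeros are the frequencies of the orthogonal decompositions. -/
def modFun (σ : ℝ) (C : ℝ → ℝ) (u : ℤ → ℂ) (ω : ℝ) : ℝ :=
  ((ps (phi σ C ω) u).re * (ps (phi1 σ C ω) u).re + (ps (phi σ C ω) u).im * (ps (phi1 σ C ω) u).im) ^ 2 -
    nrm σ C ω ^ 2 * ((ps (phi1 σ C ω) u).re ^ 2 + (ps (phi1 σ C ω) u).im ^ 2)

/-- The phase factor of the decomposition. -/
def modPhase (σ : ℝ) (C : ℝ → ℝ) (u : ℤ → ℂ) (ω : ℝ) : ℂ :=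
  ps (phi1 σ C ω) u * (((ps (phi σ C ω) u).re * (ps (phi1 σ C ω) u).re +
    (ps (phi σ C ω) u).im * (ps (phi1 σ C ω) u).im) / (nrm σ C ω *
      ((ps (phi1 σ C ω) u).re ^ 2 + (ps (phi1 σ C ω) u).im ^ 2)) : ℝ)

/-- The derivative of `modFun`, as a function of the pairings. -/
def modPoly (A B D : ℂ) (N Δ : ℝ) : ℝ :=
  2 * (A.re * B.re + A.im * B.im) * (B.re ^ 2 + B.im ^ 2 + (A.re * D.re + A.im * D.im)) -
    4 * N * Δ * (B.re ^ 2 + B.im ^ 2) - 2 * N ^ 2 * (B.re * D.re + B.im * D.im)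

lemma hasDerivAt_re {f : ℝ → ℂ} {f' : ℂ} {t : ℝ} (hf : HasDerivAt f f' t) :
    HasDerivAt (fun s => (f s).re) f'.re t := reCLM.hasFDerivAt.comp_hasDerivAt t hf

lemma hasDerivAt_im {f : ℝ → ℂ} {f' : ℂ} {t : ℝ} (hf : HasDerivAt f f' t) :
    HasDerivAt (fun s => (f s).im) f'.im t := imCLM.hasFDerivAt.comp_hasDerivAt t hf

namespace Branch

variable {a : ℝ → ℝ} {σ ω₀ r : ℝ} {C : ℝ → ℝ} {h : ℤ → ℝ} {u : ℤ → ℂ} {M ω : ℝ}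

variable (hb : Branch a σ ω₀ r C h)
include hb

lemma hasDerivAt_ps_phi (hu : ∀ x, ‖u x‖ ≤ M * wt x) (hω : |ω - ω₀| < r) :
    HasDerivAt (fun ω => ps (phi σ C ω) u) (ps (phi1 σ C ω) u) ω :=
  DiscreteNLS.hasDerivAt_ps (fun _ h x => hb.hasDerivAt_phi h x) (fun _ h x => hb.phi_le h x)
    (fun _ h x => hb.phi1_le h x) hb.summable hu hω

lemma hasDerivAt_ps_phi1 (hu : ∀ x, ‖u x‖ ≤ M * wt x) (hω : |ω - ω₀| < r) :
    HasDerivAt (fun ω => ps (phi1 σ C ω) u) (ps (phi2 σ C ω) u) ω :=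
  DiscreteNLS.hasDerivAt_ps (fun _ h x => hb.hasDerivAt_phi1 h x) (fun _ h x => hb.phi1_le h x)
    (fun _ h x => hb.phi2_le h x) hb.summable hu hω

lemma hasDerivAt_nrm (hω : |ω - ω₀| < r) :
    HasDerivAt (nrm σ C) (2 * dlt σ C ω) ω := by
  have hs : Summable fun x => wt x * (2 * mass h * h x) := by
    refine (hb.summable.mul_left (2 * mass h)).congr fun x => by ring
  have hm := hb.mass_nonneg
  have bd : ∀ {f g : ℤ → ℝ}, (∀ x, |f x| ≤ h x) → (∀ x, |g x| ≤ h x) → ∀ x,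
      |f x * g x| ≤ mass h * h x := fun hf hg x => by
    rw [abs_mul]
    exact mul_le_mul ((hf x).trans (hb.h_le_mass x)) (hg x) (abs_nonneg _) hm
  have k := DiscreteNLS.hasDerivAt_ps (F := fun ω x => phi σ C ω x ^ 2)
    (F' := fun ω x => 2 * (phi σ C ω x * phi1 σ C ω x)) (h := fun x => 2 * mass h * h x)
    (u := fun _ => 1) (M := 1) (ω₀ := ω₀) (r := r) (ω := ω)
    (fun y hy x => by
      refine ((hb.hasDerivAt_phi hy x).pow 2).congr_deriv ?_
      simp; ring)
    (fun y hy x => by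
      have := bd (hb.phi_le hy) (hb.phi_le hy) x
      rw [sq]; nlinarith [hb.h_nonneg x, mul_nonneg hm (hb.h_nonneg x)])
    (fun y hy x => by
      have := bd (hb.phi_le hy) (hb.phi1_le hy) x
      rw [abs_mul, abs_two]; linarith) hs (fun x => by simpa using one_le_wt x) hω
  have k2 := hasDerivAt_re k
  have e1 : ∀ ω, (ps (fun x => phi σ C ω x ^ 2) fun _ => 1).re = nrm σ C ω := fun y => by
    unfold ps nrm
    simp only [one_mul]
    rw [← ofReal_tsum, ofReal_re]
  have e2 : (ps (fun x => 2 * (phi σ C ω x * phi1 σ C ω x)) fun _ => 1).re = 2 * dlt σ C ω := by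
    unfold ps dlt
    simp only [one_mul]
    rw [← ofReal_tsum, ofReal_re, tsum_mul_left]
  simp only [e1, e2] at k2
  exact k2

lemma hasDerivAt_modFun (hu : ∀ x, ‖u x‖ ≤ M * wt x) (hω : |ω - ω₀| < r) :
    HasDerivAt (modFun σ C u) (modPoly (ps (phi σ C ω) u) (ps (phi1 σ C ω) u) (ps (phi2 σ C ω) u)
      (nrm σ C ω) (dlt σ C ω)) ω := by
  have hA := hb.hasDerivAt_ps_phi hu hω
  have hB := hb.hasDerivAt_ps_phi1 hu hω
  have hN := hb.hasDerivAt_nrm hω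
  have k := ((((hasDerivAt_re hA).mul (hasDerivAt_re hB)).add
    ((hasDerivAt_im hA).mul (hasDerivAt_im hB))).pow 2).sub
    ((hN.pow 2).mul (((hasDerivAt_re hB).pow 2).add ((hasDerivAt_im hB).pow 2)))
  refine HasDerivAt.congr_deriv (f' := _) k ?_
  simp only [modPoly, Pi.add_apply, Pi.mul_apply, Pi.pow_apply]
  push_cast
  ring

end Branch

/-! ### Regularity in time -/

section
variable {a : ℝ → ℝ} {σ ω₀ r : ℝ} {C : ℝ → ℝ} {h : ℤ → ℝ} {ψ : ℝ → ℓ²} {t ω : ℝ}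

lemma IsSolution.hasDerivAt_ps_phi (ha : Continuous a) (hψ : IsSolution a ψ) (hb : Branch a σ ω₀ r C h)
    (hω : |ω - ω₀| < r) (t : ℝ) :
    HasDerivAt (fun s => ps (phi σ C ω) (fun x => ψ s x))
      (I * (ω * ps (phi σ C ω) (fun x => ψ t x) - (coup σ ω * C ω : ℝ) * ψ t 0 +
        C ω * force a (ψ t 0))) t := by
  refine (hψ.hasDerivAt_ps ha (hb.phi_le hω) hb.summable t).congr_deriv ?_
  have s1 := (summable_ps (hb.phi_le hω) hb.summable (growth_lp (ψ t))).hasSum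
  have s2 := hasSum_single (f := fun x => ψ t x * ((if x = 0 then coup σ ω * C ω else 0 : ℝ) : ℂ)) 0
    (fun x hx => by simp [hx])
  have s3 := (s1.mul_left (ω : ℂ)).sub s2
  have e : ps (fun x => phi σ C ω (x + 1) + phi σ C ω (x - 1) - 2 * phi σ C ω x) (fun x => ψ t x) =
      ω * ps (phi σ C ω) (fun x => ψ t x) - ψ t 0 * (coup σ ω * C ω : ℝ) := by
    unfold ps
    rw [show ((coup σ ω * C ω : ℝ) : ℂ) = ((if (0 : ℤ) = 0 then coup σ ω * C ω else 0 : ℝ) : ℂ) by simp,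
      ← s3.tsum_eq]
    refine tsum_congr fun x => ?_
    dsimp only
    rw [phi_step hb.sign (hb.two_lt ω hω)]
    push_cast
    ring
  rw [e, phi_zero]
  ring

lemma IsSolution.hasDerivAt_ps_phi1 (ha : Continuous a) (hψ : IsSolution a ψ) (hb : Branch a σ ω₀ r C h)
    (hω : |ω - ω₀| < r) (t : ℝ) :
    HasDerivAt (fun s => ps (phi1 σ C ω) (fun x => ψ s x))
      (I * (ω * ps (phi1 σ C ω) (fun x => ψ t x) + ps (phi σ C ω) (fun x => ψ t x) -
        ((ω + 2) / coup σ ω * C ω + coup σ ω * deriv C ω : ℝ) * ψ t 0 +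
        deriv C ω * force a (ψ t 0))) t := by
  refine (hψ.hasDerivAt_ps ha (hb.phi1_le hω) hb.summable t).congr_deriv ?_
  have s0 := (summable_ps (hb.phi_le hω) hb.summable (growth_lp (ψ t))).hasSum
  have s1 := (summable_ps (hb.phi1_le hω) hb.summable (growth_lp (ψ t))).hasSum
  have s2 := hasSum_single (f := fun x => ψ t x *
    ((if x = 0 then (ω + 2) / coup σ ω * C ω + coup σ ω * deriv C ω else 0 : ℝ) : ℂ)) 0
    (fun x hx => by simp [hx])
  have s3 := ((s1.mul_left (ω : ℂ)).add s0).sub s2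
  have e : ps (fun x => phi1 σ C ω (x + 1) + phi1 σ C ω (x - 1) - 2 * phi1 σ C ω x) (fun x => ψ t x) =
      ω * ps (phi1 σ C ω) (fun x => ψ t x) + ps (phi σ C ω) (fun x => ψ t x) -
        ψ t 0 * ((ω + 2) / coup σ ω * C ω + coup σ ω * deriv C ω : ℝ) := by
    unfold ps
    have s4 := s3.tsum_eq
    simp only [if_true] at s4
    rw [← s4]
    refine tsum_congr fun x => ?_
    dsimp only
    rw [hb.phi1_step hω]
    push_cast
    ring
  rw [e, phi1_zero]
  ring

lemma IsSolution.continuousAt_ps_phi (ha : Continuous a) (hψ : IsSolution a ψ) (hb : Branch a σ ω₀ r C h)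
    (hω : |ω - ω₀| < r) :
    ContinuousAt (fun p : ℝ × ℝ => ps (phi σ C p.2) (fun x => ψ p.1 x)) (t, ω) :=
  hψ.continuousAt_ps ha (fun _ h => hb.phi_le h) (fun _ h x => (hb.hasDerivAt_phi h x).continuousAt)
    hb.summable hω

lemma IsSolution.continuousAt_ps_phi1 (ha : Continuous a) (hψ : IsSolution a ψ) (hb : Branch a σ ω₀ r C h)
    (hω : |ω - ω₀| < r) :
    ContinuousAt (fun p : ℝ × ℝ => ps (phi1 σ C p.2) (fun x => ψ p.1 x)) (t, ω) :=
  hψ.continuousAt_ps ha (fun _ h => hb.phi1_le h) (fun _ h x => (hb.hasDerivAt_phi1 h x).continuousAt)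
    hb.summable hω

lemma continuousAt_ofReal {g : ℝ × ℝ → ℝ} {p : ℝ × ℝ} (hg : ContinuousAt g p) :
    ContinuousAt (fun p => (g p : ℂ)) p := continuous_ofReal.continuousAt.comp hg

lemma isOpen_strip (ω₀ r : ℝ) : IsOpen {p : ℝ × ℝ | |p.2 - ω₀| < r} :=
  isOpen_lt (by fun_prop) continuous_const

lemma IsSolution.contDiffAt_ps_phi (ha : Continuous a) (hψ : IsSolution a ψ) (hb : Branch a σ ω₀ r C h)
    (hω : |ω - ω₀| < r) :
    ContDiffAt ℝ 1 (fun p : ℝ × ℝ => ps (phi σ C p.2) (fun x => ψ p.1 x)) (t, ω) := by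
  refine contDiffAt_one_of_partial (f := fun t ω => ps (phi σ C ω) (fun x => ψ t x))
    (f₁ := fun t ω => I * (ω * ps (phi σ C ω) (fun x => ψ t x) - (coup σ ω * C ω : ℝ) * ψ t 0 +
        C ω * force a (ψ t 0)))
    (isOpen_strip ω₀ r) (fun p hp => hψ.hasDerivAt_ps_phi ha hb hp p.1)
    (fun p hp => hb.hasDerivAt_ps_phi (growth_lp (ψ p.1)) hp) (fun p hp => ?_)
    (f₂ := fun t ω => ps (phi1 σ C ω) (fun x => ψ t x))
    (fun p hp => hψ.continuousAt_ps_phi1 (t := p.1) ha hb hp) hω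
  have c1 : ContinuousAt (fun p : ℝ × ℝ => ps (phi σ C p.2) (fun x => ψ p.1 x)) p :=
    hψ.continuousAt_ps_phi ha hb hp
  have c2 : ContinuousAt (fun p : ℝ × ℝ => ψ p.1 0) p :=
    ((hψ.continuous_coord 0).comp continuous_fst).continuousAt
  have c3 : ContinuousAt (fun p : ℝ × ℝ => force a (ψ p.1 0)) p :=
    ((continuous_force ha).comp ((hψ.continuous_coord 0).comp continuous_fst)).continuousAt
  have c4 : ContinuousAt (fun p : ℝ × ℝ => C p.2) p :=
    ContinuousAt.comp (f := fun p : ℝ × ℝ => p.2) (hb.hasDerivAt_C hp).continuousAt continuousAt_snd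
  have c5 : ContinuousAt (fun p : ℝ × ℝ => coup σ p.2) p :=
    ContinuousAt.comp (f := fun p : ℝ × ℝ => p.2)
      (hasDerivAt_coup hb.sign (hb.two_lt _ hp)).continuousAt continuousAt_snd
  exact continuousAt_const.mul ((((continuousAt_ofReal continuousAt_snd).mul c1).sub
    ((continuousAt_ofReal (c5.mul c4)).mul c2)).add ((continuousAt_ofReal c4).mul c3))

lemma IsSolution.contDiffAt_ps_phi1 (ha : Continuous a) (hψ : IsSolution a ψ) (hb : Branch a σ ω₀ r C h)
    (hω : |ω - ω₀| < r) :
    ContDiffAt ℝ 1 (fun p : ℝ × ℝ => ps (phi1 σ C p.2) (fun x => ψ p.1 x)) (t, ω) := by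
  refine contDiffAt_one_of_partial (f := fun t ω => ps (phi1 σ C ω) (fun x => ψ t x))
    (f₁ := fun t ω => I * (ω * ps (phi1 σ C ω) (fun x => ψ t x) + ps (phi σ C ω) (fun x => ψ t x) -
        ((ω + 2) / coup σ ω * C ω + coup σ ω * deriv C ω : ℝ) * ψ t 0 +
        deriv C ω * force a (ψ t 0)))
    (isOpen_strip ω₀ r) (fun p hp => hψ.hasDerivAt_ps_phi1 ha hb hp p.1)
    (fun p hp => hb.hasDerivAt_ps_phi1 (growth_lp (ψ p.1)) hp) (fun p hp => ?_)
    (f₂ := fun t ω => ps (phi2 σ C ω) (fun x => ψ t x))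
    (fun p hp => hψ.continuousAt_ps (t := p.1) ha (fun _ h => hb.phi2_le h)
      (fun _ h x => hb.continuousAt_phi2 h x) hb.summable hp) hω
  have c0 : ContinuousAt (fun p : ℝ × ℝ => ps (phi σ C p.2) (fun x => ψ p.1 x)) p :=
    hψ.continuousAt_ps_phi ha hb hp
  have c1 : ContinuousAt (fun p : ℝ × ℝ => ps (phi1 σ C p.2) (fun x => ψ p.1 x)) p :=
    hψ.continuousAt_ps_phi1 ha hb hp
  have c2 : ContinuousAt (fun p : ℝ × ℝ => ψ p.1 0) p :=
    ((hψ.continuous_coord 0).comp continuous_fst).continuousAt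
  have c3 : ContinuousAt (fun p : ℝ × ℝ => force a (ψ p.1 0)) p :=
    ((continuous_force ha).comp ((hψ.continuous_coord 0).comp continuous_fst)).continuousAt
  have c4 : ContinuousAt (fun p : ℝ × ℝ => C p.2) p :=
    ContinuousAt.comp (f := fun p : ℝ × ℝ => p.2) (hb.hasDerivAt_C hp).continuousAt continuousAt_snd
  have c5 : ContinuousAt (fun p : ℝ × ℝ => coup σ p.2) p :=
    ContinuousAt.comp (f := fun p : ℝ × ℝ => p.2)
      (hasDerivAt_coup hb.sign (hb.two_lt _ hp)).continuousAt continuousAt_snd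
  have c6 : ContinuousAt (fun p : ℝ × ℝ => deriv C p.2) p :=
    ContinuousAt.comp (f := fun p : ℝ × ℝ => p.2) (hb.hasDerivAt_C1 hp).continuousAt continuousAt_snd
  have hne : coup σ p.2 ≠ 0 := hb.coup_ne hp
  have c7 : ContinuousAt (fun p : ℝ × ℝ => (p.2 + 2) / coup σ p.2 * C p.2 + coup σ p.2 * deriv C p.2) p :=
    (((continuousAt_snd.add continuousAt_const).div c5 hne).mul c4).add (c5.mul c6)
  exact continuousAt_const.mul (((((continuousAt_ofReal continuousAt_snd).mul c1).add c0).sub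
    ((continuousAt_ofReal c7).mul c2)).add ((continuousAt_ofReal c6).mul c3))

end

/-! ### Phase rotations -/

lemma inner_rot {e : ℂ} (he : ‖e‖ = 1) (A B : ℂ) :
    (e * A).re * (e * B).re + (e * A).im * (e * B).im = A.re * B.re + A.im * B.im := by
  have h : e.re ^ 2 + e.im ^ 2 = 1 := by
    have := Complex.sq_norm e
    rw [he, normSq_apply] at this
    linarith
  simp only [mul_re, mul_im]
  linear_combination (A.re * B.re + A.im * B.im) * h

lemma sq_rot {e : ℂ} (he : ‖e‖ = 1) (B : ℂ) :
    (e * B).re ^ 2 + (e * B).im ^ 2 = B.re ^ 2 + B.im ^ 2 := by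
  have := inner_rot he B B
  linarith

lemma modFun_rot (σ : ℝ) (C : ℝ → ℝ) {e : ℂ} (he : ‖e‖ = 1) (v : ℤ → ℂ) (ω : ℝ) :
    modFun σ C (fun x => e * v x) ω = modFun σ C v ω := by
  simp only [modFun, ps_smul, inner_rot he, sq_rot he]

lemma modPhase_rot (σ : ℝ) (C : ℝ → ℝ) {e : ℂ} (he : ‖e‖ = 1) (v : ℤ → ℂ) (ω : ℝ) :
    modPhase σ C (fun x => e * v x) ω = e * modPhase σ C v ω := by
  simp only [modPhase, ps_smul, inner_rot he, sq_rot he, mul_assoc]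

lemma modPoly_rot {e : ℂ} (he : ‖e‖ = 1) (A B D : ℂ) (N Δ : ℝ) :
    modPoly (e * A) (e * B) (e * D) N Δ = modPoly A B D N Δ := by
  simp only [modPoly, inner_rot he, sq_rot he]

lemma conj_mul_self {e : ℂ} (he : ‖e‖ = 1) : conj e * e = 1 := by
  rw [mul_comm, mul_conj, normSq_eq_norm_sq, he]; norm_num

/-- At a zero of `modFun`, the phase factor is unimodular and gives the orthogonality relations. -/
lemma modPhase_spec {σ : ℝ} {C : ℝ → ℝ} {u : ℤ → ℂ} {ω : ℝ} (h0 : modFun σ C u ω = 0)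
    (hN : nrm σ C ω ≠ 0) (hB : ps (phi1 σ C ω) u ≠ 0) :
    ‖modPhase σ C u ω‖ = 1 ∧
    (conj (modPhase σ C u ω) * ps (phi σ C ω) u).re = nrm σ C ω ∧
    (conj (modPhase σ C u ω) * ps (phi1 σ C ω) u).im = 0 := by
  unfold modFun at h0
  unfold modPhase
  set A := ps (phi σ C ω) u
  set B := ps (phi1 σ C ω) u
  set N := nrm σ C ω
  have hS : 0 < B.re ^ 2 + B.im ^ 2 := by
    have := normSq_pos.2 hB
    rw [normSq_apply] at this
    linarith
  have hS' := hS.ne'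
  refine ⟨?_, ?_, ?_⟩
  · have : ‖B * (((A.re * B.re + A.im * B.im) / (N * (B.re ^ 2 + B.im ^ 2)) : ℝ) : ℂ)‖ ^ 2 = 1 := by
      rw [Complex.sq_norm, normSq_apply]
      simp only [mul_re, mul_im, ofReal_re, ofReal_im, mul_zero, sub_zero, zero_add]
      field_simp
      linear_combination h0
    exact (pow_eq_one_iff_of_nonneg (norm_nonneg _) two_ne_zero).1 this
  · simp only [map_mul, conj_ofReal, mul_re, mul_im, conj_re, conj_im, ofReal_re, ofReal_im]
    field_simp
    linear_combination h0
  · simp only [map_mul, conj_ofReal, mul_re, mul_im, conj_re, conj_im, ofReal_re, ofReal_im]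
    ring

/-! ### Continuity of the pairings in the frequency -/

lemma continuousAt_ps_param {F : ℝ → ℤ → ℝ} {h : ℤ → ℝ} {u : ℤ → ℂ} {M ω₀ r ω : ℝ}
    (hF : ∀ ω, |ω - ω₀| < r → ∀ x, |F ω x| ≤ h x)
    (hc : ∀ ω, |ω - ω₀| < r → ∀ x, ContinuousAt (fun ω => F ω x) ω)
    (hs : Summable fun x => wt x * h x) (hu : ∀ x, ‖u x‖ ≤ M * wt x) (hω : |ω - ω₀| < r) :
    ContinuousAt (fun ω => ps (F ω) u) ω := by
  have : ContinuousOn (fun ω => ps (F ω) u) (Metric.ball ω₀ r) :=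
    continuousOn_tsum (fun x y hy => (continuousAt_const.mul
      (continuous_ofReal.continuousAt.comp (hc y hy x))).continuousWithinAt) (hs.mul_left M)
      (fun x y hy => norm_mul_le_wt (hF y hy) hu x)
  exact this.continuousAt (Metric.isOpen_ball.mem_nhds hω)

namespace Branch

variable {a : ℝ → ℝ} {σ ω₀ r : ℝ} {C : ℝ → ℝ} {h : ℤ → ℝ} {u : ℤ → ℂ} {M ω : ℝ}

lemma abs_mul_le (hb : Branch a σ ω₀ r C h) {f g : ℤ → ℝ} (hf : ∀ x, |f x| ≤ h x)
    (hg : ∀ x, |g x| ≤ h x) (x : ℤ) : |f x * g x| ≤ mass h * h x := by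
  rw [abs_mul]
  exact mul_le_mul ((hf x).trans (hb.h_le_mass x)) (hg x) (abs_nonneg _) hb.mass_nonneg

lemma summable_mul (hb : Branch a σ ω₀ r C h) {f g : ℤ → ℝ} (hf : ∀ x, |f x| ≤ h x)
    (hg : ∀ x, |g x| ≤ h x) : Summable fun x => f x * g x :=
  Summable.of_norm_bounded ((summable_of_wt hb.h_nonneg hb.summable).mul_left (mass h))
    (hb.abs_mul_le hf hg)

lemma ps_ofReal (f g : ℤ → ℝ) : ps f (fun x => (g x : ℂ)) = ((∑' x, g x * f x : ℝ) : ℂ) := by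
  unfold ps; rw [ofReal_tsum]; exact tsum_congr fun x => by push_cast; rfl

lemma ps_phi_phi (σ : ℝ) (C : ℝ → ℝ) (ω : ℝ) :
    ps (phi σ C ω) (fun x => (phi σ C ω x : ℂ)) = nrm σ C ω := by
  rw [ps_ofReal, nrm]; simp only [sq]

lemma ps_phi1_phi (σ : ℝ) (C : ℝ → ℝ) (ω : ℝ) :
    ps (phi1 σ C ω) (fun x => (phi σ C ω x : ℂ)) = dlt σ C ω := by
  rw [ps_ofReal, dlt]

lemma nrm_pos (hb : Branch a σ ω₀ r C h) (hω : |ω - ω₀| < r) : 0 < nrm σ C ω := by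
  have hs : Summable fun x => phi σ C ω x ^ 2 := by
    simpa only [sq] using hb.summable_mul (hb.phi_le hω) (hb.phi_le hω)
  have := hs.le_tsum 0 fun x _ => sq_nonneg _
  rw [phi_zero] at this
  exact lt_of_lt_of_le (pow_pos (hb.pos ω hω) 2) this

lemma abs_dlt_le (hb : Branch a σ ω₀ r C h) (hω : |ω - ω₀| < r) :
    |dlt σ C ω| ≤ mass h * mass h := by
  have := norm_ps_le (hb.phi1_le hω) hb.summable (hb.growth (hb.phi_le hω))
  rwa [ps_phi1_phi, norm_real] at this

lemma continuousAt_dlt (hb : Branch a σ ω₀ r C h) (hω : |ω - ω₀| < r) :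
    ContinuousAt (dlt σ C) ω := by
  have hs : Summable fun x => wt x * (mass h * h x) :=
    (hb.summable.mul_left (mass h)).congr fun x => by ring
  have k := continuousAt_ps_param (F := fun ω x => phi σ C ω x * phi1 σ C ω x) (u := fun _ => 1) (M := 1)
    (fun y hy => hb.abs_mul_le (hb.phi_le hy) (hb.phi1_le hy))
    (fun y hy x => (hb.hasDerivAt_phi hy x).continuousAt.mul (hb.hasDerivAt_phi1 hy x).continuousAt)
    hs (fun x => by simpa using one_le_wt x) hω
  have k2 := continuous_re.continuousAt.comp k
  refine k2.congr (Eventually.of_forall fun y => ?_)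
  simp only [Function.comp, ps, one_mul, dlt]
  rw [← ofReal_tsum, ofReal_re]

lemma norm_ps_sub_le_of_close (hb : Branch a σ ω₀ r C h) {f : ℤ → ℝ} (hf : ∀ x, |f x| ≤ h x) {v : ℤ → ℂ}
    {ε : ℝ} (hv : ∀ x, ‖v x - phi σ C ω₀ x‖ ≤ ε * wt x) :
    ‖ps f v - ps f (fun x => (phi σ C ω₀ x : ℂ))‖ ≤ ε * mass h := by
  have g0 := hb.growth (hb.phi_le hb.self)
  have g1 : ∀ x, ‖v x‖ ≤ (ε + mass h) * wt x := fun x => by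
    have := norm_add_le (v x - phi σ C ω₀ x) (phi σ C ω₀ x)
    rw [sub_add_cancel] at this
    linarith [hv x, g0 x]
  rw [← ps_sub hf hb.summable g1 g0]
  exact norm_ps_le hf hb.summable hv

lemma modPoly_ref (A : ℝ) (B D N Δ : ℝ) (hA : A = N) (hB : B = Δ) :
    modPoly (A : ℂ) (B : ℂ) (D : ℂ) N Δ = -(2 * N * Δ ^ 3) := by
  subst hA hB
  simp only [modPoly, ofReal_re, ofReal_im]; ring

/-- Nondegeneracy of `modFun` near the reference wave. -/
lemma exists_slope (hb : Branch a σ ω₀ r C h) (hΔ : dlt σ C ω₀ ≠ 0) : ∃ ε₁ r₁ : ℝ, 0 < ε₁ ∧ 0 < r₁ ∧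
    r₁ < r ∧ ∀ (v : ℤ → ℂ), (∀ x, ‖v x - phi σ C ω₀ x‖ ≤ ε₁ * wt x) → ∀ ω, |ω - ω₀| ≤ r₁ →
      ps (phi1 σ C ω) v ≠ 0 ∧
      |modPoly (ps (phi σ C ω) v) (ps (phi1 σ C ω) v) (ps (phi2 σ C ω) v) (nrm σ C ω) (dlt σ C ω) +
        2 * nrm σ C ω₀ * dlt σ C ω₀ ^ 3| ≤ |nrm σ C ω₀ * dlt σ C ω₀ ^ 3| := by
  set φ : ℤ → ℂ := fun x => (phi σ C ω₀ x : ℂ) with hφ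
  have g0 : ∀ x, ‖φ x‖ ≤ mass h * wt x := hb.growth (hb.phi_le hb.self)
  have hN := hb.nrm_pos hb.self
  let H : ℂ × ℂ × ℂ × ℝ × ℝ → ℝ := fun p => modPoly p.1 p.2.1 p.2.2.1 p.2.2.2.1 p.2.2.2.2
  have hH : Continuous H := by
    simp only [H, modPoly]
    fun_prop
  let P : ℝ → ℂ × ℂ × ℂ × ℝ × ℝ := fun ω =>
    (ps (phi σ C ω) φ, ps (phi1 σ C ω) φ, ps (phi2 σ C ω) φ, nrm σ C ω, dlt σ C ω)
  have hP : ContinuousAt P ω₀ :=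
    (hb.hasDerivAt_ps_phi g0 hb.self).continuousAt.prodMk
      ((hb.hasDerivAt_ps_phi1 g0 hb.self).continuousAt.prodMk
      ((continuousAt_ps_param (fun _ h => hb.phi2_le h) (fun _ h x => hb.continuousAt_phi2 h x)
        hb.summable g0 hb.self).prodMk
      ((hb.hasDerivAt_nrm hb.self).continuousAt.prodMk (hb.continuousAt_dlt hb.self))))
  have hH0 : H (P ω₀) = -(2 * nrm σ C ω₀ * dlt σ C ω₀ ^ 3) := by
    simp only [H, P, hφ, ps_ofReal]
    exact modPoly_ref _ _ _ _ _ (by simp only [nrm, sq]) rfl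
  have hne : 0 < |nrm σ C ω₀ * dlt σ C ω₀ ^ 3| := abs_pos.2 (mul_ne_zero hN.ne' (pow_ne_zero 3 hΔ))
  obtain ⟨δ, hδ, hδH⟩ := Metric.continuousAt_iff.1 hH.continuousAt _ hne
  obtain ⟨δ', hδ', hδ1, hδ2⟩ : ∃ δ' : ℝ, 0 < δ' ∧ δ' ≤ δ / 2 ∧ δ' < |dlt σ C ω₀| / 2 :=
    ⟨min (δ / 2) (|dlt σ C ω₀| / 4), lt_min (by linarith) (by have := abs_pos.2 hΔ; linarith),
      min_le_left _ _, (min_le_right _ _).trans_lt (by have := abs_pos.2 hΔ; linarith)⟩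
  obtain ⟨ρ, hρ, hρP⟩ := Metric.continuousAt_iff.1 hP _ hδ'
  have hm := hb.mass_nonneg
  refine ⟨δ' / (mass h + 1), min (ρ / 2) (r / 2), by positivity, lt_min (by linarith)
    (by linarith [hb.hr]), (min_le_right _ _).trans_lt (by linarith [hb.hr]), fun v hv ω hω => ?_⟩
  have hωr : |ω - ω₀| < r := lt_of_le_of_lt (hω.trans (min_le_right _ _)) (by linarith [hb.hr])
  have hωρ : dist ω ω₀ < ρ := lt_of_le_of_lt (hω.trans (min_le_left _ _)) (by linarith)
  have hPω := hρP hωρ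
  have em : δ' / (mass h + 1) * mass h < δ' := by
    rw [div_mul_eq_mul_div, div_lt_iff₀ (by positivity)]; nlinarith
  have cl : ∀ {f : ℤ → ℝ}, (∀ x, |f x| ≤ h x) → dist (ps f v) (ps f φ) < δ' := fun hf => by
    rw [dist_eq_norm]; exact (hb.norm_ps_sub_le_of_close hf hv).trans_lt em
  have c1 := cl (hb.phi_le hωr)
  have c2 := cl (hb.phi1_le hωr)
  have c3 := cl (hb.phi2_le hωr)
  constructor
  · intro h0
    have d2 : dist (ps (phi1 σ C ω) φ) (dlt σ C ω₀ : ℂ) < δ' := by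
      rw [← ps_phi1_phi]
      exact lt_of_le_of_lt (le_trans (le_max_left _ _) (le_max_right _ _)) hPω
    have := dist_triangle (ps (phi1 σ C ω) v) (ps (phi1 σ C ω) φ) (dlt σ C ω₀ : ℂ)
    rw [h0] at this c2
    rw [dist_eq_norm (0 : ℂ) (dlt σ C ω₀ : ℂ), zero_sub, norm_neg, norm_real, norm_eq_abs] at this
    linarith
  · have hd : dist ((ps (phi σ C ω) v, ps (phi1 σ C ω) v, ps (phi2 σ C ω) v, nrm σ C ω, dlt σ C ω) :
        ℂ × ℂ × ℂ × ℝ × ℝ) (P ω₀) < δ := by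
      have t1 : dist ((ps (phi σ C ω) v, ps (phi1 σ C ω) v, ps (phi2 σ C ω) v, nrm σ C ω, dlt σ C ω) :
        ℂ × ℂ × ℂ × ℝ × ℝ) (P ω) < δ' := by
        simp only [P, Prod.dist_eq, dist_self]
        exact max_lt c1 (max_lt c2 (max_lt c3 (by simpa using hδ')))
      linarith [dist_triangle ((ps (phi σ C ω) v, ps (phi1 σ C ω) v, ps (phi2 σ C ω) v, nrm σ C ω, dlt σ C ω) :
        ℂ × ℂ × ℂ × ℝ × ℝ) (P ω) (P ω₀)]
    have := hδH hd
    rw [hH0, Real.dist_eq, sub_neg_eq_add] at this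
    exact this.le

end Branch

/-- The function defining `modFun`, as a function of the pairings. -/
def modVal (N : ℝ) (p : ℂ × ℂ) : ℝ :=
  (p.1.re * p.2.re + p.1.im * p.2.im) ^ 2 - N ^ 2 * (p.2.re ^ 2 + p.2.im ^ 2)

/-- The phase factor, as a function of the pairings. -/
def phaseVal (p : ℂ × ℂ × ℝ) : ℂ :=
  p.2.1 * (((p.1.re * p.2.1.re + p.1.im * p.2.1.im) / (p.2.2 * (p.2.1.re ^ 2 + p.2.1.im ^ 2)) : ℝ) : ℂ)

lemma exists_lipschitz_near {E F : Type*} [NormedAddCommGroup E] [NormedSpace ℝ E]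
    [NormedAddCommGroup F] [NormedSpace ℝ F] {f : E → F} {p : E} (hf : ContDiffAt ℝ 1 f p) :
    ∃ K δ : ℝ, 0 ≤ K ∧ 0 < δ ∧ ∀ q, ‖q - p‖ < δ → ‖f q - f p‖ ≤ K * ‖q - p‖ := by
  obtain ⟨K, s, hs, hK⟩ := hf.exists_lipschitzOnWith
  obtain ⟨δ, hδ, hsub⟩ := Metric.mem_nhds_iff.1 hs
  refine ⟨K, δ, K.2, hδ, fun q hq => ?_⟩
  have := hK.dist_le_mul q (hsub (by rwa [Metric.mem_ball, dist_eq_norm])) p (mem_of_mem_nhds hs)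
  rwa [dist_eq_norm, dist_eq_norm] at this

lemma contDiff_re : ContDiff ℝ 1 re := reCLM.contDiff

lemma contDiff_im : ContDiff ℝ 1 im := imCLM.contDiff

lemma contDiffAt_modVal (N : ℝ) (p : ℂ × ℂ) : ContDiffAt ℝ 1 (modVal N) p := by
  have h1 : ContDiff ℝ 1 fun p : ℂ × ℂ => p.1.re := contDiff_re.comp contDiff_fst
  have h2 : ContDiff ℝ 1 fun p : ℂ × ℂ => p.1.im := contDiff_im.comp contDiff_fst
  have h3 : ContDiff ℝ 1 fun p : ℂ × ℂ => p.2.re := contDiff_re.comp contDiff_snd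
  have h4 : ContDiff ℝ 1 fun p : ℂ × ℂ => p.2.im := contDiff_im.comp contDiff_snd
  exact ((((h1.mul h3).add (h2.mul h4)).pow 2).sub
    (contDiff_const.mul ((h3.pow 2).add (h4.pow 2)))).contDiffAt

lemma contDiffAt_phaseVal {p : ℂ × ℂ × ℝ} (h0 : p.2.2 * (p.2.1.re ^ 2 + p.2.1.im ^ 2) ≠ 0) :
    ContDiffAt ℝ 1 phaseVal p := by
  have g1 : ContDiff ℝ 1 fun p : ℂ × ℂ × ℝ => p.2.1 := contDiff_fst.comp contDiff_snd
  have h1 : ContDiff ℝ 1 fun p : ℂ × ℂ × ℝ => p.1.re := contDiff_re.comp contDiff_fst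
  have h2 : ContDiff ℝ 1 fun p : ℂ × ℂ × ℝ => p.1.im := contDiff_im.comp contDiff_fst
  have h3 : ContDiff ℝ 1 fun p : ℂ × ℂ × ℝ => p.2.1.re := contDiff_re.comp g1
  have h4 : ContDiff ℝ 1 fun p : ℂ × ℂ × ℝ => p.2.1.im := contDiff_im.comp g1
  have h5 : ContDiff ℝ 1 fun p : ℂ × ℂ × ℝ => p.2.2 := contDiff_snd.comp contDiff_snd
  exact g1.contDiffAt.mul (ofRealCLM.contDiff.contDiffAt.comp p
    (((h1.mul h3).add (h2.mul h4)).contDiffAt.div (h5.mul ((h3.pow 2).add (h4.pow 2))).contDiffAt h0))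

namespace Branch

variable {a : ℝ → ℝ} {σ ω₀ r : ℝ} {C : ℝ → ℝ} {h : ℤ → ℝ}

lemma abs_nrm_sub_le (hb : Branch a σ ω₀ r C h) {ω : ℝ} (hω : |ω - ω₀| < r) :
    |nrm σ C ω - nrm σ C ω₀| ≤ 2 * (mass h * mass h) * |ω - ω₀| :=
  (convex_ball ω₀ r).norm_image_sub_le_of_norm_hasDerivWithin_le
    (fun y hy => (hb.hasDerivAt_nrm hy).hasDerivWithinAt)
    (fun y hy => by
      rw [norm_eq_abs, abs_mul, abs_two]
      have := hb.abs_dlt_le hy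
      linarith) hb.self hω

set_option maxHeartbeats 1000000 in
/-- Existence and uniqueness of the orthogonal decomposition near the reference wave. -/
theorem exists_modulation (hb : Branch a σ ω₀ r C h) (hΔ : dlt σ C ω₀ ≠ 0) :
    ∃ ε₁ r₁ L m : ℝ, 0 < ε₁ ∧ 0 < r₁ ∧ r₁ < r ∧ 0 ≤ L ∧ 0 < m ∧
    ∀ (u : ℤ → ℂ) (e : ℂ) (ε : ℝ), ‖e‖ = 1 → 0 ≤ ε → ε ≤ ε₁ →
    (∀ x, ‖u x - e * phi σ C ω₀ x‖ ≤ ε * wt x) →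
    (∀ ω ω', |ω - ω₀| ≤ r₁ → |ω' - ω₀| ≤ r₁ → m * |ω - ω'| ≤ |modFun σ C u ω - modFun σ C u ω'|) ∧
    (∀ ω, |ω - ω₀| ≤ r₁ → ps (phi1 σ C ω) u ≠ 0 ∧
      modPoly (ps (phi σ C ω) u) (ps (phi1 σ C ω) u) (ps (phi2 σ C ω) u) (nrm σ C ω) (dlt σ C ω) ≠ 0) ∧
    ∃ ω, |ω - ω₀| ≤ r₁ ∧ |ω - ω₀| ≤ L * ε ∧ modFun σ C u ω = 0 ∧ ‖modPhase σ C u ω - e‖ ≤ L * ε ∧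
      ∀ x, ‖conj (modPhase σ C u ω) * u x - phi σ C ω x‖ ≤ L * ε * wt x := by
  obtain ⟨εa, r₁, hεa, hr₁, hr₁r, hslope⟩ := hb.exists_slope hΔ
  have hN := hb.nrm_pos hb.self
  have hm0 := hb.mass_nonneg
  set N0 := nrm σ C ω₀
  set Δ0 := dlt σ C ω₀
  set μ := mass h
  set φ : ℤ → ℂ := fun x => (phi σ C ω₀ x : ℂ) with hφ
  have g0 : ∀ x, ‖φ x‖ ≤ μ * wt x := hb.growth (hb.phi_le hb.self)
  obtain ⟨K1, δ1, hK1, hδ1, hL1⟩ := exists_lipschitz_near (contDiffAt_modVal N0 ((N0 : ℂ), (Δ0 : ℂ)))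
  have hS : N0 * ((Δ0 : ℂ).re ^ 2 + (Δ0 : ℂ).im ^ 2) ≠ 0 := by
    simp only [ofReal_re, ofReal_im]; positivity
  obtain ⟨K2, δ2, hK2, hδ2, hL2⟩ := exists_lipschitz_near
    (contDiffAt_phaseVal (p := ((N0 : ℂ), (Δ0 : ℂ), N0)) hS)
  have v1 : modVal N0 ((N0 : ℂ), (Δ0 : ℂ)) = 0 := by
    simp only [modVal, ofReal_re, ofReal_im]; ring
  have v2 : phaseVal ((N0 : ℂ), (Δ0 : ℂ), N0) = 1 := by
    simp only [phaseVal, ofReal_re, ofReal_im]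
    rw [← ofReal_mul]
    norm_cast
    field_simp
    ring
  set c := |N0 * Δ0 ^ 3| with hc
  have hcpos : 0 < c := abs_pos.2 (mul_ne_zero hN.ne' (pow_ne_zero 3 hΔ))
  set L1 := K1 * μ / c with hL1def
  have hL1n : 0 ≤ L1 := by positivity
  set L2 := μ + 2 * (μ * μ) * L1 with hL2def
  have hL2n : 0 ≤ L2 := by positivity
  set L := L1 + K2 * L2 * (1 + μ) + 1 + μ * L1 with hLdef
  have hpos1 : 0 ≤ K2 * L2 := by positivity
  have hLn : 0 ≤ L := by positivity
  obtain ⟨ε₁, hε₁, e1, e2, e3, e4, e5⟩ : ∃ ε₁ : ℝ, 0 < ε₁ ∧ ε₁ ≤ εa ∧ ε₁ ≤ 1 ∧ ε₁ * μ < δ1 ∧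
      L2 * ε₁ < δ2 ∧ L1 * ε₁ ≤ r₁ := by
    refine ⟨min (min εa 1) (min (min (δ1 / (μ + 1)) (δ2 / (L2 + 1))) (r₁ / (L1 + 1))), by positivity,
      (min_le_left _ _).trans (min_le_left _ _), (min_le_left _ _).trans (min_le_right _ _), ?_, ?_, ?_⟩
    · have : min (min εa 1) (min (min (δ1 / (μ + 1)) (δ2 / (L2 + 1))) (r₁ / (L1 + 1))) ≤ δ1 / (μ + 1) :=
        (min_le_right _ _).trans ((min_le_left _ _).trans (min_le_left _ _))
      refine lt_of_le_of_lt (mul_le_mul_of_nonneg_right this hm0) ?_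
      rw [div_mul_eq_mul_div, div_lt_iff₀ (by positivity)]; nlinarith
    · have : min (min εa 1) (min (min (δ1 / (μ + 1)) (δ2 / (L2 + 1))) (r₁ / (L1 + 1))) ≤ δ2 / (L2 + 1) :=
        (min_le_right _ _).trans ((min_le_left _ _).trans (min_le_right _ _))
      refine lt_of_le_of_lt (mul_le_mul_of_nonneg_left this hL2n) ?_
      rw [mul_div_assoc', div_lt_iff₀ (by positivity)]; nlinarith
    · have : min (min εa 1) (min (min (δ1 / (μ + 1)) (δ2 / (L2 + 1))) (r₁ / (L1 + 1))) ≤ r₁ / (L1 + 1) :=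
        (min_le_right _ _).trans (min_le_right _ _)
      refine le_trans (mul_le_mul_of_nonneg_left this hL1n) ?_
      rw [mul_div_assoc', div_le_iff₀ (by positivity)]; nlinarith
  refine ⟨ε₁, r₁, L, c, hε₁, hr₁, hr₁r, hLn, hcpos, fun u e ε he hε hεε hu => ?_⟩
  set v : ℤ → ℂ := fun x => conj e * u x with hv
  have he' := conj_mul_self he
  have huv : u = fun x => e * v x := by
    funext x; simp only [hv]; rw [← mul_assoc, mul_comm e, he', one_mul]
  have hnc : ‖conj e‖ = 1 := by rw [RCLike.norm_conj, he]
  have hvc : ∀ x, ‖v x - phi σ C ω₀ x‖ ≤ ε * wt x := fun x => by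
    have : v x - phi σ C ω₀ x = conj e * (u x - e * phi σ C ω₀ x) := by
      simp only [hv]; linear_combination (phi σ C ω₀ x : ℂ) * he'
    rw [this, norm_mul, hnc, one_mul]; exact hu x
  have hva : ∀ x, ‖v x - phi σ C ω₀ x‖ ≤ εa * wt x := fun x =>
    (hvc x).trans (mul_le_mul_of_nonneg_right (hεε.trans e1) (wt_pos x).le)
  have gv : ∀ x, ‖v x‖ ≤ (ε + μ) * wt x := fun x => by
    have := norm_add_le (v x - phi σ C ω₀ x) (phi σ C ω₀ x)
    rw [sub_add_cancel] at this
    have := g0 x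
    linarith [hvc x]
  have hlt : ∀ {ω}, |ω - ω₀| ≤ r₁ → |ω - ω₀| < r := fun hω => hω.trans_lt hr₁r
  have hself : |ω₀ - ω₀| ≤ r₁ := by simpa using hr₁.le
  have mvt : ∀ ω ω', |ω - ω₀| ≤ r₁ → |ω' - ω₀| ≤ r₁ →
      |(modFun σ C v ω + 2 * N0 * Δ0 ^ 3 * ω) - (modFun σ C v ω' + 2 * N0 * Δ0 ^ 3 * ω')| ≤ c * |ω - ω'| :=
    fun ω ω' hω hω' => by
      refine (convex_closedBall ω₀ r₁).norm_image_sub_le_of_norm_hasDerivWithin_le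
        (f := fun ω => modFun σ C v ω + 2 * N0 * Δ0 ^ 3 * ω) (C := c)
        (fun y hy => ((hb.hasDerivAt_modFun gv (hlt hy)).add
          ((hasDerivAt_id y).const_mul (2 * N0 * Δ0 ^ 3))).hasDerivWithinAt) (fun y hy => ?_) hω' hω
      rw [mul_one]
      exact (hslope v hva y hy).2
  have slope : ∀ ω ω', |ω - ω₀| ≤ r₁ → |ω' - ω₀| ≤ r₁ →
      c * |ω - ω'| ≤ |modFun σ C v ω - modFun σ C v ω'| := fun ω ω' hω hω' => by
    have h1 := mvt ω ω' hω hω'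
    have h2 : |2 * N0 * Δ0 ^ 3 * (ω - ω')| = 2 * c * |ω - ω'| := by
      rw [abs_mul, mul_assoc, abs_mul, abs_two]
    have h3 := abs_sub_abs_le_abs_sub (2 * N0 * Δ0 ^ 3 * (ω - ω')) (-(modFun σ C v ω - modFun σ C v ω'))
    rw [abs_neg, h2, show 2 * N0 * Δ0 ^ 3 * (ω - ω') - -(modFun σ C v ω - modFun σ C v ω') =
      (modFun σ C v ω + 2 * N0 * Δ0 ^ 3 * ω) - (modFun σ C v ω' + 2 * N0 * Δ0 ^ 3 * ω') by ring] at h3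
    linarith
  -- smallness at the reference frequency
  have cA : ‖ps (phi σ C ω₀) v - N0‖ ≤ ε * μ := by
    have := hb.norm_ps_sub_le_of_close (hb.phi_le hb.self) hvc
    rwa [ps_phi_phi] at this
  have cB : ‖ps (phi1 σ C ω₀) v - Δ0‖ ≤ ε * μ := by
    have := hb.norm_ps_sub_le_of_close (hb.phi1_le hb.self) hvc
    rwa [ps_phi1_phi] at this
  have small : |modFun σ C v ω₀| ≤ c * (L1 * ε) := by
    have hq : ‖((ps (phi σ C ω₀) v, ps (phi1 σ C ω₀) v) : ℂ × ℂ) - ((N0 : ℂ), (Δ0 : ℂ))‖ ≤ ε * μ := by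
      rw [Prod.mk_sub_mk, Prod.norm_mk]; exact max_le cA cB
    have := hL1 _ (lt_of_le_of_lt (hq.trans (mul_le_mul_of_nonneg_right hεε hm0)) e3)
    rw [v1, sub_zero] at this
    have e : c * (L1 * ε) = K1 * (ε * μ) := by rw [hL1def]; field_simp
    rw [e]
    exact this.trans (mul_le_mul_of_nonneg_left hq hK1)
  -- the root
  obtain ⟨ω, hω, hroot⟩ : ∃ ω, |ω - ω₀| ≤ r₁ ∧ modFun σ C v ω = 0 := by
    set s := N0 * Δ0 ^ 3 with hs
    have hs0 : s ≠ 0 := abs_pos.1 hcpos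
    have hcs : c * c = s * s := by rw [hc]; exact abs_mul_abs_self s
    have hcon : ContinuousOn (fun ω => -s * modFun σ C v ω) (Icc (ω₀ - r₁) (ω₀ + r₁)) := fun y hy =>
      (continuousAt_const.mul (hb.hasDerivAt_modFun gv (hlt (abs_le.2
        ⟨by linarith [hy.1], by linarith [hy.2]⟩))).continuousAt).continuousWithinAt
    have sm : |modFun σ C v ω₀| ≤ c * r₁ := small.trans (mul_le_mul_of_nonneg_left
      ((mul_le_mul_of_nonneg_left hεε hL1n).trans e5) hcpos.le)
    have sm' : |s * modFun σ C v ω₀| ≤ s * s * r₁ := by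
      rw [abs_mul, ← hcs]
      have := mul_le_mul_of_nonneg_left sm hcpos.le
      rw [hc] at this ⊢; linarith
    have bnd : ∀ ω, |ω - ω₀| = r₁ → |s * (modFun σ C v ω - modFun σ C v ω₀) + 2 * (s * s) * (ω - ω₀)| ≤ s * s * r₁ :=
      fun ω hω => by
        have := mul_le_mul_of_nonneg_left (mvt ω ω₀ hω.le hself) hcpos.le
        rw [hω, ← mul_assoc, hcs] at this
        refine le_trans (le_of_eq ?_) this
        rw [hc, ← abs_mul]; congr 1; rw [hs]; ring
    have b1 := abs_le.1 (bnd (ω₀ + r₁) (by rw [add_sub_cancel_left, abs_of_pos hr₁]))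
    have b2 := abs_le.1 (bnd (ω₀ - r₁) (by rw [sub_sub_cancel_left, abs_neg, abs_of_pos hr₁]))
    have b3 := abs_le.1 sm'
    obtain ⟨ω, hω, hz⟩ := intermediate_value_Icc (by linarith) hcon
      (show (0 : ℝ) ∈ _ from ⟨by nlinarith [b2.1, b3.1], by nlinarith [b1.2, b3.2]⟩)
    refine ⟨ω, abs_le.2 ⟨by linarith [hω.1], by linarith [hω.2]⟩, ?_⟩
    exact (mul_eq_zero.1 hz).resolve_left (neg_ne_zero.2 hs0)
  have hωL : |ω - ω₀| ≤ L1 * ε := by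
    have h1 := slope ω ω₀ hω hself
    rw [hroot, zero_sub, abs_neg] at h1
    exact le_of_mul_le_mul_left (h1.trans small) hcpos
  have hωr := hlt hω
  have dA : ∀ {f f₀ : ℤ → ℝ} {z : ℂ}, (‖ps f φ - ps f₀ φ‖ ≤ μ * μ * |ω - ω₀|) → (∀ x, |f x| ≤ h x) →
      ps f₀ φ = z → ‖ps f v - z‖ ≤ L2 * ε := fun {f f₀ z} h1 hf hz => by
    have h2 := hb.norm_ps_sub_le_of_close hf hvc
    have h3 := norm_add_le (ps f v - ps f φ) (ps f φ - ps f₀ φ)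
    rw [sub_add_sub_cancel, hz] at h3
    have h4 : μ * μ * |ω - ω₀| ≤ μ * μ * (L1 * ε) := mul_le_mul_of_nonneg_left hωL (by positivity)
    have h5 : 0 ≤ μ * μ * (L1 * ε) := by positivity
    rw [hz] at h1
    rw [hL2def]
    nlinarith
  have kA := dA (norm_ps_sub_le (fun _ h x => hb.hasDerivAt_phi h x) (fun _ h x => hb.phi_le h x)
    (fun _ h x => hb.phi1_le h x) hb.summable g0 hb.self hωr) (hb.phi_le hωr) (ps_phi_phi σ C ω₀)
  have kB := dA (norm_ps_sub_le (fun _ h x => hb.hasDerivAt_phi1 h x) (fun _ h x => hb.phi1_le h x)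
    (fun _ h x => hb.phi2_le h x) hb.summable g0 hb.self hωr) (hb.phi1_le hωr) (ps_phi1_phi σ C ω₀)
  have kN : ‖nrm σ C ω - N0‖ ≤ L2 * ε := by
    have h1 := hb.abs_nrm_sub_le hωr
    have h4 : 2 * (μ * μ) * |ω - ω₀| ≤ 2 * (μ * μ) * (L1 * ε) := mul_le_mul_of_nonneg_left hωL (by positivity)
    rw [norm_eq_abs, hL2def]
    have : 0 ≤ μ * ε := by positivity
    nlinarith
  have hE : ‖modPhase σ C v ω - 1‖ ≤ K2 * L2 * ε := by
    have hq : ‖((ps (phi σ C ω) v, ps (phi1 σ C ω) v, nrm σ C ω) : ℂ × ℂ × ℝ) -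
        ((N0 : ℂ), (Δ0 : ℂ), N0)‖ ≤ L2 * ε := by
      rw [Prod.mk_sub_mk, Prod.mk_sub_mk, Prod.norm_mk, Prod.norm_mk]; exact max_le kA (max_le kB kN)
    have := hL2 _ (lt_of_le_of_lt (hq.trans (mul_le_mul_of_nonneg_left hεε hL2n)) e4)
    rw [v2] at this
    refine this.trans ?_
    rw [mul_assoc]
    exact mul_le_mul_of_nonneg_left hq hK2
  refine ⟨fun ω ω' hω hω' => ?_, fun ω hω => ?_, ω, hω, ?_, ?_, ?_, fun x => ?_⟩
  · rw [huv, modFun_rot σ C he, modFun_rot σ C he]; exact slope ω ω' hω hω'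
  · have hs := hslope v hva ω hω
    have he0 : e ≠ 0 := norm_ne_zero_iff.1 (by rw [he]; norm_num)
    rw [huv]
    simp only [ps_smul, modPoly_rot he]
    refine ⟨mul_ne_zero he0 hs.1, fun h0 => ?_⟩
    have := hs.2
    rw [h0, zero_add, mul_assoc, abs_mul, abs_two] at this
    linarith
  · refine hωL.trans (mul_le_mul_of_nonneg_right ?_ hε)
    rw [hLdef]; nlinarith [mul_nonneg hpos1 hm0, mul_nonneg hm0 hL1n]
  · rw [huv, modFun_rot σ C he]; exact hroot
  · rw [huv, modPhase_rot σ C he, show e * modPhase σ C v ω - e = e * (modPhase σ C v ω - 1) by ring,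
      norm_mul, he, one_mul]
    refine hE.trans (mul_le_mul_of_nonneg_right ?_ hε)
    rw [hLdef]; nlinarith [mul_nonneg hpos1 hm0, mul_nonneg hm0 hL1n]
  · have hconj : conj (modPhase σ C u ω) * u x = conj (modPhase σ C v ω) * v x := by
      rw [huv, modPhase_rot σ C he, map_mul]
      linear_combination conj (modPhase σ C v ω) * v x * he'
    rw [hconj, show conj (modPhase σ C v ω) * v x - phi σ C ω x =
      (conj (modPhase σ C v ω - 1) * v x + (v x - phi σ C ω₀ x)) +
        -((phi σ C ω x - phi σ C ω₀ x : ℝ) : ℂ) by push_cast; rw [map_sub, map_one]; ring]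
    have n1 : ‖conj (modPhase σ C v ω - 1) * v x‖ ≤ K2 * L2 * ε * ((1 + μ) * wt x) := by
      rw [norm_mul, RCLike.norm_conj]
      refine mul_le_mul hE ((gv x).trans (mul_le_mul_of_nonneg_right (by linarith) (wt_pos x).le))
        (norm_nonneg _) (by positivity)
    have n2 := hvc x
    have n3 : ‖-((phi σ C ω x - phi σ C ω₀ x : ℝ) : ℂ)‖ ≤ μ * (L1 * ε) * wt x := by
      rw [norm_neg, norm_real, norm_eq_abs]
      have h1 := abs_sub_le_of_hasDerivAt (fun _ h x => hb.hasDerivAt_phi h x)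
        (fun _ h x => hb.phi1_le h x) hb.self hωr x
      have h2 := mul_le_mul (hb.h_le_mass x) hωL (abs_nonneg _) hm0
      exact (h1.trans h2).trans (le_mul_of_one_le_right (by positivity) (one_le_wt x))
    refine (norm_add₃_le ..).trans ?_
    have n4 : 0 ≤ L1 * ε * wt x := mul_nonneg (mul_nonneg hL1n hε) (wt_pos x).le
    rw [hLdef]
    linarith

end Branch

/-- `u` is within weighted distance `ε` of the orbit of the reference wave. -/
def Tube (σ ω₀ : ℝ) (C : ℝ → ℝ) (ε : ℝ) (u : ℤ → ℂ) : Prop :=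
  ∃ e : ℂ, ‖e‖ = 1 ∧ ∀ x, ‖u x - e * phi σ C ω₀ x‖ ≤ ε * wt x

lemma Tube.of_close {σ ω₀ : ℝ} {C : ℝ → ℝ} {ε δ : ℝ} {u v : ℤ → ℂ} (hu : Tube σ ω₀ C ε u) (hδ : 0 ≤ δ)
    (h : ∀ x, ‖v x - u x‖ ≤ δ) : Tube σ ω₀ C (ε + δ) v := by
  obtain ⟨e, he, hx⟩ := hu
  refine ⟨e, he, fun x => ?_⟩
  have := norm_add_le (v x - u x) (u x - e * phi σ C ω₀ x)
  rw [sub_add_sub_cancel] at this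
  nlinarith [h x, hx x, one_le_wt x]

/-- The conclusion of `Branch.exists_modulation`. -/
structure Modulation (a : ℝ → ℝ) (σ ω₀ r : ℝ) (C : ℝ → ℝ) (h : ℤ → ℝ) (ε₁ r₁ L m : ℝ) : Prop extends
    Branch a σ ω₀ r C h where
  cont : Continuous a
  lt_r : r₁ < r
  m_pos : 0 < m
  L_nonneg : 0 ≤ L
  dlt_ne : ∀ ω, |ω - ω₀| < r → dlt σ C ω ≠ 0
  slope : ∀ (u : ℤ → ℂ) (ε : ℝ), 0 ≤ ε → ε ≤ ε₁ → Tube σ ω₀ C ε u → ∀ ω ω', |ω - ω₀| ≤ r₁ →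
    |ω' - ω₀| ≤ r₁ → m * |ω - ω'| ≤ |modFun σ C u ω - modFun σ C u ω'|
  nondeg : ∀ (u : ℤ → ℂ) (ε : ℝ), 0 ≤ ε → ε ≤ ε₁ → Tube σ ω₀ C ε u → ∀ ω, |ω - ω₀| ≤ r₁ →
    ps (phi1 σ C ω) u ≠ 0 ∧
      modPoly (ps (phi σ C ω) u) (ps (phi1 σ C ω) u) (ps (phi2 σ C ω) u) (nrm σ C ω) (dlt σ C ω) ≠ 0
  root : ∀ (u : ℤ → ℂ) (e : ℂ) (ε : ℝ), ‖e‖ = 1 → 0 ≤ ε → ε ≤ ε₁ →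
    (∀ x, ‖u x - e * phi σ C ω₀ x‖ ≤ ε * wt x) →
    ∃ ω, |ω - ω₀| ≤ r₁ ∧ |ω - ω₀| ≤ L * ε ∧ modFun σ C u ω = 0 ∧ ‖modPhase σ C u ω - e‖ ≤ L * ε ∧
      ∀ x, ‖conj (modPhase σ C u ω) * u x - phi σ C ω x‖ ≤ L * ε * wt x

open Classical in
/-- The modulated frequency of `u`. -/
def modFreq (σ ω₀ r₁ : ℝ) (C : ℝ → ℝ) (u : ℤ → ℂ) : ℝ :=
  if hu : ∃ ω, |ω - ω₀| ≤ r₁ ∧ modFun σ C u ω = 0 then hu.choose else ω₀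

/-- The modulated phase factor of `u`. -/
def modRot (σ ω₀ r₁ : ℝ) (C : ℝ → ℝ) (u : ℤ → ℂ) : ℂ := modPhase σ C u (modFreq σ ω₀ r₁ C u)

/-- The remainder of the orthogonal decomposition of `u`. -/
def modRem (σ ω₀ r₁ : ℝ) (C : ℝ → ℝ) (u : ℤ → ℂ) (x : ℤ) : ℂ :=
  conj (modRot σ ω₀ r₁ C u) * u x - phi σ C (modFreq σ ω₀ r₁ C u) x

/-- The nonlinear remainder of the force. -/
def forceRem (a : ℝ → ℝ) (α b c : ℝ) (z : ℂ) : ℂ :=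
  force a (c + z) - force a c - (α * z + b * conj z)

lemma hasDerivAt_comp_partial {g : ℝ × ℝ → ℂ} {w : ℝ → ℝ} {t w' : ℝ} {d₁ d₂ : ℂ}
    (hg : DifferentiableAt ℝ g (t, w t)) (h₁ : HasDerivAt (fun s => g (s, w t)) d₁ t)
    (h₂ : HasDerivAt (fun y => g (t, y)) d₂ (w t)) (hw : HasDerivAt w w' t) :
    HasDerivAt (fun s => g (s, w s)) (d₁ + w' * d₂) t := by
  have k := hg.hasFDerivAt
  have k1 := (HasFDerivAt.comp_hasDerivAt t k ((hasDerivAt_id t).prodMk (hasDerivAt_const t (w t)))).unique h₁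
  have k2 := (HasFDerivAt.comp_hasDerivAt (w t) k
    ((hasDerivAt_const (w t) t).prodMk (hasDerivAt_id (w t)))).unique h₂
  have k3 := HasFDerivAt.comp_hasDerivAt t k ((hasDerivAt_id t).prodMk hw)
  refine HasDerivAt.congr_deriv k3 ?_
  rw [← k1, ← k2, show ((1 : ℝ), w') = (1, 0) + w' • ((0 : ℝ), (1 : ℝ)) by simp, map_add, map_smul]
  simp

namespace Modulation

variable {a : ℝ → ℝ} {σ ω₀ r : ℝ} {C : ℝ → ℝ} {h : ℤ → ℝ} {ε₁ r₁ L m ε : ℝ} {u : ℤ → ℂ} {e : ℂ}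

lemma lt (hm : Modulation a σ ω₀ r C h ε₁ r₁ L m) {ω : ℝ} (hω : |ω - ω₀| ≤ r₁) : |ω - ω₀| < r :=
  hω.trans_lt hm.lt_r

lemma freq_spec (hm : Modulation a σ ω₀ r C h ε₁ r₁ L m) (hε : 0 ≤ ε) (hε₁ : ε ≤ ε₁)
    (hu : Tube σ ω₀ C ε u) : |modFreq σ ω₀ r₁ C u - ω₀| ≤ r₁ ∧ modFun σ C u (modFreq σ ω₀ r₁ C u) = 0 := by
  obtain ⟨e, he, hx⟩ := hu
  obtain ⟨ω, h1, -, h2, -⟩ := hm.root u e ε he hε hε₁ hx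
  have hex : ∃ ω, |ω - ω₀| ≤ r₁ ∧ modFun σ C u ω = 0 := ⟨ω, h1, h2⟩
  rw [modFreq, dif_pos hex]
  exact hex.choose_spec

lemma freq_unique (hm : Modulation a σ ω₀ r C h ε₁ r₁ L m) (hε : 0 ≤ ε) (hε₁ : ε ≤ ε₁)
    (hu : Tube σ ω₀ C ε u) {ω : ℝ} (h1 : |ω - ω₀| ≤ r₁) (h2 : modFun σ C u ω = 0) :
    modFreq σ ω₀ r₁ C u = ω := by
  obtain ⟨h3, h4⟩ := hm.freq_spec hε hε₁ hu
  have := hm.slope u ε hε hε₁ hu _ _ h3 h1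
  rw [h4, h2, sub_zero, abs_zero] at this
  have h5 : |modFreq σ ω₀ r₁ C u - ω| = 0 :=
    le_antisymm (by nlinarith [hm.m_pos]) (abs_nonneg _)
  exact sub_eq_zero.1 (abs_eq_zero.1 h5)

/-- Closeness of the decomposition. -/
lemma close (hm : Modulation a σ ω₀ r C h ε₁ r₁ L m) (he : ‖e‖ = 1) (hε : 0 ≤ ε) (hε₁ : ε ≤ ε₁)
    (hu : ∀ x, ‖u x - e * phi σ C ω₀ x‖ ≤ ε * wt x) :
    |modFreq σ ω₀ r₁ C u - ω₀| ≤ L * ε ∧ ‖modRot σ ω₀ r₁ C u - e‖ ≤ L * ε ∧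
      ∀ x, ‖modRem σ ω₀ r₁ C u x‖ ≤ L * ε * wt x := by
  obtain ⟨ω, h1, h2, h3, h4, h5⟩ := hm.root u e ε he hε hε₁ hu
  have := hm.freq_unique hε hε₁ ⟨e, he, hu⟩ h1 h3
  unfold modRem modRot
  rw [this]
  exact ⟨h2, h4, h5⟩

lemma rot_spec (hm : Modulation a σ ω₀ r C h ε₁ r₁ L m) (hε : 0 ≤ ε) (hε₁ : ε ≤ ε₁)
    (hu : Tube σ ω₀ C ε u) : ‖modRot σ ω₀ r₁ C u‖ = 1 ∧
    (conj (modRot σ ω₀ r₁ C u) * ps (phi σ C (modFreq σ ω₀ r₁ C u)) u).re =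
      nrm σ C (modFreq σ ω₀ r₁ C u) ∧
    (conj (modRot σ ω₀ r₁ C u) * ps (phi1 σ C (modFreq σ ω₀ r₁ C u)) u).im = 0 := by
  obtain ⟨h1, h2⟩ := hm.freq_spec hε hε₁ hu
  exact modPhase_spec h2 (hm.nrm_pos (hm.lt h1)).ne' (hm.nondeg u ε hε hε₁ hu _ h1).1

lemma eq_rot_mul (hm : Modulation a σ ω₀ r C h ε₁ r₁ L m) (hε : 0 ≤ ε) (hε₁ : ε ≤ ε₁)
    (hu : Tube σ ω₀ C ε u) (x : ℤ) :
    u x = modRot σ ω₀ r₁ C u * (phi σ C (modFreq σ ω₀ r₁ C u) x + modRem σ ω₀ r₁ C u x) := by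
  have := conj_mul_self (hm.rot_spec hε hε₁ hu).1
  unfold modRem
  linear_combination -u x * this

end Modulation

/-! ### Dependence on time -/

lemma contDiffAt_nrm_snd {a : ℝ → ℝ} {σ ω₀ r : ℝ} {C : ℝ → ℝ} {h : ℤ → ℝ} (hb : Branch a σ ω₀ r C h)
    {t ω : ℝ} (hω : |ω - ω₀| < r) : ContDiffAt ℝ 1 (fun p : ℝ × ℝ => nrm σ C p.2) (t, ω) := by
  have k := contDiffAt_one_of_partial (f := fun _ ω => (nrm σ C ω : ℂ)) (f₁ := fun _ _ => 0)
    (f₂ := fun _ ω => ((2 * dlt σ C ω : ℝ) : ℂ)) (isOpen_strip ω₀ r) (fun p _ => hasDerivAt_const _ _)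
    (fun p hp => (hb.hasDerivAt_nrm hp).ofReal_comp) (fun p _ => continuousAt_const)
    (fun p hp => continuousAt_ofReal (continuousAt_const.mul
      (ContinuousAt.comp (f := fun p : ℝ × ℝ => p.2) (hb.continuousAt_dlt hp) continuousAt_snd)))
    (p := (t, ω)) hω
  exact contDiff_re.contDiffAt.comp _ k

/-- The times at which the solution is in the open tube. -/
def tubeTimes (σ ω₀ : ℝ) (C : ℝ → ℝ) (ε₁ : ℝ) (ψ : ℝ → ℓ²) : Set ℝ :=
  {t | ∃ ε, 0 ≤ ε ∧ ε < ε₁ ∧ Tube σ ω₀ C ε (fun x => ψ t x)}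

namespace Modulation

variable {a : ℝ → ℝ} {σ ω₀ r : ℝ} {C : ℝ → ℝ} {h : ℤ → ℝ} {ε₁ r₁ L m : ℝ}
  {ψ : ℝ → ℓ²} {t : ℝ}

lemma isOpen_tubeTimes (hψ : Continuous ψ) : IsOpen (tubeTimes σ ω₀ C ε₁ ψ) := by
  refine Metric.isOpen_iff.2 fun t ⟨ε, h0, h1, hT⟩ => ?_
  obtain ⟨δ, hδ, hd⟩ := Metric.continuousAt_iff.1 hψ.continuousAt ((ε₁ - ε) / 2) (by linarith)
  refine ⟨δ, hδ, fun s hs => ⟨ε + (ε₁ - ε) / 2, by linarith, by linarith,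
    hT.of_close (by linarith) fun x => ?_⟩⟩
  have := hd (Metric.mem_ball.1 hs)
  rw [dist_eq_norm] at this
  exact (norm_coord_le (ψ s - ψ t) x).trans this.le

lemma contDiffAt_modFun (hm : Modulation a σ ω₀ r C h ε₁ r₁ L m) (hψ : IsSolution a ψ) {ω : ℝ}
    (hω : |ω - ω₀| < r) : ContDiffAt ℝ 1 (fun p : ℝ × ℝ => modFun σ C (fun x => ψ p.1 x) p.2) (t, ω) := by
  have hA := hψ.contDiffAt_ps_phi (t := t) hm.cont hm.toBranch hω
  have hB := hψ.contDiffAt_ps_phi1 (t := t) hm.cont hm.toBranch hω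
  have hN := contDiffAt_nrm_snd (t := t) hm.toBranch hω
  have h1 := contDiff_re.contDiffAt.comp _ hA
  have h2 := contDiff_im.contDiffAt.comp _ hA
  have h3 := contDiff_re.contDiffAt.comp _ hB
  have h4 := contDiff_im.contDiffAt.comp _ hB
  exact (((h1.mul h3).add (h2.mul h4)).pow 2).sub ((hN.pow 2).mul ((h3.pow 2).add (h4.pow 2)))

lemma continuousAt_freq (hm : Modulation a σ ω₀ r C h ε₁ r₁ L m) (hψ : IsSolution a ψ)
    (ht : t ∈ tubeTimes σ ω₀ C ε₁ ψ) :
    ContinuousAt (fun s => modFreq σ ω₀ r₁ C fun x => ψ s x) t := by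
  obtain ⟨ε, h0, h1, hT⟩ := id ht
  have hspec := hm.freq_spec h0 h1.le hT
  have hwr := hm.lt hspec.1
  have c1 : Tendsto (fun s => |modFun σ C (fun x => ψ s x) (modFreq σ ω₀ r₁ C fun x => ψ t x)| / m)
      (𝓝 t) (𝓝 0) := by
    have c2 : ContinuousAt (fun s : ℝ => (s, modFreq σ ω₀ r₁ C fun x => ψ t x)) t := by fun_prop
    have c3 := ContinuousAt.comp (f := fun s : ℝ => (s, modFreq σ ω₀ r₁ C fun x => ψ t x))
      (hm.contDiffAt_modFun (t := t) hψ hwr).continuousAt c2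
    have c4 := (c3.tendsto.abs).div_const m
    simp only [Function.comp_apply] at c4
    rwa [hspec.2, abs_zero, zero_div] at c4
  refine tendsto_iff_dist_tendsto_zero.2 (squeeze_zero' (Eventually.of_forall fun _ => dist_nonneg) ?_ c1)
  filter_upwards [(isOpen_tubeTimes hψ.1).mem_nhds ht] with s ⟨ε', h0', h1', hT'⟩
  have hs := hm.freq_spec h0' h1'.le hT'
  have := hm.slope _ ε' h0' h1'.le hT' _ _ hs.1 hspec.1
  rw [hs.2, zero_sub, abs_neg] at this
  rw [Real.dist_eq, le_div_iff₀ hm.m_pos, mul_comm]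
  exact this

lemma contDiffAt_freq (hm : Modulation a σ ω₀ r C h ε₁ r₁ L m) (hψ : IsSolution a ψ)
    (ht : t ∈ tubeTimes σ ω₀ C ε₁ ψ) :
    ContDiffAt ℝ 1 (fun s => modFreq σ ω₀ r₁ C fun x => ψ s x) t := by
  obtain ⟨ε, h0, h1, hT⟩ := id ht
  have hspec := hm.freq_spec h0 h1.le hT
  have hwr := hm.lt hspec.1
  have k1 := hm.contDiffAt_modFun (t := t) hψ hwr
  have k2 := hm.hasDerivAt_modFun (growth_lp (ψ t)) hwr
  have k3 := (hm.nondeg _ ε h0 h1.le hT _ hspec.1).2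
  have k4 := hm.continuousAt_freq hψ ht
  generalize hw : (fun s => modFreq σ ω₀ r₁ C fun x => ψ s x) = w at k4 ⊢
  have hwt : ∀ s, (modFreq σ ω₀ r₁ C fun x => ψ s x) = w s := fun s => congrFun hw s
  rw [hwt t] at k1 k2 k3
  refine contDiffAt_root (g := fun p : ℝ × ℝ => modFun σ C (fun x => ψ p.1 x) p.2) k1 k2 k3 k4 ?_
  filter_upwards [(isOpen_tubeTimes hψ.1).mem_nhds ht] with s ⟨ε', h0', h1', hT'⟩
  rw [← hwt s]
  exact (hm.freq_spec h0' h1'.le hT').2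

lemma contDiffAt_rot (hm : Modulation a σ ω₀ r C h ε₁ r₁ L m) (hψ : IsSolution a ψ)
    (ht : t ∈ tubeTimes σ ω₀ C ε₁ ψ) :
    ContDiffAt ℝ 1 (fun s => modRot σ ω₀ r₁ C fun x => ψ s x) t := by
  have hw := hm.contDiffAt_freq hψ ht
  obtain ⟨ε, h0, h1, hT⟩ := ht
  have hspec := hm.freq_spec h0 h1.le hT
  have hwr := hm.lt hspec.1
  have hp : ContDiffAt ℝ 1 (fun s => (s, modFreq σ ω₀ r₁ C fun x => ψ s x)) t := contDiffAt_id.prodMk hw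
  have hA := (hψ.contDiffAt_ps_phi (t := t) hm.cont hm.toBranch hwr).comp t hp
  have hB := (hψ.contDiffAt_ps_phi1 (t := t) hm.cont hm.toBranch hwr).comp t hp
  have hN := (contDiffAt_nrm_snd (t := t) hm.toBranch hwr).comp t hp
  have hne : nrm σ C (modFreq σ ω₀ r₁ C fun x => ψ t x) *
      ((ps (phi1 σ C (modFreq σ ω₀ r₁ C fun x => ψ t x)) fun x => ψ t x).re ^ 2 +
       (ps (phi1 σ C (modFreq σ ω₀ r₁ C fun x => ψ t x)) fun x => ψ t x).im ^ 2) ≠ 0 := by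
    refine mul_ne_zero (hm.nrm_pos hwr).ne' ?_
    have := normSq_pos.2 (hm.nondeg _ ε h0 h1.le hT _ hspec.1).1
    rw [normSq_apply] at this
    nlinarith
  exact ContDiffAt.comp t (contDiffAt_phaseVal (p := (_, _, _)) hne) (hA.prodMk (hB.prodMk hN))

/-- The angular velocity of the phase factor. -/
def speed (σ ω₀ r₁ : ℝ) (C : ℝ → ℝ) (ψ : ℝ → ℓ²) (t : ℝ) : ℝ :=
  (conj (modRot σ ω₀ r₁ C fun x => ψ t x) *
    deriv (fun s => modRot σ ω₀ r₁ C fun x => ψ s x) t).im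

lemma continuousAt_deriv_of_contDiffAt {E : Type*} [NormedAddCommGroup E] [NormedSpace ℝ E] {f : ℝ → E}
    {t : ℝ} (hf : ContDiffAt ℝ 1 f t) : ContinuousAt (deriv f) t :=
  (ContDiffAt.derivWithin (m := 0) hf (by norm_num)).continuousAt

end Modulation

namespace Modulation

variable {a : ℝ → ℝ} {σ ω₀ r : ℝ} {C : ℝ → ℝ} {h : ℤ → ℝ} {ε₁ r₁ L m : ℝ}
  {ψ : ℝ → ℓ²} {t : ℝ}

lemma hasDerivAt_rot (hm : Modulation a σ ω₀ r C h ε₁ r₁ L m) (hψ : IsSolution a ψ)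
    (ht : t ∈ tubeTimes σ ω₀ C ε₁ ψ) :
    HasDerivAt (fun s => modRot σ ω₀ r₁ C fun x => ψ s x)
      (I * speed σ ω₀ r₁ C ψ t * modRot σ ω₀ r₁ C fun x => ψ t x) t := by
  have hd := ((hm.contDiffAt_rot hψ ht).differentiableAt one_ne_zero).hasDerivAt
  have hone : ∀ᶠ s in 𝓝 t, (modRot σ ω₀ r₁ C fun x => ψ s x).re ^ 2 +
      (modRot σ ω₀ r₁ C fun x => ψ s x).im ^ 2 = 1 := by
    filter_upwards [(isOpen_tubeTimes hψ.1).mem_nhds ht] with s ⟨ε', h0', h1', hT'⟩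
    have := Complex.sq_norm (modRot σ ω₀ r₁ C fun x => ψ s x)
    rw [(hm.rot_spec h0' h1'.le hT').1, normSq_apply] at this
    linarith
  have k1 := ((hasDerivAt_re hd).pow 2).add ((hasDerivAt_im hd).pow 2)
  have k2 := k1.unique ((hasDerivAt_const t (1 : ℝ)).congr_of_eventuallyEq hone)
  have h1 := hone.self_of_nhds
  refine hd.congr_deriv ?_
  unfold speed
  set E := modRot σ ω₀ r₁ C fun x => ψ t x
  set E' := deriv (fun s => modRot σ ω₀ r₁ C fun x => ψ s x) t
  norm_num at k2
  apply Complex.ext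
  · simp only [mul_re, mul_im, I_re, I_im, conj_re, conj_im, ofReal_re, ofReal_im]
    linear_combination -E'.re * h1 + E.re / 2 * k2
  · simp only [mul_re, mul_im, I_re, I_im, conj_re, conj_im, ofReal_re, ofReal_im]
    linear_combination -E'.im * h1 + E.im / 2 * k2

/-- The pairings of the rotated solution in terms of the remainder. -/
lemma rot_mul_ps (hm : Modulation a σ ω₀ r C h ε₁ r₁ L m) {u : ℤ → ℂ} {M : ℝ}
    (hE : ‖modRot σ ω₀ r₁ C u‖ = 1) (hu : ∀ x, ‖u x‖ ≤ M * wt x)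
    (hw : |modFreq σ ω₀ r₁ C u - ω₀| < r) {f : ℤ → ℝ} (hf : ∀ x, |f x| ≤ h x) :
    conj (modRot σ ω₀ r₁ C u) * ps f u =
      ((∑' x, phi σ C (modFreq σ ω₀ r₁ C u) x * f x : ℝ) : ℂ) + ps f (modRem σ ω₀ r₁ C u) := by
  have hg := hm.growth (hm.phi_le hw)
  have hr : ∀ x, ‖conj (modRot σ ω₀ r₁ C u) * u x‖ ≤ M * wt x := fun x => by
    rw [norm_mul, RCLike.norm_conj, hE, one_mul]; exact hu x
  have := ps_sub hf hm.summable hr hg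
  rw [ps_smul, Branch.ps_ofReal] at this
  unfold modRem
  rw [this]; ring

/-- The modulation equations as a linear system. -/
theorem linear_system (hm : Modulation a σ ω₀ r C h ε₁ r₁ L m) (hψ : IsSolution a ψ)
    (ht : t ∈ tubeTimes σ ω₀ C ε₁ ψ) {u : ℤ → ℂ} {w : ℝ} {χ : ℤ → ℂ} {w' f : ℝ} (hu : u = fun x => ψ t x)
    (hw : w = modFreq σ ω₀ r₁ C u) (hχ : χ = modRem σ ω₀ r₁ C u)
    (hw' : w' = deriv (fun s => modFreq σ ω₀ r₁ C fun x => ψ s x) t) (hf : f = speed σ ω₀ r₁ C ψ t) :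
    (ps (phi σ C w) χ).re = 0 ∧ (ps (phi1 σ C w) χ).im = 0 ∧
    w' * (dlt σ C w - (ps (phi1 σ C w) χ).re) - (f - w) * (ps (phi σ C w) χ).im =
      -(C w * (forceRem a (coup σ w + bcoef a C w) (bcoef a C w) (C w) (χ 0)).im) ∧
    (f - w) * (dlt σ C w + (ps (phi1 σ C w) χ).re) - w' * (ps (phi2 σ C w) χ).im =
      deriv C w * (forceRem a (coup σ w + bcoef a C w) (bcoef a C w) (C w) (χ 0)).re := by
  obtain ⟨ε, h0, h1, hT⟩ := id ht
  rw [← hu] at hT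
  have hspec := hm.freq_spec h0 h1.le hT
  have hrot := hm.rot_spec h0 h1.le hT
  have hwd := ((hm.contDiffAt_freq hψ ht).differentiableAt one_ne_zero).hasDerivAt
  have hEd := hm.hasDerivAt_rot hψ ht
  rw [← hw'] at hwd
  rw [← hf, ← hu] at hEd
  have hgu : ∀ x, ‖u x‖ ≤ ‖ψ t‖ * wt x := by rw [hu]; exact growth_lp (ψ t)
  have hnear := (isOpen_tubeTimes hψ.1).mem_nhds ht
  rw [← hw] at hspec hrot
  have hwr : |w - ω₀| < r := hm.lt hspec.1
  -- notation for the functions of time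
  generalize hW : (fun s => modFreq σ ω₀ r₁ C fun x => ψ s x) = W at *
  generalize hEE : (fun s => modRot σ ω₀ r₁ C fun x => ψ s x) = EE at *
  have hWs : ∀ s, (modFreq σ ω₀ r₁ C fun x => ψ s x) = W s := fun s => congrFun hW s
  have hEs : ∀ s, (modRot σ ω₀ r₁ C fun x => ψ s x) = EE s := fun s => congrFun hEE s
  have hWt : W t = w := by rw [← hWs, ← hu, ← hw]
  have hEt : EE t = modRot σ ω₀ r₁ C u := by rw [← hEs, ← hu]
  set E := modRot σ ω₀ r₁ C u with hEdef
  -- derivatives of the pairings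
  have hA := hasDerivAt_comp_partial (g := fun p : ℝ × ℝ => ps (phi σ C p.2) (fun x => ψ p.1 x)) (w := W)
    (by rw [hWt]; exact (hψ.contDiffAt_ps_phi hm.cont hm.toBranch hwr).differentiableAt one_ne_zero)
    (by rw [hWt]; exact hψ.hasDerivAt_ps_phi hm.cont hm.toBranch hwr t)
    (d₂ := ps (phi1 σ C w) (fun x => ψ t x))
    (by rw [hWt]; exact hm.hasDerivAt_ps_phi (growth_lp (ψ t)) hwr) hwd
  have hB := hasDerivAt_comp_partial (g := fun p : ℝ × ℝ => ps (phi1 σ C p.2) (fun x => ψ p.1 x)) (w := W)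
    (by rw [hWt]; exact (hψ.contDiffAt_ps_phi1 hm.cont hm.toBranch hwr).differentiableAt one_ne_zero)
    (by rw [hWt]; exact hψ.hasDerivAt_ps_phi1 hm.cont hm.toBranch hwr t)
    (d₂ := ps (phi2 σ C w) (fun x => ψ t x))
    (by rw [hWt]; exact hm.hasDerivAt_ps_phi1 (growth_lp (ψ t)) hwr) hwd
  have hEc : HasDerivAt (fun s => conj (EE s)) (conj (I * f * E)) t :=
    conjCLE.toContinuousLinearMap.hasFDerivAt.comp_hasDerivAt t hEd
  have hN : HasDerivAt (fun s => nrm σ C (W s)) (2 * dlt σ C w * w') t := by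
    have := hm.hasDerivAt_nrm hwr
    rw [← hWt] at this ⊢
    exact this.comp t hwd
  have eA : ∀ᶠ s in 𝓝 t, (conj (EE s) * ps (phi σ C (W s)) (fun x => ψ s x)).re =
      nrm σ C (W s) := by
    filter_upwards [hnear] with s ⟨ε', h0', h1', hT'⟩
    have := (hm.rot_spec h0' h1'.le hT').2.1
    rwa [hWs, hEs] at this
  have eB : ∀ᶠ s in 𝓝 t, (conj (EE s) * ps (phi1 σ C (W s)) (fun x => ψ s x)).im = 0 := by
    filter_upwards [hnear] with s ⟨ε', h0', h1', hT'⟩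
    have := (hm.rot_spec h0' h1'.le hT').2.2
    rwa [hWs, hEs] at this
  have q1 := (hasDerivAt_re (hEc.mul hA)).unique (hN.congr_of_eventuallyEq eA)
  have q2 := (hasDerivAt_im (hEc.mul hB)).unique ((hasDerivAt_const t (0 : ℝ)).congr_of_eventuallyEq eB)
  simp only [hWt, hEt] at q1 q2
  -- substitute the decomposition
  have hwr' : |modFreq σ ω₀ r₁ C u - ω₀| < r := by rw [← hw]; exact hwr
  have pA := hm.rot_mul_ps hrot.1 hgu hwr' (hm.phi_le hwr)
  have pB := hm.rot_mul_ps hrot.1 hgu hwr' (hm.phi1_le hwr)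
  have pD := hm.rot_mul_ps hrot.1 hgu hwr' (hm.phi2_le hwr)
  rw [← hw, ← hχ] at pA pB pD
  have sN : ∑' x, phi σ C w x * phi σ C w x = nrm σ C w := by simp only [nrm, sq]
  have sD : ∑' x, phi σ C w x * phi1 σ C w x = dlt σ C w := rfl
  rw [sN] at pA
  rw [sD] at pB
  rw [← hEdef] at pA pB pD
  have p0 : conj E * ψ t 0 = C w + χ 0 := by
    have hu0 : u 0 = ψ t 0 := by rw [hu]
    rw [hχ]; unfold modRem; rw [← hw, phi_zero, ← hEdef, hu0]; ring
  have pF : conj E * force a (ψ t 0) = force a (C w + χ 0) := by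
    rw [← p0, force_rot]; rw [RCLike.norm_conj, hrot.1]
  have hFC : force a (C w : ℂ) = (coup σ w * C w : ℝ) := by
    unfold force
    rw [norm_real, norm_eq_abs, sq_abs, hm.amp w hwr]; push_cast; ring
  have hrem : force a (C w + χ 0) = forceRem a (coup σ w + bcoef a C w) (bcoef a C w) (C w) (χ 0) +
      (coup σ w * C w : ℝ) + (((coup σ w + bcoef a C w : ℝ) : ℂ) * χ 0 +
        (bcoef a C w : ℂ) * conj (χ 0)) := by
    unfold forceRem; rw [← hFC]; push_cast; ring
  rw [← hu] at q1 q2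
  generalize forceRem a (coup σ w + bcoef a C w) (bcoef a C w) (C w) (χ 0) = R at hrem ⊢
  have hrel := hm.deriv_relation hwr
  have hnrm := hm.nrm_eq hwr
  have hcne := hm.coup_ne hwr
  have hC1 : (w + 2) / coup σ w * C w = 2 * bcoef a C w * deriv C w := by
    field_simp
    linear_combination -hrel
  have oA : (ps (phi σ C w) χ).re = 0 := by
    have := hrot.2.1
    rw [pA] at this
    simpa using this
  have oB : (ps (phi1 σ C w) χ).im = 0 := by
    have := hrot.2.2
    rw [pB] at this
    simpa using this
  refine ⟨oA, oB, ?_, ?_⟩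
  · have key : conj (I * f * E) * ps (phi σ C w) u + conj E *
        (I * (w * ps (phi σ C w) u - (coup σ w * C w : ℝ) * ψ t 0 + C w * force a (ψ t 0)) +
          w' * ps (phi1 σ C w) u) =
        I * (w - f) * (nrm σ C w + ps (phi σ C w) χ) - I * (coup σ w * C w : ℝ) * (C w + χ 0) +
        I * C w * (R + (coup σ w * C w : ℝ) + (((coup σ w + bcoef a C w : ℝ) : ℂ) * χ 0 +
        (bcoef a C w : ℂ) * conj (χ 0))) + w' * (dlt σ C w + ps (phi1 σ C w) χ) := by
      rw [← pA, ← pB, ← p0, ← hrem, ← pF]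
      simp only [map_mul, conj_I, conj_ofReal]
      ring
    rw [key] at q1
    simp only [add_re, sub_re, mul_re, mul_im, add_im, sub_im, I_re, I_im, ofReal_re, ofReal_im, conj_re,
      conj_im, oA, oB] at q1
    linear_combination -q1
  · have key : conj (I * f * E) * ps (phi1 σ C w) u + conj E *
        (I * (w * ps (phi1 σ C w) u + ps (phi σ C w) u - ((w + 2) / coup σ w * C w + coup σ w * deriv C w : ℝ)
          * ψ t 0 + deriv C w * force a (ψ t 0)) + w' * ps (phi2 σ C w) u) =
        I * (w - f) * (dlt σ C w + ps (phi1 σ C w) χ) + I * (nrm σ C w + ps (phi σ C w) χ) -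
          I * ((w + 2) / coup σ w * C w + coup σ w * deriv C w : ℝ) * (C w + χ 0) +
        I * deriv C w * (R + (coup σ w * C w : ℝ) + (((coup σ w + bcoef a C w : ℝ) : ℂ) * χ 0 +
        (bcoef a C w : ℂ) * conj (χ 0))) +
        w' * (((∑' x, phi σ C w x * phi2 σ C w x : ℝ) : ℂ) + ps (phi2 σ C w) χ) := by
      rw [← pA, ← pB, ← pD, ← p0, ← hrem, ← pF]
      simp only [map_mul, conj_I, conj_ofReal]
      ring
    rw [key, hC1, hnrm] at q2
    simp only [add_re, sub_re, mul_re, mul_im, add_im, sub_im, I_re, I_im, ofReal_re, ofReal_im, conj_re,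
      conj_im, oA, oB] at q2
    linear_combination -q2

end Modulation

/-! ### Integration of the angular velocity -/

lemma hasDerivAt_integral_of_continuousOn {f : ℝ → ℝ} {s : Set ℝ} (hs : IsOpen s) (hf : ContinuousOn f s)
    {t : ℝ} (ht : 0 ≤ t) (hsub : Icc 0 t ⊆ s) : HasDerivAt (fun y => ∫ x in (0 : ℝ)..y, f x) (f t) t := by
  have hmem : t ∈ s := hsub ⟨ht, le_rfl⟩
  exact integral_hasDerivAt_right
    ((hf.mono (by rwa [uIcc_of_le ht])).intervalIntegrable)
    (hf.stronglyMeasurableAtFilter hs t hmem) (hf.continuousAt (hs.mem_nhds hmem))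

namespace Modulation

variable {a : ℝ → ℝ} {σ ω₀ r : ℝ} {C : ℝ → ℝ} {h : ℤ → ℝ} {ε₁ r₁ L m : ℝ}
  {ψ : ℝ → ℓ²} {t : ℝ}

lemma continuousOn_speed (hm : Modulation a σ ω₀ r C h ε₁ r₁ L m) (hψ : IsSolution a ψ) :
    ContinuousOn (speed σ ω₀ r₁ C ψ) (tubeTimes σ ω₀ C ε₁ ψ) := fun t ht => by
  have h1 := hm.contDiffAt_rot hψ ht
  exact (continuous_im.continuousAt.comp
    ((continuous_conj.continuousAt.comp h1.continuousAt).mul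
      (continuousAt_deriv_of_contDiffAt h1))).continuousWithinAt

/-- A continuous argument of the phase factor. -/
def angle (σ ω₀ r₁ : ℝ) (C : ℝ → ℝ) (ψ : ℝ → ℓ²) (t : ℝ) : ℝ :=
  arg (modRot σ ω₀ r₁ C fun x => ψ 0 x) + ∫ s in (0 : ℝ)..t, speed σ ω₀ r₁ C ψ s

lemma hasDerivAt_angle (hm : Modulation a σ ω₀ r C h ε₁ r₁ L m) (hψ : IsSolution a ψ) (ht : 0 ≤ t)
    (hsub : Icc 0 t ⊆ tubeTimes σ ω₀ C ε₁ ψ) :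
    HasDerivAt (angle σ ω₀ r₁ C ψ) (speed σ ω₀ r₁ C ψ t) t :=
  (hasDerivAt_integral_of_continuousOn (isOpen_tubeTimes hψ.1) (hm.continuousOn_speed hψ) ht hsub).const_add _

lemma exp_angle (hm : Modulation a σ ω₀ r C h ε₁ r₁ L m) (hψ : IsSolution a ψ) (ht : 0 ≤ t)
    (hsub : Icc 0 t ⊆ tubeTimes σ ω₀ C ε₁ ψ) :
    exp (I * angle σ ω₀ r₁ C ψ t) = modRot σ ω₀ r₁ C fun x => ψ t x := by
  have hd : ∀ s ∈ Icc 0 t, HasDerivAt (fun s => exp (-(I * angle σ ω₀ r₁ C ψ s)) *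
      modRot σ ω₀ r₁ C fun x => ψ s x) 0 s := fun s hs => by
    have h1 := hm.hasDerivAt_angle hψ hs.1 ((Icc_subset_Icc_right hs.2).trans hsub)
    have h2 := hm.hasDerivAt_rot hψ (hsub hs)
    have h3 := ((h1.ofReal_comp.const_mul I).neg.cexp).mul h2
    refine h3.congr_deriv ?_
    ring
  have hc := constant_of_derivWithin_zero (f := fun s => exp (-(I * angle σ ω₀ r₁ C ψ s)) *
      modRot σ ω₀ r₁ C fun x => ψ s x) (a := 0) (b := t)
    (fun s hs => (hd s hs).differentiableAt.differentiableWithinAt)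
    (fun s hs => by
      have hs' : s ∈ Icc 0 t := ⟨hs.1, hs.2.le⟩
      exact (hd s hs').hasDerivWithinAt.derivWithin
        (uniqueDiffOn_Icc (lt_of_le_of_lt hs.1 hs.2) s hs')) t ⟨ht, le_rfl⟩
  obtain ⟨ε', h0', h1', hT'⟩ := hsub ⟨le_rfl, ht⟩
  have hn := (hm.rot_spec h0' h1'.le hT').1
  have h00 : exp (I * angle σ ω₀ r₁ C ψ 0) = modRot σ ω₀ r₁ C fun x => ψ 0 x := by
    have := norm_mul_exp_arg_mul_I (modRot σ ω₀ r₁ C fun x => ψ 0 x)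
    rw [hn, ofReal_one, one_mul] at this
    rw [angle, integral_same, add_zero, mul_comm]
    exact this
  dsimp only at hc
  rw [← h00, ← exp_add, neg_add_cancel, exp_zero] at hc
  rw [exp_neg] at hc
  have hne := exp_ne_zero (I * angle σ ω₀ r₁ C ψ t)
  field_simp at hc
  exact hc.symm

end Modulation

/-! ### Duality with the kernel -/

lemma sum_step_eq (f g : ℤ → ℂ) (L : ℕ) :
    ∑ x ∈ Finset.Ico (-(L : ℤ)) L, ((f (x + 1) + f (x - 1)) * g x - f x * (g (x + 1) + g (x - 1))) =
      (f L * g (L - 1) - f (L - 1) * g L) - (f (-L) * g (-L - 1) - f (-L - 1) * g (-L)) := by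
  have := Finset.sum_Ico_int_sub L fun x : ℤ => f x * g (x - 1) - f (x - 1) * g x
  rw [← neg_inj, ← Finset.sum_neg_distrib] at this
  rw [neg_sub] at this
  rw [← this]
  refine Finset.sum_congr rfl fun x _ => ?_
  rw [add_sub_cancel_right]
  ring

lemma tendsto_intCast_atTop_cofinite : Tendsto (fun L : ℕ => (L : ℤ)) atTop cofinite :=
  (Nat.cast_injective (R := ℤ)).tendsto_cofinite.mono_left Nat.cofinite_eq_atTop.ge

section
variable {K w α b q T : ℝ} {k : ℝ → ℤ → ℂ} {R : ℝ → ℂ}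

lemma duality {c : ℂ} {z : ℤ} {U : ℤ → ℝ → ℂ} (hU : IsKernel K w α b q c z U) (hq : |q| < 1)
    (hd : ∀ x t, HasDerivAt (fun t => k t x) (-I * (w * k t x - k t (x + 1) - k t (x - 1)) +
      I * delta x * (α * k t 0 + b * conj (k t 0) + R t)) t)
    (hR : Continuous R) (hbd : ∃ B, ∀ t ∈ uIcc 0 T, ∀ x, ‖k t x‖ ≤ B)
    (hlim : ∀ t, Tendsto (k t) cofinite (𝓝 0)) (hsum : Summable fun x => wt x * ‖k 0 x‖)
    (horth : ∀ μ κ : ℝ, (∑' x, k T x * (((μ * (w - 2 * b * x.natAbs) : ℝ) + I * (κ : ℝ)) *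
      (q : ℂ) ^ x.natAbs)).im = 0) :
    (c * k T z).im = (∑' x, k 0 x * U x T).im + ∫ s in (0 : ℝ)..T, (I * R s * U 0 (T - s)).im := by
  obtain ⟨B, hB⟩ := hbd
  obtain ⟨B', hB'⟩ := hU.bdd
  have hB0 : 0 ≤ B := (norm_nonneg _).trans (hB 0 left_mem_uIcc 0)
  have hB0' : 0 ≤ B' := (norm_nonneg _).trans (hB' 0 0)
  have hkc : ∀ x, Continuous fun t => k t x := fun x =>
    continuous_iff_continuousAt.2 fun t => (hd x t).continuousAt
  have hUc : ∀ x, Continuous fun s => U x (T - s) := fun x =>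
    (continuous_iff_continuousAt.2 fun t => (hU.deriv x t).continuousAt).comp (by fun_prop)
  have hUd : ∀ x s, HasDerivAt (fun s => U x (T - s)) (-(-I * (w * U x (T - s) - U (x + 1) (T - s) -
      U (x - 1) (T - s)) + I * delta x * (α * U 0 (T - s) + b * conj (U 0 (T - s))))) s :=
    fun x s => by
      have := (hU.deriv x (T - s)).scomp s ((hasDerivAt_id s).const_sub T)
      refine this.congr_deriv ?_
      rw [neg_one_smul]
  let bd : ℕ → ℝ → ℂ := fun L s => (k s L * U (L - 1) (T - s) - k s (L - 1) * U L (T - s)) -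
    (k s (-L) * U (-L - 1) (T - s) - k s (-L - 1) * U (-L) (T - s))
  have hbdc : ∀ L, Continuous (bd L) := fun L =>
    ((((hkc _).mul (hUc _)).sub ((hkc _).mul (hUc _)))).sub
      (((hkc _).mul (hUc _)).sub ((hkc _).mul (hUc _)))
  have hFc : ∀ L, Continuous fun s => (I * (bd L s + R s * U 0 (T - s))).im := fun L =>
    continuous_im.comp (continuous_const.mul ((hbdc L).add (hR.mul (hUc 0))))
  have hderiv : ∀ L : ℕ, 0 < L → ∀ s, HasDerivAt
      (fun s => (∑ x ∈ Finset.Ico (-(L : ℤ)) L, k s x * U x (T - s)).im)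
      (I * (bd L s + R s * U 0 (T - s))).im s := fun L hL s => by
    have h1 := hasDerivAt_im (HasDerivAt.fun_sum (u := Finset.Ico (-(L : ℤ)) L)
      fun x _ => (hd x s).mul (hUd x s))
    refine h1.congr_deriv ?_
    have h2 : ∑ x ∈ Finset.Ico (-(L : ℤ)) L, delta x * (R s * U 0 (T - s) + b * (conj (k s 0) *
        U 0 (T - s) - k s 0 * conj (U 0 (T - s)))) = R s * U 0 (T - s) +
        b * (conj (k s 0) * U 0 (T - s) - k s 0 * conj (U 0 (T - s))) := by
      rw [Finset.sum_eq_single_of_mem (0 : ℤ) (Finset.mem_Ico.2 ⟨by omega, by omega⟩)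
        (fun x _ hx => by rw [delta_of_ne hx, zero_mul]), delta_zero, one_mul]
    have h3 : ∑ x ∈ Finset.Ico (-(L : ℤ)) L, ((-I * (w * k s x - k s (x + 1) - k s (x - 1)) +
        I * delta x * (α * k s 0 + b * conj (k s 0) + R s)) * U x (T - s) + k s x *
        (-(-I * (w * U x (T - s) - U (x + 1) (T - s) - U (x - 1) (T - s)) +
          I * delta x * (α * U 0 (T - s) + b * conj (U 0 (T - s)))))) =
        I * (bd L s + R s * U 0 (T - s)) +
        I * (b * (conj (k s 0) * U 0 (T - s) - k s 0 * conj (U 0 (T - s)))) := by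
      have e1 := sum_step_eq (k s) (fun x => U x (T - s)) L
      rw [← mul_add, add_assoc (bd L s), ← h2]
      simp only [bd]
      rw [← e1, ← Finset.sum_add_distrib, Finset.mul_sum]
      refine Finset.sum_congr rfl fun x _ => ?_
      rcases eq_or_ne x 0 with rfl | hx
      · simp only [delta_zero]; ring
      · simp only [delta_of_ne hx]; ring
    rw [h3, add_im]
    have h4 : (I * (b * (conj (k s 0) * U 0 (T - s) - k s 0 * conj (U 0 (T - s))))).im = 0 := by
      simp only [mul_im, mul_re, sub_re, sub_im, I_re, I_im, ofReal_re, ofReal_im, conj_re, conj_im]; ring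
    rw [h4, add_zero]
  have hint : ∀ L : ℕ, 0 < L → ∫ s in (0 : ℝ)..T, (I * (bd L s + R s * U 0 (T - s))).im =
      (∑ x ∈ Finset.Ico (-(L : ℤ)) L, k T x * U x 0).im - (∑ x ∈ Finset.Ico (-(L : ℤ)) L, k 0 x * U x T).im :=
    fun L hL => by
      have := integral_eq_sub_of_hasDerivAt (a := 0) (b := T) (fun s _ => hderiv L hL s)
        ((hFc L).intervalIntegrable _ _)
      simpa using this
  -- the limit of the integral
  have hcast := tendsto_intCast_atTop_cofinite
  have hcomp : ∀ g : ℤ → ℤ, Function.Injective g → ∀ s, Tendsto (fun L : ℕ => k s (g L)) atTop (𝓝 0) :=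
    fun g hg s => (hlim s).comp (hg.tendsto_cofinite.comp hcast)
  have hprod : ∀ (g : ℤ → ℤ) (g' : ℕ → ℤ), Function.Injective g → ∀ s,
      Tendsto (fun L : ℕ => k s (g L) * U (g' L) (T - s)) atTop (𝓝 0) := fun g g' hg s =>
    squeeze_zero_norm (a := fun L : ℕ => ‖k s (g L)‖ * B') (fun L => by
      rw [norm_mul]; exact mul_le_mul_of_nonneg_left (hB' _ _) (norm_nonneg _))
      (by simpa using ((hcomp g hg s).norm.mul_const B'))
  have hbd0 : ∀ s, Tendsto (fun L => bd L s) atTop (𝓝 0) := fun s => by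
    have := ((hprod (fun x => x) (fun L => L - 1) (fun _ _ h => h) s).sub
      (hprod (fun x => x - 1) (fun L => L) (fun _ _ h => by simpa using h) s)).sub
      ((hprod (fun x => -x) (fun L => -L - 1) neg_injective s).sub
      (hprod (fun x => -x - 1) (fun L => -L) (fun _ _ h => by simpa using h) s))
    simpa using this
  have hlimI : Tendsto (fun L => ∫ s in (0 : ℝ)..T, (I * (bd L s + R s * U 0 (T - s))).im) atTop
      (𝓝 (∫ s in (0 : ℝ)..T, (I * R s * U 0 (T - s)).im)) := by
    refine tendsto_integral_filter_of_dominated_convergence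
      (fun s => 4 * (B * B') + ‖R s * U 0 (T - s)‖)
      (Eventually.of_forall fun L => (hFc L).aestronglyMeasurable)
      (Eventually.of_forall fun L => Eventually.of_forall fun s hs => ?_)
      ((continuous_const.add (hR.mul (hUc 0)).norm).intervalIntegrable _ _)
      (Eventually.of_forall fun s _ => ?_)
    · have hs' := uIoc_subset_uIcc hs
      have hkU : ∀ x y, ‖k s x * U y (T - s)‖ ≤ B * B' := fun x y => by
        rw [norm_mul]; exact mul_le_mul (hB s hs' x) (hB' _ _) (norm_nonneg _) hB0
      refine (abs_im_le_norm _).trans ?_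
      rw [norm_mul, norm_I, one_mul]
      refine (norm_add_le _ _).trans (add_le_add_left ?_ _)
      refine (norm_sub_le _ _).trans ?_
      have n1 := norm_sub_le (k s L * U (L - 1) (T - s)) (k s (L - 1) * U L (T - s))
      have n2 := norm_sub_le (k s (-L) * U (-L - 1) (T - s)) (k s (-L - 1) * U (-L) (T - s))
      linarith [hkU L (L - 1), hkU (L - 1) L, hkU (-L) (-L - 1), hkU (-L - 1) (-L)]
    · have := (continuous_im.tendsto _).comp
        (((hbd0 s).add_const (R s * U 0 (T - s))).const_mul I)
      rw [zero_add, ← mul_assoc] at this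
      exact this
  -- the limits of the sums
  have hIco : Tendsto (fun L : ℕ => Finset.Ico (-(L : ℤ)) L) atTop atTop := Finset.tendsto_Ico_neg
  have hs0 : Summable fun x => k 0 x * U x T := by
    refine Summable.of_norm_bounded (hsum.mul_left B') fun x => ?_
    rw [norm_mul]
    nlinarith [hB' x T, norm_nonneg (k 0 x), one_le_wt x, norm_nonneg (U x T),
      mul_nonneg (mul_nonneg hB0' (norm_nonneg (k 0 x))) (sub_nonneg.2 (one_le_wt x)),
      mul_nonneg (norm_nonneg (k 0 x)) (sub_nonneg.2 (hB' x T))]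
  have hl0 := (continuous_im.tendsto _).comp (hs0.hasSum.comp hIco)
  obtain ⟨μ, κ, hinit⟩ := hU.init
  have hBT := hB T right_mem_uIcc
  have hsT : Summable fun x => k T x * (((μ * (w - 2 * b * x.natAbs) : ℝ) + I * (κ : ℝ)) *
      (q : ℂ) ^ x.natAbs) := by
    have hs := (summable_wt_mul_pow (abs_nonneg q) hq (B * (|μ| * (|w| + 2 * |b|) + |κ|)))
    refine Summable.of_norm_bounded hs fun x => ?_
    have hxw : (x.natAbs : ℝ) ≤ wt x := by
      rw [Nat.cast_natAbs, Int.cast_abs]; unfold wt; nlinarith [abs_nonneg (x : ℝ)]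
    have h1 : ‖((μ * (w - 2 * b * x.natAbs) : ℝ) : ℂ) + I * (κ : ℝ)‖ ≤ (|μ| * (|w| + 2 * |b|) + |κ|) * wt x := by
      refine (norm_add_le _ _).trans ?_
      rw [norm_mul I, norm_I, one_mul, norm_real, norm_real, norm_eq_abs,
        norm_eq_abs, abs_mul]
      have e1 := abs_sub w (2 * b * x.natAbs)
      rw [abs_mul, abs_mul, abs_two, Nat.abs_cast] at e1
      have e2 : |w| + 2 * |b| * x.natAbs ≤ (|w| + 2 * |b|) * wt x := by
        nlinarith [abs_nonneg w, abs_nonneg b, one_le_wt x]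
      have e3 := mul_le_mul_of_nonneg_left (e1.trans e2) (abs_nonneg μ)
      nlinarith [abs_nonneg κ, one_le_wt x]
    rw [norm_mul, norm_mul, norm_pow, norm_real, norm_eq_abs]
    have h2 := mul_le_mul (hBT x) h1 (norm_nonneg _) hB0
    have h3 := mul_le_mul_of_nonneg_right h2 (pow_nonneg (abs_nonneg q) x.natAbs)
    have h4 : (1 : ℝ) ≤ (1 + (x.natAbs : ℝ)) ^ 2 := one_le_pow₀ (by linarith [Nat.cast_nonneg (α := ℝ) x.natAbs])
    have h5 : 0 ≤ B * ((|μ| * (|w| + 2 * |b|) + |κ|) * wt x) * |q| ^ x.natAbs := by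
      have := wt_pos x
      positivity
    nlinarith
  have hsz := hasSum_single (f := fun x => k T x * (if x = z then c else 0)) z
    (fun x hx => by rw [if_neg hx, mul_zero])
  have hTsum : HasSum (fun x => k T x * U x 0) (k T z * c - ∑' x, k T x *
      (((μ * (w - 2 * b * x.natAbs) : ℝ) + I * (κ : ℝ)) * (q : ℂ) ^ x.natAbs)) := by
    rw [if_pos rfl] at hsz
    refine (hsz.sub hsT.hasSum).congr_fun fun x => ?_
    rw [hinit x]; ring
  have hlT := (continuous_im.tendsto _).comp (hTsum.comp hIco)
  have hfin := tendsto_nhds_unique (hlimI.congr' (by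
    filter_upwards [eventually_gt_atTop 0] with L hL using hint L hL)) (hlT.sub hl0)
  rw [sub_im, horth, sub_zero, mul_comm (k T z)] at hfin
  linarith

/-- Decay of a solution of the forced linear equation whose value at the final time satisfies the
orthogonality relations. -/
theorem norm_le_of_kernel (hT : 0 ≤ T)
    (hK : ∀ c : ℂ, ‖c‖ = 1 → ∀ z, ∃ U, IsKernel K w α b q c z U) (hq : |q| < 1)
    (hd : ∀ x t, HasDerivAt (fun t => k t x) (-I * (w * k t x - k t (x + 1) - k t (x - 1)) +
      I * delta x * (α * k t 0 + b * conj (k t 0) + R t)) t)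
    (hR : Continuous R) (hbd : ∃ B, ∀ t ∈ uIcc 0 T, ∀ x, ‖k t x‖ ≤ B)
    (hlim : ∀ t, Tendsto (k t) cofinite (𝓝 0)) (hsum : Summable fun x => wt x * ‖k 0 x‖)
    (horth : ∀ μ κ : ℝ, (∑' x, k T x * (((μ * (w - 2 * b * x.natAbs) : ℝ) + I * (κ : ℝ)) *
      (q : ℂ) ^ x.natAbs)).im = 0) (z : ℤ) :
    ‖k T z‖ ≤ K * wt z * ((1 + T) ^ (-(3 / 2) : ℝ) * ∑' x, wt x * ‖k 0 x‖ +
      ∫ s in (0 : ℝ)..T, (1 + (T - s)) ^ (-(3 / 2) : ℝ) * ‖R s‖) := by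
  obtain ⟨c, hc, hcz⟩ : ∃ c : ℂ, ‖c‖ = 1 ∧ (c * k T z).im = ‖k T z‖ := by
    rcases eq_or_ne (k T z) 0 with h0 | h0
    · exact ⟨1, by simp, by simp [h0]⟩
    · have hn : ‖k T z‖ ≠ 0 := norm_ne_zero_iff.2 h0
      refine ⟨I * conj (k T z) / ‖k T z‖, ?_, ?_⟩
      · rw [norm_div, norm_mul, norm_I, RCLike.norm_conj, one_mul, norm_real, norm_norm, div_self hn]
      · have : I * conj (k T z) / ‖k T z‖ * k T z = I * (‖k T z‖ : ℂ) := by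
          have h2 : k T z * conj (k T z) = (‖k T z‖ : ℂ) ^ 2 := by
            rw [mul_conj, normSq_eq_norm_sq]; push_cast; rfl
          have hn' : (‖k T z‖ : ℂ) ≠ 0 := by exact_mod_cast hn
          field_simp
          linear_combination h2
        rw [this]; simp
  obtain ⟨U, hU⟩ := hK c hc z
  have hdual := duality hU hq hd hR hbd hlim hsum horth
  have hwz := wt_pos z
  have hUw : ∀ x t, 0 ≤ t → ‖U x t‖ ≤ K * wt z * (1 + t) ^ (-(3 / 2) : ℝ) * wt x := fun x t ht => by
    have := hU.decay x t
    rw [abs_of_nonneg ht] at this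
    unfold wt; linarith
  rw [← hcz, hdual]
  have b1 : (∑' x, k 0 x * U x T).im ≤ K * wt z * ((1 + T) ^ (-(3 / 2) : ℝ) * ∑' x, wt x * ‖k 0 x‖) := by
    refine (abs_im_le_norm _ |> (le_abs_self _).trans).trans ?_
    rw [← mul_assoc, ← tsum_mul_left]
    refine tsum_of_norm_bounded (hsum.mul_left _).hasSum fun x => ?_
    rw [norm_mul]
    have := mul_le_mul_of_nonneg_left (hUw x T hT) (norm_nonneg (k 0 x))
    linarith
  have hUc : Continuous fun s => U 0 (T - s) :=
    (continuous_iff_continuousAt.2 fun t => (hU.deriv 0 t).continuousAt).comp (by fun_prop)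
  have b2 : ∫ s in (0 : ℝ)..T, (I * R s * U 0 (T - s)).im ≤ K * wt z *
      ∫ s in (0 : ℝ)..T, (1 + (T - s)) ^ (-(3 / 2) : ℝ) * ‖R s‖ := by
    rw [← integral_const_mul]
    refine integral_mono_on hT ?_ ?_ fun s hs => ?_
    · exact (continuous_im.comp ((continuous_const.mul hR).mul hUc)).intervalIntegrable _ _
    · refine ContinuousOn.intervalIntegrable ?_
      rw [uIcc_of_le hT]
      refine continuousOn_const.mul (ContinuousOn.mul (ContinuousOn.rpow_const (by fun_prop)
        fun s hs => Or.inl (by linarith [hs.2])) hR.norm.continuousOn)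
    · refine (abs_im_le_norm _ |> (le_abs_self _).trans).trans ?_
      rw [norm_mul, norm_mul, norm_I, one_mul]
      have h1 := hUw 0 (T - s) (by linarith [hs.2])
      have h2 : wt 0 = 1 := by simp [wt]
      rw [h2, mul_one] at h1
      have := mul_le_mul_of_nonneg_left h1 (norm_nonneg (R s))
      linarith
  linarith

end

/-! ### The solitary waves along the branch -/

lemma exp_neg_decayRate {ω : ℝ} (hw : 2 < |ω + 2|) : Real.exp (-decayRate ω) = root0 |ω + 2| := by
  rw [← Real.cosh_sub_sinh, sinh_decayRate hw, decayRate, Real.cosh_arcosh (by linarith), root0, sq_abs]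
  ring

lemma abs_add_two_eq {σ ω : ℝ} (hσ : σ = 1 ∨ σ = -1) (h : 2 < σ * (ω + 2)) : |ω + 2| = σ * (ω + 2) := by
  have h1 : |σ| = 1 := by rcases hσ with rfl | rfl <;> simp
  rw [← abs_of_pos (show 0 < σ * (ω + 2) by linarith), abs_mul, h1, one_mul]

lemma profile_eq {σ ω : ℝ} (hσ : σ = 1 ∨ σ = -1) (h : 2 < σ * (ω + 2)) (c : ℝ) (x : ℤ) :
    profile ω c x = c * ratio σ ω ^ x.natAbs := by
  have hab := abs_add_two_eq hσ h
  have hx : |(x : ℝ)| = (x.natAbs : ℝ) := by rw [Nat.cast_natAbs, Int.cast_abs]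
  rw [profile, hx, mul_comm (-decayRate ω), Real.exp_nat_mul, exp_neg_decayRate (by rw [hab]; exact h), hab,
    ratio, mul_pow, mul_assoc]
  congr 2
  rcases hσ with rfl | rfl
  · rw [if_pos (by linarith), one_pow]
  · rw [if_neg (by linarith)]

/-- Pairing with a real sequence. -/
lemma pair_ofReal {u : ℤ → ℂ} {f : ℤ → ℝ} (hs : Summable fun x => u x * (f x : ℂ)) :
    pair u (fun x => (f x : ℂ)) = (ps f u).re := by
  rw [ps, re_tsum hs, pair]
  exact tsum_congr fun x => by simp

lemma pair_I_ofReal {u : ℤ → ℂ} {f : ℤ → ℝ} (hs : Summable fun x => u x * (f x : ℂ)) :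
    pair u (fun x => I * (f x : ℂ)) = (ps f u).im := by
  rw [ps, im_tsum hs, pair]
  exact tsum_congr fun x => by simp

lemma pair_comm (u v : ℤ → ℂ) : pair u v = pair v u := tsum_congr fun x => by ring

/-- The vectors in the range of the symplectic projection. -/
def tvec (σ : ℝ) (C : ℝ → ℝ) (ω m₁ m₂ : ℝ) (x : ℤ) : ℂ := m₁ * phi1 σ C ω x + I * m₂ * phi σ C ω x

lemma hasFDerivAt_force {a : ℝ → ℝ} {c : ℝ} (ha : DifferentiableAt ℝ a (c ^ 2)) :
    HasFDerivAt (force a) (((a (c ^ 2) + deriv a (c ^ 2) * c ^ 2 : ℝ) : ℂ) • (1 : ℂ →L[ℝ] ℂ) +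
      ((deriv a (c ^ 2) * c ^ 2 : ℝ) : ℂ) • (conjCLE : ℂ →L[ℝ] ℂ)) (c : ℂ) := by
  have h1 : HasFDerivAt (fun z : ℂ => ‖z‖ ^ 2) (2 • (innerSL ℝ (c : ℂ))) (c : ℂ) :=
    (hasStrictFDerivAt_norm_sq (c : ℂ)).hasFDerivAt
  have hc : ‖(c : ℂ)‖ ^ 2 = c ^ 2 := by rw [norm_real, norm_eq_abs, sq_abs]
  have h2 := (HasDerivAt.comp_hasFDerivAt (c : ℂ) (by rw [hc]; exact ha.hasDerivAt) h1 :
    HasFDerivAt (fun z : ℂ => a (‖z‖ ^ 2)) _ (c : ℂ))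
  have h3 := (ofRealCLM.hasFDerivAt.comp (c : ℂ) h2).mul (hasFDerivAt_id (c : ℂ))
  refine HasFDerivAt.congr_fderiv h3 ?_
  ext z
  have hz := add_conj z
  push_cast at hz
  simp
  linear_combination -(((deriv a (c ^ 2) : ℝ) : ℂ) * c ^ 2) * hz

namespace Branch

variable {a : ℝ → ℝ} {σ ω₀ r : ℝ} {C : ℝ → ℝ} {h : ℤ → ℝ} {ω : ℝ} {χ u : ℤ → ℂ} {M : ℝ}

lemma nhds_ball (hω : |ω - ω₀| < r) : ∀ᶠ w in 𝓝 ω, |w - ω₀| < r :=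
  Metric.isOpen_ball.mem_nhds (show ω ∈ Metric.ball ω₀ r from hω)

lemma hasDerivAt_mul_of_zero {f : ℝ → ℝ} {g : ℝ → ℂ} {g' : ℂ} {t : ℝ} (hf : ContinuousAt f t)
    (hg : HasDerivAt g g' t) (h0 : g t = 0) : HasDerivAt (fun s => (f s : ℂ) * g s) (f t * g') t := by
  rw [hasDerivAt_iff_tendsto_slope] at hg ⊢
  have := ((continuous_ofReal.continuousAt.comp hf).tendsto.mono_left
    (nhdsWithin_le_nhds (s := {t}ᶜ))).mul hg
  refine this.congr fun s => ?_
  simp only [slope_def_module, h0, Function.comp_apply, mul_zero, sub_zero, real_smul]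
  ring

lemma ps_Q (f : ℤ → ℝ) (χ : ℤ → ℂ) : ps f (Q a C ω χ) = Q a C ω χ 0 * f 0 :=
  tsum_eq_single 0 fun x hx => by simp [Q, delta_of_ne hx]

lemma growth_Q (χ : ℤ → ℂ) (x : ℤ) : ‖Q a C ω χ x‖ ≤ ‖Q a C ω χ 0‖ * wt x := by
  rcases eq_or_ne x 0 with rfl | hx
  · exact le_mul_of_one_le_right (norm_nonneg _) (one_le_wt 0)
  · rw [show Q a C ω χ x = 0 by simp [Q, delta_of_ne hx], norm_zero]
    exact mul_nonneg (norm_nonneg _) (wt_pos x).le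

variable (hb : Branch a σ ω₀ r C h) (hω : |ω - ω₀| < r)
include hb hω

lemma isSolitaryWave : IsSolitaryWave a ω (C ω) := by
  have h2 := hb.two_lt ω hω
  have hs := sinh_decayRate (ω := ω) (by rw [abs_add_two_eq hb.sign h2]; exact h2)
  have ha := hb.amp ω hω
  unfold coup at ha
  refine ⟨hb.pos ω hω, ?_⟩
  rcases hb.sign with rfl | rfl
  · exact Or.inl ⟨by linarith, by rw [hs, ha, one_mul]⟩
  · exact Or.inr ⟨by linarith, by rw [hs, ha]; ring⟩

lemma Phi_eq :
    Phi C ω = fun x => (phi σ C ω x : ℂ) := by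
  funext x; rw [Phi, profile_eq hb.sign (hb.two_lt ω hω), phi]

lemma dPhi_eq :
    dPhi C ω = fun x => (phi1 σ C ω x : ℂ) := by
  funext x
  refine HasDerivAt.deriv ?_
  refine ((hb.hasDerivAt_phi hω x).ofReal_comp).congr_of_eventuallyEq ?_
  filter_upwards [nhds_ball hω] with w hw
  rw [hb.Phi_eq hw]

lemma pair_Phi_dPhi :
    pair (Phi C ω) (dPhi C ω) = dlt σ C ω := by
  rw [hb.Phi_eq hω, hb.dPhi_eq hω, pair_ofReal (summable_ps (hb.phi1_le hω) hb.summable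
    (hb.growth (hb.phi_le hω))), ps_phi1_phi, ofReal_re]

lemma P0_eq (hu : ∀ x, ‖u x‖ ≤ M * wt x) :
    P0 C ω u = tvec σ C ω ((dlt σ C ω)⁻¹ * (ps (phi σ C ω) u).re) ((dlt σ C ω)⁻¹ * (ps (phi1 σ C ω) u).im) := by
  funext x
  rw [P0, hb.pair_Phi_dPhi hω, hb.Phi_eq hω, hb.dPhi_eq hω,
    pair_ofReal (summable_ps (hb.phi_le hω) hb.summable hu),
    pair_I_ofReal (summable_ps (hb.phi1_le hω) hb.summable hu), tvec]
  push_cast; ring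

lemma pair_tvec (hu : ∀ x, ‖u x‖ ≤ M * wt x) (m₁ m₂ : ℝ) :
    pair u (tvec σ C ω m₁ m₂) = m₁ * (ps (phi1 σ C ω) u).re + m₂ * (ps (phi σ C ω) u).im := by
  have s1 := summable_ps (hb.phi1_le hω) hb.summable hu
  have s2 := summable_ps (hb.phi_le hω) hb.summable hu
  have := ((hasSum_re s1.hasSum).mul_left m₁).add ((hasSum_im s2.hasSum).mul_left m₂)
  refine HasSum.tsum_eq (this.congr_fun fun x => ?_)
  simp only [tvec, add_re, add_im, mul_re, mul_im, I_re, I_im, ofReal_re, ofReal_im]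
  ring

lemma growth_tvec (m₁ m₂ : ℝ) (x : ℤ) :
    ‖tvec σ C ω m₁ m₂ x‖ ≤ (|m₁| * mass h + |m₂| * mass h) * wt x := by
  refine (norm_add_le _ _).trans ?_
  rw [norm_mul, norm_mul, norm_mul, norm_I, one_mul, norm_real m₁, norm_real m₂, add_mul,
    mul_assoc, mul_assoc]
  exact add_le_add (mul_le_mul_of_nonneg_left (hb.growth (hb.phi1_le hω) x) (abs_nonneg _))
    (mul_le_mul_of_nonneg_left (hb.growth (hb.phi_le hω) x) (abs_nonneg _))

lemma ps_tvec {f : ℤ → ℝ} (hf : ∀ x, |f x| ≤ h x) (m₁ m₂ : ℝ) :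
    ps f (tvec σ C ω m₁ m₂) = m₁ * ((∑' x, phi1 σ C ω x * f x : ℝ) : ℂ) +
      I * m₂ * ((∑' x, phi σ C ω x * f x : ℝ) : ℂ) := by
  have s1 := (summable_ps hf hb.summable (hb.growth (hb.phi1_le hω))).hasSum
  have s2 := (summable_ps hf hb.summable (hb.growth (hb.phi_le hω))).hasSum
  have e1 := ps_ofReal f (phi1 σ C ω)
  have e2 := ps_ofReal f (phi σ C ω)
  unfold ps at e1 e2
  rw [e1] at s1
  rw [e2] at s2
  refine HasSum.tsum_eq (((s1.mul_left (m₁ : ℂ)).add (s2.mul_left (I * m₂))).congr_fun fun x => ?_)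
  simp only [tvec]; ring

lemma ps_phi_tvec (m₁ m₂ : ℝ) :
    ps (phi σ C ω) (tvec σ C ω m₁ m₂) = m₁ * dlt σ C ω + I * m₂ * nrm σ C ω := by
  rw [hb.ps_tvec hω (hb.phi_le hω)]
  simp only [dlt, nrm, sq, mul_comm (phi1 σ C ω _)]

lemma ps_phi1_tvec (m₁ m₂ : ℝ) :
    (ps (phi1 σ C ω) (tvec σ C ω m₁ m₂)).im = m₂ * dlt σ C ω := by
  rw [hb.ps_tvec hω (hb.phi1_le hω)]
  simp [dlt]

/-- The derivative of the projection on a vector in its kernel. -/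
lemma dP0_eq (hΔ : dlt σ C ω ≠ 0) (hχ : ∀ x, ‖χ x‖ ≤ M * wt x)
    (h1 : (ps (phi σ C ω) χ).re = 0) (h2 : (ps (phi1 σ C ω) χ).im = 0) :
    dP0 C ω χ = tvec σ C ω ((dlt σ C ω)⁻¹ * (ps (phi1 σ C ω) χ).re) ((dlt σ C ω)⁻¹ * (ps (phi2 σ C ω) χ).im) := by
  funext x
  refine HasDerivAt.deriv ?_
  have d1 := (hasDerivAt_re (hb.hasDerivAt_ps_phi hχ hω)).ofReal_comp.mul (hb.hasDerivAt_phi1 hω x).ofReal_comp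
  have d2 := ((hasDerivAt_im (hb.hasDerivAt_ps_phi1 hχ hω)).ofReal_comp.mul
    (hb.hasDerivAt_phi hω x).ofReal_comp).const_mul I
  have d3 := hasDerivAt_mul_of_zero (f := fun w => (dlt σ C w)⁻¹) ((hb.continuousAt_dlt hω).inv₀ hΔ)
    (d1.add d2) (by simp [h1, h2])
  refine (d3.congr_of_eventuallyEq ?_).congr_deriv ?_
  · filter_upwards [nhds_ball hω] with w hw
    rw [hb.P0_eq hw hχ, tvec]
    simp only [Pi.add_apply, Pi.mul_apply]
    push_cast; ring
  · rw [tvec, h1, h2]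
    push_cast; ring

lemma modVec_eq (hΔ : dlt σ C ω ≠ 0) (hχ : ∀ x, ‖χ x‖ ≤ M * wt x)
    (h1 : (ps (phi σ C ω) χ).re = 0) (h2 : (ps (phi1 σ C ω) χ).im = 0) :
    modVec C ω χ = tvec σ C ω (1 - (dlt σ C ω)⁻¹ * (ps (phi1 σ C ω) χ).re)
      (-((dlt σ C ω)⁻¹ * (ps (phi2 σ C ω) χ).im)) := by
  funext x
  rw [modVec, hb.dPhi_eq hω, hb.dP0_eq hω hΔ hχ h1 h2, tvec, tvec]
  push_cast; ring

/-- Pairing of the range of the projection with `Φ + χ`. -/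
lemma pair_tvec_Phi_add (hχ : ∀ x, ‖χ x‖ ≤ M * wt x) (m₁ m₂ : ℝ) :
    pair (tvec σ C ω m₁ m₂) (fun x => Phi C ω x + χ x) = m₁ * (dlt σ C ω + (ps (phi1 σ C ω) χ).re) +
      m₂ * (ps (phi σ C ω) χ).im := by
  have hg := hb.growth (hb.phi_le hω)
  have hn : ∀ x, ‖-χ x‖ ≤ M * wt x := fun x => by rw [norm_neg]; exact hχ x
  have hgc : ∀ x, ‖Phi C ω x + χ x‖ ≤ (mass h + M) * wt x := fun x => by
    rw [hb.Phi_eq hω]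
    refine (norm_add_le _ _).trans ?_
    linarith [hg x, hχ x]
  have hadd : ∀ {f : ℤ → ℝ}, (∀ x, |f x| ≤ h x) → ps f (fun x => Phi C ω x + χ x) =
      ps f (fun x => (phi σ C ω x : ℂ)) + ps f χ := fun {f} hf => by
    have s1 := (summable_ps hf hb.summable hg).hasSum
    have s2 := (summable_ps hf hb.summable hχ).hasSum
    refine HasSum.tsum_eq ((s1.add s2).congr_fun fun x => ?_)
    rw [hb.Phi_eq hω]; ring
  rw [pair_comm, hb.pair_tvec hω hgc, hadd (hb.phi1_le hω), hadd (hb.phi_le hω), ps_phi1_phi, ps_phi_phi]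
  simp

lemma Q_zero (χ : ℤ → ℂ) : Q a C ω χ 0 =
    I * forceRem a (coup σ ω + bcoef a C ω) (bcoef a C ω) (C ω) (χ 0) := by
  have hP : Phi C ω 0 = (C ω : ℂ) := by
    rw [hb.Phi_eq hω]; exact congrArg ofReal (phi_zero σ C ω)
  rw [Q, hP, delta_zero, (hasFDerivAt_force ((hb.smooth_a ω hω).differentiableAt two_ne_zero)).fderiv,
    hb.amp ω hω, inv_I, forceRem]
  simp [bcoef]

/-- The modulation equations solved by Cramer's rule. -/
theorem modulation_eqs (hΔ : dlt σ C ω ≠ 0)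
    (hχ : ∀ x, ‖χ x‖ ≤ M * wt x) (h1 : (ps (phi σ C ω) χ).re = 0) (h2 : (ps (phi1 σ C ω) χ).im = 0)
    {w' g : ℝ} {p s bb : ℝ} {R : ℂ} (hp : p = (ps (phi1 σ C ω) χ).re) (hs : s = (ps (phi σ C ω) χ).im)
    (hbb : bb = (ps (phi2 σ C ω) χ).im)
    (hR : R = forceRem a (coup σ ω + bcoef a C ω) (bcoef a C ω) (C ω) (χ 0))
    (hdet : dlt σ C ω ^ 2 - p ^ 2 - s * bb ≠ 0)
    (e1 : w' * (dlt σ C ω - p) - g * s = -(C ω * R.im))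
    (e2 : g * (dlt σ C ω + p) - w' * bb = deriv C ω * R.re) :
    P0 C ω χ = 0 ∧ modDen C ω χ ≠ 0 ∧ w' = omegaRhs a C ω χ ∧ g = gammaRhs a C ω χ := by
  have hD : modDen C ω χ = (dlt σ C ω ^ 2 - p ^ 2 - s * bb) / dlt σ C ω := by
    rw [modDen, hb.modVec_eq hω hΔ hχ h1 h2, hb.pair_tvec_Phi_add hω hχ, ← hp, ← hs, ← hbb]
    field_simp; ring
  have hQ0 := hb.Q_zero hω χ
  rw [← hR] at hQ0
  have hPQ : P0 C ω (Q a C ω χ) = tvec σ C ω ((dlt σ C ω)⁻¹ * -(C ω * R.im))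
      ((dlt σ C ω)⁻¹ * (deriv C ω * R.re)) := by
    rw [hb.P0_eq hω (growth_Q χ), ps_Q, ps_Q, hQ0, phi_zero, phi1_zero]
    congr 2
    · simp; ring
    · simp; ring
  rw [← e1, ← e2] at hPQ
  have hD0 : modDen C ω χ ≠ 0 := by rw [hD]; exact div_ne_zero hdet hΔ
  refine ⟨?_, hD0, ?_, ?_⟩
  · rw [hb.P0_eq hω hχ, h1, h2]
    funext x; simp [tvec]
  · rw [omegaRhs, eq_div_iff hD0, hPQ, hb.pair_tvec_Phi_add hω hχ, hD, ← hp, ← hs]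
    field_simp; ring
  · rw [gammaRhs, eq_div_iff hD0, hPQ, hb.modVec_eq hω hΔ hχ h1 h2, hD, ← hp, ← hbb]
    rw [hb.P0_eq hω (hb.growth_tvec hω _ _), hb.ps_phi_tvec hω, hb.ps_phi1_tvec hω]
    rw [hb.pair_tvec hω (M := _) (fun x => by
      rw [norm_mul, norm_I, one_mul]; exact hb.growth_tvec hω _ _ x), ps_smul, ps_smul, hb.ps_phi_tvec hω]
    simp only [mul_re, mul_im, I_re, I_im, add_re, add_im, ofReal_re, ofReal_im, hb.ps_phi1_tvec hω]
    field_simp; ring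

end Branch

/-! ### The equation in a frame rotating with constant frequency -/

/-- The deviation from the solitary wave of frequency `ω` in the frame rotating with phase `ω t + p`. -/
def frame (σ : ℝ) (C : ℝ → ℝ) (ω p : ℝ) (ψ : ℝ → ℓ²) (t : ℝ) (x : ℤ) : ℂ :=
  exp (-(I * (ω * t + p : ℝ))) * ψ t x - phi σ C ω x

lemma norm_exp_neg_I (x : ℝ) : ‖exp (-(I * (x : ℂ)))‖ = 1 := by
  rw [← mul_neg, ← ofReal_neg, norm_exp_I_mul_ofReal]

namespace Branch

variable {a : ℝ → ℝ} {σ ω₀ r : ℝ} {C : ℝ → ℝ} {h : ℤ → ℝ} {ω p : ℝ} {ψ : ℝ → ℓ²}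

lemma hasDerivAt_frame (hb : Branch a σ ω₀ r C h) (hω : |ω - ω₀| < r) (hψ : IsSolution a ψ) (x : ℤ) (t : ℝ) :
    HasDerivAt (fun t => frame σ C ω p ψ t x)
      (-I * ((ω + 2 : ℝ) * frame σ C ω p ψ t x - frame σ C ω p ψ t (x + 1) - frame σ C ω p ψ t (x - 1)) +
        I * delta x * ((coup σ ω + bcoef a C ω : ℝ) * frame σ C ω p ψ t 0 +
          bcoef a C ω * conj (frame σ C ω p ψ t 0) +
          forceRem a (coup σ ω + bcoef a C ω) (bcoef a C ω) (C ω) (frame σ C ω p ψ t 0))) t := by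
  have hE : HasDerivAt (fun t : ℝ => exp (-(I * (ω * t + p : ℝ)))) (exp (-(I * (ω * t + p : ℝ))) * -(I * ω)) t := by
    have h1 : HasDerivAt (fun t : ℝ => ω * t + p) ω t := by
      simpa using ((hasDerivAt_id t).const_mul ω).add_const p
    exact ((h1.ofReal_comp.const_mul I).neg).cexp
  refine ((hE.mul (hψ.hasDerivAt t x)).sub_const ((phi σ C ω x : ℝ) : ℂ)).congr_deriv ?_
  have hn := norm_exp_neg_I (ω * t + p)
  have hs : ((phi σ C ω (x + 1) : ℝ) : ℂ) + phi σ C ω (x - 1) = (ω + 2) * phi σ C ω x -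
      delta x * (coup σ ω * C ω) := by
    have := phi_step hb.sign (hb.two_lt ω hω) C x
    rcases eq_or_ne x 0 with rfl | hx
    · rw [if_pos rfl] at this; rw [delta_zero, one_mul]; exact_mod_cast this
    · rw [if_neg hx] at this; rw [delta_of_ne hx, zero_mul]; exact_mod_cast this
  have hF : force a (C ω : ℂ) = coup σ ω * C ω := by
    rw [force, norm_real, norm_eq_abs, sq_abs, hb.amp ω hω]
  have hf0 : (C ω : ℂ) + frame σ C ω p ψ t 0 = exp (-(I * (ω * t + p : ℝ))) * ψ t 0 := by
    rw [frame, phi_zero]; ring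
  have hfr : forceRem a (coup σ ω + bcoef a C ω) (bcoef a C ω) (C ω) (frame σ C ω p ψ t 0) =
      exp (-(I * (ω * t + p : ℝ))) * force a (ψ t 0) - coup σ ω * C ω -
      ((coup σ ω + bcoef a C ω : ℝ) * frame σ C ω p ψ t 0 +
        bcoef a C ω * conj (frame σ C ω p ψ t 0)) := by
    rw [forceRem, hf0, hF, force_rot a hn]
  rw [hfr]
  unfold frame
  push_cast at hs ⊢
  linear_combination I * hs

lemma kernel_orth (hb : Branch a σ ω₀ r C h) (hω : |ω - ω₀| < r) {χ : ℤ → ℂ} {A : ℝ}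
    (hχ : ∀ x, ‖χ x‖ ≤ A * wt x) (h1 : (ps (phi σ C ω) χ).re = 0) (h2 : (ps (phi1 σ C ω) χ).im = 0) (μ κ : ℝ) :
    (∑' x, χ x * (((μ * (ω + 2 - 2 * bcoef a C ω * x.natAbs) : ℝ) + I * (κ : ℝ)) *
      (ratio σ ω : ℂ) ^ x.natAbs)).im = 0 := by
  have hC := (hb.pos ω hω).ne'
  have hc := hb.coup_ne hω
  have hrel := hb.deriv_relation hω
  have e : ∀ x : ℤ, χ x * (((μ * (ω + 2 - 2 * bcoef a C ω * x.natAbs) : ℝ) + I * (κ : ℝ)) *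
      (ratio σ ω : ℂ) ^ x.natAbs) =
      ((μ * (2 * bcoef a C ω * coup σ ω / C ω) : ℝ) : ℂ) * (χ x * (phi1 σ C ω x : ℂ)) +
      (I * (κ / C ω : ℝ)) * (χ x * (phi σ C ω x : ℂ)) := fun x => by
    have r1 : μ * (ω + 2 - 2 * bcoef a C ω * x.natAbs) * ratio σ ω ^ x.natAbs =
        μ * (2 * bcoef a C ω * coup σ ω / C ω) * phi1 σ C ω x := by
      unfold phi1
      have : ω + 2 = 2 * bcoef a C ω * coup σ ω / C ω * deriv C ω := by
        field_simp; linarith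
      rw [this]; field_simp
    have r2 : κ * ratio σ ω ^ x.natAbs = κ / C ω * phi σ C ω x := by
      unfold phi; field_simp
    have c1 := congrArg (fun y : ℝ => (y : ℂ)) r1
    have c2 := congrArg (fun y : ℝ => (y : ℂ)) r2
    push_cast at c1 c2 ⊢
    linear_combination χ x * c1 + I * χ x * c2
  rw [tsum_congr e, Summable.tsum_add ((summable_ps (hb.phi1_le hω) hb.summable hχ).mul_left _)
    ((summable_ps (hb.phi_le hω) hb.summable hχ).mul_left _), tsum_mul_left, tsum_mul_left]
  change (_ * ps (phi1 σ C ω) χ + _ * ps (phi σ C ω) χ).im = 0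
  simp [h1, h2]

end Branch

/-! ### A convolution estimate -/

lemma rpow_conv_le {s T : ℝ} (hs : 0 ≤ s) (hsT : s ≤ T) :
    (1 + (T - s)) ^ (-(3 / 2) : ℝ) * ((1 + s) ^ 2)⁻¹ ≤
      3 * (1 + T) ^ (-(3 / 2) : ℝ) * ((1 + (T - s)) ^ (-(3 / 2) : ℝ) + (1 + s) ^ (-(3 / 2) : ℝ)) := by
  have hT : 0 ≤ T := hs.trans hsT
  have h2 : ((1 + s) ^ 2)⁻¹ ≤ (1 + s) ^ (-(3 / 2) : ℝ) := by
    rw [← rpow_natCast, ← rpow_neg (by linarith)]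
    exact rpow_le_rpow_of_exponent_le (by linarith) (by norm_num)
  have hf : 0 ≤ (1 + (T - s)) ^ (-(3 / 2) : ℝ) := rpow_nonneg (by linarith) _
  have hg : 0 ≤ (1 + s) ^ (-(3 / 2) : ℝ) := rpow_nonneg (by linarith) _
  have h3 : ((1 + T) / 2) ^ (-(3 / 2) : ℝ) ≤ 3 * (1 + T) ^ (-(3 / 2) : ℝ) := by
    rw [Real.div_rpow (by linarith) (by norm_num), rpow_neg (by norm_num : (0:ℝ) ≤ 2), div_inv_eq_mul, mul_comm]
    refine mul_le_mul_of_nonneg_right ?_ (rpow_nonneg (by linarith) _)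
    refine le_of_sq_le_sq ?_ (by norm_num) |>.trans le_rfl
    rw [← rpow_natCast, ← Real.rpow_mul (by norm_num)]
    norm_num
  have hmul := mul_le_mul_of_nonneg_left h2 hf
  rcases le_total (1 + s) (1 + (T - s)) with hc | hc
  · have : (1 + (T - s)) ^ (-(3 / 2) : ℝ) ≤ ((1 + T) / 2) ^ (-(3 / 2) : ℝ) :=
      rpow_le_rpow_of_nonpos (by linarith) (by linarith) (by norm_num)
    nlinarith [mul_le_mul_of_nonneg_right (this.trans h3) hg, mul_nonneg ((hf.trans this).trans h3) hf]
  · have : (1 + s) ^ (-(3 / 2) : ℝ) ≤ ((1 + T) / 2) ^ (-(3 / 2) : ℝ) :=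
      rpow_le_rpow_of_nonpos (by linarith) (by linarith) (by norm_num)
    nlinarith [mul_le_mul_of_nonneg_right (this.trans h3) hf, mul_nonneg ((hg.trans this).trans h3) hg]

lemma integral_rpow_le {T : ℝ} (hT : 0 ≤ T) : ∫ s in (0 : ℝ)..T, (1 + s) ^ (-(3 / 2) : ℝ) ≤ 2 := by
  have hd : ∀ s ∈ uIcc 0 T, HasDerivAt (fun s : ℝ => -2 * (1 + s) ^ (-(1 / 2) : ℝ)) ((1 + s) ^ (-(3 / 2) : ℝ)) s :=
    fun s hs => by
      rw [uIcc_of_le hT] at hs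
      have h1 := (((hasDerivAt_id s).const_add 1).rpow_const (p := -(1 / 2)) (Or.inl (by simp only [id]; linarith [hs.1]))).const_mul (-2)
      refine h1.congr_deriv ?_
      simp only [id]
      norm_num
      ring
  rw [integral_eq_sub_of_hasDerivAt hd (ContinuousOn.intervalIntegrable
    (ContinuousOn.rpow_const (by fun_prop) fun s hs => Or.inl (by rw [uIcc_of_le hT] at hs; linarith [hs.1])))]
  have := rpow_nonneg (show (0 : ℝ) ≤ 1 + T by linarith) (-(1 / 2))
  norm_num at this ⊢
  linarith

lemma integral_conv_le {T A : ℝ} (hT : 0 ≤ T) {f : ℝ → ℝ} (hf : Continuous f) (hA : 0 ≤ A)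
    (hfA : ∀ s ∈ Icc 0 T, f s ≤ A * ((1 + s) ^ 2)⁻¹) :
    ∫ s in (0 : ℝ)..T, (1 + (T - s)) ^ (-(3 / 2) : ℝ) * f s ≤ 12 * A * (1 + T) ^ (-(3 / 2) : ℝ) := by
  have c1 : ContinuousOn (fun s : ℝ => (1 + (T - s)) ^ (-(3 / 2) : ℝ)) (uIcc 0 T) :=
    ContinuousOn.rpow_const (by fun_prop) fun s hs => Or.inl (by rw [uIcc_of_le hT] at hs; linarith [hs.2])
  have c2 : ContinuousOn (fun s : ℝ => (1 + s) ^ (-(3 / 2) : ℝ)) (uIcc 0 T) :=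
    ContinuousOn.rpow_const (by fun_prop) fun s hs => Or.inl (by rw [uIcc_of_le hT] at hs; linarith [hs.1])
  have hTp : 0 ≤ (1 + T) ^ (-(3 / 2) : ℝ) := rpow_nonneg (by linarith) _
  have i1 := integral_rpow_le hT
  have i2 : ∫ s in (0 : ℝ)..T, (1 + (T - s)) ^ (-(3 / 2) : ℝ) ≤ 2 := by
    rw [integral_comp_sub_left (fun s => (1 + s) ^ (-(3 / 2) : ℝ)) T]
    simpa using i1
  calc ∫ s in (0 : ℝ)..T, (1 + (T - s)) ^ (-(3 / 2) : ℝ) * f s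
      ≤ ∫ s in (0 : ℝ)..T, A * (3 * (1 + T) ^ (-(3 / 2) : ℝ)) *
          ((1 + (T - s)) ^ (-(3 / 2) : ℝ) + (1 + s) ^ (-(3 / 2) : ℝ)) := by
        refine integral_mono_on hT (c1.mul hf.continuousOn).intervalIntegrable
          (continuousOn_const.mul (c1.add c2)).intervalIntegrable fun s hs => ?_
        have hk := mul_le_mul_of_nonneg_left (hfA s hs) (rpow_nonneg (show 0 ≤ 1 + (T - s) by linarith [hs.2]) (-(3 / 2)))
        have := mul_le_mul_of_nonneg_left (rpow_conv_le hs.1 hs.2) hA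
        linarith
    _ = A * (3 * (1 + T) ^ (-(3 / 2) : ℝ)) * ((∫ s in (0 : ℝ)..T, (1 + (T - s)) ^ (-(3 / 2) : ℝ)) +
          ∫ s in (0 : ℝ)..T, (1 + s) ^ (-(3 / 2) : ℝ)) := by
        rw [integral_const_mul, integral_add c1.intervalIntegrable c2.intervalIntegrable]
    _ ≤ A * (3 * (1 + T) ^ (-(3 / 2) : ℝ)) * 4 := mul_le_mul_of_nonneg_left (by linarith) (by positivity)
    _ = 12 * A * (1 + T) ^ (-(3 / 2) : ℝ) := by ring

/-- The data of the stability argument. -/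
structure Setup (a : ℝ → ℝ) (σ ω₀ r : ℝ) (C : ℝ → ℝ) (h : ℤ → ℝ) (ε₁ r₁ L m K G ρ δ : ℝ) : Prop extends
    Modulation a σ ω₀ r C h ε₁ r₁ L m where
  ker : ∀ ω, |ω - ω₀| ≤ r₁ → ∀ c : ℂ, ‖c‖ = 1 → ∀ z, ∃ U, IsKernel K (ω + 2)
    (coup σ ω + bcoef a C ω) (bcoef a C ω) (ratio σ ω) c z U
  rem : ∀ ω, |ω - ω₀| ≤ r₁ → ∀ z : ℂ, ‖z‖ ≤ ρ →
    ‖forceRem a (coup σ ω + bcoef a C ω) (bcoef a C ω) (C ω) z‖ ≤ G * ‖z‖ ^ 2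
  gap : ∀ ω, |ω - ω₀| ≤ r₁ → δ ≤ |dlt σ C ω|
  K_nonneg : 0 ≤ K
  G_nonneg : 0 ≤ G
  δ_pos : 0 < δ

/-- The modulated frequency as a function of time. -/
def freqAt (σ ω₀ r₁ : ℝ) (C : ℝ → ℝ) (ψ : ℝ → ℓ²) (t : ℝ) : ℝ :=
  modFreq σ ω₀ r₁ C fun x => ψ t x

/-- The remainder as a function of time. -/
def remAt (σ ω₀ r₁ : ℝ) (C : ℝ → ℝ) (ψ : ℝ → ℓ²) (t : ℝ) : ℤ → ℂ :=
  modRem σ ω₀ r₁ C fun x => ψ t x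

lemma sub_le_of_deriv_le {f f' B B' : ℝ → ℝ} {s t : ℝ} (hst : s ≤ t)
    (hf : ∀ x ∈ Icc s t, HasDerivAt f (f' x) x) (hB : ∀ x ∈ Icc s t, HasDerivAt B (B' x) x)
    (hle : ∀ x ∈ Icc s t, |f' x| ≤ B' x) : |f t - f s| ≤ B t - B s := by
  refine image_norm_le_of_norm_deriv_right_le_deriv_boundary' (f := fun x => f x - f s) (f' := f')
    (B := fun x => B x - B s) (B' := B') (a := s) (b := t)
    (fun x hx => ((hf x hx).sub_const _).continuousAt.continuousWithinAt)
    (fun x hx => ((hf x ⟨hx.1, hx.2.le⟩).sub_const _).hasDerivWithinAt) (by simp)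
    (fun x hx => ((hB x hx).sub_const _).continuousAt.continuousWithinAt)
    (fun x hx => ((hB x ⟨hx.1, hx.2.le⟩).sub_const _).hasDerivWithinAt)
    (fun x hx => hle x ⟨hx.1, hx.2.le⟩) ⟨hst, le_rfl⟩

lemma linear_bound {w g Δ p s b q₁ q₂ δ Q : ℝ} (hδ : 0 < δ) (hΔ : δ ≤ |Δ|) (hp : |p| ≤ δ / 4)
    (hs : |s| ≤ δ / 4) (hb : |b| ≤ δ / 4) (h1 : w * (Δ - p) - g * s = q₁) (h2 : g * (Δ + p) - w * b = q₂)
    (hq₁ : |q₁| ≤ Q) (hq₂ : |q₂| ≤ Q) :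
    |w| + |g| ≤ 4 * Q / δ ∧ Δ ^ 2 - p ^ 2 - s * b ≠ 0 := by
  have e1 : |w| * |Δ - p| ≤ Q + |g| * (δ / 4) := by
    rw [← abs_mul, show w * (Δ - p) = q₁ + g * s by linarith]
    refine (abs_add_le _ _).trans ?_
    rw [abs_mul]
    exact add_le_add hq₁ (mul_le_mul_of_nonneg_left hs (abs_nonneg _))
  have e2 : |g| * |Δ + p| ≤ Q + |w| * (δ / 4) := by
    rw [← abs_mul, show g * (Δ + p) = q₂ + w * b by linarith]
    refine (abs_add_le _ _).trans ?_
    rw [abs_mul]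
    exact add_le_add hq₂ (mul_le_mul_of_nonneg_left hb (abs_nonneg _))
  have f1 : 3 / 4 * δ ≤ |Δ - p| := by linarith [abs_sub_abs_le_abs_sub Δ p]
  have f2 : 3 / 4 * δ ≤ |Δ + p| := by
    have := abs_sub_abs_le_abs_sub Δ (-p)
    rw [abs_neg, sub_neg_eq_add] at this
    linarith
  refine ⟨?_, ?_⟩
  · rw [le_div_iff₀ hδ]
    nlinarith [abs_nonneg w, abs_nonneg g, mul_le_mul_of_nonneg_left f1 (abs_nonneg w),
      mul_le_mul_of_nonneg_left f2 (abs_nonneg g)]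
  · have k1 : δ ^ 2 ≤ Δ ^ 2 := by rw [← sq_abs Δ]; exact pow_le_pow_left₀ hδ.le hΔ 2
    have k2 : p ^ 2 ≤ (δ / 4) ^ 2 := by rw [← sq_abs p]; exact pow_le_pow_left₀ (abs_nonneg _) hp 2
    have k3 : s * b ≤ (δ / 4) ^ 2 := by
      refine (le_abs_self _).trans ?_
      rw [abs_mul, sq]
      exact mul_le_mul hs hb (abs_nonneg _) (by linarith)
    have := pow_pos hδ 2
    exact ne_of_gt (by nlinarith)

lemma norm_exp_sub_exp_le (x y : ℝ) : ‖exp (I * x) - exp (I * y)‖ ≤ |x - y| := by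
  have h1 : exp (I * x) - exp (I * y) = exp (I * y) * (exp (I * (x - y : ℝ)) - 1) := by
    rw [mul_sub, mul_one, ← exp_add]; congr 2; push_cast; ring
  rw [h1, norm_mul, norm_exp_I_mul_ofReal, one_mul]
  exact Real.norm_exp_I_mul_ofReal_sub_one_le

lemma lp_tendsto_cofinite (u : ℓ²) : Tendsto (fun x => ‖u x‖) cofinite (𝓝 0) := by
  have h1 := ((lp.memℓp u).summable (by norm_num)).tendsto_cofinite_zero
  have h2 := (Real.continuous_sqrt.tendsto 0).comp h1
  rw [Real.sqrt_zero] at h2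
  refine h2.congr fun x => ?_
  simp [Real.sqrt_sq (norm_nonneg _)]

lemma continuous_induction {P : ℝ → Prop} (h0 : P 0)
    (hc : ∀ T, 0 < T → (∀ t ∈ Ico 0 T, P t) → P T)
    (ho : ∀ T, 0 ≤ T → (∀ t ∈ Icc 0 T, P t) → ∀ᶠ t in 𝓝 T, P t) {t : ℝ} (ht : 0 ≤ t) : P t := by
  by_contra hnot
  set B := {t : ℝ | 0 ≤ t ∧ ¬P t} with hB
  have hne : B.Nonempty := ⟨t, ht, hnot⟩
  have hbdd : BddBelow B := ⟨0, fun _ h => h.1⟩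
  have hT0 : 0 ≤ sInf B := le_csInf hne fun _ h => h.1
  have hlt : ∀ s ∈ Ico 0 (sInf B), P s := fun s hs => by
    by_contra h
    exact (csInf_le hbdd ⟨hs.1, h⟩).not_gt hs.2
  have hT : P (sInf B) := by
    rcases hT0.eq_or_lt with h | h
    · rwa [← h]
    · exact hc _ h hlt
  have hle : ∀ s ∈ Icc 0 (sInf B), P s := fun s hs => by
    rcases hs.2.eq_or_lt with h | h
    · rwa [h]
    · exact hlt s ⟨hs.1, h⟩
  obtain ⟨ε, hε, hball⟩ := Metric.eventually_nhds_iff.1 (ho _ hT0 hle)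
  obtain ⟨b, hb, hbε⟩ := exists_lt_of_csInf_lt hne (show sInf B < sInf B + ε by linarith)
  exact hb.2 (hball (by
    rw [Real.dist_eq, abs_lt]; constructor <;> linarith [csInf_le hbdd hb]))

lemma Branch.mono {a : ℝ → ℝ} {σ ω₀ r : ℝ} {C : ℝ → ℝ} {h : ℤ → ℝ} (hb : Branch a σ ω₀ r C h) {r' : ℝ}
    (h0 : 0 < r') (hr : r' ≤ r) : Branch a σ ω₀ r' C h where
  sign := hb.sign
  hr := h0
  two_lt ω hω := hb.two_lt ω (hω.trans_le hr)
  pos ω hω := hb.pos ω (hω.trans_le hr)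
  smooth ω hω := hb.smooth ω (hω.trans_le hr)
  amp ω hω := hb.amp ω (hω.trans_le hr)
  smooth_a ω hω := hb.smooth_a ω (hω.trans_le hr)
  maj ω hω := hb.maj ω (hω.trans_le hr)
  summable := hb.summable

/-- The Taylor remainder of a `C²` function is quadratic, locally uniformly in the base point. -/
lemma exists_taylor_le {E F : Type*} [NormedAddCommGroup E] [NormedSpace ℝ E]
    [NormedAddCommGroup F] [NormedSpace ℝ F] {f : E → F} {p : E} (hf : ContDiffAt ℝ 2 f p) :
    ∃ G ρ : ℝ, 0 ≤ G ∧ 0 < ρ ∧ ∀ c z, ‖c - p‖ ≤ ρ → ‖z‖ ≤ ρ →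
      ‖f (c + z) - f c - fderiv ℝ f c z‖ ≤ G * ‖z‖ ^ 2 := by
  obtain ⟨K, s, hs, hK⟩ := (hf.fderiv_right (m := 1) (by norm_num)).exists_lipschitzOnWith
  have hev : ∀ᶠ y in 𝓝 p, y ∈ s ∧ DifferentiableAt ℝ f y := by
    filter_upwards [hs, hf.eventually (by simp)] with y h1 h2
    exact ⟨h1, h2.differentiableAt (by norm_num)⟩
  obtain ⟨δ, hδ, hball⟩ := Metric.eventually_nhds_iff.1 hev
  refine ⟨K, δ / 3, K.2, by positivity, fun c z hc hz => ?_⟩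
  have hin : ∀ y ∈ Metric.closedBall c ‖z‖, y ∈ s ∧ DifferentiableAt ℝ f y := fun y hy => hball (by
    have := dist_triangle y c p
    rw [Metric.mem_closedBall] at hy
    rw [← dist_eq_norm] at hc
    linarith)
  have hcm : c ∈ Metric.closedBall c ‖z‖ := Metric.mem_closedBall_self (norm_nonneg _)
  have key := (convex_closedBall c ‖z‖).norm_image_sub_le_of_norm_hasFDerivWithin_le' (f := f)
    (f' := fun y => fderiv ℝ f y) (φ := fderiv ℝ f c) (C := K * ‖z‖) (x := c) (y := c + z)
    (fun y hy => (hin y hy).2.hasFDerivAt.hasFDerivWithinAt)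
    (fun y hy => by
      have h1 := hK.dist_le_mul y (hin y hy).1 c (hin c hcm).1
      rw [dist_eq_norm] at h1
      exact h1.trans (mul_le_mul_of_nonneg_left (Metric.mem_closedBall.1 hy) K.2))
    hcm (by simp)
  rw [add_sub_cancel_left] at key
  exact key.trans (le_of_eq (by ring))

lemma contDiffAt_force {a : ℝ → ℝ} {c : ℝ} (ha : ContDiffAt ℝ 2 a (c ^ 2)) :
    ContDiffAt ℝ 2 (force a) (c : ℂ) := by
  have hc : ‖(c : ℂ)‖ ^ 2 = c ^ 2 := by rw [norm_real, norm_eq_abs, sq_abs]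
  have h1 : ContDiffAt ℝ 2 (fun z : ℂ => a (‖z‖ ^ 2)) (c : ℂ) :=
    ContDiffAt.comp (c : ℂ) (by rw [hc]; exact ha) (contDiff_norm_sq ℝ).contDiffAt
  exact (ofRealCLM.contDiff.contDiffAt.comp (c : ℂ) h1).mul contDiffAt_id

theorem exists_setup {a : ℝ → ℝ} (ha : Continuous a) {ω₀ C₀ : ℝ} (hwave : IsSolitaryWave a ω₀ C₀)
    (ha₂ : ContDiffAt ℝ 2 a (C₀ ^ 2)) (hSP : SpectralCondition a ω₀ C₀) :
    ∃ σ r C h ε₁ r₁ L m K G ρ δ, C ω₀ = C₀ ∧ 0 < ε₁ ∧ 0 < ρ ∧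
      Setup a σ ω₀ r C h ε₁ r₁ L m K G ρ δ := by
  obtain ⟨K, rK, hK, hrK, hker⟩ := hSP.exists_kernel hwave
  obtain ⟨r, C, h, hC, hb, hΔ, hcl⟩ := exists_branch hwave ha₂ hSP.1 hSP.2.1 rK hrK
  obtain ⟨G, ρ, hG, hρ, htay⟩ := exists_taylor_le (contDiffAt_force ha₂)
  have hΔ0 := hΔ ω₀ hb.self
  have ev : ∀ᶠ ω in 𝓝 ω₀, |dlt (waveSign ω₀) C ω₀| / 2 < |dlt (waveSign ω₀) C ω| ∧ |C ω - C ω₀| < ρ ∧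
      |ω - ω₀| < r := by
    have c1 := (hb.continuousAt_dlt hb.self).abs
    have c2 : ContinuousAt (fun ω => |C ω - C ω₀|) ω₀ :=
      ((hb.smooth ω₀ hb.self).continuousAt.sub continuousAt_const).abs
    filter_upwards [c1.eventually (lt_mem_nhds (half_lt_self (abs_pos.2 hΔ0))),
      c2.eventually (gt_mem_nhds (by simpa using hρ)), Branch.nhds_ball hb.self] with ω h1 h2 h3
    exact ⟨h1, h2, h3⟩
  obtain ⟨r', hr', hball⟩ := Metric.eventually_nhds_iff.1 ev
  have hb' := hb.mono (r' := min r r') (lt_min hb.hr hr') (min_le_left _ _)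
  have hin : ∀ ω, |ω - ω₀| < min r r' → |dlt (waveSign ω₀) C ω₀| / 2 < |dlt (waveSign ω₀) C ω| ∧
      |C ω - C ω₀| < ρ ∧ |ω - ω₀| < r := fun ω hω => hball (hω.trans_le (min_le_right _ _))
  obtain ⟨ε₁, r₁, L, m, hε₁, -, hr₁, hL, hm, hmod⟩ := hb'.exists_modulation hΔ0
  refine ⟨waveSign ω₀, min r r', C, h, ε₁, r₁, L, m, K, G, ρ, |dlt (waveSign ω₀) C ω₀| / 2, hC, hε₁, hρ,
    { hb' with
      cont := ha
      lt_r := hr₁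
      m_pos := hm
      L_nonneg := hL
      dlt_ne := fun ω hω => hΔ ω (hin ω hω).2.2
      slope := fun u ε h0 h1 ⟨e, he, hx⟩ => (hmod u e ε he h0 h1 hx).1
      nondeg := fun u ε h0 h1 ⟨e, he, hx⟩ => (hmod u e ε he h0 h1 hx).2.1
      root := fun u e ε he h0 h1 hx => (hmod u e ε he h0 h1 hx).2.2
      ker := fun ω hω => ?_
      rem := fun ω hω z hz => ?_
      gap := fun ω hω => (hin ω (hω.trans_lt hr₁)).1.le
      K_nonneg := hK
      G_nonneg := hG
      δ_pos := half_pos (abs_pos.2 hΔ0) }⟩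
  · have hwr := (hin ω (hω.trans_lt hr₁)).2.2
    exact hker ω _ (hcl ω hwr).1 (hcl ω hwr).2
  · obtain ⟨-, h2, hwr⟩ := hin ω (hω.trans_lt hr₁)
    have := htay (C ω) z (by rw [← ofReal_sub, norm_real, norm_eq_abs, ← hC]; exact h2.le) hz
    rw [(hasFDerivAt_force ((hb.smooth_a ω hwr).differentiableAt two_ne_zero)).fderiv, hb.amp ω hwr] at this
    simpa [forceRem, bcoef] using this

/-- Smallness conditions for the bootstrap. -/
lemma exists_small {μ L K G v ε₁ ρ δ : ℝ} (hμ : 0 ≤ μ) (hL : 0 ≤ L) (hK : 0 ≤ K)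
    (hε₁ : 0 < ε₁) (hρ : 0 < ρ) (hδ : 0 < δ) :
    ∃ B d₁ : ℝ, 0 < B ∧ 0 < d₁ ∧ ∀ d M V, 0 < d → d < d₁ → M = B * d → V = v * M ^ 2 →
      2 * M ≤ ρ ∧ M * μ ≤ δ / 4 ∧ 3 * V * μ ≤ M ∧ d < ε₁ ∧ L * d ≤ M ∧
      K * (d + (2 * L * d + 3 * V) * μ + 48 * G * M ^ 2) ≤ M / 2 ∧ M + μ * (L * d + V) < ε₁ := by
  set B := 1 + L + 4 * (K * (1 + 2 * L * μ)) with hB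
  have hB0 : 0 < B := by positivity
  have small : ∀ (f : ℝ → ℝ) (p : ℝ), Continuous f → f 0 < p → ∀ᶠ d in 𝓝 (0 : ℝ), f d < p :=
    fun f p hf h => hf.continuousAt.eventually (gt_mem_nhds h)
  have ev := (small (fun d => 2 * (B * d)) ρ (by fun_prop) (by simpa)).and <|
    (small (fun d => B * d * μ) (δ / 4) (by fun_prop) (by simpa)).and <|
    (small (fun d => 3 * v * μ * (B * d)) 1 (by fun_prop) (by simp)).and <|
    (small (fun d => d) ε₁ (by fun_prop) hε₁).and <|
    (small (fun d => K * (3 * v * μ + 48 * G) * (B * d)) (1 / 4) (by fun_prop) (by simp)).and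
    (small (fun d => B * d + μ * (L * d + v * (B * d) ^ 2)) ε₁ (by fun_prop) (by simpa))
  obtain ⟨d₁, hd₁, hball⟩ := Metric.eventually_nhds_iff.1 ev
  refine ⟨B, d₁, hB0, hd₁, fun d M V h0 h1 hM hV => ?_⟩
  obtain ⟨e1, e2, e3, e4, e5, e6⟩ := hball (show dist d 0 < d₁ by rwa [Real.dist_0_eq_abs, abs_of_pos h0])
  rw [← hM] at e1 e2 e3 e5 e6
  rw [← hV] at e6
  have hM0 : 0 ≤ M := by rw [hM]; positivity
  have f3 := mul_le_mul_of_nonneg_right e3.le hM0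
  have f5 := mul_le_mul_of_nonneg_right e5.le hM0
  have hBd : M = d + L * d + 4 * (K * (1 + 2 * L * μ)) * d := by rw [hM, hB]; ring
  have p1 : 0 ≤ K * (1 + 2 * L * μ) * d := by positivity
  have p2 : 0 ≤ L * d := by positivity
  refine ⟨e1.le, e2.le, ?_, e4, by linarith, ?_, e6⟩
  · rw [hV]; linarith
  · rw [hV]; linarith

lemma wt_le_weight {β : ℝ} (hβ : 2 ≤ β) (x : ℤ) : wt x ≤ weight β x := by
  unfold wt weight
  rw [← rpow_natCast]
  exact rpow_le_rpow_of_exponent_le (by linarith [abs_nonneg (x : ℝ)]) (by exact_mod_cast hβ)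

lemma weight_neg_mul_wt_le {β : ℝ} (hβ : 2 ≤ β) (x : ℤ) : weight (-β) x * wt x ≤ 1 := by
  have hx : (0 : ℝ) < 1 + |(x : ℝ)| := by positivity
  have h1 : weight (-β) x * weight β x = 1 := by
    unfold weight; rw [← rpow_add hx, neg_add_cancel, rpow_zero]
  rw [← h1]
  exact mul_le_mul_of_nonneg_left (wt_le_weight hβ x) (rpow_nonneg hx.le _)

lemma summable_weight_mul_pow {q : ℝ} (β : ℝ) (h0 : 0 < q) (h1 : q < 1) :
    Summable fun x : ℤ => weight β x * q ^ x.natAbs := by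
  obtain ⟨N, hN⟩ := exists_nat_ge β
  have hs : Summable fun n : ℕ => (1 + (n : ℝ)) ^ N * q ^ n := by
    have k : Summable fun n : ℕ => (n : ℝ) ^ N * q ^ n :=
      summable_pow_mul_geometric_of_norm_lt_one N (by rwa [norm_eq_abs, abs_of_pos h0])
    have := ((summable_nat_add_iff (f := fun n : ℕ => (n : ℝ) ^ N * q ^ n) 1).2 k).mul_right q⁻¹
    refine this.congr fun n => ?_
    rw [pow_succ, add_comm (1 : ℝ)]
    push_cast
    field_simp
  have hsZ : Summable fun x : ℤ => (1 + (x.natAbs : ℝ)) ^ N * q ^ x.natAbs :=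
    Summable.of_nat_of_neg (f := fun x : ℤ => (1 + (x.natAbs : ℝ)) ^ N * q ^ x.natAbs)
      (by simpa using hs) (by simpa using hs)
  refine Summable.of_nonneg_of_le (fun x => ?_) (fun x => mul_le_mul_of_nonneg_right ?_ (by positivity)) hsZ
  · exact mul_nonneg (rpow_nonneg (by positivity) _) (by positivity)
  · rw [weight, ← rpow_natCast, Nat.cast_natAbs, Int.cast_abs]
    exact rpow_le_rpow_of_exponent_le (by linarith [abs_nonneg (x : ℝ)]) hN

/-- The deviation of the initial value from the solitary wave, measured in `l¹` with the quadratic weight. -/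
lemma initial_le {β : ℝ} (hβ : 2 ≤ β) {σ ω₀ C₀ θ₀ : ℝ} (hσ : σ = 1 ∨ σ = -1) (hω : 2 < σ * (ω₀ + 2))
    {u : ℤ → ℂ} (hu : MemL1 β u) :
    (Summable fun x => wt x * ‖u x - exp (I * θ₀) * profile ω₀ C₀ x‖) ∧
      ∑' x, wt x * ‖u x - exp (I * θ₀) * profile ω₀ C₀ x‖ ≤ initialDist β ω₀ C₀ θ₀ u := by
  obtain ⟨q0, q1⟩ := abs_ratio hσ hω
  have hw : ∀ x, 0 ≤ weight β x := fun x => rpow_nonneg (by positivity) _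
  have hs : Summable fun x => weight β x * ‖u x - exp (I * θ₀) * profile ω₀ C₀ x‖ := by
    refine Summable.of_nonneg_of_le (fun x => mul_nonneg (hw x) (norm_nonneg _)) (fun x => ?_)
      (hu.add ((summable_weight_mul_pow β q0 q1).mul_left |C₀|))
    have h1 := mul_le_mul_of_nonneg_left (norm_sub_le (u x) (exp (I * θ₀) * profile ω₀ C₀ x)) (hw x)
    have h2 : ‖exp (I * θ₀) * profile ω₀ C₀ x‖ = |C₀| * |ratio σ ω₀| ^ x.natAbs := by
      rw [norm_mul, norm_exp_I_mul_ofReal, one_mul, norm_real, norm_eq_abs, profile_eq hσ hω,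
        abs_mul, abs_pow]
    rw [h2] at h1
    linarith
  have hle : ∀ x, wt x * ‖u x - exp (I * θ₀) * profile ω₀ C₀ x‖ ≤
      weight β x * ‖u x - exp (I * θ₀) * profile ω₀ C₀ x‖ := fun x =>
    mul_le_mul_of_nonneg_right (wt_le_weight hβ x) (norm_nonneg _)
  have hs' := Summable.of_nonneg_of_le (fun x => mul_nonneg (wt_pos x).le (norm_nonneg _)) hle hs
  exact ⟨hs', (hs'.tsum_le_tsum hle hs).trans (le_add_of_nonneg_left (sqrt_nonneg _))⟩

namespace Setup

/-- The bootstrap hypothesis at time `t`. -/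
def Good (σ ω₀ r₁ : ℝ) (C : ℝ → ℝ) (ε₁ M : ℝ) (ψ : ℝ → ℓ²) (t : ℝ) : Prop :=
  t ∈ tubeTimes σ ω₀ C ε₁ ψ ∧ ∀ x, ‖remAt σ ω₀ r₁ C ψ t x‖ ≤ M * (1 + t) ^ (-(3 / 2) : ℝ) * wt x

/-- The phase correction. -/
def phaseAt (σ ω₀ r₁ : ℝ) (C : ℝ → ℝ) (ψ : ℝ → ℓ²) (t : ℝ) : ℝ :=
  Modulation.angle σ ω₀ r₁ C ψ t - ∫ s in (0 : ℝ)..t, freqAt σ ω₀ r₁ C ψ s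

lemma rpow_sq {t : ℝ} (ht : 0 ≤ t) : ((1 + t) ^ (-(3 / 2) : ℝ)) ^ 2 = ((1 + t) ^ 3)⁻¹ := by
  rw [← rpow_natCast, ← Real.rpow_mul (by linarith), ← rpow_natCast, ← rpow_neg (by linarith)]
  norm_num

lemma rpow_le_one' {t : ℝ} (ht : 0 ≤ t) : (1 + t) ^ (-(3 / 2) : ℝ) ≤ 1 :=
  Real.rpow_le_one_of_one_le_of_nonpos (by linarith) (by norm_num)

lemma conj_exp_I (x : ℝ) : conj (exp (I * x)) = exp (-(I * x)) := by
  rw [← exp_conj, map_mul, conj_I, conj_ofReal, neg_mul]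

variable {a : ℝ → ℝ} {σ ω₀ r : ℝ} {C : ℝ → ℝ} {h : ℤ → ℝ} {ε₁ r₁ L m K G ρ δ : ℝ} {ψ : ℝ → ℓ²}
  {t T M A V d : ℝ} {e₀ : ℂ} {D : ℤ → ℝ}

local notation "Ω" => freqAt σ ω₀ r₁ C ψ
local notation "X" => remAt σ ω₀ r₁ C ψ
local notation "Θ" => Modulation.angle σ ω₀ r₁ C ψ
local notation "Υ" => Modulation.speed σ ω₀ r₁ C ψ
local notation "Γ" => phaseAt σ ω₀ r₁ C ψ
local notation "𝒯" => tubeTimes σ ω₀ C ε₁ ψ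
local notation "𝒢" => Good σ ω₀ r₁ C ε₁ M ψ

variable (S : Setup a σ ω₀ r C h ε₁ r₁ L m K G ρ δ)
include S

lemma abs_freqAt_le (ht : t ∈ 𝒯) :
    |Ω t - ω₀| ≤ r₁ := by
  obtain ⟨ε, h0, h1, hT⟩ := ht
  exact (S.freq_spec h0 h1.le hT).1

lemma phi_sub_le {ω ω' : ℝ} (hω : |ω - ω₀| < r)
    (hω' : |ω' - ω₀| < r) (x : ℤ) : ‖((phi σ C ω' x : ℝ) : ℂ) - phi σ C ω x‖ ≤ h x * |ω' - ω| := by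
  rw [← ofReal_sub, norm_real, norm_eq_abs]
  exact abs_sub_le_of_hasDerivAt (fun _ h x => S.hasDerivAt_phi h x) (fun _ h x => S.phi1_le h x) hω hω' x

lemma norm_phi_le {ω : ℝ} (hω : |ω - ω₀| < r) (x : ℤ) :
    ‖((phi σ C ω x : ℝ) : ℂ)‖ ≤ h x := by
  rw [norm_real, norm_eq_abs]; exact S.phi_le hω x

lemma coeff_nonneg (hV : V = 4 * mass h * G / δ * M ^ 2) :
    0 ≤ V := by
  have := S.mass_nonneg; have := S.G_nonneg; have := S.δ_pos; rw [hV]; positivity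

lemma isBranch :
    IsBranch a ω₀ (C ω₀) (Ioo (ω₀ - r) (ω₀ + r)) C := by
  have hmem : ∀ ω ∈ Ioo (ω₀ - r) (ω₀ + r), |ω - ω₀| < r := fun ω hω => by
    rw [abs_lt]; constructor <;> linarith [hω.1, hω.2]
  have := S.hr
  exact ⟨isOpen_Ioo, ⟨by linarith, by linarith⟩, rfl, fun ω hω => (S.smooth ω (hmem ω hω)).contDiffWithinAt,
    fun ω hω => S.isSolitaryWave (hmem ω hω)⟩

variable (hψ : IsSolution a ψ)
include hψ

lemma orth (ht : t ∈ 𝒯) :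
    (ps (phi σ C (Ω t)) (X t)).re = 0 ∧
    (ps (phi1 σ C (Ω t)) (X t)).im = 0 :=
  ⟨(S.linear_system hψ ht rfl rfl rfl rfl rfl).1, (S.linear_system hψ ht rfl rfl rfl rfl rfl).2.1⟩

/-- The modulation equations and their quadratic bound. -/
lemma rates
    (ht : t ∈ 𝒯) (hA : ∀ x, ‖X t x‖ ≤ A * wt x) (hρ : A ≤ ρ)
    (hδ : A * mass h ≤ δ / 4) :
    |deriv (Ω) t| + |Υ t - Ω t| ≤
      4 * mass h * G / δ * A ^ 2 ∧
    P0 C (Ω t) (X t) = 0 ∧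
    modDen C (Ω t) (X t) ≠ 0 ∧
    deriv (Ω) t = omegaRhs a C (Ω t) (X t) ∧
    Υ t - Ω t =
      gammaRhs a C (Ω t) (X t) := by
  obtain ⟨o1, o2, e1, e2⟩ := S.linear_system hψ ht rfl (w := Ω t)
    (χ := X t) rfl rfl (w' := deriv (Ω) t) rfl rfl
  have hr := S.abs_freqAt_le ht
  generalize Ω t = w at *
  generalize X t = χ at *
  have hwr := S.lt hr
  have hm := S.mass_nonneg
  have hχ0 : ‖χ 0‖ ≤ A := by simpa [wt] using hA 0
  have hA0 : 0 ≤ A := (norm_nonneg _).trans hχ0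
  have hR := (S.rem w hr (χ 0) (hχ0.trans hρ)).trans
    (mul_le_mul_of_nonneg_left (pow_le_pow_left₀ (norm_nonneg _) hχ0 2) S.G_nonneg)
  have b1 := norm_ps_le (S.phi_le hwr) S.summable hA
  have b2 := norm_ps_le (S.phi1_le hwr) S.summable hA
  have b3 := norm_ps_le (S.phi2_le hwr) S.summable hA
  have hC : |C w| ≤ mass h := by
    have := (S.phi_le hwr 0).trans (S.h_le_mass 0)
    rwa [phi_zero] at this
  have hC1 : |deriv C w| ≤ mass h := by
    have := (S.phi1_le hwr 0).trans (S.h_le_mass 0)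
    rwa [phi1_zero] at this
  obtain ⟨c1, c2⟩ := linear_bound (Q := mass h * (G * A ^ 2)) S.δ_pos (S.gap w hr)
    ((abs_re_le_norm _).trans (b2.trans hδ)) ((abs_im_le_norm _).trans (b1.trans hδ))
    ((abs_im_le_norm _).trans (b3.trans hδ)) e1 e2
    (by rw [abs_neg, abs_mul]
        exact mul_le_mul hC ((abs_im_le_norm _).trans hR) (abs_nonneg _) hm)
    (by rw [abs_mul]
        exact mul_le_mul hC1 ((abs_re_le_norm _).trans hR) (abs_nonneg _) hm)
  have := S.toBranch.modulation_eqs hwr (S.dlt_ne w hwr) hA o1 o2 rfl rfl rfl rfl c2 e1 e2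
  exact ⟨c1.trans (le_of_eq (by ring)), this⟩

lemma rates_of_good (hM : 0 ≤ M)
    (hρ : M ≤ ρ) (hδ : M * mass h ≤ δ / 4) (ht : 0 ≤ t) (hg : 𝒢 t) :
    |deriv (Ω) t| + |Υ t - Ω t| ≤
      4 * mass h * G / δ * M ^ 2 * ((1 + t) ^ 3)⁻¹ := by
  have h1 := rpow_le_one' ht
  have h2 : M * (1 + t) ^ (-(3 / 2) : ℝ) ≤ M := mul_le_of_le_one_right hM h1
  have := (S.rates hψ hg.1 hg.2 (h2.trans hρ)
    ((mul_le_mul_of_nonneg_right h2 S.mass_nonneg).trans hδ)).1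
  rwa [mul_pow, rpow_sq ht, ← mul_assoc] at this

lemma eq_exp_mul (ht : 0 ≤ t)
    (hsub : Icc 0 t ⊆ 𝒯) (x : ℤ) :
    ψ t x = exp (I * Θ t) *
      (phi σ C (Ω t) x + X t x) := by
  obtain ⟨ε, h0, h1, hT⟩ := hsub ⟨ht, le_rfl⟩
  rw [S.exp_angle hψ ht hsub]
  exact S.eq_rot_mul h0 h1.le hT x

lemma continuousAt_remAt
    (ht : t ∈ 𝒯) :
    ∃ g : ℝ → ℝ, Tendsto g (𝓝 t) (𝓝 0) ∧
      ∀ᶠ s in 𝓝 t, ∀ x, ‖X s x - X t x‖ ≤ g s := by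
  have c1 := hψ.1.continuousAt (x := t)
  have c2 : ContinuousAt (fun s => modRot σ ω₀ r₁ C fun x => ψ s x) t := (S.contDiffAt_rot hψ ht).continuousAt
  have c3 : ContinuousAt (Ω) t := S.continuousAt_freq hψ ht
  refine ⟨fun s => ‖ψ s - ψ t‖ + ‖(modRot σ ω₀ r₁ C fun x => ψ s x) - (modRot σ ω₀ r₁ C fun x => ψ t x)‖ * ‖ψ t‖ +
    mass h * |Ω s - Ω t|, ?_, ?_⟩
  · have := (((c1.sub_const (ψ t)).norm.add ((c2.sub_const (modRot σ ω₀ r₁ C fun x => ψ t x)).norm.mul_const ‖ψ t‖)).add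
      ((c3.sub_const (Ω t)).abs.const_mul (mass h)))
    simpa using this
  · filter_upwards [(Modulation.isOpen_tubeTimes hψ.1).mem_nhds ht] with s hs x
    have w1 := S.lt (S.abs_freqAt_le hs)
    have w2 := S.lt (S.abs_freqAt_le ht)
    have he : ‖modRot σ ω₀ r₁ C fun x => ψ s x‖ = 1 := by
      obtain ⟨ε, h0, h1, hTu⟩ := hs
      exact (S.rot_spec h0 h1.le hTu).1
    have e1 : X s x - X t x =
        conj (modRot σ ω₀ r₁ C fun x => ψ s x) * (ψ s - ψ t) x +
        conj ((modRot σ ω₀ r₁ C fun x => ψ s x) - (modRot σ ω₀ r₁ C fun x => ψ t x)) * ψ t x -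
        (phi σ C (Ω s) x - phi σ C (Ω t) x) := by
      rw [lp.coeFn_sub, Pi.sub_apply, map_sub]
      unfold remAt modRem freqAt
      ring
    rw [e1]
    refine (norm_sub_le _ _).trans (add_le_add ((norm_add_le _ _).trans (add_le_add ?_ ?_)) ?_)
    · rw [norm_mul, RCLike.norm_conj, he, one_mul]; exact norm_coord_le _ x
    · rw [norm_mul, RCLike.norm_conj]
      exact mul_le_mul_of_nonneg_left (norm_coord_le _ x) (norm_nonneg _)
    · exact (S.phi_sub_le w2 w1 x).trans (mul_le_mul_of_nonneg_right (S.h_le_mass x) (abs_nonneg _))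

section
variable (hsub : Ici 0 ⊆ tubeTimes σ ω₀ C ε₁ ψ)
include hsub

lemma hasDerivAt_phaseAt (ht : 0 ≤ t) : HasDerivAt (Γ)
    (Υ t - Ω t) t := by
  have hs : Icc 0 t ⊆ 𝒯 := Icc_subset_Ici_self.trans hsub
  exact (S.hasDerivAt_angle hψ ht hs).sub (hasDerivAt_integral_of_continuousOn
    (Modulation.isOpen_tubeTimes hψ.1) (fun s hs => (S.continuousAt_freq hψ hs).continuousWithinAt) ht hs)

lemma contDiffOn_freqAt : ContDiffOn ℝ 1 (Ω) (Ici 0) := fun _ ht =>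
  (S.contDiffAt_freq hψ (hsub ht)).contDiffWithinAt

lemma derivWithin_freqAt (ht : 0 ≤ t) :
    derivWithin (Ω) (Ici 0) t = deriv (Ω) t :=
  (((S.contDiffAt_freq hψ (hsub ht)).differentiableAt one_ne_zero).hasDerivAt.hasDerivWithinAt).derivWithin
    (uniqueDiffOn_Ici 0 t ht)

lemma derivWithin_phaseAt (ht : 0 ≤ t) : derivWithin (Γ) (Ici 0) t =
    Υ t - Ω t :=
  (S.hasDerivAt_phaseAt hψ hsub ht).hasDerivWithinAt.derivWithin (uniqueDiffOn_Ici 0 t ht)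

lemma contDiffOn_phaseAt : ContDiffOn ℝ 1 (Γ) (Ici 0) := by
  rw [contDiffOn_one_iff_derivWithin (uniqueDiffOn_Ici 0)]
  refine ⟨fun t ht => (S.hasDerivAt_phaseAt hψ hsub ht).differentiableAt.differentiableWithinAt, ?_⟩
  refine ContinuousOn.congr (f := fun t => Υ t - Ω t) ?_
    fun t ht => S.derivWithin_phaseAt hψ hsub ht
  exact ((S.continuousOn_speed hψ).mono hsub).sub
    fun t ht => (S.continuousAt_freq hψ (hsub ht)).continuousWithinAt

end

lemma decay_of_good {β : ℝ} (hβ : 2 ≤ β)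
    (hM : 0 ≤ M) (hρ : M ≤ ρ) (hδ : M * mass h ≤ δ / 4) (ht : 0 ≤ t)
    (hg : 𝒢 t) :
    (1 + t) ^ (3 / 2 : ℝ) * normLinf (-β) (X t) +
      (1 + t) ^ 3 * (|Υ t - Ω t| + |deriv (Ω) t|) ≤
      M + 4 * mass h * G / δ * M ^ 2 := by
  have h1t : (0 : ℝ) < 1 + t := by linarith
  have hp : 0 ≤ (1 + t) ^ (-(3 / 2) : ℝ) := rpow_nonneg h1t.le _
  have n1 : normLinf (-β) (X t) ≤ M * (1 + t) ^ (-(3 / 2) : ℝ) := ciSup_le fun x => by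
    have hw : 0 ≤ weight (-β) x := rpow_nonneg (by positivity) _
    have k1 := mul_le_mul_of_nonneg_left (hg.2 x) hw
    have k2 := mul_le_mul_of_nonneg_left (weight_neg_mul_wt_le hβ x) (mul_nonneg hM hp)
    linarith
  have n2 := mul_le_mul_of_nonneg_left n1 (rpow_nonneg h1t.le (3 / 2))
  have e1 : (1 + t) ^ (3 / 2 : ℝ) * (M * (1 + t) ^ (-(3 / 2) : ℝ)) = M := by
    rw [mul_left_comm, ← rpow_add h1t]; norm_num
  have n3 := mul_le_mul_of_nonneg_left (S.rates_of_good hψ hM hρ hδ ht hg) (pow_pos h1t 3).le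
  have e2 : (1 + t) ^ 3 * (4 * mass h * G / δ * M ^ 2 * ((1 + t) ^ 3)⁻¹) =
      4 * mass h * G / δ * M ^ 2 := by
    rw [mul_left_comm, mul_inv_cancel₀ (pow_pos h1t 3).ne', mul_one]
  linarith

section
variable (hV : V = 4 * mass h * G / δ * M ^ 2) (hM : 0 ≤ M) (hρ : M ≤ ρ) (hδ : M * mass h ≤ δ / 4)
include hV hM hρ hδ

lemma freq_sub_le
    (hg : ∀ s ∈ Icc 0 T, 𝒢 s) {s t : ℝ} (hs : 0 ≤ s) (hst : s ≤ t) (ht : t ≤ T) :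
    |Ω t - Ω s| ≤ V * ((1 + s) ^ 2)⁻¹ := by
  have hV0 : 0 ≤ V := by
    have := S.mass_nonneg; have := S.G_nonneg; have := S.δ_pos; rw [hV]; positivity
  have k := sub_le_of_deriv_le (f := Ω) (f' := deriv (Ω))
    (B := fun x => -(V / 2 * ((1 + x) ^ 2)⁻¹)) (B' := fun x => V * ((1 + x) ^ 3)⁻¹) hst
    (fun x hx => ((S.contDiffAt_freq hψ (hg x ⟨by linarith [hx.1], by linarith [hx.2]⟩).1).differentiableAt
      one_ne_zero).hasDerivAt)
    (fun x hx => by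
      have hx0 : 1 + x ≠ 0 := by linarith [hx.1]
      refine ((((((hasDerivAt_id x).const_add 1).pow 2).inv (pow_ne_zero 2 hx0)).const_mul (V / 2)).neg).congr_deriv ?_
      simp only [id, Pi.pow_apply]
      push_cast
      field_simp)
    (fun x hx => by
      have := S.rates_of_good hψ hM hρ hδ (hs.trans hx.1) (hg x ⟨by linarith [hx.1], by linarith [hx.2]⟩)
      rw [← hV] at this
      linarith [abs_nonneg (Υ x - Ω x)])
  have p1 : 0 ≤ V * ((1 + s) ^ 2)⁻¹ := by positivity
  have p2 : 0 ≤ V * ((1 + t) ^ 2)⁻¹ := mul_nonneg hV0 (inv_nonneg.2 (sq_nonneg _))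
  linarith

lemma angle_sub_le
    (hg : ∀ s ∈ Icc 0 T, 𝒢 s) {s : ℝ} (hs : 0 ≤ s) (hsT : s ≤ T) :
    |(Θ T - Ω T * T) -
      (Θ s - Ω T * s)| ≤ 2 * V * (1 + s)⁻¹ := by
  have hV0 : 0 ≤ V := by
    have := S.mass_nonneg; have := S.G_nonneg; have := S.δ_pos; rw [hV]; positivity
  have k := sub_le_of_deriv_le
    (f := fun x => Θ x - Ω T * x)
    (f' := fun x => Υ x - Ω T * 1)
    (B := fun x => -(2 * V * (1 + x)⁻¹)) (B' := fun x => 2 * V * ((1 + x) ^ 2)⁻¹) hsT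
    (fun x hx => (S.hasDerivAt_angle hψ (hs.trans hx.1) fun y hy =>
      (hg y ⟨hy.1, hy.2.trans hx.2⟩).1).sub ((hasDerivAt_id x).const_mul _))
    (fun x hx => by
      have hx0 : 1 + x ≠ 0 := by linarith [hx.1]
      refine (((((hasDerivAt_id x).const_add 1).inv hx0).const_mul (2 * V)).neg).congr_deriv ?_
      simp only [id]
      field_simp)
    (fun x hx => by
      have hx0 : 0 ≤ x := hs.trans hx.1
      have h1 := S.rates_of_good hψ hM hρ hδ hx0 (hg x ⟨hx0, hx.2⟩)
      rw [← hV] at h1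
      have h2 := S.freq_sub_le hψ hV hM hρ hδ hg hx0 hx.2 le_rfl
      have h3 : ((1 + x) ^ 3)⁻¹ ≤ ((1 + x) ^ 2)⁻¹ :=
        inv_anti₀ (by positivity) (pow_le_pow_right₀ (by linarith) (by norm_num))
      have h4 := abs_sub_le (Υ x) (Ω x) (Ω T)
      rw [abs_sub_comm] at h2
      rw [mul_one]
      nlinarith [abs_nonneg (deriv (Ω) x), mul_le_mul_of_nonneg_left h3 hV0])
  have p2 : 0 ≤ 2 * V * (1 + T)⁻¹ := mul_nonneg (by linarith) (inv_nonneg.2 (by linarith))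
  linarith

/-- The bootstrap hypothesis controls the solution in the frame of the final time. -/
lemma norm_frame_le
    (hV3 : 3 * V * mass h ≤ M)
    (hg : ∀ s ∈ Icc 0 T, 𝒢 s) {s : ℝ} (hs : s ∈ Icc 0 T) :
    ‖frame σ C (Ω T)
      (Θ T - Ω T * T) ψ s 0‖ ≤ 2 * M * (1 + s)⁻¹ := by
  have hV0 := S.coeff_nonneg hV
  have hm := S.mass_nonneg
  have hT : 0 ≤ T := hs.1.trans hs.2
  have hsub : Icc 0 s ⊆ 𝒯 := fun y hy => (hg y ⟨hy.1, hy.2.trans hs.2⟩).1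
  have a1 := S.angle_sub_le hψ hV hM hρ hδ hg hs.1 hs.2
  have a2 := S.freq_sub_le hψ hV hM hρ hδ hg hs.1 hs.2 le_rfl
  have a3 := (hg s hs).2 0
  have w1 := S.lt (S.abs_freqAt_le (hg s hs).1)
  have w2 := S.lt (S.abs_freqAt_le (hg T ⟨hT, le_rfl⟩).1)
  rw [frame, S.eq_exp_mul hψ hs.1 hsub]
  generalize Ω T = ω₁ at *
  generalize Ω s = ω₂ at *
  generalize Θ T - ω₁ * T = p at *
  generalize Θ s = θ at *
  generalize X s 0 = χ at *
  have e1 : exp (-(I * (ω₁ * s + p : ℝ))) * (exp (I * θ) * (phi σ C ω₂ 0 + χ)) - phi σ C ω₁ 0 =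
      exp (-(I * (ω₁ * s + p : ℝ))) * ((exp (I * θ) - exp (I * (ω₁ * s + p : ℝ))) * phi σ C ω₂ 0) +
      (phi σ C ω₂ 0 - phi σ C ω₁ 0) + exp (-(I * (ω₁ * s + p : ℝ))) * (exp (I * θ) * χ) := by
    have : exp (-(I * (ω₁ * s + p : ℝ))) * exp (I * (ω₁ * s + p : ℝ)) = 1 := by
      rw [← exp_add, neg_add_cancel, exp_zero]
    linear_combination (phi σ C ω₂ 0 : ℂ) * this
  rw [e1]
  have hh := S.h_le_mass 0
  have n1 : ‖exp (-(I * (ω₁ * s + p : ℝ))) * ((exp (I * θ) - exp (I * (ω₁ * s + p : ℝ))) * phi σ C ω₂ 0)‖ ≤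
      2 * V * (1 + s)⁻¹ * mass h := by
    rw [norm_mul, norm_exp_neg_I, one_mul, norm_mul]
    refine mul_le_mul ((norm_exp_sub_exp_le _ _).trans ?_) ((S.norm_phi_le w1 0).trans hh) (norm_nonneg _)
      (mul_nonneg (by linarith) (inv_nonneg.2 (by linarith [hs.1])))
    rw [abs_sub_comm, show ω₁ * s + p - θ = p - (θ - ω₁ * s) by ring]
    exact a1
  have n2 : ‖((phi σ C ω₂ 0 : ℝ) : ℂ) - phi σ C ω₁ 0‖ ≤ mass h * (V * (1 + s)⁻¹) := by
    refine (S.phi_sub_le w2 w1 0).trans (mul_le_mul hh ?_ (abs_nonneg _) hm)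
    rw [abs_sub_comm]
    refine a2.trans (mul_le_mul_of_nonneg_left (inv_anti₀ (by linarith [hs.1]) ?_) hV0)
    nlinarith [hs.1]
  have n3 : ‖exp (-(I * (ω₁ * s + p : ℝ))) * (exp (I * θ) * χ)‖ ≤ M * (1 + s)⁻¹ := by
    rw [norm_mul, norm_exp_neg_I, one_mul, norm_mul, norm_exp_I_mul_ofReal, one_mul]
    have hw : wt 0 = 1 := by simp [wt]
    rw [hw, mul_one] at a3
    refine a3.trans (mul_le_mul_of_nonneg_left ?_ hM)
    rw [← Real.rpow_neg_one]
    exact rpow_le_rpow_of_exponent_le (by linarith [hs.1]) (by norm_num)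
  refine (norm_add₃_le ..).trans ?_
  nlinarith [mul_le_mul_of_nonneg_right hV3 (inv_nonneg.2 (show 0 ≤ 1 + s by linarith [hs.1]))]

lemma norm_frame_zero_le
    (he : ‖e₀‖ = 1) (hD : ∀ x, ‖ψ 0 x - e₀ * phi σ C ω₀ x‖ ≤ D x) (hd0 : 0 ≤ d) (hdε : d ≤ ε₁)
    (hDd : ∀ x, D x ≤ d * wt x)
    (hT : 0 ≤ T) (hg : ∀ s ∈ Icc 0 T, 𝒢 s) (x : ℤ) :
    ‖frame σ C (Ω T)
      (Θ T - Ω T * T) ψ 0 x‖ ≤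
        D x + (2 * L * d + 3 * V) * h x := by
  have hV0 := S.coeff_nonneg hV
  have h0T : (0 : ℝ) ∈ Icc 0 T := ⟨le_rfl, hT⟩
  have a1 := S.angle_sub_le hψ hV hM hρ hδ hg le_rfl hT
  have a2 := S.freq_sub_le hψ hV hM hρ hδ hg le_rfl hT le_rfl
  have w2 := S.lt (S.abs_freqAt_le (hg T ⟨hT, le_rfl⟩).1)
  obtain ⟨c1, c2, -⟩ := S.close he hd0 hdε fun x => (hD x).trans (hDd x)
  have c3 := S.exp_angle hψ le_rfl (fun y hy => (hg y ⟨hy.1, hy.2.trans hT⟩).1)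
  rw [← c3] at c2
  change |Ω 0 - ω₀| ≤ L * d at c1
  rw [frame]
  generalize Ω T = ω₁ at *
  generalize Ω 0 = ω₂ at *
  generalize Θ T - ω₁ * T = p at *
  generalize Θ 0 = θ at *
  norm_num at a1 a2 ⊢
  have e1 : exp (-(I * p)) * ψ 0 x - phi σ C ω₁ x = exp (-(I * p)) * (ψ 0 x - e₀ * phi σ C ω₀ x) +
      exp (-(I * p)) * ((e₀ - exp (I * p)) * phi σ C ω₀ x) + (phi σ C ω₀ x - phi σ C ω₁ x) := by
    have : exp (-(I * p)) * exp (I * p) = 1 := by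
      rw [← exp_add, neg_add_cancel, exp_zero]
    linear_combination (phi σ C ω₀ x : ℂ) * this
  rw [e1]
  have n1 : ‖exp (-(I * p)) * (ψ 0 x - e₀ * phi σ C ω₀ x)‖ ≤ D x := by
    rw [norm_mul, norm_exp_neg_I, one_mul]; exact hD x
  have n2 : ‖exp (-(I * p)) * ((e₀ - exp (I * p)) * phi σ C ω₀ x)‖ ≤ (L * d + 2 * V) * h x := by
    rw [norm_mul, norm_exp_neg_I, one_mul, norm_mul]
    refine mul_le_mul ?_ (S.norm_phi_le S.self x) (norm_nonneg _)
      (add_nonneg (mul_nonneg S.L_nonneg hd0) (by linarith))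
    rw [norm_sub_rev] at c2
    have := norm_sub_le_norm_sub_add_norm_sub e₀ (exp (I * θ)) (exp (I * p))
    have k := norm_exp_sub_exp_le θ p
    rw [abs_sub_comm] at k
    linarith
  have n3 : ‖((phi σ C ω₀ x : ℝ) : ℂ) - phi σ C ω₁ x‖ ≤ h x * (L * d + V) := by
    refine (S.phi_sub_le w2 S.self x).trans (mul_le_mul_of_nonneg_left ?_ (S.h_nonneg x))
    have := abs_sub_le ω₀ ω₂ ω₁
    rw [abs_sub_comm] at c1 a2
    linarith
  refine (norm_add₃_le ..).trans ?_
  linarith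

lemma tube_of_good
    (hd : |Ω 0 - ω₀| ≤ L * d)
    (hT : 0 ≤ T) (hg : ∀ s ∈ Icc 0 T, 𝒢 s) :
    Tube σ ω₀ C (M + mass h * (L * d + V)) (fun x => ψ T x) := by
  obtain ⟨⟨ε, h0, h1, hTu⟩, hx⟩ := hg T ⟨hT, le_rfl⟩
  have w1 := S.lt (S.abs_freqAt_le (hg T ⟨hT, le_rfl⟩).1)
  have he := (S.rot_spec h0 h1.le hTu).1
  refine ⟨_, he, fun x => ?_⟩
  have a2 := S.freq_sub_le hψ hV hM hρ hδ hg le_rfl hT le_rfl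
  norm_num at a2
  have hf : |Ω T - ω₀| ≤ L * d + V := by
    have := abs_sub_le (Ω T) (Ω 0) ω₀
    linarith
  have e1 : ψ T x - (modRot σ ω₀ r₁ C fun x => ψ T x) * phi σ C ω₀ x = (modRot σ ω₀ r₁ C fun x => ψ T x) *
      (X T x + (phi σ C (Ω T) x - phi σ C ω₀ x)) := by
    have := S.eq_rot_mul h0 h1.le hTu x
    unfold remAt freqAt
    linear_combination this
  rw [e1, norm_mul, he, one_mul]
  refine (norm_add_le _ _).trans ?_
  have n1 : ‖X T x‖ ≤ M * wt x := (hx x).trans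
    (mul_le_mul_of_nonneg_right (mul_le_of_le_one_right hM (rpow_le_one' hT)) (wt_pos x).le)
  have n2 := (S.phi_sub_le S.self w1 x).trans (mul_le_mul (S.h_le_mass x) hf (abs_nonneg _) S.mass_nonneg)
  have n3 : mass h * (L * d + V) ≤ mass h * (L * d + V) * wt x :=
    le_mul_of_one_le_right (mul_nonneg S.mass_nonneg ((abs_nonneg _).trans hf)) (one_le_wt x)
  linarith

end

/-- The bootstrap hypothesis on `[0, T]` yields a better bound at `T`. -/
theorem improve
    (hV : V = 4 * mass h * G / δ * M ^ 2) (hM : 0 ≤ M) (hρ : 2 * M ≤ ρ) (hδ : M * mass h ≤ δ / 4)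
    (hV3 : 3 * V * mass h ≤ M)
    (he : ‖e₀‖ = 1) (hD : ∀ x, ‖ψ 0 x - e₀ * phi σ C ω₀ x‖ ≤ D x) (hdε : d ≤ ε₁)
    (hDs : Summable fun x => wt x * D x) (hDd : ∑' x, wt x * D x ≤ d)
    (hT : 0 ≤ T) (hg : ∀ s ∈ Icc 0 T, 𝒢 s) (z : ℤ) :
    ‖X T z‖ ≤ K * (d + (2 * L * d + 3 * V) * mass h + 48 * G * M ^ 2) *
      (1 + T) ^ (-(3 / 2) : ℝ) * wt z := by
  have hV0 := S.coeff_nonneg hV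
  have hm := S.mass_nonneg
  have hD0 : ∀ x, 0 ≤ D x := fun x => (norm_nonneg _).trans (hD x)
  have hDw : ∀ x, D x ≤ d * wt x := fun x =>
    ((le_tsum_wt hD0 hDs x).trans hDd).trans (le_mul_of_one_le_right
      ((hD0 x).trans ((le_tsum_wt hD0 hDs x).trans hDd)) (one_le_wt x))
  have hd0 : 0 ≤ d := (hD0 0).trans ((le_tsum_wt hD0 hDs 0).trans hDd)
  have hρ1 : M ≤ ρ := by linarith
  have hTm : T ∈ Icc 0 T := ⟨hT, le_rfl⟩
  have hTt := (hg T hTm).1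
  have hw1 := S.abs_freqAt_le hTt
  have hw := S.lt hw1
  have hor := S.orth hψ hTt
  have hfT : frame σ C (Ω T)
      (Θ T - Ω T * T) ψ T = X T := by
    funext x
    rw [frame, add_sub_cancel, ← conj_exp_I, S.exp_angle hψ hT fun y hy => (hg y hy).1]
    rfl
  have hf := fun s hs => S.norm_frame_le hψ hV hM hρ1 hδ hV3 hg (s := s) hs
  have hf0 := S.norm_frame_zero_le hψ hV hM hρ1 hδ he hD hd0 hdε hDw hT hg
  have hAT : ∀ x, ‖X T x‖ ≤ M * (1 + T) ^ (-(3 / 2) : ℝ) * wt x := (hg T hTm).2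
  rw [← hfT] at hor hAT ⊢
  generalize Ω T = ω₁ at *
  generalize Θ T - ω₁ * T = p at *
  have hfd := S.hasDerivAt_frame (p := p) hw hψ
  have hfc : Continuous fun s => frame σ C ω₁ p ψ s 0 :=
    continuous_iff_continuousAt.2 fun s => (hfd 0 s).continuousAt
  have hn : ∀ s x, ‖frame σ C ω₁ p ψ s x‖ ≤ ‖ψ s x‖ + h x := fun s x => by
    refine (norm_sub_le _ _).trans ?_
    rw [norm_mul, norm_exp_neg_I, one_mul]
    exact add_le_add le_rfl (S.norm_phi_le hw x)
  have hhs : Summable h := summable_of_wt S.h_nonneg S.summable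
  have hsum : Summable fun x => wt x * (D x + (2 * L * d + 3 * V) * h x) :=
    (hDs.add (S.summable.mul_left (2 * L * d + 3 * V))).congr fun x => by ring
  have hle0 : ∀ x, wt x * ‖frame σ C ω₁ p ψ 0 x‖ ≤ wt x * (D x + (2 * L * d + 3 * V) * h x) := fun x =>
    mul_le_mul_of_nonneg_left (hf0 x) (wt_pos x).le
  have hs0 : Summable fun x => wt x * ‖frame σ C ω₁ p ψ 0 x‖ :=
    Summable.of_nonneg_of_le (fun x => mul_nonneg (wt_pos x).le (norm_nonneg _)) hle0 hsum
  obtain ⟨B, hB⟩ := (isCompact_uIcc (a := 0) (b := T)).exists_bound_of_continuousOn hψ.1.continuousOn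
  have hRc : Continuous fun s => forceRem a (coup σ ω₁ + bcoef a C ω₁) (bcoef a C ω₁) (C ω₁)
      (frame σ C ω₁ p ψ s 0) := by
    have := continuous_force S.cont
    unfold forceRem
    exact ((this.comp (continuous_const.add hfc)).sub continuous_const).sub
      ((continuous_const.mul hfc).add (continuous_const.mul (continuous_conj.comp hfc)))
  have key := norm_le_of_kernel hT (S.ker ω₁ hw1) (abs_ratio S.sign (S.two_lt ω₁ hw)).2 hfd hRc
    ⟨B + mass h, fun s hs x => (hn s x).trans (add_le_add ((norm_coord_le _ x).trans (hB s hs))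
      (S.h_le_mass x))⟩
    (fun s => squeeze_zero_norm (hn s) (by simpa using (lp_tendsto_cofinite (ψ s)).add hhs.tendsto_cofinite_zero))
    hs0 (fun μ κ => S.kernel_orth hw hAT hor.1 hor.2 μ κ) z
  have i1 : ∑' x, wt x * ‖frame σ C ω₁ p ψ 0 x‖ ≤ d + (2 * L * d + 3 * V) * mass h := by
    refine (hs0.tsum_le_tsum hle0 hsum).trans ?_
    have : (fun x => wt x * (D x + (2 * L * d + 3 * V) * h x)) =
      fun x => wt x * D x + (2 * L * d + 3 * V) * (wt x * h x) := by ext x; ring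
    rw [this, hDs.tsum_add (S.summable.mul_left _), tsum_mul_left]
    exact add_le_add hDd le_rfl
  have hG := S.G_nonneg
  have i2 := integral_conv_le hT (A := 4 * G * M ^ 2) hRc.norm (by positivity) (fun s hs => by
    have k1 := hf s hs
    have hs1 : (1 + s)⁻¹ ≤ 1 := inv_le_one_of_one_le₀ (by linarith [hs.1])
    refine (S.rem ω₁ hw1 _ (k1.trans ((mul_le_of_le_one_right (by linarith) hs1).trans hρ))).trans ?_
    refine (mul_le_mul_of_nonneg_left (pow_le_pow_left₀ (norm_nonneg _) k1 2) hG).trans (le_of_eq ?_)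
    rw [mul_pow, inv_pow]; ring)
  refine key.trans ?_
  have hTp : 0 ≤ (1 + T) ^ (-(3 / 2) : ℝ) := rpow_nonneg (by linarith) _
  have := mul_le_mul_of_nonneg_left (add_le_add (mul_le_mul_of_nonneg_left i1 hTp) i2)
    (mul_nonneg S.K_nonneg (wt_pos z).le)
  refine this.trans (le_of_eq ?_)
  ring

/-- The bootstrap. -/
theorem good
    (hV : V = 4 * mass h * G / δ * M ^ 2) (hM : 0 < M) (hρ : 2 * M ≤ ρ) (hδ : M * mass h ≤ δ / 4)
    (hV3 : 3 * V * mass h ≤ M)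
    (he : ‖e₀‖ = 1) (hD : ∀ x, ‖ψ 0 x - e₀ * phi σ C ω₀ x‖ ≤ D x) (hdε : d < ε₁)
    (hDs : Summable fun x => wt x * D x) (hDd : ∑' x, wt x * D x ≤ d) (hLd : L * d ≤ M)
    (himp : K * (d + (2 * L * d + 3 * V) * mass h + 48 * G * M ^ 2) ≤ M / 2)
    (hε : M + mass h * (L * d + V) < ε₁) (ht : 0 ≤ t) : 𝒢 t := by
  have hV0 := S.coeff_nonneg hV
  have hm := S.mass_nonneg
  have hD0 : ∀ x, 0 ≤ D x := fun x => (norm_nonneg _).trans (hD x)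
  have hDw : ∀ x, D x ≤ d * wt x := fun x =>
    ((le_tsum_wt hD0 hDs x).trans hDd).trans (le_mul_of_one_le_right
      ((hD0 x).trans ((le_tsum_wt hD0 hDs x).trans hDd)) (one_le_wt x))
  have hd0 : 0 ≤ d := (hD0 0).trans ((le_tsum_wt hD0 hDs 0).trans hDd)
  have hρ1 : M ≤ ρ := by linarith
  obtain ⟨c1, -, c3⟩ := S.close he hd0 hdε.le fun x => (hD x).trans (hDw x)
  have hε20 : 0 ≤ M + mass h * (L * d + V) :=
    add_nonneg hM.le (mul_nonneg hm (add_nonneg (mul_nonneg S.L_nonneg hd0) hV0))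
  have hpow : ∀ s : ℝ, -1 < s → ContinuousAt (fun s : ℝ => (1 + s) ^ (-(3 / 2) : ℝ)) s := fun s hs =>
    ContinuousAt.rpow_const (by fun_prop) (Or.inl (by linarith))
  refine continuous_induction (P := 𝒢) ?_ (fun T hT hg => ?_) (fun T hT hg => ?_) ht
  · refine ⟨⟨d, hd0, hdε, e₀, he, fun x => (hD x).trans (hDw x)⟩, fun x => ?_⟩
    rw [add_zero, one_rpow, mul_one]
    exact (c3 x).trans (mul_le_mul_of_nonneg_right hLd (wt_pos x).le)
  · have hTt : T ∈ 𝒯 := by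
      set η := ε₁ - (M + mass h * (L * d + V)) with hη
      obtain ⟨ν, hν, hd⟩ := Metric.continuousAt_iff.1 (hψ.1.continuousAt (x := T)) (η / 2) (by linarith)
      have hs : max 0 (T - ν / 2) ∈ Ico 0 T := ⟨le_max_left _ _, max_lt hT (by linarith)⟩
      have hdist : dist (max 0 (T - ν / 2)) T < ν := by
        rw [Real.dist_eq, abs_sub_comm, abs_of_pos (by linarith [hs.2])]
        linarith [le_max_right 0 (T - ν / 2)]
      have htube := S.tube_of_good hψ hV hM.le hρ1 hδ c1 hs.1
        fun y hy => hg y ⟨hy.1, hy.2.trans_lt hs.2⟩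
      have hcl := hd hdist
      rw [dist_eq_norm, norm_sub_rev] at hcl
      exact ⟨_, add_nonneg hε20 (by linarith), by linarith, htube.of_close (δ := η / 2) (by linarith)
        fun x => (norm_coord_le (ψ T - ψ _) x).trans hcl.le⟩
    refine ⟨hTt, fun x => ?_⟩
    obtain ⟨g, hg0, hgx⟩ := S.continuousAt_remAt hψ hTt
    have lim : Tendsto (fun s => M * (1 + s) ^ (-(3 / 2) : ℝ) * wt x + g s) (𝓝[<] T)
        (𝓝 (M * (1 + T) ^ (-(3 / 2) : ℝ) * wt x + 0)) :=
      (((((hpow T (by linarith)).const_mul M).mul_const (wt x)).tendsto).add hg0).mono_left nhdsWithin_le_nhds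
    rw [add_zero] at lim
    refine ge_of_tendsto lim ?_
    filter_upwards [nhdsWithin_le_nhds hgx, Ioo_mem_nhdsLT hT] with s hs hsT
    have n1 := hs x
    have n2 := (hg s ⟨hsT.1.le, hsT.2⟩).2 x
    have n3 := norm_sub_norm_le (X T x) (X s x)
    rw [norm_sub_rev] at n3
    linarith
  · have hTt := (hg T ⟨hT, le_rfl⟩).1
    obtain ⟨g, hg0, hgx⟩ := S.continuousAt_remAt hψ hTt
    have hp : 0 < (1 + T) ^ (-(3 / 2) : ℝ) := rpow_pos_of_pos (by linarith) _
    have lim : Tendsto (fun s => M / 2 * (1 + T) ^ (-(3 / 2) : ℝ) + g s) (𝓝 T)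
        (𝓝 (M / 2 * (1 + T) ^ (-(3 / 2) : ℝ) + 0)) := hg0.const_add _
    have lt1 : M / 2 * (1 + T) ^ (-(3 / 2) : ℝ) + 0 < M * (1 + T) ^ (-(3 / 2) : ℝ) := by nlinarith
    filter_upwards [hgx, (Modulation.isOpen_tubeTimes hψ.1).mem_nhds hTt,
      lim.eventually_lt ((hpow T (by linarith)).const_mul M).tendsto lt1] with s hs hst hlt
    refine ⟨hst, fun x => ?_⟩
    have n1 := S.improve hψ hV hM.le hρ hδ hV3 he hD hdε.le hDs hDd hT hg x
    have n2 : ‖X T x‖ ≤ M / 2 * (1 + T) ^ (-(3 / 2) : ℝ) * wt x :=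
      n1.trans (mul_le_mul_of_nonneg_right (mul_le_mul_of_nonneg_right himp hp.le) (wt_pos x).le)
    have n3 := norm_sub_norm_le (X s x) (X T x)
    have n4 := hs x
    have g0 : 0 ≤ g s := (norm_nonneg _).trans n4
    have n5 := mul_le_mul_of_nonneg_right hlt.le (wt_pos x).le
    nlinarith [one_le_wt x, mul_nonneg g0 (sub_nonneg.2 (one_le_wt x))]

end Setup

end DiscreteNLS

end

open DiscreteNLS

theorem mainTheorem3 (a : ℝ → ℝ) (ha : ContDiff ℝ 1 a) (β : ℝ) (hβ : 2 ≤ β)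
    (ω₀ C₀ θ₀ : ℝ) (hwave : DiscreteNLS.IsSolitaryWave a ω₀ C₀)
    (ha₂ : ContDiffAt ℝ 2 a (C₀ ^ 2))
    (hSP : DiscreteNLS.SpectralCondition a ω₀ C₀) :
    ∃ (J : Set ℝ) (C : ℝ → ℝ), DiscreteNLS.IsBranch a ω₀ C₀ J C ∧ J.OrdConnected ∧
      (∀ w ∈ J, DiscreteNLS.pair (DiscreteNLS.Phi C w) (DiscreteNLS.dPhi C w) ≠ 0) ∧
      ∃ d₀ > 0, ∃ K > 0, ∀ ψ : ℝ → lp (fun _ : ℤ => ℂ) 2,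
        DiscreteNLS.IsSolution a ψ → DiscreteNLS.MemL1 β (fun x => ψ 0 x) →
        DiscreteNLS.initialDist β ω₀ C₀ θ₀ (fun x => ψ 0 x) ≤ d₀ →
        ∃ (ω γ : ℝ → ℝ) (χ : ℝ → ℤ → ℂ),
          ContDiffOn ℝ 1 ω (Set.Ici 0) ∧ ContDiffOn ℝ 1 γ (Set.Ici 0) ∧
          ∀ t : ℝ, 0 ≤ t →
            ω t ∈ J ∧
            (∀ x : ℤ, ψ t x = Complex.exp (Complex.I * (((∫ s in (0 : ℝ)..t, ω s) + γ t : ℝ) : ℂ)) *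
              (DiscreteNLS.Phi C (ω t) x + χ t x)) ∧
            DiscreteNLS.P0 C (ω t) (χ t) = 0 ∧
            DiscreteNLS.modDen C (ω t) (χ t) ≠ 0 ∧
            derivWithin ω (Set.Ici 0) t = DiscreteNLS.omegaRhs a C (ω t) (χ t) ∧
            derivWithin γ (Set.Ici 0) t = DiscreteNLS.gammaRhs a C (ω t) (χ t) ∧
            (1 + t) ^ (3 / 2 : ℝ) * DiscreteNLS.normLinf (-β) (χ t) +
                (1 + t) ^ 3 * (|derivWithin γ (Set.Ici 0) t| + |derivWithin ω (Set.Ici 0) t|) ≤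
              K * DiscreteNLS.initialDist β ω₀ C₀ θ₀ (fun x => ψ 0 x) := by
  obtain ⟨σ, r, C, h, ε₁, r₁, L, m, K, G, ρ, δ, hC, hε₁, hρ, S⟩ := exists_setup ha.continuous hwave ha₂ hSP
  obtain ⟨B, d₁, hB, hd₁, hsmall⟩ := exists_small (G := G) (v := 4 * mass h * G / δ) S.mass_nonneg
    S.L_nonneg S.K_nonneg hε₁ hρ S.δ_pos
  have hv : 0 ≤ 4 * mass h * G / δ :=
    div_nonneg (mul_nonneg (mul_nonneg (by norm_num) S.mass_nonneg) S.G_nonneg) S.δ_pos.le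
  have hmem : ∀ ω, |ω - ω₀| < r → ω ∈ Set.Ioo (ω₀ - r) (ω₀ + r) := fun ω hω => by
    rw [abs_lt] at hω; constructor <;> linarith [hω.1, hω.2]
  have hmem' : ∀ ω ∈ Set.Ioo (ω₀ - r) (ω₀ + r), |ω - ω₀| < r := fun ω hω => by
    rw [abs_lt]; constructor <;> linarith [hω.1, hω.2]
  refine ⟨Set.Ioo (ω₀ - r) (ω₀ + r), C, by rw [← hC]; exact S.isBranch, Set.ordConnected_Ioo, fun w hw => ?_,
    d₁ / 2, by positivity, B + 4 * mass h * G / δ * B ^ 2 * d₁, by positivity, fun ψ hψ hψ₀ hd => ?_⟩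
  · rw [S.pair_Phi_dPhi (hmem' w hw)]; exact S.dlt_ne w (hmem' w hw)
  obtain ⟨hDs, hDd⟩ := initial_le (θ₀ := θ₀) (C₀ := C₀) hβ S.sign (S.two_lt ω₀ S.self) hψ₀
  set d := initialDist β ω₀ C₀ θ₀ (fun x => ψ 0 x) with hddef
  have hd0 : 0 ≤ d := (tsum_nonneg fun x => mul_nonneg (wt_pos x).le (norm_nonneg _)).trans hDd
  have hD : ∀ x, ‖ψ 0 x - Complex.exp (Complex.I * θ₀) * phi σ C ω₀ x‖ ≤
      ‖ψ 0 x - Complex.exp (Complex.I * θ₀) * profile ω₀ C₀ x‖ := fun x => by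
    rw [profile_eq S.sign (S.two_lt ω₀ S.self), phi, hC]
  have he : ‖Complex.exp (Complex.I * θ₀)‖ = 1 := Complex.norm_exp_I_mul_ofReal θ₀
  have hgood : ∀ d', d < d' → d' < d₁ → (∀ t, 0 ≤ t → Setup.Good σ ω₀ r₁ C ε₁ (B * d') ψ t) ∧
      B * d' ≤ ρ ∧ B * d' * mass h ≤ δ / 4 := fun d' h1 h2 => by
    have h0 : 0 < d' := hd0.trans_lt h1
    obtain ⟨s1, s2, s3, s4, s5, s6, s7⟩ := hsmall d' _ _ h0 h2 rfl rfl
    have hM : 0 < B * d' := mul_pos hB h0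
    exact ⟨fun t ht => S.good hψ rfl hM s1 s2 s3 he hD s4 hDs (hDd.trans h1.le) s5 s6 s7 ht, by linarith, s2⟩
  obtain ⟨d', hd'1, hd'2⟩ := exists_between (show d < d₁ by linarith)
  obtain ⟨hg, hgρ, hgδ⟩ := hgood d' hd'1 hd'2
  have hM' : 0 ≤ B * d' := mul_nonneg hB.le (hd0.trans hd'1.le)
  have hsub : Set.Ici 0 ⊆ tubeTimes σ ω₀ C ε₁ ψ := fun t ht => (hg t ht).1
  refine ⟨freqAt σ ω₀ r₁ C ψ, Setup.phaseAt σ ω₀ r₁ C ψ, remAt σ ω₀ r₁ C ψ, S.contDiffOn_freqAt hψ hsub,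
    S.contDiffOn_phaseAt hψ hsub, fun t ht => ?_⟩
  have hwt := S.lt (S.abs_freqAt_le (hg t ht).1)
  have hone : B * d' * (1 + t) ^ (-(3 / 2) : ℝ) ≤ B * d' := mul_le_of_le_one_right hM' (Setup.rpow_le_one' ht)
  obtain ⟨-, q1, q2, q3, q4⟩ := S.rates hψ (hg t ht).1 (hg t ht).2 (hone.trans hgρ)
    ((mul_le_mul_of_nonneg_right hone S.mass_nonneg).trans hgδ)
  rw [S.derivWithin_freqAt hψ hsub ht, S.derivWithin_phaseAt hψ hsub ht]
  refine ⟨hmem _ hwt, fun x => ?_, q1, q2, q3, q4, ?_⟩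
  · rw [Setup.phaseAt, add_sub_cancel, S.Phi_eq hwt]
    exact S.eq_exp_mul hψ ht (Set.Icc_subset_Ici_self.trans hsub) x
  · have hlim : Filter.Tendsto (fun y => (B + 4 * mass h * G / δ * B ^ 2 * d₁) * y) (nhdsWithin d (Set.Ioi d))
        (nhds ((B + 4 * mass h * G / δ * B ^ 2 * d₁) * d)) :=
      (continuous_const.mul continuous_id).continuousAt.mono_left nhdsWithin_le_nhds
    refine ge_of_tendsto hlim ?_
    filter_upwards [Ioo_mem_nhdsGT (show d < d₁ by linarith)] with y hy
    obtain ⟨g1, g2, g3⟩ := hgood y hy.1 hy.2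
    have hy0 : 0 ≤ y := hd0.trans hy.1.le
    refine (S.decay_of_good hψ hβ (mul_nonneg hB.le hy0) g2 g3 ht (g1 t ht)).trans ?_
    have := mul_le_mul_of_nonneg_left hy.2.le (mul_nonneg (mul_nonneg hv (sq_nonneg B)) hy0)
    linarith
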